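/- **Notation.** Let $m\ge 1$, $N\ge 0$, $M=m+1$, $B_0(r)=[0,r]^m$, and for $\varepsilon>0$ let $B_0^\varepsilon(r)=(\varepsilon\mathbb Z)^m\cap[0,r]^m$, $B^\varepsilon(r)=B_0^\varepsilon(r)\times\{0,1\}$. For functions on $B^\varepsilon(r)$ put $\delta_i u(\xi)=\varepsilon_i^{-1}(u(\xi+\varepsilon_i e_i)-u(\xi))$ with $\varepsilon_1=\dots=\varepsilon_m=\varepsilon$ and $\varepsilon_M=1$. Smooth means $C^\infty$. * A smooth map $x:B_0(r)\to\mathbb R^N$ is a *conjugate net* with rotation coefficients $c_{ij}:B_0(r)\to\mathbb R$ if $\partial_i\partial_jx=c_{ji}\partial_ix+c_{ij}\partial_jx$ for all $1\le i\ne j\le m$. A *Jonas transform* of $x$ is a conjugate net $x^+:B_0(r)\to\mathbb R^N$ such that, for some functions $c_{Mi},c_{iM}:B_0(r)\to\mathbb R$, one has $\partial_ix^+-\partial_ix=c_{Mi}\partial_ix+c_{iM}(x^+-x)$ for $1\le i\le m$; then $(x,x^+)$ is a Jonas pair. * A map $x^\varepsilon:B^\varepsilon(r)\to\mathbb R^N$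 is a *discrete $M$-dimensional conjugate net* with rotation coefficients $c^\varepsilon_{ij}$ if $\delta_i\delta_jx^\varepsilon=c^\varepsilon_{ji}\delta_ix^\varepsilon+c^\varepsilon_{ij}\delta_jx^\varepsilon$ for all $1\le i\ne j\le M$ on each elementary square contained in $B^\varepsilon(r)$. * Maps $u^\varepsilon:B_0^\varepsilon(r)\to\mathbb R^N$ ($0<\varepsilon<\varepsilon_1$) *$O(\varepsilon)$-converge in $C^\infty(B_0(r))$* to $u:B_0(r)\to\mathbb R^N$ if for every integer $\ell\ge0$ there is a constant $K_\ell$ with $|\delta^\alpha(u^\varepsilon-u)(\xi)|\le K_\ell\,\varepsilon$ for all $\varepsilon<\varepsilon_1$ with $\varepsilon\ell<r$, all multi-indices $|\alpha|\le\ell$ and all $\xi\in B_0^\varepsilon(r-\varepsilon|\alpha|)$. **Theorem (approximation of a Jonas pair).** Let there be given * smooth curves $X_i:\mathbb R\to\mathbb R^N$ ($1\le i\le m$) with a common point $X=X_1(0)=\dots=X_m(0)$; * smooth functions $C_{ij}:\mathbb R^2\to\mathbb R$ for $1\le i\ne j\le m$, where $C_{ij}(s,t)$ is regarded as attached to the point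 $se_i+te_j$ of the coordinate plane spanned by $e_i,e_j$; * smooth curves $X_i^+:\mathbb R\to\mathbb R^N$ ($1\le i\le m$) with a common point $X^+=X_1^+(0)=\dots=X_m^+(0)$, such that for all $i$ and $t$ the three vectors $X_i'(t)$, $X_i^{+\prime}(t)$, $X_i^+(t)-X_i(t)$ are coplanar (linearly dependent). Assume that, for each $i$, the vectors $X^+-X$ and $X_i^{+\prime}(0)$ are not parallel (i.e. are linearly independent), and that functions $C_{Mi},C_{iM}:\mathbb R\to\mathbb R$ are defined near $0$ by the formula $$X_i^{+\prime}-X_i'=C_{Mi}X_i'+C_{iM}(X_i^+-X_i).$$ Consider the general position conditions * (G1) $X_i'(0),X_j'(0),X_k'(0)$ are linearly independent for all pairwise distinct $i,j,k\le m$; * (G2) $X_i'(0),X_j'(0),X^+-X$ are linearly independent for all $i\ne j$, $i,j\le m$. Then there is $r>0$ such that the following holds. 1. There is a conjugate net $x:B_0(r)\to\mathbb R^N$ with rotation coefficients $c_{ij}$ such that $x(te_i)=X_i(t)$ and $c_{ij}(se_i+te_j)=C_{ij}(s,t)$ for $s,t\in[0,r]$; it is unique if (G1) holds. The net $x$ has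 a Jonas transform $x^+:B_0(r)\to\mathbb R^N$ with $x^+(te_i)=X_i^+(t)$ for $t\in[0,r]$, $1\le i\le m$; it is unique if (G2) holds. 2. There are $\varepsilon_1>0$ and discrete $M$-dimensional conjugate nets $x^\varepsilon:B^\varepsilon(r)\to\mathbb R^N$, $0<\varepsilon<\varepsilon_1$, with rotation coefficients $c^\varepsilon_{ij}$ such that, for all lattice points $s,t\in\varepsilon\mathbb Z\cap[0,r]$ and $1\le i\neq j\le m$, $$x^\varepsilon(te_i,0)=X_i(t),\qquad c^\varepsilon_{ij}(se_i+te_j,0)=C_{ij}(s,t),$$ and, for $1\le i\le m$, $$x^\varepsilon(0,1)=X^+,\qquad c^\varepsilon_{Mi}(te_i,0)=C_{Mi}(t),\qquad c^\varepsilon_{iM}(te_i,0)=C_{iM}(t).$$ If (G1) and (G2) hold, then $x^\varepsilon$ is the only discrete $M$-dimensional conjugate net on $B^\varepsilon(r)$ satisfying these requirements. The functions $x^\varepsilon(\cdot,0)$ and $x^\varepsilon(\cdot,1)$ $O(\varepsilon)$-converge in $C^\infty(B_0(r))$ to $x$ and $x^+$, respectively. -/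

import Mathlib

open scoped ContDiff ENNReal

namespace ConjNet

/-! ### Smooth nets on the cube -/

/-- The closed cube `B₀(r) = [0, r]^m`. -/
def cube (m : ℕ) (r : ℝ) : Set (Fin m → ℝ) := {ξ | ∀ i, 0 ≤ ξ i ∧ ξ i ≤ r}

/-- The partial derivative `∂ᵢ u` of a function on the cube `B₀(r)` (at boundary points of the
cube the derivative is taken within the cube). -/
noncomputable def pderiv {m N : ℕ} (r : ℝ) (i : Fin m)
    (u : (Fin m → ℝ) → EuclideanSpace ℝ (Fin N)) : (Fin m → ℝ) → EuclideanSpace ℝ (Fin N) :=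
  fun ξ => fderivWithin ℝ u (cube m r) ξ (Pi.single i 1)

/-- `x : B₀(r) → ℝᴺ` is a smooth conjugate net with rotation coefficients `c i j` (`i ≠ j`):
`∂ᵢ∂ⱼ x = cⱼᵢ ∂ᵢ x + cᵢⱼ ∂ⱼ x` on `B₀(r)`. Only the values on the cube matter. -/
def IsConjugateNetWith {m N : ℕ} (r : ℝ) (x : (Fin m → ℝ) → EuclideanSpace ℝ (Fin N))
    (c : Fin m → Fin m → (Fin m → ℝ) → ℝ) : Prop :=
  ContDiffOn ℝ ∞ x (cube m r) ∧
    ∀ i j, i ≠ j → ∀ ξ ∈ cube m r,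
      pderiv r i (pderiv r j x) ξ = c j i ξ • pderiv r i x ξ + c i j ξ • pderiv r j x ξ

/-- `x : B₀(r) → ℝᴺ` is an `m`-dimensional conjugate net. -/
def IsConjugateNet {m N : ℕ} (r : ℝ) (x : (Fin m → ℝ) → EuclideanSpace ℝ (Fin N)) : Prop :=
  ∃ c, IsConjugateNetWith r x c

/-- `x, x⁺ : B₀(r) → ℝᴺ` form a Jonas pair (`x⁺` is a Jonas transform of `x`): both are conjugate
nets, and `∂ᵢ x⁺ - ∂ᵢ x = c_{Mi} ∂ᵢ x + c_{iM} (x⁺ - x)` with some functions `c_{Mi}`, `c_{iM}`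
on `B₀(r)`. -/
def IsJonasPair {m N : ℕ} (r : ℝ) (x xp : (Fin m → ℝ) → EuclideanSpace ℝ (Fin N)) : Prop :=
  IsConjugateNet r x ∧ IsConjugateNet r xp ∧
    ∃ cM ciM : Fin m → (Fin m → ℝ) → ℝ, ∀ i, ∀ ξ ∈ cube m r,
      pderiv r i xp ξ - pderiv r i x ξ = cM i ξ • pderiv r i x ξ + ciM i ξ • (xp ξ - x ξ)

/-- `x` agrees with the curves `X i` on the coordinate axes: `x(t eᵢ) = Xᵢ(t)` for
`0 ≤ t ≤ r`. -/
def AgreesOnAxes {m N : ℕ} (r : ℝ) (x : (Fin m → ℝ) → EuclideanSpace ℝ (Fin N))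
    (X : Fin m → ℝ → EuclideanSpace ℝ (Fin N)) : Prop :=
  ∀ i, ∀ t, 0 ≤ t → t ≤ r → x (Pi.single i t) = X i t

/-- `c i j` agrees with `C i j` on the coordinate plane spanned by `eᵢ, eⱼ`:
`cᵢⱼ(s eᵢ + t eⱼ) = Cᵢⱼ(s, t)` for `0 ≤ s, t ≤ r`. -/
def AgreesOnPlanes {m : ℕ} (r : ℝ) (c : Fin m → Fin m → (Fin m → ℝ) → ℝ)
    (C : Fin m → Fin m → ℝ × ℝ → ℝ) : Prop :=
  ∀ i j, i ≠ j → ∀ s t, 0 ≤ s → s ≤ r → 0 ≤ t → t ≤ r →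
    c i j (Pi.single i s + Pi.single j t) = C i j (s, t)

/-! ### Lattice functions

A point `ξ` of a lattice with mesh sizes `h i` and non-negative coordinates is recorded by its
integer coordinates `n`, so that `ξᵢ = hᵢ nᵢ`. -/

/-- The partial difference `(δᵢ u)(ξ) = (u(ξ + hᵢ eᵢ) - u(ξ)) / hᵢ`. -/
noncomputable def pdiff {k N : ℕ} (h : Fin k → ℝ) (i : Fin k)
    (u : (Fin k → ℕ) → EuclideanSpace ℝ (Fin N)) : (Fin k → ℕ) → EuclideanSpace ℝ (Fin N) :=
  fun n => (h i)⁻¹ • (u (n + Pi.single i 1) - u n)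

/-- The higher partial difference `δ^α = δ₁^{α₁} ⋯ δ_k^{α_k}`. -/
noncomputable def multiDiff {k N : ℕ} (h : Fin k → ℝ) (α : Fin k → ℕ)
    (u : (Fin k → ℕ) → EuclideanSpace ℝ (Fin N)) : (Fin k → ℕ) → EuclideanSpace ℝ (Fin N) :=
  (List.finRange k).foldr (fun i v => (pdiff h i)^[α i] v) u

/-- The mesh sizes `(ε, …, ε, 1)`: the last of the `M = m + 1` directions stays discrete. -/
def mesh (m : ℕ) (ε : ℝ) : Fin (m + 1) → ℝ := Fin.snoc (α := fun _ => ℝ) (fun _ => ε) 1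

/-- The index set of `B^ε(r) = B₀^ε(r) × {0, 1}`. -/
def latticeBox (m : ℕ) (ε r : ℝ) : Set (Fin (m + 1) → ℕ) :=
  {n | (∀ i : Fin m, ε * (n i.castSucc : ℝ) ≤ r) ∧ n (Fin.last m) ≤ 1}

/-- `x : B^ε(r) → ℝᴺ` is an `(m+1)`-dimensional discrete conjugate net with rotation coefficients
`c i j` (`i ≠ j`): `δᵢδⱼ x = cⱼᵢ δᵢ x + cᵢⱼ δⱼ x` for each elementary square inside `B^ε(r)`. -/
def IsDiscreteConjugateNetWith {m N : ℕ} (ε r : ℝ)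
    (x : (Fin (m + 1) → ℕ) → EuclideanSpace ℝ (Fin N))
    (c : Fin (m + 1) → Fin (m + 1) → (Fin (m + 1) → ℕ) → ℝ) : Prop :=
  ∀ i j, i ≠ j → ∀ n, n + Pi.single i 1 + Pi.single j 1 ∈ latticeBox m ε r →
    pdiff (mesh m ε) i (pdiff (mesh m ε) j x) n =
      c j i n • pdiff (mesh m ε) i x n + c i j n • pdiff (mesh m ε) j x n

/-- `x : B^ε(r) → ℝᴺ` is an `(m+1)`-dimensional discrete conjugate net which has the restrictions
of the curves `X i` as its coordinate curves in the level `ξ_M = 0`, takes the value `P` at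
`(0, 1)`, and has rotation coefficients equal to the restrictions of `C i j` on the coordinate
planes `(i, j)`, `1 ≤ i ≠ j ≤ m`, and of `C_{Mi}`, `C_{iM}` on the `i`-th axis. -/
def SolvesDiscreteProblem {m N : ℕ} (ε r : ℝ)
    (X : Fin m → ℝ → EuclideanSpace ℝ (Fin N)) (C : Fin m → Fin m → ℝ × ℝ → ℝ)
    (P : EuclideanSpace ℝ (Fin N)) (CM CiM : Fin m → ℝ → ℝ)
    (x : (Fin (m + 1) → ℕ) → EuclideanSpace ℝ (Fin N)) : Prop :=
  ∃ c, IsDiscreteConjugateNetWith ε r x c ∧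
    (∀ i : Fin m, ∀ k : ℕ, ε * k ≤ r → x (Pi.single i.castSucc k) = X i (ε * k)) ∧
    (∀ i j : Fin m, i ≠ j → ∀ k l : ℕ, ε * k ≤ r → ε * l ≤ r →
      c i.castSucc j.castSucc (Pi.single i.castSucc k + Pi.single j.castSucc l)
        = C i j (ε * k, ε * l)) ∧
    x (Pi.single (Fin.last m) 1) = P ∧
    (∀ i : Fin m, ∀ k : ℕ, ε * k ≤ r →
      c (Fin.last m) i.castSucc (Pi.single i.castSucc k) = CM i (ε * k) ∧
      c i.castSucc (Fin.last m) (Pi.single i.castSucc k) = CiM i (ε * k))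

/-! ### Convergence -/

/-- The norm `‖u‖_ℓ = sup { |δ^α u(ξ)| : |α| ≤ ℓ, ξ ∈ B₀^ε(r - ε|α|) }` of `u : B₀^ε(r) → ℝᴺ`. -/
noncomputable def latticeNorm {m N : ℕ} (ε r : ℝ) (l : ℕ)
    (u : (Fin m → ℕ) → EuclideanSpace ℝ (Fin N)) : ℝ≥0∞ :=
  ⨆ (α : Fin m → ℕ) (_ : ∑ i, α i ≤ l) (n : Fin m → ℕ)
    (_ : ∀ i, ε * (n i : ℝ) ≤ r - ε * ((∑ i, α i : ℕ) : ℝ)),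
    ‖multiDiff (fun _ => ε) α u n‖ₑ

/-- The family `u ε : B₀^ε(r) → ℝᴺ`, `0 < ε < ε₁`, is `O(ε)`-convergent in `C^∞(B₀(r))` to `v`:
for every `ℓ` there is a constant `K` with `‖u ε - v‖_ℓ ≤ K ε` for all `ε < ε₁` with
`ε < r / ℓ`. -/
def OConverges {m N : ℕ} (r ε₁ : ℝ) (u : ℝ → (Fin m → ℕ) → EuclideanSpace ℝ (Fin N))
    (v : (Fin m → ℝ) → EuclideanSpace ℝ (Fin N)) : Prop :=
  ∀ l : ℕ, ∃ K : ℝ, ∀ ε : ℝ, 0 < ε → ε < ε₁ → ε * l < r →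
    latticeNorm ε r l (fun n => u ε n - v (fun i => ε * n i)) ≤ ENNReal.ofReal (K * ε)

end ConjNet

open ConjNet

/-! Conjugate nets are encoded in matrices β indexed by `NetIdx`: the m directions i, the
transformation direction M, one index o, and the N coordinates l. The Darboux system is ∂_k β_ab =
β_ak β_kb for k different from a and b. Put h_i = β_oi, x_l = β_ol, and let w_i be the vector with
entries β_il. The system then contains ∂_i x = h_i w_i, ∂_i h_j = h_i β_ij and ∂_i w_j = β_ji w_i,
so x is a conjugate net with rotation coefficients h_i β_ij / h_j.

The discrete counterpart is the rational map `darbouxStep`, a rank-one update by the column and row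
of the direction of the step. Steps in different directions commute (`darbouxStep_comm`), also with
different mesh sizes. The Jonas transform is one step with mesh 1 in the direction M, and the
discrete nets use the same step with mesh ε in the other directions. Thus x, x⁺ and the discrete
nets are all read off from solutions of one hyperbolic system whose data β_ab live on the (a,
b)-planes. With the normalisation h_i = 1, β_ii = 0 on the i-th axis, prescribed rotation
coefficients determine these data explicitly through exponentials (smooth case) and products
(discrete case).

Smooth existence: an integral form of the system is solved by the inverse function theorem, with
smooth dependence on a scaling parameter. It yields the Darboux equations only in radial
combination; the defects satisfy a linear homogeneous system of their own, which forces them to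
vanish near 0 (`exists_darboux_solution`).

Convergence: (discrete - smooth)/ε solves a linear hyperbolic difference system with bounded
coefficients and data. A discrete Gronwall estimate bounds it together with all its difference
quotients, uniformly in ε (`diffBdd_of_linear_system`, `exists_discreteDarboux_convergence`).

Smooth uniqueness: in general position the rotation and transformation coefficients are smooth and
obey a closed first-order system, obtained by comparing mixed derivatives, so a Goursat uniqueness
theorem applies (`goursat_unique`). General position of a competitor is not given in advance; it is
obtained by continuation in the size of the cube.

Discrete uniqueness: a square with given coefficients determines its last vertex, and the last
vertex of a 3-cube is the common point of three planes. The planes are transversal for small ε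
because the first differences are close to the vectors at the origin (`discreteProblem_eqOn`). -/

section Curry

/-! ### Smoothness of maps into spaces of continuous functions, and Hadamard's lemma. -/

variable {K H E : Type} [TopologicalSpace K] [CompactSpace K] [NormedAddCommGroup H]
  [NormedSpace ℝ H] [NormedAddCommGroup E] [NormedSpace ℝ E]

/-- A continuous family of linear maps as a linear map into continuous functions. -/
noncomputable def familyToLinear (K E F : Type) [TopologicalSpace K] [CompactSpace K]
    [NormedAddCommGroup E] [NormedSpace ℝ E] [NormedAddCommGroup F] [NormedSpace ℝ F] :
    C(K, E →L[ℝ] F) →L[ℝ] (E →L[ℝ] C(K, F)) :=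
  LinearMap.mkContinuous₂
    (LinearMap.mk₂ ℝ (fun (φ : C(K, E →L[ℝ] F)) (e : E) =>
        (⟨fun k => φ k e, by fun_prop⟩ : C(K, F)))
      (by intros; ext; simp) (by intros; ext; simp) (by intros; ext; simp)
      (by intros; ext; simp)) 1 (by
    intro φ e
    rw [ContinuousMap.norm_le _ (by positivity)]
    intro k
    calc ‖φ k e‖ ≤ ‖φ k‖ * ‖e‖ := (φ k).le_opNorm e
      _ ≤ 1 * ‖φ‖ * ‖e‖ := by
        rw [one_mul]; gcongr; exact φ.norm_coe_le_norm k)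

@[simp] theorem familyToLinear_apply {F : Type} [NormedAddCommGroup F] [NormedSpace ℝ F]
    (φ : C(K, E →L[ℝ] F)) (e : E) (k : K) : familyToLinear K E F φ e k = φ k e := rfl

/-- The derivative of the curried map is the curried partial derivative of `g` in the direction of
`E`, transported by `familyToLinear`. This is a map of the same kind with one order of smoothness
less, so induction applies once the target space `F` is left free. -/
theorem contDiff_nat_curry (κ : C(K, H)) (n : ℕ) : ∀ {F : Type} [NormedAddCommGroup F]
    [NormedSpace ℝ F] (g : E × H → F) (f : E → C(K, F)), ContDiff ℝ n g →
    (∀ e k, f e k = g (e, κ k)) → ContDiff ℝ n f := by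
  induction n with
  | zero =>
    intro F _ _ g f hg hf
    rw [Nat.cast_zero, contDiff_zero] at hg ⊢
    refine ContinuousMap.continuous_of_continuous_uncurry f ?_
    have : Function.uncurry (fun x y => f x y) = fun p : E × K => g (p.1, κ p.2) := by
      ext p; exact hf _ _
    rw [this]; fun_prop
  | succ n ih =>
    intro F _ _ g f hg hf
    have hg1 : ContDiff ℝ 1 g := hg.of_le (by exact_mod_cast Nat.succ_le_succ (Nat.zero_le n))
    have hgd : Differentiable ℝ g := hg1.differentiable (by norm_num)
    have hg' : ContDiff ℝ n (fderiv ℝ g) := hg.fderiv_right (by norm_cast)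
    set g1 : E × H → E →L[ℝ] F :=
      fun p => (fderiv ℝ g p).comp (ContinuousLinearMap.inl ℝ E H) with hg1def
    have hg1c : ContDiff ℝ n g1 := hg'.clm_comp contDiff_const
    have hc1 : Continuous g1 := hg1c.continuous
    let f1 : E → C(K, E →L[ℝ] F) := fun e => ⟨fun k => g1 (e, κ k), by fun_prop⟩
    have hf1 : ContDiff ℝ n f1 := ih g1 f1 hg1c (fun _ _ => rfl)
    have hL : ContDiff ℝ n (fun φ : C(K, E →L[ℝ] F) => familyToLinear K E F φ) :=
      ContinuousLinearMap.contDiff (𝕜 := ℝ) (E := C(K, E →L[ℝ] F)) (F := E →L[ℝ] C(K, F)) (familyToLinear K E F)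
    rw [Nat.cast_succ, contDiff_succ_iff_hasFDerivAt]
    refine ⟨fun e => familyToLinear K E F (f1 e),
      hL.comp hf1, fun e => ?_⟩
    rw [hasFDerivAt_iff_isLittleO_nhds_zero, Asymptotics.isLittleO_iff]
    intro c hc
    obtain ⟨δ, hδ, hball⟩ := Metric.continuousAt_iff.1 (hf1.continuous.continuousAt (x := e)) c hc
    filter_upwards [Metric.ball_mem_nhds (0 : E) hδ] with h hh
    rw [ContinuousMap.norm_le _ (by positivity)]
    intro k
    -- The mean value inequality gives the remainder estimate uniformly in `k`, because the
    -- derivative is continuous in `e` for the supremum norm.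
    have hseg := (convex_ball e δ).norm_image_sub_le_of_norm_hasFDerivWithin_le'
      (f := fun x => g (x, κ k)) (f' := fun x => g1 (x, κ k)) (φ := g1 (e, κ k)) (C := c)
      (x := e) (y := e + h)
      (fun x _ => by
        have h1 : HasFDerivAt (fun x : E => (x, κ k)) (ContinuousLinearMap.inl ℝ E H) x :=
          hasFDerivAt_prodMk_left x (κ k)
        exact ((hgd (x, κ k)).hasFDerivAt.comp x h1).hasFDerivWithinAt)
      (fun x hx => by
        have := hball hx
        rw [dist_eq_norm] at this
        exact ((f1 x - f1 e).norm_coe_le_norm k).trans this.le)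
      (Metric.mem_ball_self hδ) (by simpa [dist_eq_norm] using hh)
    simpa [hf, f1] using hseg

theorem contDiff_curry (κ : C(K, H)) {F : Type} [NormedAddCommGroup F]
    [NormedSpace ℝ F] (g : E × H → F) (f : E → C(K, F)) (hg : ContDiff ℝ ∞ g)
    (hf : ∀ e k, f e k = g (e, κ k)) : ContDiff ℝ ∞ f :=
  contDiff_infty.2 fun n => contDiff_nat_curry κ n g f (contDiff_infty.1 hg n) hf

/-- Integration over `[0, 1]` as a continuous linear map. -/
noncomputable def unitIntegral (F : Type) [NormedAddCommGroup F] [NormedSpace ℝ F]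
    [CompleteSpace F] : C(Set.Icc (0 : ℝ) 1, F) →L[ℝ] F :=
  LinearMap.mkContinuous
    { toFun := fun f => ∫ s in (0 : ℝ)..1, Set.IccExtend zero_le_one f s
      map_add' := fun f g => by
        have hf : Continuous (Set.IccExtend zero_le_one f) := f.continuous.Icc_extend'
        have hg : Continuous (Set.IccExtend zero_le_one g) := g.continuous.Icc_extend'
        rw [← intervalIntegral.integral_add (hf.intervalIntegrable _ _)
          (hg.intervalIntegrable _ _)]
        rfl
      map_smul' := fun c f => by
        rw [RingHom.id_apply, ← intervalIntegral.integral_smul]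
        rfl } 1 (fun f => by
    have := intervalIntegral.norm_integral_le_of_norm_le_const (a := (0 : ℝ)) (b := 1) (C := ‖f‖)
      (f := Set.IccExtend zero_le_one f) (fun s _ => f.norm_coe_le_norm _)
    simpa using this)

theorem unitIntegral_apply {F : Type} [NormedAddCommGroup F] [NormedSpace ℝ F]
    [CompleteSpace F] (f : C(Set.Icc (0 : ℝ) 1, F)) (g : ℝ → F) (h : ∀ s, f s = g s) :
    unitIntegral F f = ∫ s in (0 : ℝ)..1, g s := by
  refine intervalIntegral.integral_congr fun s hs => ?_
  rw [Set.uIcc_of_le zero_le_one] at hs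
  rw [Set.IccExtend_of_mem _ _ hs, h]

/-- The integrand depends smoothly on the parameter as an element of C([0, 1], F), and integration
is a continuous linear map on that space. -/
theorem ContDiff.unit_parametric_integral {F : Type} [NormedAddCommGroup F] [NormedSpace ℝ F]
    [CompleteSpace F] {g : E × ℝ → F} (hg : ContDiff ℝ ∞ g) :
    ContDiff ℝ ∞ (fun e => ∫ s in (0 : ℝ)..1, g (e, s)) := by
  have hc := hg.continuous
  let f : E → C(Set.Icc (0 : ℝ) 1, F) := fun e => ⟨fun s => g (e, s), by fun_prop⟩
  have hf : ContDiff ℝ ∞ f := contDiff_curry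
    (⟨fun s => (s : ℝ), by fun_prop⟩ : C(Set.Icc (0 : ℝ) 1, ℝ)) g f hg (fun _ _ => rfl)
  have : ContDiff ℝ ∞ (fun e => unitIntegral F (f e)) := (unitIntegral F).contDiff.comp hf
  convert this using 2 with e
  exact (unitIntegral_apply (f e) (fun s => g (e, s)) (fun _ => rfl)).symm

/-- Hadamard's lemma: the increment of a smooth function in its last variable is divisible by
that variable. -/
theorem exists_hadamard_quotient {F : Type} [NormedAddCommGroup F] [NormedSpace ℝ F]
    [CompleteSpace F] {g : E × ℝ → F} (hg : ContDiff ℝ ∞ g) :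
    ∃ q : E × ℝ → F, ContDiff ℝ ∞ q ∧ (∀ e s, g (e, s) - g (e, 0) = s • q (e, s)) ∧
      ∀ e, q (e, 0) = deriv (fun s => g (e, s)) 0 := by
  have hd : ContDiff ℝ ∞ (fun p : E × ℝ => fderiv ℝ g p (0, 1)) :=
    (hg.fderiv_right (m := ∞) le_rfl).clm_apply contDiff_const
  have hder : ∀ e s, HasDerivAt (fun s => g (e, s)) (fderiv ℝ g (e, s) (0, 1)) s := by
    intro e s
    have h1 : HasDerivAt (fun s : ℝ => (e, s)) ((0 : E), (1 : ℝ)) s :=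
      (hasDerivAt_const s e).prodMk (hasDerivAt_id s)
    exact ((hg.differentiable (by simp)) (e, s)).hasFDerivAt.comp_hasDerivAt s h1
  refine ⟨fun p => ∫ t in (0 : ℝ)..1, fderiv ℝ g (p.1, t * p.2) (0, 1), ?_, ?_, ?_⟩
  · refine ContDiff.unit_parametric_integral (E := E × ℝ)
      (g := fun q : (E × ℝ) × ℝ => fderiv ℝ g (q.1.1, q.2 * q.1.2) (0, 1)) ?_
    exact hd.comp (by fun_prop)
  · intro e s
    have h1 : ∀ t ∈ Set.uIcc (0 : ℝ) 1, HasDerivAt (fun t => g (e, t * s))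
        (s • fderiv ℝ g (e, t * s) (0, 1)) t := by
      intro t _
      have := (hder e (t * s)).scomp t ((hasDerivAt_id t).mul_const s)
      simpa [Function.comp_def] using this
    have h2 := intervalIntegral.integral_eq_sub_of_hasDerivAt h1 (by
      refine Continuous.intervalIntegrable ?_ _ _
      have := hd.continuous
      exact continuous_const.smul (this.comp (f := fun t : ℝ => (e, t * s)) (by fun_prop)))
    rw [intervalIntegral.integral_smul] at h2
    simp only [one_mul, zero_mul] at h2
    exact h2.symm
  · intro e
    simp [(hder e 0).deriv]

end Curry

/-! ### Smooth extension, and an implicit function theorem for small perturbations. -/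

/-- A function which is smooth on a ball agrees with a globally smooth one on smaller balls. -/
theorem exists_contDiff_eqOn_ball {E F : Type} [NormedAddCommGroup E] [NormedSpace ℝ E]
    [FiniteDimensional ℝ E] [NormedAddCommGroup F] [NormedSpace ℝ F] {f : E → F} {ρ : ℝ}
    (hρ : 0 < ρ) (hf : ContDiffOn ℝ ∞ f (Metric.ball 0 ρ)) :
    ∃ g : E → F, ContDiff ℝ ∞ g ∧ Set.EqOn g f (Metric.ball 0 (ρ / 2)) := by
  let χ : ContDiffBump (0 : E) := ⟨ρ / 2, 3 * ρ / 4, by linarith, by linarith⟩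
  refine ⟨fun x => χ x • f x, ?_, fun x hx => ?_⟩
  · rw [contDiff_iff_contDiffAt]
    intro x
    by_cases hx : x ∈ Metric.ball (0 : E) ρ
    · exact χ.contDiffAt.smul (hf.contDiffAt (Metric.isOpen_ball.mem_nhds hx))
    · have h0 : (fun x => χ x • f x) =ᶠ[nhds x] fun _ => 0 := by
        have : x ∈ (Metric.closedBall (0 : E) (3 * ρ / 4))ᶜ := by
          simp only [Metric.mem_ball, dist_zero_right, not_lt] at hx
          simp only [Set.mem_compl_iff, Metric.mem_closedBall, dist_zero_right, not_le]
          linarith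
        filter_upwards [Metric.isClosed_closedBall.isOpen_compl.mem_nhds this] with y hy
        rw [χ.zero_of_le_dist, zero_smul]
        simp only [Set.mem_compl_iff, Metric.mem_closedBall, not_le] at hy
        exact hy.le
      exact contDiffAt_const.congr_of_eventuallyEq h0
  · have : χ x = 1 := χ.one_of_mem_closedBall (Metric.ball_subset_closedBall hx)
    simp [this]

/-- A smooth one-parameter-per-direction perturbation `v = D σ + ∑ σₖ Nₖ(v)` has a locally unique
smooth solution near `σ = 0`. -/
theorem exists_smooth_perturbed_solution {m : ℕ} {V : Type} [NormedAddCommGroup V]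
    [NormedSpace ℝ V] [CompleteSpace V] {D : (Fin m → ℝ) → V} (hD : ContDiff ℝ ∞ D)
    {N : Fin m → V → V} (hN : ∀ k, ContDiff ℝ ∞ (N k)) :
    ∃ ρ > 0, ∃ δ > 0, ∃ ψ : (Fin m → ℝ) → V, ContDiffOn ℝ ∞ ψ (Metric.ball 0 ρ) ∧
      (∀ σ ∈ Metric.ball 0 ρ, ψ σ = D σ + ∑ k, σ k • N k (ψ σ)) ∧
      (∀ σ ∈ Metric.ball 0 ρ, ‖ψ σ - D 0‖ < δ) ∧
      ∀ σ ∈ Metric.ball 0 ρ, ∀ v, ‖v - D 0‖ < δ → v = D σ + ∑ k, σ k • N k v → v = ψ σ := by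
  set Q : (Fin m → ℝ) × V → V := fun p => D p.1 + ∑ k, p.1 k • N k p.2 with hQ
  -- Solutions of the equation for σ are exactly the preimages of (σ, 0) under this map, so the
  -- inverse function theorem applies.
  set Φ : (Fin m → ℝ) × V → (Fin m → ℝ) × V := fun p => (p.1, p.2 - Q p) with hΦ
  have hproj : ∀ k : Fin m, ContDiff ℝ ∞ (fun p : (Fin m → ℝ) × V => p.1 k) := fun k =>
    (contDiff_apply ℝ ℝ k).comp contDiff_fst
  have hQs : ContDiff ℝ ∞ Q := (hD.comp contDiff_fst).add
    (ContDiff.sum fun k _ => (hproj k).smul ((hN k).comp contDiff_snd))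
  have hΦs : ContDiff ℝ ∞ Φ := contDiff_fst.prodMk (contDiff_snd.sub hQs)
  set p0 : (Fin m → ℝ) × V := (0, D 0) with hp0
  let T : (Fin m → ℝ) →L[ℝ] V := fderiv ℝ D 0 +
    ∑ k, (ContinuousLinearMap.proj (R := ℝ) (φ := fun _ : Fin m => ℝ) k).smulRight (N k (D 0))
  let F : (Fin m → ℝ) × V →L[ℝ] (Fin m → ℝ) := ContinuousLinearMap.fst ℝ _ _
  let S : (Fin m → ℝ) × V →L[ℝ] V := ContinuousLinearMap.snd ℝ _ _
  -- The derivative of `Φ` at σ = 0: the nonlinear terms carry a factor σ_k, so they contribute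
  -- nothing in the direction of `V` and the derivative is triangular.
  let L : ((Fin m → ℝ) × V) ≃L[ℝ] (Fin m → ℝ) × V :=
    ContinuousLinearEquiv.equivOfInverse (F.prod (S - T.comp F)) (F.prod (S + T.comp F))
      (fun p => by simp [F, S]) (fun p => by simp [F, S])
  have hQd : HasFDerivAt Q (T.comp F) p0 := by
    have h1 : HasFDerivAt (fun p : (Fin m → ℝ) × V => D p.1) ((fderiv ℝ D 0).comp F) p0 := by
      have := ((hD.differentiable (by simp)) 0).hasFDerivAt
      exact this.comp p0 (hasFDerivAt_fst (p := p0))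
    have h2 : ∀ k, HasFDerivAt (fun p : (Fin m → ℝ) × V => p.1 k • N k p.2)
        (((ContinuousLinearMap.proj (R := ℝ) (φ := fun _ : Fin m => ℝ) k).smulRight
          (N k (D 0))).comp F) p0 := by
      intro k
      have hc : HasFDerivAt (fun p : (Fin m → ℝ) × V => p.1 k)
          ((ContinuousLinearMap.proj (R := ℝ) (φ := fun _ : Fin m => ℝ) k).comp F) p0 :=
        ((ContinuousLinearMap.proj (R := ℝ) (φ := fun _ : Fin m => ℝ) k).comp F).hasFDerivAt
      have hf : HasFDerivAt (fun p : (Fin m → ℝ) × V => N k p.2)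
          ((fderiv ℝ (N k) (D 0)).comp S) p0 :=
        (((hN k).differentiable (by simp)) (D 0)).hasFDerivAt.comp p0 (hasFDerivAt_snd (p := p0))
      refine (hc.fun_smul hf).congr_fderiv ?_
      ext q <;> simp [hp0]
    refine (h1.add (HasFDerivAt.fun_sum fun k (_ : k ∈ Finset.univ) => h2 k)).congr_fderiv ?_
    simp only [T, ContinuousLinearMap.add_comp, ContinuousLinearMap.finsetSum_comp]
  have hΦd : HasFDerivAt Φ (L : (Fin m → ℝ) × V →L[ℝ] (Fin m → ℝ) × V) p0 :=
    (hasFDerivAt_fst (p := p0)).prodMk ((hasFDerivAt_snd (p := p0)).sub hQd)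
  have hΦ0 : Φ p0 = (0, 0) := by simp [hΦ, hQ, hp0]
  set e := ContDiffAt.toOpenPartialHomeomorph Φ (hΦs.contDiffAt (x := p0)) hΦd (by simp) with he
  have he_coe : ∀ p, e p = Φ p := fun p => rfl
  have hmem : p0 ∈ e.source := ContDiffAt.mem_toOpenPartialHomeomorph_source _ hΦd (by simp)
  -- Invertibility of the derivative near `p0`, and not only at `p0`, makes the local inverse smooth
  -- on a whole neighbourhood.
  have hinv : {p | ∃ L' : ((Fin m → ℝ) × V) ≃L[ℝ] (Fin m → ℝ) × V,
      (L' : (Fin m → ℝ) × V →L[ℝ] (Fin m → ℝ) × V) = fderiv ℝ Φ p} ∈ nhds p0 := by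
    have hc : ContinuousAt (fderiv ℝ Φ) p0 := (hΦs.continuous_fderiv (by simp)).continuousAt
    have hL := L.nhds
    rw [← hΦd.fderiv] at hL
    exact hc.preimage_mem_nhds hL
  obtain ⟨δ, hδ, hδsub⟩ := Metric.mem_nhds_iff.1
    (Filter.inter_mem (e.open_source.mem_nhds hmem) hinv)
  have hcont : ContinuousAt (fun σ : Fin m → ℝ => e.symm (σ, 0)) 0 := by
    have h1 : ContinuousAt e.symm ((0 : Fin m → ℝ), (0 : V)) := by
      have := e.continuousAt_symm (e.map_source hmem)
      rwa [he_coe, hΦ0] at this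
    exact ContinuousAt.comp (g := e.symm) (f := fun σ : Fin m → ℝ => (σ, (0 : V))) h1
      (by fun_prop)
  have hs0 : e.symm ((0 : Fin m → ℝ), (0 : V)) = p0 := by
    rw [← hΦ0, ← he_coe, e.left_inv hmem]
  have htar : {σ : Fin m → ℝ | (σ, (0 : V)) ∈ e.target} ∈ nhds (0 : Fin m → ℝ) := by
    have hc : ContinuousAt (fun σ : Fin m → ℝ => (σ, (0 : V))) 0 := by fun_prop
    apply hc
    refine e.open_target.mem_nhds ?_
    have := e.map_source hmem
    rwa [he_coe, hΦ0] at this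
  have hball : {σ : Fin m → ℝ | e.symm (σ, 0) ∈ Metric.ball p0 δ} ∈ nhds (0 : Fin m → ℝ) := by
    apply hcont
    simp only [hs0]
    exact Metric.ball_mem_nhds _ hδ
  obtain ⟨ρ, hρ, hρsub⟩ := Metric.mem_nhds_iff.1
    (Filter.inter_mem (Filter.inter_mem htar hball) (Metric.ball_mem_nhds (0 : Fin m → ℝ) hδ))
  have hright : ∀ σ ∈ Metric.ball (0 : Fin m → ℝ) ρ, Φ (e.symm (σ, 0)) = (σ, 0) := fun σ hσ => by
    rw [← he_coe, e.right_inv (hρsub hσ).1.1]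
  have hfst : ∀ σ ∈ Metric.ball (0 : Fin m → ℝ) ρ, (e.symm (σ, 0)).1 = σ := fun σ hσ =>
    congrArg Prod.fst (hright σ hσ)
  have hpair : ∀ σ ∈ Metric.ball (0 : Fin m → ℝ) ρ,
      e.symm (σ, 0) = (σ, (e.symm (σ, 0)).2) := fun σ hσ => Prod.ext (hfst σ hσ) rfl
  refine ⟨ρ, hρ, δ, hδ, fun σ => (e.symm (σ, 0)).2, ?_, ?_, ?_, ?_⟩
  · intro σ hσ
    obtain ⟨L', hL'⟩ := (hδsub (hρsub hσ).1.2).2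
    have hd : HasFDerivAt e (L' : (Fin m → ℝ) × V →L[ℝ] (Fin m → ℝ) × V) (e.symm (σ, 0)) := by
      rw [hL']
      exact ((hΦs.differentiable (by simp)) _).hasFDerivAt
    have h1 := e.contDiffAt_symm (hρsub hσ).1.1 hd (hΦs.contDiffAt (n := ∞))
    have h2 : ContDiffAt ℝ ∞ (fun σ : Fin m → ℝ => (σ, (0 : V))) σ := by fun_prop
    exact (contDiff_snd.contDiffAt.comp σ (h1.comp σ h2)).contDiffWithinAt
  · intro σ hσ
    have := congrArg Prod.snd (hright σ hσ)
    rw [hpair σ hσ] at this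
    simp only [hΦ, hQ] at this
    exact sub_eq_zero.1 this
  · intro σ hσ
    have := (hρsub hσ).1.2
    rw [Set.mem_ofPred_eq, Metric.mem_ball, Prod.dist_eq, max_lt_iff, dist_eq_norm,
      dist_eq_norm] at this
    exact this.2
  · intro σ hσ v hv hveq
    have hmem' : ((σ, v) : (Fin m → ℝ) × V) ∈ e.source := by
      refine (hδsub ?_).1
      rw [Metric.mem_ball, Prod.dist_eq, max_lt_iff, dist_eq_norm, dist_eq_norm]
      refine ⟨?_, hv⟩
      have := (hρsub hσ).2
      rwa [Metric.mem_ball, dist_eq_norm] at this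
    have h1 : Φ (σ, v) = (σ, 0) := by
      simp only [hΦ, hQ, Prod.mk.injEq, true_and]
      exact sub_eq_zero.2 hveq
    have h2 := e.left_inv hmem'
    rw [he_coe, h1] at h2
    simp [h2]

/-! ### The integral form of the Darboux system. -/

/-- The unit cube as a compact space. -/
abbrev UnitCube (m : ℕ) : Type := Set.Icc (0 : Fin m → ℝ) 1

/-- Square matrices of continuous functions on the unit cube. -/
abbrev MatrixOnCube (m : ℕ) (A : Type) : Type := A → A → C(UnitCube m, ℝ)

section Planes

variable {m : ℕ} {A : Type} [DecidableEq A] (ι : Fin m → A) (a b : A)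

/-- Keep the coordinates in the directions `a`, `b` and set the others to zero. -/
def keep {R : Type} [Zero R] (t : Fin m → R) : Fin m → R :=
  fun i => if ι i = a ∨ ι i = b then t i else 0

/-- Keep the coordinates in the directions `a`, `b` and multiply the others by `μ`. -/
def ray (μ : ℝ) (t : Fin m → ℝ) : Fin m → ℝ :=
  fun i => if ι i = a ∨ ι i = b then t i else μ * t i

theorem ray_one (t : Fin m → ℝ) : ray ι a b 1 t = t := by
  ext i; simp [ray]

theorem ray_zero (t : Fin m → ℝ) : ray ι a b 0 t = keep ι a b t := by
  ext i; simp [ray, keep]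

theorem ray_ray (μ ν : ℝ) (t : Fin m → ℝ) : ray ι a b μ (ray ι a b ν t) = ray ι a b (μ * ν) t := by
  ext i
  by_cases h : ι i = a ∨ ι i = b <;> simp [ray, h, mul_assoc]

theorem ray_mul (μ : ℝ) (s t : Fin m → ℝ) : ray ι a b μ (s * t) = s * ray ι a b μ t := by
  ext i
  by_cases h : ι i = a ∨ ι i = b <;> simp [ray, h, mul_left_comm]

theorem keep_ray (μ : ℝ) (t : Fin m → ℝ) : keep ι a b (ray ι a b μ t) = keep ι a b t := by
  ext i
  by_cases h : ι i = a ∨ ι i = b <;> simp [ray, keep, h]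

theorem continuous_ray : Continuous (fun p : ℝ × (Fin m → ℝ) => ray ι a b p.1 p.2) := by
  refine continuous_pi fun i => ?_
  by_cases h : ι i = a ∨ ι i = b
  · simp only [ray, h, if_true]; fun_prop
  · simp only [ray, h, if_false]; fun_prop

theorem norm_ray_le {μ : ℝ} (h0 : 0 ≤ μ) (h1 : μ ≤ 1) (t : Fin m → ℝ) : ‖ray ι a b μ t‖ ≤ ‖t‖ := by
  refine (pi_norm_le_iff_of_nonneg (norm_nonneg t)).2 fun i => ?_
  by_cases h : ι i = a ∨ ι i = b
  · simpa [ray, h] using norm_le_pi_norm t i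
  · simp only [ray, h, if_false, norm_mul, Real.norm_of_nonneg h0]
    exact (mul_le_of_le_one_left (norm_nonneg _) h1).trans (norm_le_pi_norm t i)

theorem ray_mem_Icc {μ : ℝ} (hμ : μ ∈ Set.Icc (0 : ℝ) 1) {t : Fin m → ℝ}
    (ht : t ∈ Set.Icc (0 : Fin m → ℝ) 1) : ray ι a b μ t ∈ Set.Icc (0 : Fin m → ℝ) 1 := by
  have h2 := fun i => ht.1 i
  have h3 := fun i => ht.2 i
  constructor <;> intro i <;> by_cases h : ι i = a ∨ ι i = b <;> simp [ray, h]
  · simpa using h2 i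
  · exact mul_nonneg hμ.1 (h2 i)
  · simpa using h3 i
  · exact mul_le_one₀ hμ.2 (h2 i) (h3 i)

/-- The mean over the ray from the `(a, b)`-plane, on continuous functions on the unit cube. -/
noncomputable def rayMean :
    C(Set.Icc (0 : Fin m → ℝ) 1, ℝ) →L[ℝ] C(Set.Icc (0 : Fin m → ℝ) 1, ℝ) :=
  let R : C(Set.Icc (0 : Fin m → ℝ) 1 × Set.Icc (0 : ℝ) 1, Set.Icc (0 : Fin m → ℝ) 1) :=
    ⟨fun p => ⟨ray ι a b p.2 p.1, ray_mem_Icc ι a b p.2.2 p.1.2⟩,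
      ((continuous_ray ι a b).comp (by fun_prop :
        Continuous fun p : Set.Icc (0 : Fin m → ℝ) 1 × Set.Icc (0 : ℝ) 1 =>
          ((p.2 : ℝ), (p.1 : Fin m → ℝ)))).subtype_mk _⟩
  LinearMap.mkContinuous
    { toFun := fun f => ⟨fun s => unitIntegral ℝ ((f.comp R).curry s), by fun_prop⟩
      map_add' := fun f g => by
        ext s
        exact (unitIntegral ℝ).map_add ((f.comp R).curry s) ((g.comp R).curry s)
      map_smul' := fun c f => by
        ext s
        exact (unitIntegral ℝ).map_smul c ((f.comp R).curry s) } ‖unitIntegral ℝ‖ (fun f => by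
    rw [ContinuousMap.norm_le _ (by positivity)]
    intro s
    refine ((unitIntegral ℝ).le_opNorm _).trans ?_
    gcongr
    rw [ContinuousMap.norm_le _ (by positivity)]
    intro x
    exact f.norm_coe_le_norm _)

end Planes

section Existence

variable {m : ℕ} {A : Type} [Fintype A] [DecidableEq A] (ι : Fin m → A)

/-- Write t = σ * s with s in the unit cube. For fixed σ the unknown is a matrix of continuous
functions of s, and every integral term carries a factor σ_k, so `exists_smooth_perturbed_solution`
applies. Evaluation at s = 1 turns smooth dependence on σ into smoothness in t. -/
theorem exists_integral_solution (D : A → A → (Fin m → ℝ) → ℝ)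
    (hD : ∀ a b, ContDiff ℝ ∞ (D a b)) :
    ∃ ρ > 0, ∃ β : A → A → (Fin m → ℝ) → ℝ,
      (∀ a b, ContDiffOn ℝ ∞ (β a b) (Metric.ball 0 ρ)) ∧
      ∀ t ∈ Metric.ball (0 : Fin m → ℝ) ρ, ∀ a b, β a b t = D a b t +
        ∑ k, if ι k = a ∨ ι k = b then 0 else t k * ∫ μ in (0 : ℝ)..1,
          β a (ι k) (ray ι a b μ t) * β (ι k) b (ray ι a b μ t) := by
  let incl : C(UnitCube m, Fin m → ℝ) := ⟨fun s => s, by fun_prop⟩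
  let Dc : (Fin m → ℝ) → MatrixOnCube m A := fun σ a b =>
    ⟨fun s => D a b (σ * s), (hD a b).continuous.comp (by fun_prop)⟩
  have hDc : ContDiff ℝ ∞ Dc := by
    refine contDiff_pi.2 fun a => contDiff_pi.2 fun b => ?_
    refine contDiff_curry incl (fun p => D a b (p.1 * p.2)) _ ?_ (fun _ _ => rfl)
    exact (hD a b).comp (contDiff_fst.mul contDiff_snd)
  let crd : Fin m → C(UnitCube m, ℝ) := fun k => ⟨fun s => (s : Fin m → ℝ) k,
    (continuous_apply k).comp continuous_subtype_val⟩
  -- The factor t_k = σ_k s_k is split: s_k stays in the nonlinear operator and σ_k becomes the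
  -- small parameter.
  let N : Fin m → MatrixOnCube m A → MatrixOnCube m A := fun k v a b =>
    if ι k = a ∨ ι k = b then 0 else crd k * rayMean ι a b (v a (ι k) * v (ι k) b)
  have hN : ∀ k, ContDiff ℝ ∞ (N k) := by
    intro k
    refine contDiff_pi.2 fun a => contDiff_pi.2 fun b => ?_
    by_cases h : ι k = a ∨ ι k = b
    · simp only [N, h, if_true]; exact contDiff_const
    · simp only [N, h, if_false]
      have hap : ∀ c d, ContDiff ℝ ∞ (fun v : MatrixOnCube m A => v c d) := fun c d =>
        (contDiff_apply ℝ (C(UnitCube m, ℝ)) d).comp (contDiff_apply ℝ (A → C(UnitCube m, ℝ)) c)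
      have h1 : ContDiff ℝ ∞ (fun v : MatrixOnCube m A => rayMean ι a b (v a (ι k) * v (ι k) b)) :=
        (rayMean ι a b).contDiff.comp ((hap a (ι k)).mul (hap (ι k) b))
      exact contDiff_const.mul h1
  obtain ⟨ρ, hρ, δ, hδ, ψ, hψs, hψe, hψn, hψu⟩ := exists_smooth_perturbed_solution hDc hN
  let one : UnitCube m := ⟨1, Set.right_mem_Icc.2 zero_le_one⟩
  have hmulK : ∀ s s' : UnitCube m, (s : Fin m → ℝ) * s' ∈ Set.Icc (0 : Fin m → ℝ) 1 := fun s s' => by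
    have := s.2; have := s'.2
    constructor <;> intro i
    · exact mul_nonneg (s.2.1 i) (s'.2.1 i)
    · exact mul_le_one₀ (s.2.2 i) (s'.2.1 i) (s'.2.2 i)
  have hball : ∀ σ ∈ Metric.ball (0 : Fin m → ℝ) ρ, ∀ s : UnitCube m,
      σ * (s : Fin m → ℝ) ∈ Metric.ball (0 : Fin m → ℝ) ρ := by
    intro σ hσ s
    rw [Metric.mem_ball, dist_zero_right] at hσ ⊢
    refine lt_of_le_of_lt ((pi_norm_le_iff_of_nonneg (norm_nonneg σ)).2 fun i => ?_) hσ
    rw [Pi.mul_apply, norm_mul]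
    refine (mul_le_of_le_one_right (norm_nonneg _) ?_).trans (norm_le_pi_norm σ i)
    rw [Real.norm_of_nonneg (s.2.1 i)]
    exact s.2.2 i
  -- pointwise form of the fixed point equation
  have hpt : ∀ σ ∈ Metric.ball (0 : Fin m → ℝ) ρ, ∀ a b, ∀ s : UnitCube m, ψ σ a b s = D a b (σ * s) +
      ∑ k, if ι k = a ∨ ι k = b then 0 else σ k * ((s : Fin m → ℝ) k *
        rayMean ι a b (ψ σ a (ι k) * ψ σ (ι k) b) s) := by
    intro σ hσ a b s
    have := congrArg (fun f : C(UnitCube m, ℝ) => f s) (congrFun (congrFun (hψe σ hσ) a) b)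
    simp only [Pi.add_apply, Finset.sum_apply, Pi.smul_apply, ContinuousMap.add_apply] at this
    rw [this]
    congr 1
    rw [ContinuousMap.sum_apply]
    refine Finset.sum_congr rfl fun k _ => ?_
    by_cases h : ι k = a ∨ ι k = b <;> simp [N, h, crd]
  -- the scaling property
  have hscale : ∀ σ ∈ Metric.ball (0 : Fin m → ℝ) ρ, ∀ s : UnitCube m, ∀ a b, ∀ s' : UnitCube m,
      ψ (σ * s) a b s' = ψ σ a b ⟨(s : Fin m → ℝ) * s', hmulK s s'⟩ := by
    intro σ hσ s
    let M : C(UnitCube m, UnitCube m) := ⟨fun s' => ⟨(s : Fin m → ℝ) * s', hmulK s s'⟩, by fun_prop⟩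
    let v : MatrixOnCube m A := fun a b => (ψ σ a b).comp M
    have hv : v = ψ (σ * s) := by
      -- Restricting the solution for σ to the subcube s * [0, 1]^m gives a solution for the
      -- parameter σ * s that is no further from the data at 0. Local uniqueness identifies it.
      refine hψu _ (hball σ hσ s) v ?_ ?_
      · refine lt_of_le_of_lt ?_ (hψn σ hσ)
        refine (pi_norm_le_iff_of_nonneg (norm_nonneg _)).2 fun a =>
          (pi_norm_le_iff_of_nonneg (norm_nonneg _)).2 fun b =>
          (ContinuousMap.norm_le _ (norm_nonneg _)).2 fun s' => ?_
        have h1 : (v - Dc 0) a b s' = (ψ σ - Dc 0) a b (M s') := by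
          simp [v, Dc]
        rw [h1]
        exact ((ContinuousMap.norm_coe_le_norm _ _).trans (norm_le_pi_norm _ b)).trans
          (norm_le_pi_norm (ψ σ - Dc 0) a)
      · funext a b
        ext s'
        simp only [Pi.add_apply, Finset.sum_apply, Pi.smul_apply, ContinuousMap.add_apply]
        rw [ContinuousMap.sum_apply]
        change ψ σ a b (M s') = _
        rw [hpt σ hσ a b (M s')]
        congr 1
        · simp [Dc, M, mul_assoc]
        · refine Finset.sum_congr rfl fun k _ => ?_
          by_cases h : ι k = a ∨ ι k = b
          · simp [N, h]
          · simp only [N, h, if_false, ContinuousMap.smul_apply, ContinuousMap.mul_apply,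
              smul_eq_mul]
            have : rayMean ι a b (ψ σ a (ι k) * ψ σ (ι k) b) (M s')
                = rayMean ι a b (v a (ι k) * v (ι k) b) s' := by
              refine congrArg (unitIntegral ℝ) ?_
              ext μ
              have : M ⟨ray ι a b μ s', ray_mem_Icc ι a b μ.2 s'.2⟩
                  = ⟨ray ι a b μ (M s'), ray_mem_Icc ι a b μ.2 (M s').2⟩ := by
                ext1
                simp [M, ray_mul]
              change (ψ σ a (ι k) * ψ σ (ι k) b)
                  ⟨ray ι a b μ (M s'), ray_mem_Icc ι a b μ.2 (M s').2⟩ =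
                (ψ σ a (ι k) * ψ σ (ι k) b) (M ⟨ray ι a b μ s', ray_mem_Icc ι a b μ.2 s'.2⟩)
              rw [this]
            rw [this]
            simp only [crd, M, ContinuousMap.coe_mk, Pi.mul_apply]
            ring
    intro a b s'
    rw [← hv]
    rfl
  refine ⟨ρ, hρ, fun a b t => ψ t a b one, fun a b => ?_, fun t ht a b => ?_⟩
  · have hap : ContDiff ℝ ∞ (fun v : MatrixOnCube m A => v a b) :=
      (contDiff_apply ℝ (C(UnitCube m, ℝ)) b).comp (contDiff_apply ℝ (A → C(UnitCube m, ℝ)) a)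
    have hev : ContDiff ℝ ∞ (fun f : C(UnitCube m, ℝ) => f one) :=
      ContinuousLinearMap.contDiff (𝕜 := ℝ) (E := C(UnitCube m, ℝ)) (F := ℝ)
        (ContinuousMap.evalCLM ℝ one)
    exact (hev.comp hap).comp_contDiffOn hψs
  · refine (hpt t ht a b one).trans ?_
    congr 1
    · simp [one]
    · refine Finset.sum_congr rfl fun k _ => ?_
      split_ifs with h
      · rfl
      · congr 1
        simp only [one, Pi.one_apply, one_mul]
        refine unitIntegral_apply _ (fun μ => ψ (ray ι a b μ t) a (ι k) one *
          ψ (ray ι a b μ t) (ι k) b one) fun μ => ?_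
        -- A point of the ray is t times a point of the unit cube, so scaling expresses the values
        -- there through `ψ t` alone.
        have h1 : ray ι a b μ t = t * (⟨ray ι a b μ 1, ray_mem_Icc ι a b μ.2 one.2⟩ : UnitCube m) := by
          rw [← ray_mul, mul_one]
        rw [h1, hscale t ht, hscale t ht]
        have h2 : (⟨((⟨ray ι a b μ 1, ray_mem_Icc ι a b μ.2 one.2⟩ : UnitCube m) : Fin m → ℝ) * one,
            hmulK _ _⟩ : UnitCube m) = ⟨ray ι a b μ 1, ray_mem_Icc ι a b μ.2 one.2⟩ := by
          ext1; simp [one]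
        rw [h2]
        rfl

end Existence

/-! ### From the integral equation to the Darboux system. -/

/-- The partial derivative in the `k`-th coordinate direction. -/
noncomputable def pd {m : ℕ} (k : Fin m) (u : (Fin m → ℝ) → ℝ) : (Fin m → ℝ) → ℝ :=
  fun t => fderiv ℝ u t (Pi.single k 1)

section PD

variable {m : ℕ} {u v : (Fin m → ℝ) → ℝ}

theorem pd_contDiff (k : Fin m) (hu : ContDiff ℝ ∞ u) : ContDiff ℝ ∞ (pd k u) :=
  (hu.fderiv_right (m := ∞) le_rfl).clm_apply contDiff_const

theorem pd_comm (k l : Fin m) (hu : ContDiff ℝ ∞ u) : pd k (pd l u) = pd l (pd k u) := by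
  have hd : Differentiable ℝ (fderiv ℝ u) :=
    (hu.fderiv_right (m := ∞) le_rfl).differentiable (by simp)
  have key : ∀ (i j : Fin m) t, pd i (pd j u) t
      = fderiv ℝ (fderiv ℝ u) t (Pi.single i 1) (Pi.single j 1) := by
    intro i j t
    have h1 : HasFDerivAt (pd j u) _ t :=
      (hd t).hasFDerivAt.clm_apply (hasFDerivAt_const (Pi.single j (1 : ℝ) : Fin m → ℝ) t)
    rw [pd, h1.fderiv]
    simp
  funext t
  rw [key, key]
  exact (hu.contDiffAt.isSymmSndFDerivAt (by rw [minSmoothness_of_isRCLikeNormedField]; exact WithTop.coe_le_coe.2 le_top)) _ _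

theorem pd_mul (k : Fin m) (hu : ContDiff ℝ ∞ u) (hv : ContDiff ℝ ∞ v) (t : Fin m → ℝ) :
    pd k (fun t => u t * v t) t = pd k u t * v t + u t * pd k v t := by
  have h1 := (hu.differentiable (by simp) t).hasFDerivAt
  have h2 := (hv.differentiable (by simp) t).hasFDerivAt
  rw [pd, (h1.fun_mul h2).fderiv]
  simp [pd]
  ring

theorem pd_sub (k : Fin m) (hu : ContDiff ℝ ∞ u) (hv : ContDiff ℝ ∞ v) (t : Fin m → ℝ) :
    pd k (fun t => u t - v t) t = pd k u t - pd k v t := by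
  have h1 := (hu.differentiable (by simp) t).hasFDerivAt
  have h2 := (hv.differentiable (by simp) t).hasFDerivAt
  rw [pd, (h1.fun_sub h2).fderiv]
  simp [pd]

theorem pd_coord (k l : Fin m) (t : Fin m → ℝ) :
    pd k (fun t => t l) t = if k = l then 1 else 0 := by
  have h : HasFDerivAt (fun t : Fin m → ℝ => t l)
      (ContinuousLinearMap.proj (R := ℝ) (φ := fun _ : Fin m => ℝ) l) t :=
    (ContinuousLinearMap.proj (R := ℝ) (φ := fun _ : Fin m => ℝ) l).hasFDerivAt
  rw [pd, h.fderiv]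
  simp [Pi.single_apply, eq_comm]

theorem fderiv_eq_sum_pd (t w : Fin m → ℝ) : fderiv ℝ u t w = ∑ k, w k * pd k u t := by
  conv_lhs => rw [← Finset.univ_sum_single w]
  rw [map_sum]
  refine Finset.sum_congr rfl fun k _ => ?_
  have : (Pi.single k (w k) : Fin m → ℝ) = w k • Pi.single k 1 := by
    rw [← Pi.single_smul]; simp
  rw [this, map_smul, smul_eq_mul, pd]

theorem pd_congr_of_eqOn {k : Fin m} {s : Set (Fin m → ℝ)} (hs : IsOpen s) (h : Set.EqOn u v s)
    {t : Fin m → ℝ} (ht : t ∈ s) : pd k u t = pd k v t := by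
  rw [pd, pd, (h.eventuallyEq_of_mem (hs.mem_nhds ht)).fderiv_eq]

end PD

section Euler

variable {m : ℕ} {A : Type} [DecidableEq A] (ι : Fin m → A)

theorem hasDerivAt_ray (a b : A) (μ : ℝ) (t : Fin m → ℝ) :
    HasDerivAt (fun μ => ray ι a b μ t) (fun i => if ι i = a ∨ ι i = b then 0 else t i) μ := by
  rw [hasDerivAt_pi]
  intro i
  by_cases h : ι i = a ∨ ι i = b
  · simpa [ray, h] using hasDerivAt_const μ (t i)
  · simpa [ray, h] using (hasDerivAt_id μ).mul_const (t i)

theorem hasDerivAt_comp_ray (a b : A) {u : (Fin m → ℝ) → ℝ} (hu : ContDiff ℝ ∞ u) (μ : ℝ)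
    (t : Fin m → ℝ) : HasDerivAt (fun μ => u (ray ι a b μ t))
      (∑ k, if ι k = a ∨ ι k = b then 0 else t k * pd k u (ray ι a b μ t)) μ := by
  have h := ((hu.differentiable (by simp)) (ray ι a b μ t)).hasFDerivAt.comp_hasDerivAt μ
    (hasDerivAt_ray ι a b μ t)
  rw [fderiv_eq_sum_pd] at h
  refine h.congr_deriv (Finset.sum_congr rfl fun k _ => ?_)
  by_cases hk : ι k = a ∨ ι k = b <;> simp [hk]

/-- The defect in the `k`-th Darboux equation. -/
noncomputable def darbouxDefect (β : A → A → (Fin m → ℝ) → ℝ) (k : Fin m) (a b : A) :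
    (Fin m → ℝ) → ℝ :=
  if ι k = a ∨ ι k = b then 0 else fun t => pd k (β a b) t - β a (ι k) t * β (ι k) b t

variable {ι}

theorem darbouxDefect_contDiff {β : A → A → (Fin m → ℝ) → ℝ} (hβ : ∀ a b, ContDiff ℝ ∞ (β a b))
    (k : Fin m) (a b : A) : ContDiff ℝ ∞ (darbouxDefect ι β k a b) := by
  unfold darbouxDefect
  split_ifs
  · exact contDiff_const
  · exact (pd_contDiff k (hβ a b)).sub ((hβ a (ι k)).mul (hβ (ι k) b))

/-- Differentiate the integral equation along the ray through t at μ = 1; the data do not change on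
the ray. The integral equation gives in this way only the combination of the defects weighted by
t_k. -/
theorem euler_of_integral_solution {D β : A → A → (Fin m → ℝ) → ℝ} {ρ : ℝ}
    (hDk : ∀ a b t, D a b (keep ι a b t) = D a b t) (hβ : ∀ a b, ContDiff ℝ ∞ (β a b))
    (h : ∀ t ∈ Metric.ball (0 : Fin m → ℝ) ρ, ∀ a b, β a b t = D a b t +
        ∑ k, if ι k = a ∨ ι k = b then 0 else t k * ∫ μ in (0 : ℝ)..1,
          β a (ι k) (ray ι a b μ t) * β (ι k) b (ray ι a b μ t))
    {t : Fin m → ℝ} (ht : t ∈ Metric.ball (0 : Fin m → ℝ) ρ) (a b : A) :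
    ∑ k, t k * darbouxDefect ι β k a b t = 0 := by
  set g : Fin m → ℝ → ℝ := fun k μ => β a (ι k) (ray ι a b μ t) * β (ι k) b (ray ι a b μ t)
    with hg
  have hgc : ∀ k, Continuous (g k) := fun k => by
    have hr : Continuous fun μ => ray ι a b μ t :=
      (continuous_ray ι a b).comp (by fun_prop : Continuous fun μ : ℝ => (μ, t))
    exact ((hβ a (ι k)).continuous.comp hr).mul ((hβ (ι k) b).continuous.comp hr)
  have hleft := hasDerivAt_comp_ray ι a b (hβ a b) 1 t
  have hright : HasDerivAt (fun μ => D a b t + ∑ k, if ι k = a ∨ ι k = b then 0 else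
      t k * ∫ ν in (0 : ℝ)..μ, g k ν) (∑ k, if ι k = a ∨ ι k = b then 0 else t k * g k 1) 1 := by
    refine HasDerivAt.const_add _ (HasDerivAt.fun_sum fun k _ => ?_)
    split_ifs
    · exact hasDerivAt_const _ _
    · exact ((hgc k).integral_hasStrictDerivAt 0 1).hasDerivAt.const_mul _
  have heq : (fun μ => β a b (ray ι a b μ t)) =ᶠ[nhds 1] fun μ => D a b t +
      ∑ k, if ι k = a ∨ ι k = b then 0 else t k * ∫ ν in (0 : ℝ)..μ, g k ν := by
    have hc : ContinuousAt (fun μ => ray ι a b μ t) 1 := (hasDerivAt_ray ι a b 1 t).continuousAt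
    have : Metric.ball (0 : Fin m → ℝ) ρ ∈ nhds (ray ι a b 1 t) := by
      rw [ray_one]; exact Metric.isOpen_ball.mem_nhds ht
    filter_upwards [hc this] with μ hμ
    rw [h (ray ι a b μ t) hμ, ← hDk, keep_ray, hDk]
    congr 1
    refine Finset.sum_congr rfl fun k _ => ?_
    split_ifs with hk
    · rfl
    -- At the point of the ray with parameter μ, the factor t_k μ and the integral over [0, 1]
    -- combine to t_k times an integral over [0, μ].
    · have h1 : ray ι a b μ t k = t k * μ := by simp [ray, hk, mul_comm]
      rw [h1, mul_assoc]
      simp only [ray_ray]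
      have := intervalIntegral.mul_integral_comp_mul_right (a := 0) (b := 1) (f := g k) μ
      rw [zero_mul, one_mul] at this
      rw [← this]
  have := (hleft.congr_of_eventuallyEq heq.symm).unique hright
  rw [← sub_eq_zero, ← Finset.sum_sub_distrib] at this
  rw [← this]
  refine Finset.sum_congr rfl fun k _ => ?_
  by_cases hk : ι k = a ∨ ι k = b
  · simp [darbouxDefect, hk]
  · simp only [darbouxDefect, hk, if_false, hg, ray_one]; ring

end Euler

section Darboux

variable {m : ℕ} {A : Type} [DecidableEq A] {ι : Fin m → A}

/-- In the antisymmetrised derivative the second derivatives of β cancel. Replacing first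
derivatives by defect plus product, the cubic terms cancel as well, and only terms linear in the
defects remain. -/
theorem pd_darbouxDefect_sub (hι : Function.Injective ι) {β : A → A → (Fin m → ℝ) → ℝ}
    (hβ : ∀ a b, ContDiff ℝ ∞ (β a b)) {k l : Fin m} {a b : A} (hkl : k ≠ l)
    (hk : ¬(ι k = a ∨ ι k = b)) (hl : ¬(ι l = a ∨ ι l = b)) (t : Fin m → ℝ) :
    pd l (darbouxDefect ι β k a b) t - pd k (darbouxDefect ι β l a b) t =
      darbouxDefect ι β k a (ι l) t * β (ι l) b t + β a (ι l) t * darbouxDefect ι β k (ι l) b t -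
      darbouxDefect ι β l a (ι k) t * β (ι k) b t - β a (ι k) t * darbouxDefect ι β l (ι k) b t := by
  have hkl' : ι k ≠ ι l := fun h => hkl (hι h)
  have hlk' : ι l ≠ ι k := hkl'.symm
  have e1 : ∀ (i j : Fin m), ¬(ι i = a ∨ ι i = b) →
      pd j (darbouxDefect ι β i a b) t = pd j (pd i (β a b)) t -
        (pd j (β a (ι i)) t * β (ι i) b t + β a (ι i) t * pd j (β (ι i) b) t) := by
    intro i j hi
    rw [darbouxDefect, if_neg hi, pd_sub j (pd_contDiff i (hβ a b))
      ((hβ a (ι i)).mul (hβ (ι i) b)), pd_mul j (hβ a (ι i)) (hβ (ι i) b)]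
  rw [e1 k l hk, e1 l k hl, pd_comm l k (hβ a b)]
  push Not at hk hl
  simp only [darbouxDefect, hk, hl, hkl', hlk', or_self, if_false]
  ring

/-- Differentiating Σ t_l F_l = 0 in the direction k expresses F_k by derivatives of the defects.
Hence the derivative of μ F_k along the ray is Σ q_l (∂_l F_k - ∂_k F_l) at the point q of the ray.
Each bracket is linear in the defects and at most 4BM; integration to μ = 1 gives the factor mδ · 4B
≤ 1/2. -/
theorem abs_darbouxDefect_le (hι : Function.Injective ι) {β : A → A → (Fin m → ℝ) → ℝ}
    (hβ : ∀ a b, ContDiff ℝ ∞ (β a b)) {ρ B M : ℝ}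
    (hE : ∀ t ∈ Metric.ball (0 : Fin m → ℝ) ρ, ∀ a b,
      ∑ k, t k * darbouxDefect ι β k a b t = 0)
    {δ : ℝ} (hδ : δ < ρ) (hδB : m * δ * (4 * B) ≤ 1 / 2) (hB : 0 ≤ B) (hM : 0 ≤ M)
    (hβB : ∀ t, ‖t‖ ≤ δ → ∀ a b, |β a b t| ≤ B)
    (hF : ∀ t, ‖t‖ ≤ δ → ∀ k a b, |darbouxDefect ι β k a b t| ≤ M)
    (t : Fin m → ℝ) (ht : ‖t‖ ≤ δ) (k : Fin m) (a b : A) :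
    |darbouxDefect ι β k a b t| ≤ M / 2 := by
  by_cases hk : ι k = a ∨ ι k = b
  · simp [darbouxDefect, hk]; positivity
  have hFs := fun k => darbouxDefect_contDiff (ι := ι) hβ k a b
  have hδ0 : 0 ≤ δ := (norm_nonneg t).trans ht
  -- the differentiated Euler identity
  have hE' : ∀ q ∈ Metric.ball (0 : Fin m → ℝ) ρ, darbouxDefect ι β k a b q +
      ∑ l, q l * pd k (darbouxDefect ι β l a b) q = 0 := by
    intro q hq
    have h0 : pd k (fun t => ∑ l, t l * darbouxDefect ι β l a b t) q = 0 := by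
      rw [pd_congr_of_eqOn (v := fun _ => 0) Metric.isOpen_ball (fun t ht => hE t ht a b) hq, pd]
      simp
    have h1 : pd k (fun t => ∑ l, t l * darbouxDefect ι β l a b t) q =
        ∑ l, pd k (fun t => t l * darbouxDefect ι β l a b t) q := by
      simp only [pd]
      rw [fderiv_fun_sum fun l _ => (((contDiff_apply ℝ ℝ l).mul (hFs l)).differentiable
        (by simp)) q]
      simp
    rw [h1] at h0
    rw [← h0]
    simp only [pd_mul k (contDiff_apply ℝ ℝ _) (hFs _), pd_coord, Finset.sum_add_distrib]
    simp
  have hder : ∀ μ ∈ Set.Icc (0 : ℝ) 1, HasDerivWithinAt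
      (fun μ => μ * darbouxDefect ι β k a b (ray ι a b μ t))
      (∑ l, if ι l = a ∨ ι l = b then 0 else ray ι a b μ t l *
        (pd l (darbouxDefect ι β k a b) (ray ι a b μ t) -
          pd k (darbouxDefect ι β l a b) (ray ι a b μ t))) (Set.Icc 0 1) μ := by
    intro μ hμ
    have h1 := ((hasDerivAt_id μ).fun_mul
      (hasDerivAt_comp_ray ι a b (hFs k) μ t)).hasDerivWithinAt (s := Set.Icc 0 1)
    refine h1.congr_deriv ?_
    have hq : ray ι a b μ t ∈ Metric.ball (0 : Fin m → ℝ) ρ := by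
      rw [Metric.mem_ball, dist_zero_right]
      exact ((norm_ray_le ι a b hμ.1 hμ.2 t).trans ht).trans_lt hδ
    have h2 := hE' _ hq
    -- The undifferentiated term F_k is traded for -Σ q_l ∂_k F_l, which leaves only antisymmetric
    -- differences.
    rw [id, one_mul, eq_neg_of_add_eq_zero_left h2, Finset.mul_sum, ← Finset.sum_neg_distrib,
      ← Finset.sum_add_distrib]
    refine Finset.sum_congr rfl fun l _ => ?_
    by_cases hl : ι l = a ∨ ι l = b
    · have : pd k (darbouxDefect ι β l a b) (ray ι a b μ t) = 0 := by
        rw [darbouxDefect, if_pos hl, pd]; simp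
      simp [hl, this]
    · simp only [hl, if_false, ray]
      ring
  have hbound : ∀ μ ∈ Set.Ico (0 : ℝ) 1, ‖∑ l, if ι l = a ∨ ι l = b then 0 else
      ray ι a b μ t l * (pd l (darbouxDefect ι β k a b) (ray ι a b μ t) -
          pd k (darbouxDefect ι β l a b) (ray ι a b μ t))‖ ≤ M / 2 := by
    intro μ hμ
    have hq : ‖ray ι a b μ t‖ ≤ δ := (norm_ray_le ι a b hμ.1 hμ.2.le t).trans ht
    have hterm : ∀ l, ‖if ι l = a ∨ ι l = b then (0 : ℝ) else
        ray ι a b μ t l * (pd l (darbouxDefect ι β k a b) (ray ι a b μ t) -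
          pd k (darbouxDefect ι β l a b) (ray ι a b μ t))‖ ≤ δ * (4 * B * M) := by
      intro l
      split_ifs with hl
      · rw [norm_zero]; positivity
      rw [norm_mul]
      refine mul_le_mul ((norm_le_pi_norm _ l).trans hq) ?_ (norm_nonneg _) hδ0
      by_cases hkl : k = l
      · subst hkl; rw [sub_self, norm_zero]; positivity
      rw [pd_darbouxDefect_sub hι hβ hkl hk hl, Real.norm_eq_abs]
      have p1 : ∀ {x y : ℝ}, |x| ≤ M → |y| ≤ B → |x * y| ≤ B * M := fun hx hy => by
        rw [abs_mul, mul_comm B]; exact mul_le_mul hx hy (abs_nonneg _) hM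
      have p2 : ∀ {x y : ℝ}, |x| ≤ B → |y| ≤ M → |x * y| ≤ B * M := fun hx hy => by
        rw [abs_mul]; exact mul_le_mul hx hy (abs_nonneg _) hB
      have q1 := p1 (hF _ hq k a (ι l)) (hβB _ hq (ι l) b)
      have q2 := p2 (hβB _ hq a (ι l)) (hF _ hq k (ι l) b)
      have q3 := p1 (hF _ hq l a (ι k)) (hβB _ hq (ι k) b)
      have q4 := p2 (hβB _ hq a (ι k)) (hF _ hq l (ι k) b)
      rw [abs_le] at q1 q2 q3 q4 ⊢
      constructor <;> linarith
    refine (norm_sum_le _ _).trans ((Finset.sum_le_sum fun l _ => hterm l).trans ?_)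
    rw [Finset.sum_const, Finset.card_univ, Fintype.card_fin, nsmul_eq_mul]
    nlinarith
  have := norm_image_sub_le_of_norm_deriv_le_segment_01' hder hbound
  simpa [ray_one] using this

/-- On a sufficiently small ball any bound for the defects of the integral solution can be halved,
so the defects vanish there. -/
theorem exists_darboux_solution [Fintype A] (hι : Function.Injective ι)
    (D : A → A → (Fin m → ℝ) → ℝ) (hD : ∀ a b, ContDiff ℝ ∞ (D a b))
    (hDk : ∀ a b t, D a b (keep ι a b t) = D a b t) :
    ∃ ρ > 0, ∃ β : A → A → (Fin m → ℝ) → ℝ, (∀ a b, ContDiff ℝ ∞ (β a b)) ∧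
      (∀ t, ‖t‖ ≤ ρ → ∀ a b, β a b (keep ι a b t) = D a b t) ∧
      ∀ t, ‖t‖ ≤ ρ → ∀ a b k, ι k ≠ a → ι k ≠ b →
        pd k (β a b) t = β a (ι k) t * β (ι k) b t := by
  obtain ⟨ρ, hρ, β₀, hβ₀, hint₀⟩ := exists_integral_solution ι D hD
  -- The local solution is replaced by globally smooth functions, at the price of half the radius,
  -- which then obey the same integral equation there.
  choose β hβ hββ₀ using fun a b => exists_contDiff_eqOn_ball hρ (hβ₀ a b)
  have hint : ∀ t ∈ Metric.ball (0 : Fin m → ℝ) (ρ / 2), ∀ a b, β a b t = D a b t +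
        ∑ k, if ι k = a ∨ ι k = b then 0 else t k * ∫ μ in (0 : ℝ)..1,
          β a (ι k) (ray ι a b μ t) * β (ι k) b (ray ι a b μ t) := by
    intro t ht a b
    have ht' : t ∈ Metric.ball (0 : Fin m → ℝ) ρ :=
      Metric.ball_subset_ball (by linarith) ht
    rw [hββ₀ a b ht, hint₀ t ht']
    congr 1
    refine Finset.sum_congr rfl fun k _ => ?_
    congr 2
    refine intervalIntegral.integral_congr fun μ hμ => ?_
    rw [Set.uIcc_of_le zero_le_one] at hμ
    have hr : ray ι a b μ t ∈ Metric.ball (0 : Fin m → ℝ) (ρ / 2) := by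
      rw [Metric.mem_ball, dist_zero_right] at ht ⊢
      exact (norm_ray_le ι a b hμ.1 hμ.2 t).trans_lt ht
    simp only [hββ₀ _ _ hr]
  have hE := fun t ht a b => euler_of_integral_solution hDk hβ hint (t := t) ht a b
  have hcomp : IsCompact (Metric.closedBall (0 : Fin m → ℝ) (ρ / 4)) := isCompact_closedBall _ _
  obtain ⟨B, hB0, hB⟩ : ∃ B, 0 ≤ B ∧ ∀ t, ‖t‖ ≤ ρ / 4 → ∀ a b, |β a b t| ≤ B := by
    choose B hB using fun a b => hcomp.exists_bound_of_continuousOn (hβ a b).continuous.continuousOn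
    refine ⟨∑ a, ∑ b, |B a b|, by positivity, fun t ht a b => ?_⟩
    calc |β a b t| ≤ |B a b| := (hB a b t (by simpa using ht)).trans (le_abs_self _)
      _ ≤ ∑ b, |B a b| := Finset.single_le_sum (f := fun b => |B a b|)
        (fun _ _ => abs_nonneg _) (Finset.mem_univ b)
      _ ≤ _ := Finset.single_le_sum (f := fun a => ∑ b, |B a b|)
        (fun _ _ => by positivity) (Finset.mem_univ a)
  obtain ⟨M, hM0, hM⟩ : ∃ M, 0 ≤ M ∧ ∀ t, ‖t‖ ≤ ρ / 4 → ∀ k a b,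
      |darbouxDefect ι β k a b t| ≤ M := by
    choose B hB using fun k a b => hcomp.exists_bound_of_continuousOn
      (darbouxDefect_contDiff (ι := ι) hβ k a b).continuous.continuousOn
    refine ⟨∑ k, ∑ a, ∑ b, |B k a b|, by positivity, fun t ht k a b => ?_⟩
    calc |darbouxDefect ι β k a b t| ≤ |B k a b| :=
          (hB k a b t (by simpa using ht)).trans (le_abs_self _)
      _ ≤ ∑ b, |B k a b| := Finset.single_le_sum (f := fun b => |B k a b|)
        (fun _ _ => abs_nonneg _) (Finset.mem_univ b)
      _ ≤ ∑ a, ∑ b, |B k a b| := Finset.single_le_sum (f := fun a => ∑ b, |B k a b|)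
        (fun _ _ => by positivity) (Finset.mem_univ a)
      _ ≤ _ := Finset.single_le_sum (f := fun k => ∑ a, ∑ b, |B k a b|)
        (fun _ _ => by positivity) (Finset.mem_univ k)
  -- The second bound makes m δ · 4B ≤ 1/2, the contraction condition for the defects.
  set δ : ℝ := min (ρ / 4) (1 / (8 * (m + 1) * (B + 1))) with hδdef
  have hδ0 : 0 < δ := lt_min (by positivity) (by positivity)
  have hδ1 : δ ≤ ρ / 4 := min_le_left _ _
  have hδ2 : m * δ * (4 * B) ≤ 1 / 2 := by
    have h1 : δ ≤ 1 / (8 * (m + 1) * (B + 1)) := min_le_right _ _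
    rw [le_div_iff₀ (by positivity)] at h1
    have h2 : (m : ℝ) * B ≤ (m + 1) * (B + 1) := by gcongr <;> linarith
    nlinarith
  have hiter : ∀ n : ℕ, ∀ t, ‖t‖ ≤ δ → ∀ k a b, |darbouxDefect ι β k a b t| ≤ M / 2 ^ n := by
    intro n
    induction n with
    | zero => intro t ht k a b; simpa using hM t (ht.trans hδ1) k a b
    | succ n ih =>
      intro t ht k a b
      have := abs_darbouxDefect_le hι hβ hE (by linarith) hδ2 hB0 (by positivity)
        (fun t ht => hB t (ht.trans hδ1)) ih t ht k a b
      rwa [pow_succ, ← div_div]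
  refine ⟨δ, hδ0, β, hβ, fun t ht a b => ?_, fun t ht a b k hka hkb => ?_⟩
  · have hk : keep ι a b t ∈ Metric.ball (0 : Fin m → ℝ) (ρ / 2) := by
      rw [Metric.mem_ball, dist_zero_right, ← ray_zero]
      exact ((norm_ray_le ι a b le_rfl zero_le_one t).trans ht).trans_lt (by linarith)
    -- On the (a, b)-plane every t_k in front of an integral is zero.
    rw [hint _ hk, hDk, add_eq_left]
    refine Finset.sum_eq_zero fun k _ => ?_
    split_ifs with h
    · rfl
    · simp [keep, h]
  · have h0 : darbouxDefect ι β k a b t = 0 := by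
      have hlim : Filter.Tendsto (fun n : ℕ => M / 2 ^ n) Filter.atTop (nhds 0) :=
        tendsto_const_nhds.div_atTop (tendsto_pow_atTop_atTop_of_one_lt one_lt_two)
      exact abs_eq_zero.1 (le_antisymm (ge_of_tendsto' hlim fun n => hiter n t ht k a b)
        (abs_nonneg _))
    rw [darbouxDefect, if_neg (by tauto)] at h0
    exact sub_eq_zero.1 h0

end Darboux

/-! ### Lattice functions with difference quotients bounded uniformly in the mesh size. -/

/-- A family of functions on `ℕ^m`, one for every mesh size. -/
abbrev LatticeFamily (m : ℕ) : Type := ℝ → (Fin m → ℕ) → ℝ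

namespace LatticeFamily

variable {m : ℕ}

/-- The shift in the direction `i`. -/
def shift (i : Fin m) (u : LatticeFamily m) : LatticeFamily m :=
  fun ε n => u ε (n + Pi.single i 1)

/-- The difference quotient in the direction `i`. -/
noncomputable def dq (i : Fin m) (u : LatticeFamily m) : LatticeFamily m :=
  fun ε n => (u ε (n + Pi.single i 1) - u ε n) / ε

/-- The points which the shift in the direction `i` takes to `D`. -/
def pre (i : Fin m) (D : Set (ℝ × (Fin m → ℕ))) : Set (ℝ × (Fin m → ℕ)) :=
  {p | (p.1, p.2 + Pi.single i 1) ∈ D}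

/-- A domain with positive, bounded mesh sizes which is closed under lattice descent. -/
structure Admissible (D : Set (ℝ × (Fin m → ℕ))) : Prop where
  pos : ∀ p ∈ D, 0 < p.1
  le_one : ∀ p ∈ D, p.1 ≤ 1
  lower : ∀ i, pre i D ⊆ D

theorem Admissible.pre {D : Set (ℝ × (Fin m → ℕ))} (hD : Admissible D) (i : Fin m) :
    Admissible (pre i D) where
  pos p hp := hD.pos p (hD.lower i hp)
  le_one p hp := hD.le_one p (hD.lower i hp)
  lower j p hp := by
    refine hD.lower j (a := (p.1, p.2 + Pi.single i 1)) ?_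
    simpa [LatticeFamily.pre, add_right_comm] using hp

theorem pre_mono {D D' : Set (ℝ × (Fin m → ℕ))} (h : D ⊆ D') (i : Fin m) : pre i D ⊆ pre i D' :=
  fun _ hp => h hp

theorem pre_comm (D : Set (ℝ × (Fin m → ℕ))) (i j : Fin m) : pre i (pre j D) = pre j (pre i D) := by
  ext p; simp [pre, add_right_comm]

/-- Boundedness of all iterated difference quotients up to the order `l`, uniformly in the mesh
size. -/
def DiffBdd : ℕ → Set (ℝ × (Fin m → ℕ)) → LatticeFamily m → Prop
  | 0, D, u => ∃ K, ∀ p ∈ D, |u p.1 p.2| ≤ K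
  | l + 1, D, u => (∃ K, ∀ p ∈ D, |u p.1 p.2| ≤ K) ∧ ∀ i, DiffBdd l (pre i D) (dq i u)

theorem DiffBdd.bdd {l : ℕ} {D : Set (ℝ × (Fin m → ℕ))} {u : LatticeFamily m}
    (h : DiffBdd l D u) : ∃ K, ∀ p ∈ D, |u p.1 p.2| ≤ K := by
  cases l with
  | zero => exact h
  | succ l => exact h.1

theorem DiffBdd.subset {l : ℕ} : ∀ {D D' : Set (ℝ × (Fin m → ℕ))} {u : LatticeFamily m},
    DiffBdd l D u → D' ⊆ D → DiffBdd l D' u := by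
  induction l with
  | zero => exact fun ⟨K, hK⟩ hs => ⟨K, fun p hp => hK p (hs hp)⟩
  | succ l ih =>
    exact fun ⟨⟨K, hK⟩, h⟩ hs => ⟨⟨K, fun p hp => hK p (hs hp)⟩,
      fun i => ih (h i) (pre_mono hs i)⟩

theorem DiffBdd.of_succ {l : ℕ} : ∀ {D : Set (ℝ × (Fin m → ℕ))} {u : LatticeFamily m},
    DiffBdd (l + 1) D u → DiffBdd l D u := by
  induction l with
  | zero => exact fun h => h.1
  | succ l ih => exact fun h => ⟨h.1, fun i => ih (h.2 i)⟩

theorem DiffBdd.congr {l : ℕ} : ∀ {D : Set (ℝ × (Fin m → ℕ))} {u v : LatticeFamily m},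
    DiffBdd l D u → Admissible D → (∀ p ∈ D, u p.1 p.2 = v p.1 p.2) → DiffBdd l D v := by
  induction l with
  | zero => exact fun ⟨K, hK⟩ _ h => ⟨K, fun p hp => h p hp ▸ hK p hp⟩
  | succ l ih =>
    refine fun ⟨⟨K, hK⟩, hi⟩ hD h => ⟨⟨K, fun p hp => h p hp ▸ hK p hp⟩,
      fun i => ih (hi i) (hD.pre i) fun p hp => ?_⟩
    rw [dq, dq, h p (hD.lower i hp), h (p.1, p.2 + Pi.single i 1) hp]

theorem dq_shift (i j : Fin m) (u : LatticeFamily m) : dq i (shift j u) = shift j (dq i u) := by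
  funext ε n; simp [dq, shift, add_right_comm]

theorem dq_comm (i j : Fin m) (u : LatticeFamily m) : dq i (dq j u) = dq j (dq i u) := by
  funext ε n
  simp only [dq, add_right_comm n (Pi.single j 1) (Pi.single i 1)]
  ring

theorem DiffBdd.shift {l : ℕ} (j : Fin m) : ∀ {D : Set (ℝ × (Fin m → ℕ))} {u : LatticeFamily m},
    DiffBdd l D u → DiffBdd l (pre j D) (shift j u) := by
  induction l with
  | zero => exact fun ⟨K, hK⟩ => ⟨K, fun p hp => hK (p.1, p.2 + Pi.single j 1) hp⟩
  | succ l ih =>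
    refine fun ⟨⟨K, hK⟩, hi⟩ => ⟨⟨K, fun p hp => hK (p.1, p.2 + Pi.single j 1) hp⟩, fun i => ?_⟩
    rw [dq_shift, pre_comm]
    exact ih (hi i)

theorem diffBdd_const (l : ℕ) (c : ℝ) : ∀ D : Set (ℝ × (Fin m → ℕ)),
    DiffBdd l D (fun _ _ => c) := by
  induction l generalizing c with
  | zero => exact fun D => ⟨|c|, fun _ _ => le_rfl⟩
  | succ l ih =>
    refine fun D => ⟨⟨|c|, fun _ _ => le_rfl⟩, fun i => ?_⟩
    have : dq i (fun _ _ => c : LatticeFamily m) = fun _ _ => 0 := by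
      funext ε n; simp [dq]
    rw [this]
    exact ih 0 _

theorem DiffBdd.add {l : ℕ} : ∀ {D : Set (ℝ × (Fin m → ℕ))} {u v : LatticeFamily m},
    DiffBdd l D u → DiffBdd l D v → DiffBdd l D (fun ε n => u ε n + v ε n) := by
  have h0 : ∀ {D : Set (ℝ × (Fin m → ℕ))} {u v : LatticeFamily m},
      DiffBdd 0 D u → DiffBdd 0 D v → DiffBdd 0 D (fun ε n => u ε n + v ε n) :=
    fun ⟨K, hK⟩ ⟨L, hL⟩ => ⟨K + L, fun p hp => (abs_add_le _ _).trans (add_le_add (hK p hp) (hL p hp))⟩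
  induction l with
  | zero => exact h0
  | succ l ih =>
    refine fun {D u v} hu hv => ⟨h0 hu.1 hv.1, fun i => ?_⟩
    have : dq i (fun ε n => u ε n + v ε n) = fun ε n => dq i u ε n + dq i v ε n := by
      funext ε n; simp only [dq]; ring
    rw [this]
    exact ih (hu.2 i) (hv.2 i)

/-- The discrete Leibniz rule δ(uv) = δu · (shifted v) + u · δv. Both factors lose one lattice step
of their domain, which is why domains closed under descent are used. -/
theorem DiffBdd.mul {l : ℕ} : ∀ {D : Set (ℝ × (Fin m → ℕ))} {u v : LatticeFamily m},
    Admissible D → DiffBdd l D u → DiffBdd l D v → DiffBdd l D (fun ε n => u ε n * v ε n) := by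
  have h0 : ∀ {D : Set (ℝ × (Fin m → ℕ))} {u v : LatticeFamily m},
      DiffBdd 0 D u → DiffBdd 0 D v → DiffBdd 0 D (fun ε n => u ε n * v ε n) :=
    fun ⟨K, hK⟩ ⟨L, hL⟩ => ⟨K * L, fun p hp => by
      rw [abs_mul]
      exact mul_le_mul (hK p hp) (hL p hp) (abs_nonneg _) ((abs_nonneg _).trans (hK p hp))⟩
  induction l with
  | zero => exact fun _ => h0
  | succ l ih =>
    refine fun {D u v} hD hu hv => ⟨h0 hu.1 hv.1, fun i => ?_⟩
    have : dq i (fun ε n => u ε n * v ε n) =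
        fun ε n => dq i u ε n * LatticeFamily.shift i v ε n + u ε n * dq i v ε n := by
      funext ε n; simp only [dq, LatticeFamily.shift]; ring
    rw [this]
    exact (ih (hD.pre i) (hu.2 i) (hv.of_succ.shift i)).add
      (ih (hD.pre i) (hu.of_succ.subset (hD.lower i)) (hv.2 i))

theorem DiffBdd.const_mul {l : ℕ} {D : Set (ℝ × (Fin m → ℕ))} {u : LatticeFamily m}
    (hD : Admissible D) (hu : DiffBdd l D u) (c : ℝ) : DiffBdd l D (fun ε n => c * u ε n) :=
  DiffBdd.mul hD (diffBdd_const l c D) hu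

theorem DiffBdd.neg {l : ℕ} {D : Set (ℝ × (Fin m → ℕ))} {u : LatticeFamily m}
    (hD : Admissible D) (hu : DiffBdd l D u) : DiffBdd l D (fun ε n => -u ε n) := by
  simpa using hu.const_mul hD (-1)

theorem DiffBdd.sub {l : ℕ} {D : Set (ℝ × (Fin m → ℕ))} {u v : LatticeFamily m}
    (hD : Admissible D) (hu : DiffBdd l D u) (hv : DiffBdd l D v) :
    DiffBdd l D (fun ε n => u ε n - v ε n) := by
  simpa only [sub_eq_add_neg] using hu.add (hv.neg hD)

theorem DiffBdd.sum {l : ℕ} {D : Set (ℝ × (Fin m → ℕ))} {S : Type} (T : Finset S)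
    {u : S → LatticeFamily m} (hu : ∀ s ∈ T, DiffBdd l D (u s)) :
    DiffBdd l D (fun ε n => ∑ s ∈ T, u s ε n) := by
  classical
  induction T using Finset.induction_on with
  | empty => simpa using diffBdd_const l 0 D
  | insert a T ha ih =>
    simp only [Finset.sum_insert ha]
    exact (hu a (Finset.mem_insert_self a T)).add
      (ih fun s hs => hu s (Finset.mem_insert_of_mem hs))

theorem DiffBdd.inv {l : ℕ} {c : ℝ} (hc : 0 < c) : ∀ {D : Set (ℝ × (Fin m → ℕ))}
    {u : LatticeFamily m}, Admissible D → DiffBdd l D u → (∀ p ∈ D, c ≤ |u p.1 p.2|) →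
    DiffBdd l D (fun ε n => (u ε n)⁻¹) := by
  have h0 : ∀ {D : Set (ℝ × (Fin m → ℕ))} {u : LatticeFamily m},
      (∀ p ∈ D, c ≤ |u p.1 p.2|) → DiffBdd 0 D (fun ε n => (u ε n)⁻¹) := fun h =>
    ⟨c⁻¹, fun p hp => by rw [abs_inv]; exact inv_anti₀ hc (h p hp)⟩
  induction l with
  | zero => exact fun _ _ h => h0 h
  | succ l ih =>
    refine fun {D u} hD hu h => ⟨h0 h, fun i => ?_⟩
    have hinv := ih hD hu.of_succ h
    have h1 := DiffBdd.mul (hD.pre i) ((hu.2 i).neg (hD.pre i))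
      (DiffBdd.mul (hD.pre i) (hinv.subset (hD.lower i)) (hinv.shift i))
    refine h1.congr (hD.pre i) fun p hp => ?_
    have e1 : u p.1 p.2 ≠ 0 := fun h' => by
      have := h p (hD.lower i hp); rw [h', abs_zero] at this; linarith
    have e2 : u p.1 (p.2 + Pi.single i 1) ≠ 0 := fun h' => by
      have := h (p.1, p.2 + Pi.single i 1) hp; rw [h', abs_zero] at this; linarith
    have e3 : p.1 ≠ 0 := (hD.pos p (hD.lower i hp)).ne'
    simp only [dq, LatticeFamily.shift]
    field_simp
    ring

/-- A factor ε gains one order: the difference quotient of ε u is the plain difference of two values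
of u. This gain drives the bootstrap in the convergence proof. -/
theorem DiffBdd.eps_mul {l : ℕ} : ∀ {D : Set (ℝ × (Fin m → ℕ))}
    {u : LatticeFamily m}, Admissible D → DiffBdd l D u →
    DiffBdd (l + 1) D (fun ε n => ε * u ε n) := by
  have h0 : ∀ {D : Set (ℝ × (Fin m → ℕ))} {u : LatticeFamily m}, Admissible D →
      DiffBdd 0 D u → DiffBdd 0 D (fun ε n => ε * u ε n) := fun hD ⟨K, hK⟩ =>
    ⟨K, fun p hp => by
      rw [abs_mul, abs_of_pos (hD.pos p hp)]
      exact (mul_le_of_le_one_left (abs_nonneg _) (hD.le_one p hp)).trans (hK p hp)⟩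
  intro D u hD hu
  refine ⟨h0 hD hu.bdd, fun i => ?_⟩
  refine DiffBdd.congr (DiffBdd.sub (hD.pre i) (hu.shift i) (hu.subset (hD.lower i)))
    (hD.pre i) fun p hp => ?_
  have e3 : p.1 ≠ 0 := (hD.pos p (hD.lower i hp)).ne'
  simp only [dq, LatticeFamily.shift]
  field_simp

end LatticeFamily

/-! ### The discrete Gronwall estimate. -/

namespace LatticeFamily

variable {m : ℕ}

/-- Set the coordinates in `T` to zero. -/
def zeroOut (T : Finset (Fin m)) (n : Fin m → ℕ) : Fin m → ℕ := fun i => if i ∈ T then 0 else n i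

theorem zeroOut_add_single {T : Finset (Fin m)} {i : Fin m} (hi : i ∉ T) (n : Fin m → ℕ) :
    zeroOut T (n + Pi.single i 1) = zeroOut T n + Pi.single i 1 := by
  funext j
  by_cases hj : j ∈ T
  · have : j ≠ i := fun h => hi (h ▸ hj)
    simp [zeroOut, hj, this]
  · simp [zeroOut, hj]

theorem sum_add_single (n : Fin m → ℕ) (i : Fin m) :
    ∑ j, (n + Pi.single i 1 : Fin m → ℕ) j = ∑ j, n j + 1 := by
  simp [Finset.sum_add_distrib]

theorem exists_eq_add_single {n : Fin m → ℕ} {i : Fin m} (hi : n i ≠ 0) :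
    ∃ n' : Fin m → ℕ, n = n' + Pi.single i 1 := by
  refine ⟨n - Pi.single i 1, ?_⟩
  funext j
  by_cases h : j = i
  · subst h; simp; omega
  · simp [h]

/-- The discrete Gronwall estimate for hyperbolic systems. -/
theorem bdd_of_linear_system {S : Type} [Fintype S] (ev : S → Finset (Fin m))
    {D : Set (ℝ × (Fin m → ℕ))} (hD : Admissible D) {R : ℝ}
    (hR : ∀ p ∈ D, p.1 * ∑ i, (p.2 i : ℝ) ≤ R) (U : S → LatticeFamily m)
    (A : Fin m → S → S → LatticeFamily m) (F : Fin m → S → LatticeFamily m)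
    (heq : ∀ s, ∀ k ∈ ev s, ∀ p ∈ pre k D, dq k (U s) p.1 p.2 =
      ∑ s', A k s s' p.1 p.2 * U s' p.1 p.2 + F k s p.1 p.2)
    (hA : ∀ s, ∀ k ∈ ev s, ∀ s', DiffBdd 0 (pre k D) (A k s s'))
    (hF : ∀ s, ∀ k ∈ ev s, DiffBdd 0 (pre k D) (F k s))
    (hU : ∀ s, DiffBdd 0 D (fun ε n => U s ε (zeroOut (ev s) n))) (s : S) :
    DiffBdd 0 D (U s) := by
  obtain ⟨a, ha0, ha⟩ : ∃ a, 0 ≤ a ∧ ∀ s, ∀ k ∈ ev s, ∀ s', ∀ p ∈ pre k D,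
      |A k s s' p.1 p.2| ≤ a := by
    have : ∀ k s s', ∃ a, k ∈ ev s → ∀ p ∈ pre k D, |A k s s' p.1 p.2| ≤ a := fun k s s' => by
      by_cases h : k ∈ ev s
      · obtain ⟨a, h'⟩ := hA s k h s'
        exact ⟨a, fun _ => h'⟩
      · exact ⟨0, fun h' => absurd h' h⟩
    choose a ha using this
    refine ⟨∑ k, ∑ s, ∑ s', |a k s s'|, by positivity, fun s k hk s' p hp => ?_⟩
    calc _ ≤ |a k s s'| := (ha k s s' hk p hp).trans (le_abs_self _)
      _ ≤ ∑ s', |a k s s'| := Finset.single_le_sum (f := fun s' => |a k s s'|)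
        (fun _ _ => abs_nonneg _) (Finset.mem_univ s')
      _ ≤ ∑ s, ∑ s', |a k s s'| := Finset.single_le_sum (f := fun s => ∑ s', |a k s s'|)
        (fun _ _ => by positivity) (Finset.mem_univ s)
      _ ≤ _ := Finset.single_le_sum (f := fun k => ∑ s, ∑ s', |a k s s'|)
        (fun _ _ => by positivity) (Finset.mem_univ k)
  obtain ⟨f, hf0, hf⟩ : ∃ f, 0 ≤ f ∧ ∀ s, ∀ k ∈ ev s, ∀ p ∈ pre k D, |F k s p.1 p.2| ≤ f := by
    have : ∀ k s, ∃ a, k ∈ ev s → ∀ p ∈ pre k D, |F k s p.1 p.2| ≤ a := fun k s => by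
      by_cases h : k ∈ ev s
      · obtain ⟨a, h'⟩ := hF s k h
        exact ⟨a, fun _ => h'⟩
      · exact ⟨0, fun h' => absurd h' h⟩
    choose a ha using this
    refine ⟨∑ k, ∑ s, |a k s|, by positivity, fun s k hk p hp => ?_⟩
    calc _ ≤ |a k s| := (ha k s hk p hp).trans (le_abs_self _)
      _ ≤ ∑ s, |a k s| := Finset.single_le_sum (f := fun s => |a k s|)
        (fun _ _ => by positivity) (Finset.mem_univ s)
      _ ≤ _ := Finset.single_le_sum (f := fun k => ∑ s, |a k s|)
        (fun _ _ => by positivity) (Finset.mem_univ k)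
  choose d hd using hU
  set H : ℝ := f + ∑ s, |d s| with hH
  have hH0 : 0 ≤ H := by positivity
  have hfH : f ≤ H := le_add_of_nonneg_right (by positivity)
  have hdH : ∀ s, d s ≤ H := fun s => (le_abs_self _).trans
    ((Finset.single_le_sum (f := fun s => |d s|) (fun _ _ => abs_nonneg _)
      (Finset.mem_univ s)).trans (le_add_of_nonneg_left hf0))
  -- One lattice step multiplies the common bound by at most 1 + εc: card S · a comes from the
  -- linear part, and 1 from the inhomogeneity, which never exceeds the current bound.
  set c : ℝ := Fintype.card S * a + 1 with hc
  have hc0 : 0 ≤ c := by positivity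
  have key : ∀ N : ℕ, ∀ p ∈ D, ∑ i, p.2 i = N → ∀ s, |U s p.1 p.2| ≤ H * (1 + p.1 * c) ^ N := by
    intro N
    induction N with
    | zero =>
      intro p hp hN s
      have h0 : zeroOut (ev s) p.2 = p.2 := by
        funext i
        have : p.2 i = 0 := by
          have := Finset.sum_eq_zero_iff.1 hN i (Finset.mem_univ i)
          exact this
        simp [zeroOut, this]
      have := hd s p hp
      simp only [h0] at this
      simpa using this.trans (hdH s)
    | succ N ih =>
      rintro ⟨ε, n⟩ hp hN s
      have hε : 0 < ε := hD.pos _ hp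
      -- Either the unknown can be traced one step back in a direction of evolution, or the point
      -- lies on its data set.
      by_cases hz : ∃ k ∈ ev s, n k ≠ 0
      · obtain ⟨k, hk, hnk⟩ := hz
        obtain ⟨n', rfl⟩ := exists_eq_add_single hnk
        have hp' : (ε, n') ∈ pre k D := hp
        have hN' : ∑ i, n' i = N := by
          have := sum_add_single n' k
          simp only at hN
          omega
        have ih' := fun s => ih (ε, n') (hD.lower k hp') hN' s
        simp only at ih'
        set G : ℝ := H * (1 + ε * c) ^ N with hG
        have hG1 : H ≤ G := le_mul_of_one_le_right hH0 (one_le_pow₀ (by nlinarith))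
        have h1 := heq s k hk (ε, n') hp'
        simp only [dq] at h1
        rw [div_eq_iff hε.ne'] at h1
        have h2 : |∑ s', A k s s' ε n' * U s' ε n'| ≤ Fintype.card S * (a * G) := by
          refine (Finset.abs_sum_le_sum_abs _ _).trans ?_
          refine (Finset.sum_le_sum fun s' _ => ?_ : _ ≤ ∑ s' : S, a * G).trans (by simp)
          rw [abs_mul]
          exact mul_le_mul (ha s k hk s' _ hp') (ih' s') (abs_nonneg _) ha0
        have h3 := hf s k hk _ hp'
        have h4 : |(∑ s', A k s s' ε n' * U s' ε n' + F k s ε n') * ε| ≤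
            (Fintype.card S * (a * G) + G) * ε := by
          rw [abs_mul, abs_of_pos hε]
          refine mul_le_mul_of_nonneg_right ((abs_add_le _ _).trans (add_le_add h2 ?_)) hε.le
          exact h3.trans (hfH.trans hG1)
        have h5 : U s ε (n' + Pi.single k 1) = U s ε n' +
            (∑ s', A k s s' ε n' * U s' ε n' + F k s ε n') * ε := by linarith
        rw [h5]
        refine (abs_add_le _ _).trans ((add_le_add (ih' s) h4).trans (le_of_eq ?_))
        change _ = H * (1 + ε * c) ^ (N + 1)
        rw [pow_succ, show H * ((1 + ε * c) ^ N * (1 + ε * c)) = G * (1 + ε * c) by rw [hG]; ring, hc]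
        ring
      · push Not at hz
        have h0 : zeroOut (ev s) n = n := by
          funext i
          by_cases hi : i ∈ ev s <;> simp [zeroOut, hi, hz]
        have := hd s _ hp
        simp only [h0] at this
        refine this.trans ((hdH s).trans (le_mul_of_one_le_right hH0 (one_le_pow₀ ?_)))
        nlinarith
  -- After N steps with εN ≤ R the growth (1 + εc)^N is at most exp(cR), independently of ε.
  refine ⟨H * Real.exp (c * R), fun p hp => (key _ p hp rfl s).trans ?_⟩
  have hε := hD.pos p hp
  refine mul_le_mul_of_nonneg_left ?_ hH0
  calc (1 + p.1 * c) ^ (∑ i, p.2 i) ≤ Real.exp (p.1 * c) ^ (∑ i, p.2 i) := by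
        refine pow_le_pow_left₀ (by positivity) ?_ _
        linarith [Real.add_one_le_exp (p.1 * c)]
    _ = Real.exp (c * (p.1 * ∑ i, (p.2 i : ℝ))) := by
        rw [← Real.exp_nat_mul]; push_cast; ring_nf
    _ ≤ _ := Real.exp_le_exp.2 (mul_le_mul_of_nonneg_left (hR p hp) hc0)

/-- Induction on the order. Differences in the evolution directions of an unknown are given by the
equations. In another direction i, the differences of those unknowns that do not evolve along i
satisfy the differenced system, which has the same form and one order less to prove. -/
theorem diffBdd_of_linear_system (l : ℕ) : ∀ {S : Type} [Fintype S] (ev : S → Finset (Fin m))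
    {D : Set (ℝ × (Fin m → ℕ))}, Admissible D → ∀ {R : ℝ},
    (∀ p ∈ D, p.1 * ∑ i, (p.2 i : ℝ) ≤ R) → ∀ (U : S → LatticeFamily m)
    (A : Fin m → S → S → LatticeFamily m) (F : Fin m → S → LatticeFamily m),
    (∀ s, ∀ k ∈ ev s, ∀ p ∈ pre k D, dq k (U s) p.1 p.2 =
      ∑ s', A k s s' p.1 p.2 * U s' p.1 p.2 + F k s p.1 p.2) →
    (∀ s, ∀ k ∈ ev s, ∀ s', DiffBdd l (pre k D) (A k s s')) →
    (∀ s, ∀ k ∈ ev s, DiffBdd l (pre k D) (F k s)) →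
    (∀ s, DiffBdd l D (fun ε n => U s ε (zeroOut (ev s) n))) → ∀ s, DiffBdd l D (U s) := by
  induction l with
  | zero =>
    intro S _ ev D hD R hR U A F heq hA hF hU s
    exact bdd_of_linear_system ev hD hR U A F heq hA hF hU s
  | succ l ih =>
    intro S _ ev D hD R hR U A F heq hA hF hU
    have hUl : ∀ s, DiffBdd l D (U s) := ih ev hD hR U A F heq
      (fun s k hk s' => (hA s k hk s').of_succ) (fun s k hk => (hF s k hk).of_succ)
      (fun s => (hU s).of_succ)
    have hev : ∀ s, ∀ k ∈ ev s, DiffBdd l (pre k D) (dq k (U s)) := by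
      intro s k hk
      have h1 : DiffBdd l (pre k D)
          (fun ε n => ∑ s', A k s s' ε n * U s' ε n + F k s ε n) :=
        (DiffBdd.sum Finset.univ fun s' _ => DiffBdd.mul (hD.pre k) (hA s k hk s').of_succ
          ((hUl s').subset (hD.lower k))).add (hF s k hk).of_succ
      exact h1.congr (hD.pre k) fun p hp => (heq s k hk p hp).symm
    intro s
    refine ⟨(hUl s).bdd, fun i => ?_⟩
    by_cases hi : i ∈ ev s
    · exact hev s i hi
    -- The differenced system is closed only on these unknowns; differences along i of the others
    -- are already bounded.
    let S' := {s : S // i ∉ ev s}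
    -- The new inhomogeneity collects the differences of the coefficients, the difference of the old
    -- inhomogeneity, and the known differences of unknowns evolving along i.
    let F' : Fin m → S' → LatticeFamily m := fun k s ε n =>
      (∑ s', dq i (A k s s') ε n * shift i (U s') ε n + dq i (F k s) ε n) +
        ∑ s', if i ∈ ev s' then A k s s' ε n * dq i (U s') ε n else 0
    have hpp : ∀ k, pre k (pre i D) ⊆ pre k D := fun k p hp => pre_mono (hD.lower i) k hp
    have hpi : ∀ k, pre k (pre i D) ⊆ pre i D := fun k p hp => (hD.pre i).lower k hp
    refine ih (S := S') (fun s => ev s) (hD.pre i) (R := R) (fun p hp => hR p (hD.lower i hp))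
      (fun s => dq i (U s)) (fun k s s' => A k s s') F' ?_ ?_ ?_ ?_ ⟨s, hi⟩
    · rintro ⟨s, hs⟩ k hk p hp
      have hp1 : p ∈ pre k D := hpp k hp
      have hp2 : (p.1, p.2 + Pi.single i 1) ∈ pre k D := by
        have : p ∈ pre i (pre k D) := by rw [pre_comm]; exact hp
        exact this
      have hε : p.1 ≠ 0 := (hD.pos p (hD.lower k hp1)).ne'
      have e1 := heq s k hk p hp1
      have e2 := heq s k hk _ hp2
      rw [dq_comm]
      have e3 : dq i (dq k (U s)) p.1 p.2 =
          (dq k (U s) p.1 (p.2 + Pi.single i 1) - dq k (U s) p.1 p.2) / p.1 := rfl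
      rw [e3, e1, e2]
      simp only [F']
      have e4 : ∑ s' : S', A k s s' p.1 p.2 * dq i (U s') p.1 p.2 +
          ∑ s', (if i ∈ ev s' then A k s s' p.1 p.2 * dq i (U s') p.1 p.2 else 0) =
          ∑ s', A k s s' p.1 p.2 * dq i (U s') p.1 p.2 := by
        have : ∑ s' : S', A k s s' p.1 p.2 * dq i (U s') p.1 p.2 =
            ∑ s', if i ∉ ev s' then A k s s' p.1 p.2 * dq i (U s') p.1 p.2 else 0 := by
          rw [← Finset.sum_filter]
          exact (Finset.sum_subtype _ (by simp)
            (fun s' => A k s s' p.1 p.2 * dq i (U s') p.1 p.2)).symm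
        rw [this, ← Finset.sum_add_distrib]
        refine Finset.sum_congr rfl fun s' _ => ?_
        by_cases h : i ∈ ev s' <;> simp [h]
      have e5 : ∀ x y z : ℝ, x + (y + z) = y + (x + z) := fun x y z => by ring
      rw [e5, e4, div_eq_iff hε, add_right_comm, ← Finset.sum_add_distrib, add_mul,
        Finset.sum_mul, add_sub_add_comm, ← Finset.sum_sub_distrib]
      congr 1
      · refine Finset.sum_congr rfl fun s' _ => ?_
        simp only [dq, shift]
        field_simp
        ring
      · simp only [dq]
        field_simp
    · rintro ⟨s, hs⟩ k hk ⟨s', hs'⟩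
      exact (hA s k hk s').of_succ.subset (hpp k)
    · rintro ⟨s, hs⟩ k hk
      have hadm := (hD.pre i).pre k
      refine DiffBdd.add (DiffBdd.add (DiffBdd.sum _ fun s' _ => DiffBdd.mul hadm ?_ ?_) ?_)
        (DiffBdd.sum _ fun s' _ => ?_)
      · rw [pre_comm]; exact (hA s k hk s').2 i
      · exact ((hUl s').shift i).subset (hpi k)
      · rw [pre_comm]; exact (hF s k hk).2 i
      · by_cases h : i ∈ ev s'
        · simp only [h, if_true]
          exact DiffBdd.mul hadm ((hA s k hk s').of_succ.subset (hpp k))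
            ((hev s' i h).subset (hpi k))
        · simp only [h, if_false]
          exact diffBdd_const l 0 _
    · rintro ⟨s, hs⟩
      have := (hU s).2 i
      refine this.congr (hD.pre i) fun p hp => ?_
      simp only [dq, zeroOut_add_single hs]

end LatticeFamily

/-! ### Calculus of O(ε)-convergence. -/

namespace LatticeFamily

variable {m : ℕ}

/-- The lattice points in the cube `[0, R]^m`, for the mesh sizes below `ε₁`. -/
def Box (m : ℕ) (R ε₁ : ℝ) : Set (ℝ × (Fin m → ℕ)) :=
  {p | 0 < p.1 ∧ p.1 < ε₁ ∧ ∀ i, p.1 * (p.2 i : ℝ) ≤ R}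

/-- The point with mesh size `ε` and integer coordinates `n`. -/
def pt (ε : ℝ) (n : Fin m → ℕ) : Fin m → ℝ := fun i => ε * n i

theorem pt_add_single (ε : ℝ) (n : Fin m → ℕ) (i : Fin m) :
    pt ε (n + Pi.single i 1) = pt ε n + ε • Pi.single i 1 := by
  funext j
  by_cases h : j = i
  · subst h; simp [pt, mul_add]
  · simp [pt, h]

theorem box_admissible {R ε₁ : ℝ} (h : ε₁ ≤ 1) : Admissible (Box m R ε₁) where
  pos p hp := hp.1
  le_one p hp := hp.2.1.le.trans h
  lower i p hp := by
    refine ⟨hp.1, hp.2.1, fun j => le_trans ?_ (hp.2.2 j)⟩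
    have : 0 < p.1 := hp.1
    gcongr
    simp

theorem box_subset {R R' ε₁ ε₁' : ℝ} (h : R ≤ R') (h' : ε₁ ≤ ε₁') : Box m R ε₁ ⊆ Box m R' ε₁' :=
  fun _ hp => ⟨hp.1, hp.2.1.trans_le h', fun i => (hp.2.2 i).trans h⟩

theorem box_sum_le {R ε₁ : ℝ} (p : ℝ × (Fin m → ℕ)) (hp : p ∈ Box m R ε₁) :
    p.1 * ∑ i, (p.2 i : ℝ) ≤ m * R := by
  rw [Finset.mul_sum]
  refine (Finset.sum_le_sum fun i _ => hp.2.2 i).trans ?_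
  simp

theorem norm_pt_le {R ε₁ : ℝ} (hR : 0 ≤ R) {p : ℝ × (Fin m → ℕ)} (hp : p ∈ Box m R ε₁) :
    ‖pt p.1 p.2‖ ≤ R := by
  refine (pi_norm_le_iff_of_nonneg hR).2 fun i => ?_
  change ‖p.1 * (p.2 i : ℝ)‖ ≤ R
  rw [Real.norm_of_nonneg (mul_nonneg hp.1.le (Nat.cast_nonneg _))]
  exact hp.2.2 i

/-- By Hadamard's lemma the difference quotient of a smooth function of (ξ, ε) is again such a
function. Explicit dependence on ε is allowed in order to close the induction. -/
theorem diffBdd_smooth {R ε₁ : ℝ} (hε₁ : ε₁ ≤ 1) (l : ℕ) :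
    ∀ {G : (Fin m → ℝ) × ℝ → ℝ}, ContDiff ℝ ∞ G →
      DiffBdd l (Box m R ε₁) (fun ε n => G (pt ε n, ε)) := by
  have h0 : ∀ {G : (Fin m → ℝ) × ℝ → ℝ}, ContDiff ℝ ∞ G →
      DiffBdd 0 (Box m R ε₁) (fun ε n => G (pt ε n, ε)) := by
    intro G hG
    have hc : IsCompact ((Set.Icc (0 : Fin m → ℝ) (fun _ => R)) ×ˢ Set.Icc (0 : ℝ) 1) :=
      isCompact_Icc.prod isCompact_Icc
    obtain ⟨K, hK⟩ := hc.exists_bound_of_continuousOn hG.continuous.continuousOn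
    refine ⟨K, fun p hp => hK _ ⟨⟨fun i => ?_, fun i => hp.2.2 i⟩, hp.1.le,
      hp.2.1.le.trans hε₁⟩⟩
    exact mul_nonneg hp.1.le (Nat.cast_nonneg _)
  induction l with
  | zero => exact h0
  | succ l ih =>
    intro G hG
    refine ⟨h0 hG, fun i => ?_⟩
    obtain ⟨q, hq, hq1, -⟩ := exists_hadamard_quotient (E := (Fin m → ℝ) × ℝ)
      (g := fun p => G (p.1.1 + p.2 • Pi.single i 1, p.1.2)) (hG.comp (by fun_prop))
    have h1 := (ih (G := fun p => q (p, p.2)) (hq.comp (by fun_prop))).subset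
      ((box_admissible hε₁).lower i)
    refine h1.congr ((box_admissible hε₁).pre i) fun p hp => ?_
    have := hq1 (pt p.1 p.2, p.1) p.1
    have hε : p.1 ≠ 0 := ((box_admissible hε₁).pos p ((box_admissible hε₁).lower i hp)).ne'
    simp only [zero_smul, add_zero, smul_eq_mul] at this
    rw [dq, pt_add_single, this, mul_div_cancel_left₀ _ hε]

/-- Two applications of Hadamard's lemma give a Taylor expansion whose second-order remainder is
smooth in the point and in ε. It measures the local truncation error of the difference scheme. -/
theorem exists_dq_expansion {u : (Fin m → ℝ) → ℝ} (hu : ContDiff ℝ ∞ u) (i : Fin m) :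
    ∃ ρ : (Fin m → ℝ) × ℝ → ℝ, ContDiff ℝ ∞ ρ ∧ ∀ t ε,
      u (t + ε • Pi.single i 1) - u t = ε * (pd i u t + ε * ρ (t, ε)) := by
  obtain ⟨q, hq, hq1, hq2⟩ := exists_hadamard_quotient (E := Fin m → ℝ)
      (g := fun p => u (p.1 + p.2 • Pi.single i 1)) (hu.comp (by fun_prop))
  obtain ⟨ρ, hρ, hρ1, -⟩ := exists_hadamard_quotient hq
  refine ⟨ρ, hρ, fun t ε => ?_⟩
  have h1 := hq1 t ε
  have h2 := hρ1 t ε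
  have h3 : q (t, 0) = pd i u t := by
    rw [hq2]
    have h4 : HasDerivAt (fun s : ℝ => t + s • (Pi.single i 1 : Fin m → ℝ)) (Pi.single i 1) 0 := by
      simpa using ((hasDerivAt_id (0 : ℝ)).smul_const (Pi.single i 1 : Fin m → ℝ)).const_add t
    have h5 := ((hu.differentiable (by simp)) (t + (0 : ℝ) • Pi.single i 1)).hasFDerivAt
    have h6 := h5.comp_hasDerivAt (0 : ℝ) h4
    simp only [zero_smul, add_zero] at h6
    exact h6.deriv
  simp only [zero_smul, add_zero, smul_eq_mul] at h1 h2
  rw [h1, ← h3, ← h2]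
  ring

/-- `u` is `O(ε)`-close to `U` with all difference quotients on the domain `D`. -/
structure ConvOn (D : Set (ℝ × (Fin m → ℕ))) (u : LatticeFamily m) (U : (Fin m → ℝ) → ℝ) :
    Prop where
  lim : ∀ l, DiffBdd l D (fun ε n => U (pt ε n))
  err : ∀ l, DiffBdd l D (fun ε n => (u ε n - U (pt ε n)) / ε)

namespace ConvOn

variable {D D' : Set (ℝ × (Fin m → ℕ))} {u v : LatticeFamily m} {U V : (Fin m → ℝ) → ℝ}

theorem diffBdd (h : ConvOn D u U) (hD : Admissible D) (l : ℕ) : DiffBdd l D u := by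
  refine ((h.lim l).add ((h.err l).eps_mul hD).of_succ).congr hD fun p hp => ?_
  have := (hD.pos p hp).ne'
  field_simp
  ring

theorem subset (h : ConvOn D u U) (hs : D' ⊆ D) : ConvOn D' u U :=
  ⟨fun l => (h.lim l).subset hs, fun l => (h.err l).subset hs⟩

theorem congr (h : ConvOn D u U) (hD : Admissible D) (hu : ∀ p ∈ D, u p.1 p.2 = v p.1 p.2)
    (hU : ∀ p ∈ D, U (pt p.1 p.2) = V (pt p.1 p.2)) : ConvOn D v V :=
  ⟨fun l => (h.lim l).congr hD hU, fun l => (h.err l).congr hD fun p hp => by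
    rw [hu p hp, hU p hp]⟩

theorem add (h : ConvOn D u U) (h' : ConvOn D v V) :
    ConvOn D (fun ε n => u ε n + v ε n) (fun t => U t + V t) :=
  ⟨fun l => (h.lim l).add (h'.lim l), fun l => by
    have := (h.err l).add (h'.err l)
    convert this using 3
    ring⟩

theorem mul (hD : Admissible D) (h : ConvOn D u U) (h' : ConvOn D v V) :
    ConvOn D (fun ε n => u ε n * v ε n) (fun t => U t * V t) :=
  ⟨fun l => (h.lim l).mul hD (h'.lim l), fun l => by
    have := (DiffBdd.mul hD (h.err l) (h'.diffBdd hD l)).add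
      (DiffBdd.mul hD (h.lim l) (h'.err l))
    convert this using 3
    ring⟩

theorem inv (hD : Admissible D) {c : ℝ} (hc : 0 < c) (h : ConvOn D u U)
    (hu : ∀ p ∈ D, c ≤ |u p.1 p.2|) (hU : ∀ p ∈ D, c ≤ |U (pt p.1 p.2)|) :
    ConvOn D (fun ε n => (u ε n)⁻¹) (fun t => (U t)⁻¹) :=
  ⟨fun l => (h.lim l).inv hc hD hU, fun l => by
    refine DiffBdd.congr (DiffBdd.mul hD ((h.err l).neg hD) (DiffBdd.mul hD
      ((h.diffBdd hD l).inv hc hD hu) ((h.lim l).inv hc hD hU))) hD fun p hp => ?_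
    have e1 : u p.1 p.2 ≠ 0 := fun h' => by
      have := hu p hp; rw [h', abs_zero] at this; linarith
    have e2 : U (pt p.1 p.2) ≠ 0 := fun h' => by
      have := hU p hp; rw [h', abs_zero] at this; linarith
    have e3 := (hD.pos p hp).ne'
    field_simp
    ring⟩

theorem of_smooth {R ε₁ : ℝ} (hε₁ : ε₁ ≤ 1) {G : (Fin m → ℝ) × ℝ → ℝ} (hG : ContDiff ℝ ∞ G) :
    ConvOn (Box m R ε₁) (fun ε n => G (pt ε n, ε)) (fun t => G (t, 0)) :=
  ⟨fun l => diffBdd_smooth hε₁ l (G := fun p => G (p.1, 0)) (hG.comp (by fun_prop)), fun l => by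
    obtain ⟨q, hq, hq1, -⟩ := exists_hadamard_quotient hG
    refine (diffBdd_smooth hε₁ l hq).congr (box_admissible hε₁) fun p hp => ?_
    rw [hq1, smul_eq_mul, mul_div_cancel_left₀ _ hp.1.ne']⟩

theorem const {R ε₁ : ℝ} (hε₁ : ε₁ ≤ 1) (c : ℝ) :
    ConvOn (Box m R ε₁) (fun _ _ => c) (fun _ => c) :=
  of_smooth hε₁ (G := fun _ => c) contDiff_const

/-- A lower bound of the limit is inherited, up to a constant, for small mesh sizes. -/
theorem exists_pos_le_abs {R ε₁ : ℝ} (h : ConvOn (Box m R ε₁) u U) {c : ℝ} (hc : 0 < c)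
    (hε₁ : 0 < ε₁) (hU : ∀ p ∈ Box m R ε₁, c ≤ |U (pt p.1 p.2)|) :
    ∃ ε₂, 0 < ε₂ ∧ ε₂ ≤ ε₁ ∧ ∀ p ∈ Box m R ε₂, c / 2 ≤ |u p.1 p.2| := by
  obtain ⟨K, hK⟩ := h.err 0
  refine ⟨min ε₁ (c / (2 * (|K| + 1))), lt_min hε₁ (by positivity), min_le_left _ _,
    fun p hp => ?_⟩
  have hp' := box_subset le_rfl (min_le_left ε₁ (c / (2 * (|K| + 1)))) hp
  have h1 := hK p hp'
  have h2 := hU p hp'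
  have h3 : p.1 * (|K| + 1) ≤ c / 2 := by
    have := hp.2.1.le.trans (min_le_right _ _)
    rw [le_div_iff₀ (by positivity)] at this
    linarith
  rw [abs_div, abs_of_pos hp.1, div_le_iff₀ hp.1] at h1
  have h4 := abs_sub_abs_le_abs_sub (U (pt p.1 p.2)) (u p.1 p.2)
  rw [abs_sub_comm] at h4
  have h5 : K * p.1 ≤ p.1 * (|K| + 1) := by
    nlinarith [le_abs_self K, hp.1]
  linarith

end ConvOn

end LatticeFamily

/-! ### The discrete Darboux system and its solution. -/

/-- The step of the discrete Darboux system in the direction `k`, with mesh size `ε`. -/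
noncomputable def darbouxStep {A : Type} (ε : ℝ) (k : A) (β : A → A → ℝ) : A → A → ℝ :=
  fun a b => β a b + ε * (1 - ε * β k k)⁻¹ * β a k * β k b

/-- A step subtracts a Schur-complement term: it inverts the entry 1/ε - β_kk. Two steps in either
order amount to inverting the 2 × 2 block of the indices k and l, whose rescaled determinant `Δ` is
symmetric in the two directions. -/
theorem darbouxStep_comm {A : Type} (ε ε' : ℝ) (k l : A) (β : A → A → ℝ)
    (hk : 1 - ε * β k k ≠ 0) (hl : 1 - ε' * β l l ≠ 0)
    (hkl : 1 - ε * darbouxStep ε' l β k k ≠ 0) (hlk : 1 - ε' * darbouxStep ε k β l l ≠ 0)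
    (a b : A) : darbouxStep ε' l (darbouxStep ε k β) a b =
      darbouxStep ε k (darbouxStep ε' l β) a b := by
  have e1 : (1 - ε * darbouxStep ε' l β k k) * (1 - ε' * β l l) =
      (1 - ε * β k k) * (1 - ε' * β l l) - ε * ε' * β k l * β l k := by
    simp only [darbouxStep]; field_simp; ring
  have e2 : (1 - ε' * darbouxStep ε k β l l) * (1 - ε * β k k) =
      (1 - ε * β k k) * (1 - ε' * β l l) - ε * ε' * β k l * β l k := by
    simp only [darbouxStep]; field_simp; ring
  set Δ := (1 - ε * β k k) * (1 - ε' * β l l) - ε * ε' * β k l * β l k with hΔ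
  have hΔ0 : Δ ≠ 0 := e1 ▸ mul_ne_zero hkl hl
  have e3 : (1 - ε * darbouxStep ε' l β k k)⁻¹ = (1 - ε' * β l l) / Δ := by
    rw [← e1]; field_simp
  have e4 : (1 - ε' * darbouxStep ε k β l l)⁻¹ = (1 - ε * β k k) / Δ := by
    rw [← e2]; field_simp
  rw [darbouxStep, e4]
  conv_rhs => rw [darbouxStep, e3]
  simp only [darbouxStep]
  field_simp
  rw [hΔ]
  ring

section Discrete

open LatticeFamily

variable {m : ℕ} {A : Type} [DecidableEq A] (ι : Fin m → A)

open Classical in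
/-- The solution of the discrete Darboux system with the data `d` on the coordinate planes. -/
noncomputable def discreteDarboux (d : A → A → LatticeFamily m) (ε : ℝ) (n : Fin m → ℕ) :
    A → A → ℝ := fun a b =>
  -- The direction of the step back is arbitrary; `discreteDarboux_step` shows that the choice does
  -- not matter.
  if h : ∃ k, ι k ≠ a ∧ ι k ≠ b ∧ n k ≠ 0 then
    darbouxStep ε (ι h.choose) (discreteDarboux d ε (n - Pi.single h.choose 1)) a b
  else d a b ε n
termination_by ∑ i, n i
decreasing_by
  obtain ⟨n', hn'⟩ := exists_eq_add_single h.choose_spec.2.2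
  generalize h.choose = k at hn' ⊢
  subst hn'
  have : n' + Pi.single k 1 - Pi.single k 1 = n' := by ext i; simp
  rw [this, sum_add_single]
  exact Nat.lt_succ_self _

variable {ι}

theorem discreteDarboux_plane (d : A → A → LatticeFamily m) (ε : ℝ) (n : Fin m → ℕ) (a b : A)
    (h : ∀ k, ι k ≠ a → ι k ≠ b → n k = 0) : discreteDarboux ι d ε n a b = d a b ε n := by
  rw [discreteDarboux, dif_neg]
  rintro ⟨k, h1, h2, h3⟩
  exact h3 (h k h1 h2)

theorem discreteDarboux_exists_step (d : A → A → LatticeFamily m) (ε : ℝ) (n : Fin m → ℕ)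
    (a b : A) (h : ∃ k, ι k ≠ a ∧ ι k ≠ b ∧ n k ≠ 0) : ∃ k n', n = n' + Pi.single k 1 ∧
      ι k ≠ a ∧ ι k ≠ b ∧ discreteDarboux ι d ε n a b =
        darbouxStep ε (ι k) (discreteDarboux ι d ε n') a b := by
  obtain ⟨n', hn'⟩ := exists_eq_add_single h.choose_spec.2.2
  refine ⟨h.choose, n', hn', h.choose_spec.1, h.choose_spec.2.1, ?_⟩
  have e : ∀ k, n = n' + Pi.single k 1 → n - Pi.single k 1 = n' := by
    rintro k rfl
    ext i; simp
  rw [discreteDarboux, dif_pos h, e _ hn']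

/-- The system is quadratic, so a bound holds only on a small cube. While all entries are at most B
+ 1, the denominators are at least 1/2 and a step adds at most 2ε(B + 1)². The total length of a
lattice path is at most mR, so `hR` keeps the total increase below 1. -/
theorem abs_discreteDarboux_le {d : A → A → LatticeFamily m} {R ε₁ B : ℝ}
    (hd : ∀ a b, ∀ p ∈ Box m R ε₁, |d a b p.1 p.2| ≤ B) (hB : 0 ≤ B)
    (hR : 2 * (B + 1) ^ 2 * (m * R) ≤ 1) (hε₁ : ε₁ * (B + 1) ≤ 1 / 2) (hε₁' : ε₁ ≤ 1)
    (a b : A) (p : ℝ × (Fin m → ℕ)) (hp : p ∈ Box m R ε₁) :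
    |discreteDarboux ι d p.1 p.2 a b| ≤ B + 1 := by
  have key : ∀ N : ℕ, ∀ p ∈ Box m R ε₁, ∑ i, p.2 i = N → ∀ a b,
      |discreteDarboux ι d p.1 p.2 a b| ≤ B + 2 * (B + 1) ^ 2 * (p.1 * N) := by
    intro N
    induction N with
    | zero =>
      intro p hp hN a b
      rw [discreteDarboux_plane]
      · simpa using hd a b p hp
      · exact fun k _ _ => Finset.sum_eq_zero_iff.1 hN k (Finset.mem_univ k)
    | succ N ih =>
      rintro ⟨ε, n⟩ hp hN a b
      have hε : 0 < ε := hp.1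
      by_cases h : ∃ k, ι k ≠ a ∧ ι k ≠ b ∧ n k ≠ 0
      · obtain ⟨k, n', rfl, hka, hkb, h1⟩ := discreteDarboux_exists_step d ε n a b h
        have hp' : (ε, n') ∈ Box m R ε₁ := (box_admissible hε₁').lower k hp
        have hN' : ∑ i, n' i = N := by
          have := sum_add_single n' k
          simp only at hN
          omega
        have ih' := fun a b => ih (ε, n') hp' hN' a b
        have h2 : ε * (N : ℝ) ≤ m * R := by
          have := box_sum_le _ hp'
          rw [← hN']; push_cast; exact this
        have h3 : ∀ a b, |discreteDarboux ι d ε n' a b| ≤ B + 1 := fun a b =>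
          (ih' a b).trans (by simp only; nlinarith [sq_nonneg (B + 1)])
        simp only
        rw [h1, darbouxStep]
        have h4 : |ε * discreteDarboux ι d ε n' (ι k) (ι k)| ≤ 1 / 2 := by
          rw [abs_mul, abs_of_pos hε]
          exact (mul_le_mul hp.2.1.le (h3 _ _) (abs_nonneg _) (hε.le.trans hp.2.1.le)).trans hε₁
        have h5 : |(1 - ε * discreteDarboux ι d ε n' (ι k) (ι k))⁻¹| ≤ 2 := by
          rw [abs_inv, show (2 : ℝ) = (1 / 2)⁻¹ by norm_num]
          refine inv_anti₀ (by norm_num) ?_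
          rw [abs_le] at h4
          exact (by linarith : (1 : ℝ) / 2 ≤ _).trans (le_abs_self _)
        have h6 : |ε * (1 - ε * discreteDarboux ι d ε n' (ι k) (ι k))⁻¹ *
            discreteDarboux ι d ε n' a (ι k) * discreteDarboux ι d ε n' (ι k) b| ≤
            ε * 2 * (B + 1) * (B + 1) := by
          rw [abs_mul, abs_mul, abs_mul, abs_of_pos hε]
          have := h3 a (ι k)
          have := h3 (ι k) b
          gcongr
        refine (abs_add_le _ _).trans ((add_le_add (ih' a b) h6).trans (le_of_eq ?_))
        push_cast
        ring
      · rw [discreteDarboux_plane]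
        · exact (hd a b _ hp).trans (le_add_of_nonneg_right (by positivity))
        · intro k h1 h2
          by_contra h3
          exact h ⟨k, h1, h2, h3⟩
  refine (key _ p hp rfl a b).trans ?_
  have := box_sum_le _ hp
  push_cast
  nlinarith [sq_nonneg (B + 1)]

/-- The value at n + e_k was defined by a step back in some direction l. If l ≠ k, both n and the
predecessor of n + e_k lie one step above q = n - e_l. By induction on the coordinate sum the steps
from q are known, and commutation turns the step along l into the step along k. -/
theorem discreteDarboux_step (hι : Function.Injective ι) {d : A → A → LatticeFamily m}
    {R ε₁ : ℝ} (hε₁ : ε₁ ≤ 1)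
    (hne : ∀ p ∈ Box m R ε₁, ∀ a, 1 - p.1 * discreteDarboux ι d p.1 p.2 a a ≠ 0)
    {a b : A} {k : Fin m} (hka : ι k ≠ a) (hkb : ι k ≠ b) (p : ℝ × (Fin m → ℕ))
    (hp : p ∈ pre k (Box m R ε₁)) :
    discreteDarboux ι d p.1 (p.2 + Pi.single k 1) a b =
      darbouxStep p.1 (ι k) (discreteDarboux ι d p.1 p.2) a b := by
  obtain ⟨ε, n⟩ := p
  simp only
  induction hN : ∑ i, n i using Nat.strong_induction_on generalizing n a b k with
  | _ N ih =>
    obtain ⟨l, o, hlo, hla, hlb, h1⟩ := discreteDarboux_exists_step d ε (n + Pi.single k 1) a b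
      ⟨k, hka, hkb, by simp⟩
    by_cases hkl : k = l
    · subst hkl
      rw [h1, add_right_cancel hlo]
    obtain ⟨q, rfl⟩ : ∃ q : Fin m → ℕ, n = q + Pi.single l 1 := by
      refine exists_eq_add_single ?_
      have := congrFun hlo l
      simp only [Pi.add_apply, Pi.single_eq_same, Pi.single_eq_of_ne (Ne.symm hkl)] at this
      omega
    obtain rfl : o = q + Pi.single k 1 := by
      rw [add_right_comm] at hlo
      exact (add_right_cancel hlo).symm
    have hlt : ∑ i, q i < N := by rw [← hN, sum_add_single]; exact Nat.lt_succ_self _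
    have hqk : (ε, q) ∈ pre k (Box m R ε₁) := by
      refine ((box_admissible hε₁).pre k).lower l ?_
      exact hp
    have hql : (ε, q) ∈ pre l (Box m R ε₁) := (box_admissible hε₁).lower k hp
    have hιkl : ι k ≠ ι l := fun h => hkl (hι h)
    have hq : (ε, q) ∈ Box m R ε₁ := (box_admissible hε₁).lower k hqk
    have ihk : ∀ {a b}, ι k ≠ a → ι k ≠ b → discreteDarboux ι d ε (q + Pi.single k 1) a b =
        darbouxStep ε (ι k) (discreteDarboux ι d ε q) a b := fun h h' =>
      ih _ hlt h h' q hqk rfl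
    have ihl : ∀ {a b}, ι l ≠ a → ι l ≠ b → discreteDarboux ι d ε (q + Pi.single l 1) a b =
        darbouxStep ε (ι l) (discreteDarboux ι d ε q) a b := fun h h' =>
      ih _ hlt h h' q hql rfl
    rw [h1, darbouxStep, ihk hka hkb, ihk hka hιkl, ihk hιkl hkb, ihk hιkl hιkl]
    conv_rhs => rw [darbouxStep, ihl hla hlb, ihl hla hιkl.symm, ihl hιkl.symm hlb,
        ihl hιkl.symm hιkl.symm]
    refine darbouxStep_comm ε ε (ι k) (ι l) (discreteDarboux ι d ε q) (hne _ hq _) (hne _ hq _)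
      ?_ ?_ a b
    · rw [← ihl hιkl.symm hιkl.symm]; exact hne _ hql _
    · rw [← ihk hιkl hιkl]; exact hne _ hqk _

end Discrete

/-! ### Convergence of the discrete Darboux system. -/

section DiscreteConvergence

open LatticeFamily

variable {m : ℕ} {A : Type} [DecidableEq A] {ι : Fin m → A}

theorem pt_keep (a c : A) (ε : ℝ) (n : Fin m → ℕ) :
    pt ε (keep ι a c n) = keep ι a c (pt ε n) := by
  funext i
  by_cases h : ι i = a ∨ ι i = c <;> simp [pt, keep, h]

variable [Fintype A]

/-- With b_ak b_kc - β_ak β_kc = (b_ak - β_ak) b_kc + β_ak (b_kc - β_kc), the scaled error satisfies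
a linear system with coefficients b and β. Its inhomogeneity consists of the truncation error and of
the correction by the denominator 1 - ε b_kk; both have size O(ε) before the division by ε. -/
theorem diffBdd_darboux_error {β : A → A → (Fin m → ℝ) → ℝ} (hβ : ∀ a b, ContDiff ℝ ∞ (β a b))
    {b : A → A → LatticeFamily m} {R ε₁ : ℝ} (hR : 0 ≤ R) (hε₁ : ε₁ ≤ 1)
    (hpd : ∀ t, ‖t‖ ≤ R → ∀ a c k, ι k ≠ a → ι k ≠ c →
        pd k (β a c) t = β a (ι k) t * β (ι k) c t)
    (hhalf : ∀ p ∈ Box m R ε₁, ∀ a, |p.1 * b a a p.1 p.2| ≤ 1 / 2)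
    (hstep : ∀ a c k, ι k ≠ a → ι k ≠ c → ∀ p ∈ pre k (Box m R ε₁),
      b a c p.1 (p.2 + Pi.single k 1) = darbouxStep p.1 (ι k) (fun a c => b a c p.1 p.2) a c)
    (hdata : ∀ a c, ∀ l, DiffBdd l (Box m R ε₁)
      (fun ε n => (b a c ε (keep ι a c n) - β a c (pt ε (keep ι a c n))) / ε))
    (l : ℕ) (hb : ∀ a c, DiffBdd l (Box m R ε₁) (b a c)) (a c : A) :
    DiffBdd l (Box m R ε₁) (fun ε n => (b a c ε n - β a c (pt ε n)) / ε) := by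
  have hD : Admissible (Box m R ε₁) := box_admissible hε₁
  choose ρ hρ hρe using fun a c k => exists_dq_expansion (hβ a c) k
  have hβB : ∀ a c, DiffBdd l (Box m R ε₁) (fun ε n => β a c (pt ε n)) := fun a c =>
    diffBdd_smooth hε₁ l (G := fun p => β a c p.1) ((hβ a c).comp (by fun_prop))
  have hs : ∀ a, DiffBdd l (Box m R ε₁) (fun ε n => (1 - ε * b a a ε n)⁻¹) := by
    intro a
    refine DiffBdd.inv (c := 1 / 2) (by norm_num) hD
      ((diffBdd_const l 1 _).sub hD ((hb a a).eps_mul hD).of_succ) fun p hp => ?_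
    have := abs_le.1 (hhalf p hp a)
    exact (by linarith : (1 : ℝ) / 2 ≤ _).trans (le_abs_self _)
  let ev : A × A → Finset (Fin m) := fun s =>
    Finset.univ.filter fun k => ι k ≠ s.1 ∧ ι k ≠ s.2
  let U : A × A → LatticeFamily m := fun s ε n => (b s.1 s.2 ε n - β s.1 s.2 (pt ε n)) / ε
  -- The two summands are the coefficients of the errors at (a, k) and at (k, c).
  let Co : Fin m → A × A → A × A → LatticeFamily m := fun k s s' ε n =>
    (if s' = (s.1, ι k) then b (ι k) s.2 ε n else 0) +
      (if s' = (ι k, s.2) then β s.1 (ι k) (pt ε n) else 0)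
  let F : Fin m → A × A → LatticeFamily m := fun k s ε n =>
    (1 - ε * b (ι k) (ι k) ε n)⁻¹ * b (ι k) (ι k) ε n * b s.1 (ι k) ε n * b (ι k) s.2 ε n -
      ρ s.1 s.2 k (pt ε n, ε)
  refine diffBdd_of_linear_system l ev hD (R := m * R) box_sum_le U Co F ?_ ?_ ?_ ?_ (a, c)
  · rintro ⟨a, c⟩ k hk p hp
    obtain ⟨hka, hkc⟩ := (Finset.mem_filter.1 hk).2
    have hpD := hD.lower k hp
    have hε : p.1 ≠ 0 := (hD.pos p hpD).ne'
    have h1 := hstep a c k hka hkc p hp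
    have h2 := hρe a c k (pt p.1 p.2) p.1
    rw [hpd _ (norm_pt_le hR hpD) a c k hka hkc, ← pt_add_single] at h2
    have h3 : ∑ s', Co k (a, c) s' p.1 p.2 * U s' p.1 p.2 =
        b (ι k) c p.1 p.2 * U (a, ι k) p.1 p.2 +
          β a (ι k) (pt p.1 p.2) * U (ι k, c) p.1 p.2 := by
      simp only [Co, add_mul, ite_mul, zero_mul, Finset.sum_add_distrib, Finset.sum_ite_eq',
        Finset.mem_univ, if_true]
    rw [h3]
    have h4 : 1 - p.1 * b (ι k) (ι k) p.1 p.2 ≠ 0 := by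
      have := abs_le.1 (hhalf p hpD (ι k))
      intro h; linarith
    have h5 : β a c (pt p.1 (p.2 + Pi.single k 1)) = β a c (pt p.1 p.2) + p.1 *
      (β a (ι k) (pt p.1 p.2) * β (ι k) c (pt p.1 p.2) + p.1 * ρ a c k (pt p.1 p.2, p.1)) := by
      linarith
    simp only [dq, U, F, h1, darbouxStep, h5]
    field_simp
    ring
  · rintro ⟨a, c⟩ k hk ⟨a', c'⟩
    refine DiffBdd.subset (DiffBdd.add ?_ ?_) (hD.lower k)
    · by_cases h : (a', c') = (a, ι k)
      · simp only [h, if_true]; exact hb _ _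
      · simp only [h, if_false]; exact diffBdd_const l 0 _
    · by_cases h : (a', c') = (ι k, c)
      · simp only [h, if_true]; exact hβB _ _
      · simp only [h, if_false]; exact diffBdd_const l 0 _
  · rintro ⟨a, c⟩ k hk
    exact DiffBdd.subset (DiffBdd.sub hD (DiffBdd.mul hD (DiffBdd.mul hD
      (DiffBdd.mul hD (hs _) (hb _ _)) (hb _ _)) (hb _ _)) (diffBdd_smooth hε₁ l (hρ a c k)))
      (hD.lower k)
  · rintro ⟨a, c⟩
    have : ∀ n : Fin m → ℕ, zeroOut (ev (a, c)) n = keep ι a c n := by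
      intro n
      funext i
      by_cases h : ι i = a ∨ ι i = c
      · have : ¬(ι i ≠ a ∧ ι i ≠ c) := by tauto
        simp [zeroOut, keep, ev, h, this]
      · push Not at h
        simp [zeroOut, keep, ev, h]
    simp only [this]
    exact hdata a c l

/-- Convergence of the solutions of the discrete Darboux system. -/
theorem exists_discreteDarboux_convergence (hι : Function.Injective ι)
    {D β : A → A → (Fin m → ℝ) → ℝ} (hβ : ∀ a b, ContDiff ℝ ∞ (β a b)) {ρ : ℝ} (hρ : 0 < ρ)
    (hplane : ∀ t, ‖t‖ ≤ ρ → ∀ a c, β a c (keep ι a c t) = D a c t)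
    (hpd : ∀ t, ‖t‖ ≤ ρ → ∀ a c k, ι k ≠ a → ι k ≠ c →
        pd k (β a c) t = β a (ι k) t * β (ι k) c t)
    {d : A → A → LatticeFamily m} {R₀ ε₀ : ℝ} (hR₀ : 0 < R₀) (hε₀ : 0 < ε₀)
    (hd : ∀ a c, ConvOn (Box m R₀ ε₀) (d a c) (D a c))
    (hdk : ∀ a c ε n, d a c ε (keep ι a c n) = d a c ε n) :
    ∃ R > 0, ∃ ε₁ > 0, R ≤ R₀ ∧ R ≤ ρ ∧ ε₁ ≤ ε₀ ∧ ε₁ ≤ 1 ∧ ∃ b : A → A → LatticeFamily m,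
      (∀ a c, ConvOn (Box m R ε₁) (b a c) (β a c)) ∧
      (∀ p ∈ Box m R ε₁, ∀ a, |p.1 * b a a p.1 p.2| ≤ 1 / 2) ∧
      (∀ a c ε n, b a c ε (keep ι a c n) = d a c ε n) ∧
      (∀ a c k, ι k ≠ a → ι k ≠ c → ∀ p ∈ pre k (Box m R ε₁),
        b a c p.1 (p.2 + Pi.single k 1) =
          darbouxStep p.1 (ι k) (fun a c => b a c p.1 p.2) a c) := by
  have hsub0 : ∀ {R ε₁}, R ≤ R₀ → ε₁ ≤ min ε₀ 1 → Box m R ε₁ ⊆ Box m R₀ ε₀ := fun h h' =>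
    box_subset h (h'.trans (min_le_left _ _))
  obtain ⟨B, hB0, hB⟩ : ∃ B, 0 ≤ B ∧ ∀ a c, ∀ p ∈ Box m R₀ (min ε₀ 1), |d a c p.1 p.2| ≤ B := by
    choose B hB using fun a c => (((hd a c).subset (hsub0 le_rfl le_rfl)).diffBdd
      (box_admissible (min_le_right _ _)) 0).bdd
    refine ⟨∑ a, ∑ c, |B a c|, by positivity, fun a c p hp => ?_⟩
    calc _ ≤ |B a c| := (hB a c p hp).trans (le_abs_self _)
      _ ≤ ∑ c, |B a c| := Finset.single_le_sum (f := fun c => |B a c|)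
        (fun _ _ => abs_nonneg _) (Finset.mem_univ c)
      _ ≤ _ := Finset.single_le_sum (f := fun a => ∑ c, |B a c|)
        (fun _ _ => by positivity) (Finset.mem_univ a)
  -- The last entry makes the total increase of the entries of the discrete solution at most 1.
  set R : ℝ := min (min R₀ ρ) (1 / (2 * (B + 1) ^ 2 * (m + 1))) with hRdef
  set ε₁ : ℝ := min (min ε₀ 1) (1 / (2 * (B + 1))) with hε₁def
  have hR : 0 < R := lt_min (lt_min hR₀ hρ) (by positivity)
  have hRR₀ : R ≤ R₀ := (min_le_left _ _).trans (min_le_left _ _)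
  have hRρ : R ≤ ρ := (min_le_left _ _).trans (min_le_right _ _)
  have hε₁ : 0 < ε₁ := lt_min (lt_min hε₀ one_pos) (by positivity)
  have hε₁' : ε₁ ≤ min ε₀ 1 := min_le_left _ _
  have hε₁1 : ε₁ ≤ 1 := hε₁'.trans (min_le_right _ _)
  have hR2 : 2 * (B + 1) ^ 2 * (m * R) ≤ 1 := by
    have h1 : R ≤ 1 / (2 * (B + 1) ^ 2 * (m + 1)) := min_le_right _ _
    rw [le_div_iff₀ (by positivity)] at h1
    nlinarith [mul_pos hR (by positivity : 0 < 2 * (B + 1) ^ 2)]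
  have hε2 : ε₁ * (B + 1) ≤ 1 / 2 := by
    have h1 : ε₁ ≤ 1 / (2 * (B + 1)) := min_le_right _ _
    rw [le_div_iff₀ (by positivity)] at h1
    linarith
  have hD : Admissible (Box m R ε₁) := box_admissible hε₁1
  have hbd := fun a c p hp => abs_discreteDarboux_le (ι := ι)
    (fun a c p hp => hB a c p (box_subset hRR₀ hε₁' hp)) hB0 hR2 hε2 hε₁1 a c p hp
  have hhalf : ∀ p ∈ Box m R ε₁, ∀ a, |p.1 * discreteDarboux ι d p.1 p.2 a a| ≤ 1 / 2 := by
    intro p hp a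
    rw [abs_mul, abs_of_pos hp.1]
    exact (mul_le_mul hp.2.1.le (hbd a a p hp) (abs_nonneg _) hε₁.le).trans hε2
  have hne : ∀ p ∈ Box m R ε₁, ∀ a, 1 - p.1 * discreteDarboux ι d p.1 p.2 a a ≠ 0 := by
    intro p hp a h
    have := abs_le.1 (hhalf p hp a)
    linarith
  let b : A → A → LatticeFamily m := fun a c ε n => discreteDarboux ι d ε n a c
  have hbk : ∀ a c ε n, b a c ε (keep ι a c n) = d a c ε n := by
    intro a c ε n
    rw [← hdk]
    refine discreteDarboux_plane d ε _ a c fun k h1 h2 => ?_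
    simp [keep, h1, h2]
  have hstep := fun a c k (hka : ι k ≠ a) (hkc : ι k ≠ c) p hp =>
    discreteDarboux_step hι hε₁1 hne hka hkc p hp
  have hlim : ∀ a c l, DiffBdd l (Box m R ε₁) (fun ε n => β a c (pt ε n)) := fun a c l =>
    diffBdd_smooth hε₁1 l (G := fun p => β a c p.1) ((hβ a c).comp (by fun_prop))
  have herr := fun l hb => diffBdd_darboux_error hβ hR.le hε₁1
    (fun t ht => hpd t (ht.trans hRρ)) (b := b) hhalf hstep (fun a c l => by
      refine (((hd a c).err l).subset (box_subset hRR₀ (hε₁'.trans (min_le_left _ _)))).congr hD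
        fun p hp => ?_
      rw [hbk, pt_keep, hplane _ ((norm_pt_le hR.le hp).trans hRρ)]) l hb
  -- Bootstrap: bounds of order l for b give order l for the error divided by ε, hence order l + 1
  -- for the error and for b.
  have hall : ∀ l a c, DiffBdd l (Box m R ε₁) (b a c) := by
    intro l
    induction l with
    | zero => exact fun a c => ⟨B + 1, fun p hp => hbd a c p hp⟩
    | succ l ih =>
      intro a c
      have h1 := (herr l ih a c).eps_mul hD
      refine ((hlim a c (l + 1)).add h1).congr hD fun p hp => ?_
      have := (hD.pos p hp).ne'
      field_simp
      ring
  exact ⟨R, hR, ε₁, hε₁, hRR₀, hRρ, hε₁'.trans (min_le_left _ _), hε₁1, b,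
    fun a c => ⟨hlim a c, fun l => herr l (hall l) a c⟩, hhalf, hbk, hstep⟩

end DiscreteConvergence

/-! ### Scalar linear equations along one direction: exponentials and products. -/

section Exponentials

open LatticeFamily

variable {m : ℕ}

theorem hasDerivAt_comp_update {u : (Fin m → ℝ) → ℝ} {t : Fin m → ℝ} (hu : DifferentiableAt ℝ u t)
    (j : Fin m) : HasDerivAt (fun s => u (Function.update t j s)) (pd j u t) (t j) := by
  have h1 : HasDerivAt (Function.update t j) (Pi.single j (1 : ℝ)) (t j) :=
    hasDerivAt_update t j (t j)
  have h2 : HasFDerivAt u (fderiv ℝ u t) (Function.update t j (t j)) := by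
    rw [Function.update_eq_self]; exact hu.hasFDerivAt
  exact h2.comp_hasDerivAt (t j) h1

/-- The solution of `δⱼ u = g u` which is `1` for `nⱼ = 0`. -/
noncomputable def prodFam (j : Fin m) (g : LatticeFamily m) : LatticeFamily m :=
  fun ε n => ∏ l ∈ Finset.range (n j), (1 + ε * g ε (Function.update n j l))

theorem prodFam_of_eq_zero {j : Fin m} (g : LatticeFamily m) (ε : ℝ) {n : Fin m → ℕ}
    (h : n j = 0) : prodFam j g ε n = 1 := by
  simp [prodFam, h]

theorem prodFam_add_single (j : Fin m) (g : LatticeFamily m) (ε : ℝ) (n : Fin m → ℕ) :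
    prodFam j g ε (n + Pi.single j 1) = (1 + ε * g ε n) * prodFam j g ε n := by
  have h1 : ∀ l, Function.update (n + Pi.single j 1) j l = Function.update n j l := by
    intro l
    funext i
    by_cases h : i = j
    · subst h; simp
    · simp [h]
  simp only [prodFam, Pi.add_apply, Pi.single_eq_same, Finset.prod_range_succ, h1,
    Function.update_eq_self]
  ring

theorem prodFam_congr {i j : Fin m} {g : LatticeFamily m} {ε : ℝ}
    (hg : ∀ n n' : Fin m → ℕ, n i = n' i → n j = n' j → g ε n = g ε n') {n n' : Fin m → ℕ}
    (hi : n i = n' i) (hj : n j = n' j) : prodFam j g ε n = prodFam j g ε n' := by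
  simp only [prodFam, hj]
  refine Finset.prod_congr rfl fun l _ => ?_
  rw [hg (Function.update n j l) (Function.update n' j l) ?_ (by simp)]
  by_cases h : i = j
  · subst h; simp
  · simp [h, hi]

/-- The solution of `∂ⱼ u = g u` which is `1` for `tⱼ = 0`. -/
noncomputable def expFam (j : Fin m) (g : (Fin m → ℝ) → ℝ) : (Fin m → ℝ) → ℝ :=
  fun t => Real.exp (t j * ∫ s in (0 : ℝ)..1, g (Function.update t j (s * t j)))

theorem expFam_pos (j : Fin m) (g : (Fin m → ℝ) → ℝ) (t : Fin m → ℝ) : 0 < expFam j g t :=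
  Real.exp_pos _

theorem expFam_of_eq_zero {j : Fin m} (g : (Fin m → ℝ) → ℝ) {t : Fin m → ℝ} (h : t j = 0) :
    expFam j g t = 1 := by
  simp [expFam, h]

theorem expFam_congr {i j : Fin m} {g : (Fin m → ℝ) → ℝ}
    (hg : ∀ t t' : Fin m → ℝ, t i = t' i → t j = t' j → g t = g t') {t t' : Fin m → ℝ}
    (hi : t i = t' i) (hj : t j = t' j) : expFam j g t = expFam j g t' := by
  simp only [expFam, hj]
  congr 2
  refine intervalIntegral.integral_congr fun s _ => hg _ _ ?_ (by simp)
  by_cases h : i = j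
  · subst h; simp
  · simp [h, hi]

theorem contDiff_update_scale (j : Fin m) :
    ContDiff ℝ ∞ (fun q : (Fin m → ℝ) × ℝ => Function.update q.1 j (q.2 * q.1 j)) := by
  refine contDiff_pi.2 fun i => ?_
  by_cases h : i = j
  · subst h; simp only [Function.update_self]; fun_prop
  · simp only [Function.update_of_ne h]; fun_prop

theorem expFam_contDiff (j : Fin m) {g : (Fin m → ℝ) → ℝ} (hg : ContDiff ℝ ∞ g) :
    ContDiff ℝ ∞ (expFam j g) := by
  refine Real.contDiff_exp.comp ((contDiff_apply ℝ ℝ j).mul ?_)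
  exact ContDiff.unit_parametric_integral
    (g := fun q : (Fin m → ℝ) × ℝ => g (Function.update q.1 j (q.2 * q.1 j)))
    (hg.comp (contDiff_update_scale j))

theorem pd_expFam (j : Fin m) {g : (Fin m → ℝ) → ℝ} (hg : ContDiff ℝ ∞ g) (t : Fin m → ℝ) :
    pd j (expFam j g) t = g t * expFam j g t := by
  have h1 := hasDerivAt_comp_update ((expFam_contDiff j hg).differentiable (by simp) t) j
  have hc : Continuous fun s => g (Function.update t j s) :=
    hg.continuous.comp (by fun_prop)
  have h2 : (fun s => expFam j g (Function.update t j s)) =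
      fun s => Real.exp (∫ τ in (0 : ℝ)..s, g (Function.update t j τ)) := by
    funext s
    simp only [expFam, Function.update_self, Function.update_idem]
    have := intervalIntegral.mul_integral_comp_mul_right (a := 0) (b := 1)
      (f := fun τ => g (Function.update t j τ)) s
    rw [zero_mul, one_mul] at this
    rw [← this]
  have h3 := ((hc.integral_hasStrictDerivAt 0 (t j)).hasDerivAt).exp
  rw [← h2, Function.update_eq_self] at h3
  rw [h1.unique h3]
  have h4 := congrFun h2 (t j)
  simp only [Function.update_eq_self] at h4
  rw [← h4, mul_comm]

/-- The product is the Euler scheme for the equation solved by the exponential. The scaled error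
solves a linear system with one unknown and zero data. -/
theorem convOn_prodFam {R ε₁ : ℝ} (hε₁ : ε₁ ≤ 1) (j : Fin m) {g : LatticeFamily m}
    {γ : (Fin m → ℝ) → ℝ} (hγ : ContDiff ℝ ∞ γ) (hg : ConvOn (Box m R ε₁) g γ) :
    ConvOn (Box m R ε₁) (prodFam j g) (expFam j γ) := by
  have hD : Admissible (Box m R ε₁) := box_admissible hε₁
  have hE := expFam_contDiff j hγ
  have hlim : ∀ l, DiffBdd l (Box m R ε₁) (fun ε n => expFam j γ (pt ε n)) := fun l =>
    diffBdd_smooth hε₁ l (G := fun p => expFam j γ p.1) (hE.comp (by fun_prop))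
  refine ⟨hlim, fun l => ?_⟩
  obtain ⟨ρ, hρ, hρe⟩ := exists_dq_expansion hE j
  refine diffBdd_of_linear_system l (S := Unit) (fun _ => {j}) hD (R := m * R) box_sum_le
    (fun _ ε n => (prodFam j g ε n - expFam j γ (pt ε n)) / ε) (fun _ _ _ => g)
    (fun _ _ ε n => (g ε n - γ (pt ε n)) / ε * expFam j γ (pt ε n) - ρ (pt ε n, ε))
    ?_ ?_ ?_ ?_ ()
  · intro _ k hk p hp
    rw [Finset.mem_singleton] at hk
    subst hk
    have hε : p.1 ≠ 0 := (hD.pos p (hD.lower k hp)).ne'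
    have h1 := hρe (pt p.1 p.2) p.1
    rw [← pt_add_single, pd_expFam k hγ] at h1
    have h2 : expFam k γ (pt p.1 (p.2 + Pi.single k 1)) = expFam k γ (pt p.1 p.2) + p.1 *
      (γ (pt p.1 p.2) * expFam k γ (pt p.1 p.2) + p.1 * ρ (pt p.1 p.2, p.1)) := by linarith
    simp only [dq, Finset.univ_unique, Finset.sum_singleton, prodFam_add_single, h2]
    field_simp
    ring
  · exact fun _ k _ _ => (hg.diffBdd hD l).subset (hD.lower k)
  · exact fun _ k _ => (DiffBdd.sub hD (DiffBdd.mul hD (hg.err l) (hlim l))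
      (diffBdd_smooth hε₁ l hρ)).subset (hD.lower k)
  · intro _
    refine (diffBdd_const l 0 _).congr hD fun p _ => ?_
    have h1 : zeroOut {j} p.2 j = 0 := by simp [zeroOut]
    rw [prodFam_of_eq_zero g _ h1, expFam_of_eq_zero, sub_self, zero_div]
    simp [pt, h1]

theorem eventually_le_one : ∀ᶠ ε₁ in nhdsWithin (0 : ℝ) (Set.Ioi 0), ε₁ ≤ 1 := by
  filter_upwards [Ioo_mem_nhdsGT (show (0 : ℝ) < 1 by norm_num)] with ε h using h.2.le

/-- A continuous nonvanishing limit is bounded below on the compact cube, and convergence transfers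
half of this bound to the lattice functions for small ε. -/
theorem eventually_convOn_inv {R : ℝ} {u : LatticeFamily m} {U : (Fin m → ℝ) → ℝ}
    (hU : Continuous U) (hpos : ∀ t ∈ Set.Icc (0 : Fin m → ℝ) (fun _ => R), U t ≠ 0)
    (h : ∀ᶠ ε₁ in nhdsWithin (0 : ℝ) (Set.Ioi 0), ConvOn (Box m R ε₁) u U) :
    ∀ᶠ ε₁ in nhdsWithin (0 : ℝ) (Set.Ioi 0),
      ConvOn (Box m R ε₁) (fun ε n => (u ε n)⁻¹) (fun t => (U t)⁻¹) ∧
      ∀ p ∈ Box m R ε₁, u p.1 p.2 ≠ 0 := by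
  obtain ⟨c, hc, hcU⟩ : ∃ c, 0 < c ∧ ∀ t ∈ Set.Icc (0 : Fin m → ℝ) (fun _ => R), c ≤ |U t| := by
    have hcomp : IsCompact (Set.Icc (0 : Fin m → ℝ) (fun _ => R)) := isCompact_Icc
    rcases (Set.Icc (0 : Fin m → ℝ) (fun _ => R)).eq_empty_or_nonempty with h0 | hne
    · exact ⟨1, one_pos, fun t ht => by simp [h0] at ht⟩
    · obtain ⟨t₀, ht₀, hmin⟩ := hcomp.exists_isMinOn hne (f := fun t => |U t|)
        hU.abs.continuousOn
      exact ⟨|U t₀|, abs_pos.2 (hpos t₀ ht₀), fun t ht => hmin ht⟩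
  obtain ⟨ε₁, ⟨hconv, hle⟩, hpos1⟩ :=
    ((h.and eventually_le_one).and self_mem_nhdsWithin).exists
  have hU' : ∀ {ε₁}, ∀ p ∈ Box m R ε₁, c ≤ |U (pt p.1 p.2)| := fun p hp =>
    hcU _ ⟨fun i => mul_nonneg hp.1.le (Nat.cast_nonneg _), hp.2.2⟩
  obtain ⟨ε₂, hε₂, hε₂₁, hlow⟩ := hconv.exists_pos_le_abs hc hpos1 hU'
  filter_upwards [Ioo_mem_nhdsGT hε₂] with ε hε
  have hs := box_subset (m := m) (le_refl R) hε.2.le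
  refine ⟨ConvOn.inv (box_admissible (hε.2.le.trans (hε₂₁.trans hle))) (half_pos hc)
    (hconv.subset (box_subset le_rfl (hε.2.le.trans hε₂₁))) (fun p hp => hlow p (hs hp))
    (fun p hp => (half_le_self hc.le).trans (hU' p hp)), fun p hp h0 => ?_⟩
  have := hlow p (hs hp)
  rw [h0, abs_zero] at this
  linarith

end Exponentials

/-! ### The data of the Darboux systems. -/

/-- Smooth data for the approximation of a Jonas pair: coordinate curves, rotation coefficients
on the coordinate planes, the coefficients of the transformation on the axes, the quotients
`Q = C_{iM} / (1 + C_{Mi})`, the origin, and the initial displacement. -/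
structure JonasData (m N : ℕ) where
  X : Fin m → ℝ → EuclideanSpace ℝ (Fin N)
  C : Fin m → Fin m → ℝ × ℝ → ℝ
  CM : Fin m → ℝ → ℝ
  CiM : Fin m → ℝ → ℝ
  Q : Fin m → ℝ → ℝ
  P : EuclideanSpace ℝ (Fin N)
  V : EuclideanSpace ℝ (Fin N)
  hX : ∀ i, ContDiff ℝ ∞ (X i)
  hC : ∀ i j, i ≠ j → ContDiff ℝ ∞ (C i j)
  hCM : ∀ i, ContDiff ℝ ∞ (CM i)
  hCiM : ∀ i, ContDiff ℝ ∞ (CiM i)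
  hQ : ∀ i, ContDiff ℝ ∞ (Q i)

/-- The matrix indices: the `m` lattice directions, the direction of the transformation, the
index of the Lamé coefficients, and the `N` coordinates of the ambient space. -/
abbrev NetIdx (m N : ℕ) : Type := Fin m ⊕ Option (Option (Fin N))

namespace JonasData

open LatticeFamily

variable {m N : ℕ} (S : JonasData m N)

/-- The discrete value of `1 + ε c_{ij}` on the `(i, j)`-plane. -/
noncomputable def stretch (i j : Fin m) : LatticeFamily m :=
  fun ε n => 1 + ε * S.C i j (ε * n i, ε * n j)

/-- The length factor of the direction `i` on the `(i, j)`-plane. -/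
noncomputable def planeP (i j : Fin m) : LatticeFamily m :=
  prodFam j fun ε n => S.C j i (ε * n j, ε * n i)

/-- The Lamé coefficient of the direction `i` on the `(i, j)`-plane. -/
noncomputable def planeH (i j : Fin m) : LatticeFamily m :=
  prodFam j fun ε n => S.C j i (ε * n j, ε * n i) * (S.stretch i j ε n)⁻¹

/-- The smooth Lamé coefficient of the direction `i` on the `(i, j)`-plane. -/
noncomputable def planeE (i j : Fin m) : (Fin m → ℝ) → ℝ := expFam j fun t => S.C j i (t j, t i)

/-- The length factor of the transformation on the `i`-th axis. -/
noncomputable def axisP (i : Fin m) : LatticeFamily m := prodFam i fun ε n => S.CiM i (ε * n i)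

/-- The Lamé coefficient of the transformation on the `i`-th axis. -/
noncomputable def axisH (i : Fin m) : LatticeFamily m := prodFam i fun ε n => S.Q i (ε * n i)

/-- The smooth length factor of the transformation on the `i`-th axis. -/
noncomputable def axisEP (i : Fin m) : (Fin m → ℝ) → ℝ := expFam i fun t => S.CiM i (t i)

/-- The smooth Lamé coefficient of the transformation on the `i`-th axis. -/
noncomputable def axisEH (i : Fin m) : (Fin m → ℝ) → ℝ := expFam i fun t => S.Q i (t i)

/-- The data of the discrete Darboux system. -/
noncomputable def disc : NetIdx m N → NetIdx m N → LatticeFamily m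
  -- Obtained by solving c_ij = p_i' β_ij / h_j for β_ij. Here p_i = h_i/(1 - ε β_ii) is the length
  -- factor, and p_i' = (1 + ε c_ji) p_i is its value one step further along j. On the diagonal,
  -- β_ii = 0 is a normalisation on the i-th axis.
  | .inl i, .inl j => fun ε n => if i = j then 0 else
      S.C i j (ε * n i, ε * n j) * S.planeH j i ε n * ((S.stretch j i ε n)⁻¹ *
        (S.planeP i j ε n)⁻¹)
  -- The same formula for the pair (i, M), with p_i = 1 on the axis and stretching factor 1 +
  -- C_{Mi}, which is absorbed in Q.
  | .inl i, .inr none => fun ε n => S.Q i (ε * n i) * S.axisH i ε n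
  | .inr none, .inl i => fun ε n => S.CM i (ε * n i) * ((1 + ε * S.CiM i (ε * n i))⁻¹ *
      (S.axisP i ε n)⁻¹)
  | .inl i, .inr (some (some l)) => fun ε n => (S.X i (ε * n i + ε) l - S.X i (ε * n i) l) / ε
  | .inr none, .inr (some (some l)) => fun _ _ => S.V l
  -- Each Lamé coefficient is normalised to 1 on its own axis, and that of M to 1 at the origin.
  | .inr (some none), .inl _ => fun _ _ => 1
  | .inr (some none), .inr none => fun _ _ => 1
  | .inr (some none), .inr (some (some l)) => fun _ _ => S.P l
  -- This includes the initial value β_MM = 0 at the origin; β_MM then evolves in all m directions.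
  | _, _ => fun _ _ => 0

/-- The data of the smooth Darboux system. -/
noncomputable def smooth : NetIdx m N → NetIdx m N → (Fin m → ℝ) → ℝ
  | .inl i, .inl j => fun t => if i = j then 0 else
      S.C i j (t i, t j) * S.planeE j i t * (S.planeE i j t)⁻¹
  | .inl i, .inr none => fun t => S.Q i (t i) * S.axisEH i t
  | .inr none, .inl i => fun t => S.CM i (t i) * (S.axisEP i t)⁻¹
  | .inl i, .inr (some (some l)) => fun t => deriv (fun s => S.X i s l) (t i)
  | .inr none, .inr (some (some l)) => fun _ => S.V l
  | .inr (some none), .inl _ => fun _ => 1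
  | .inr (some none), .inr none => fun _ => 1
  | .inr (some none), .inr (some (some l)) => fun _ => S.P l
  | _, _ => fun _ => 0

theorem contDiff_coord (i : Fin m) (l : Fin N) : ContDiff ℝ ∞ (fun s => S.X i s l) :=
  (contDiff_piLp_apply (p := 2) (i := l)).comp (S.hX i)

theorem contDiff_C {i j : Fin m} (h : i ≠ j) : ContDiff ℝ ∞ (fun t : Fin m → ℝ => S.C i j (t i, t j)) :=
  (S.hC i j h).comp (by fun_prop)

theorem planeE_contDiff {i j : Fin m} (h : i ≠ j) : ContDiff ℝ ∞ (S.planeE i j) :=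
  expFam_contDiff j (S.contDiff_C h.symm)

theorem contDiff_axis {f : ℝ → ℝ} (hf : ContDiff ℝ ∞ f) (i : Fin m) :
    ContDiff ℝ ∞ (fun t : Fin m → ℝ => f (t i)) :=
  hf.comp (contDiff_apply ℝ ℝ i)

theorem smooth_contDiff (a b : NetIdx m N) : ContDiff ℝ ∞ (S.smooth a b) := by
  rcases a with i | _ | _ | l <;> rcases b with j | _ | _ | l' <;> simp only [smooth] <;>
    try exact contDiff_const
  · by_cases h : i = j
    · simp only [h, if_true]; exact contDiff_const
    · simp only [h, if_false]
      exact ((S.contDiff_C h).mul (S.planeE_contDiff (Ne.symm h))).mul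
        ((S.planeE_contDiff h).inv fun t => (expFam_pos _ _ t).ne')
  · exact (contDiff_axis (S.hQ i) i).mul (expFam_contDiff i (contDiff_axis (S.hQ i) i))
  · exact contDiff_axis ((contDiff_infty_iff_deriv.1 (S.contDiff_coord i l')).2) i
  · exact (contDiff_axis (S.hCM j) j).mul
      ((expFam_contDiff j (contDiff_axis (S.hCiM j) j)).inv fun t => (expFam_pos _ _ t).ne')

theorem keep_left {R : Type} [Zero R] {A : Type} [DecidableEq A] (ι : Fin m → A) (i : Fin m)
    (b : A) (t : Fin m → R) : keep ι (ι i) b t i = t i := by simp [keep]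

theorem keep_right {R : Type} [Zero R] {A : Type} [DecidableEq A] (ι : Fin m → A) (a : A)
    (i : Fin m) (t : Fin m → R) : keep ι a (ι i) t i = t i := by simp [keep]

theorem smooth_keep (a b : NetIdx m N) (t : Fin m → ℝ) :
    S.smooth a b (keep Sum.inl a b t) = S.smooth a b t := by
  rcases a with i | _ | _ | l <;> rcases b with j | _ | _ | l' <;> simp only [smooth] <;>
    simp only [keep_left, keep_right]
  · congr 2
    · rw [planeE, expFam_congr (i := j) (j := i) ?_ (keep_right _ _ _ _) (keep_left _ _ _ _)]
      intro t t' h1 h2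
      simp only [h1, h2]
    · rw [planeE, expFam_congr (i := i) (j := j) ?_ (keep_left _ _ _ _) (keep_right _ _ _ _)]
      intro t t' h1 h2
      simp only [h1, h2]
  · rw [axisEH, expFam_congr (i := i) (j := i) ?_ (keep_left _ _ _ _) (keep_left _ _ _ _)]
    intro t t' h1 h2
    simp only [h1]
  · rw [axisEP, expFam_congr (i := j) (j := j) ?_ (keep_right _ _ _ _) (keep_right _ _ _ _)]
    intro t t' h1 h2
    simp only [h1]

theorem planeP_congr (i j : Fin m) {ε : ℝ} {n n' : Fin m → ℕ} (hi : n i = n' i) (hj : n j = n' j) :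
    S.planeP i j ε n = S.planeP i j ε n' :=
  prodFam_congr (fun _ _ h1 h2 => by simp only [h1, h2]) hi hj

theorem planeH_congr (i j : Fin m) {ε : ℝ} {n n' : Fin m → ℕ} (hi : n i = n' i) (hj : n j = n' j) :
    S.planeH i j ε n = S.planeH i j ε n' :=
  prodFam_congr (fun _ _ h1 h2 => by simp only [stretch, h1, h2]) hi hj

theorem axisP_congr (i : Fin m) {ε : ℝ} {n n' : Fin m → ℕ} (hi : n i = n' i) :
    S.axisP i ε n = S.axisP i ε n' :=
  prodFam_congr (i := i) (fun _ _ h1 _ => by simp only [h1]) hi hi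

theorem axisH_congr (i : Fin m) {ε : ℝ} {n n' : Fin m → ℕ} (hi : n i = n' i) :
    S.axisH i ε n = S.axisH i ε n' :=
  prodFam_congr (i := i) (fun _ _ h1 _ => by simp only [h1]) hi hi

theorem disc_keep (a b : NetIdx m N) (ε : ℝ) (n : Fin m → ℕ) :
    S.disc a b ε (keep Sum.inl a b n) = S.disc a b ε n := by
  rcases a with i | _ | _ | l <;> rcases b with j | _ | _ | l' <;> simp only [disc] <;>
    simp only [keep_left, keep_right, stretch]
  · rw [S.planeH_congr j i (keep_right _ _ _ _) (keep_left _ _ _ _),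
      S.planeP_congr i j (keep_left _ _ _ _) (keep_right _ _ _ _)]
  · rw [S.axisH_congr i (keep_left _ _ _ _)]
  · rw [S.axisP_congr j (keep_right _ _ _ _)]

theorem convOn_C {i j : Fin m} (h : i ≠ j) {ε₁ : ℝ} (hε₁ : ε₁ ≤ 1) : ConvOn (Box m 1 ε₁)
    (fun ε n => S.C i j (ε * n i, ε * n j)) (fun t => S.C i j (t i, t j)) :=
  ConvOn.of_smooth hε₁ (G := fun p => S.C i j (p.1 i, p.1 j)) ((S.hC i j h).comp (by fun_prop))

theorem convOn_axis {f : ℝ → ℝ} (hf : ContDiff ℝ ∞ f) (i : Fin m) {ε₁ : ℝ} (hε₁ : ε₁ ≤ 1) :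
    ConvOn (Box m 1 ε₁) (fun ε n => f (ε * n i)) (fun t => f (t i)) :=
  ConvOn.of_smooth hε₁ (G := fun p => f (p.1 i)) (hf.comp (by fun_prop))

theorem eventually_stretch {f : (Fin m → ℝ) → ℝ} (hf : ContDiff ℝ ∞ f) :
    ∀ᶠ ε₁ in nhdsWithin (0 : ℝ) (Set.Ioi 0),
      ConvOn (Box m 1 ε₁) (fun ε n => (1 + ε * f (pt ε n))⁻¹) (fun _ => 1) ∧
      ∀ p ∈ Box m 1 ε₁, 1 + p.1 * f (pt p.1 p.2) ≠ 0 := by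
  have h1 : ∀ᶠ ε₁ in nhdsWithin (0 : ℝ) (Set.Ioi 0), ConvOn (Box m 1 ε₁)
      (fun ε n => 1 + ε * f (pt ε n)) (fun _ => 1) := by
    filter_upwards [eventually_le_one] with ε₁ hε₁
    have := ConvOn.of_smooth (R := 1) hε₁ (G := fun p : (Fin m → ℝ) × ℝ => 1 + p.2 * f p.1)
      (by have := hf.comp (contDiff_fst (𝕜 := ℝ) (E := Fin m → ℝ) (F := ℝ) (n := ∞))
          exact contDiff_const.add (contDiff_snd.mul this))
    exact this.congr (box_admissible hε₁) (fun _ _ => rfl) (fun _ _ => by simp)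
  have := eventually_convOn_inv (R := 1) (U := fun _ => (1 : ℝ)) continuous_const
    (fun _ _ => one_ne_zero) h1
  simpa using this

theorem eventually_planes (i j : Fin m) (h : i ≠ j) :
    ∀ᶠ ε₁ in nhdsWithin (0 : ℝ) (Set.Ioi 0),
      (ConvOn (Box m 1 ε₁) (fun ε n => (S.stretch i j ε n)⁻¹) (fun _ => 1) ∧
        ∀ p ∈ Box m 1 ε₁, S.stretch i j p.1 p.2 ≠ 0) ∧
      ConvOn (Box m 1 ε₁) (S.planeH i j) (S.planeE i j) ∧
      (ConvOn (Box m 1 ε₁) (fun ε n => (S.planeP i j ε n)⁻¹) (fun t => (S.planeE i j t)⁻¹) ∧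
        ∀ p ∈ Box m 1 ε₁, S.planeP i j p.1 p.2 ≠ 0) ∧
      ∀ p ∈ Box m 1 ε₁, S.planeH i j p.1 p.2 ≠ 0 := by
  have hs := eventually_stretch (S.contDiff_C h)
  have hH : ∀ᶠ ε₁ in nhdsWithin (0 : ℝ) (Set.Ioi 0),
      ConvOn (Box m 1 ε₁) (S.planeH i j) (S.planeE i j) := by
    filter_upwards [eventually_le_one, hs] with ε₁ hε₁ hs
    refine convOn_prodFam hε₁ j (S.contDiff_C h.symm) ?_
    have := ConvOn.mul (box_admissible hε₁) (S.convOn_C h.symm hε₁) hs.1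
    exact this.congr (box_admissible hε₁) (fun _ _ => rfl) (fun _ _ => by simp)
  have hP : ∀ᶠ ε₁ in nhdsWithin (0 : ℝ) (Set.Ioi 0),
      ConvOn (Box m 1 ε₁) (S.planeP i j) (S.planeE i j) := by
    filter_upwards [eventually_le_one] with ε₁ hε₁
    exact convOn_prodFam hε₁ j (S.contDiff_C h.symm) (S.convOn_C h.symm hε₁)
  have hc := (S.planeE_contDiff h).continuous
  have hpos : ∀ t ∈ Set.Icc (0 : Fin m → ℝ) (fun _ => 1), S.planeE i j t ≠ 0 :=
    fun t _ => (expFam_pos _ _ t).ne'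
  filter_upwards [hs, hH, eventually_convOn_inv hc hpos hP, eventually_convOn_inv hc hpos hH]
    with ε₁ h1 h2 h3 h4
  exact ⟨h1, h2, h3, h4.2⟩

theorem eventually_axes (i : Fin m) :
    ∀ᶠ ε₁ in nhdsWithin (0 : ℝ) (Set.Ioi 0),
      (ConvOn (Box m 1 ε₁) (fun ε n => (1 + ε * S.CiM i (ε * n i))⁻¹) (fun _ => 1) ∧
        ∀ p ∈ Box m 1 ε₁, 1 + p.1 * S.CiM i (p.1 * p.2 i) ≠ 0) ∧
      ConvOn (Box m 1 ε₁) (S.axisH i) (S.axisEH i) ∧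
      (ConvOn (Box m 1 ε₁) (fun ε n => (S.axisP i ε n)⁻¹) (fun t => (S.axisEP i t)⁻¹) ∧
        ∀ p ∈ Box m 1 ε₁, S.axisP i p.1 p.2 ≠ 0) ∧
      ∀ p ∈ Box m 1 ε₁, S.axisH i p.1 p.2 ≠ 0 := by
  have hs := eventually_stretch (contDiff_axis (S.hCiM i) i)
  have hH : ∀ᶠ ε₁ in nhdsWithin (0 : ℝ) (Set.Ioi 0),
      ConvOn (Box m 1 ε₁) (S.axisH i) (S.axisEH i) := by
    filter_upwards [eventually_le_one] with ε₁ hε₁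
    exact convOn_prodFam hε₁ i (contDiff_axis (S.hQ i) i) (convOn_axis (S.hQ i) i hε₁)
  have hP : ∀ᶠ ε₁ in nhdsWithin (0 : ℝ) (Set.Ioi 0),
      ConvOn (Box m 1 ε₁) (S.axisP i) (S.axisEP i) := by
    filter_upwards [eventually_le_one] with ε₁ hε₁
    exact convOn_prodFam hε₁ i (contDiff_axis (S.hCiM i) i) (convOn_axis (S.hCiM i) i hε₁)
  have hposH : ∀ t ∈ Set.Icc (0 : Fin m → ℝ) (fun _ => 1), S.axisEH i t ≠ 0 :=
    fun t _ => (expFam_pos _ _ t).ne'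
  have hposP : ∀ t ∈ Set.Icc (0 : Fin m → ℝ) (fun _ => 1), S.axisEP i t ≠ 0 :=
    fun t _ => (expFam_pos _ _ t).ne'
  filter_upwards [hs, hH, eventually_convOn_inv
      (expFam_contDiff i (contDiff_axis (S.hCiM i) i)).continuous hposP hP,
    eventually_convOn_inv (expFam_contDiff i (contDiff_axis (S.hQ i) i)).continuous hposH hH]
    with ε₁ h1 h2 h3 h4
  exact ⟨h1, h2, h3, h4.2⟩

theorem convOn_diffQuot (i : Fin m) (l : Fin N) {ε₁ : ℝ} (hε₁ : ε₁ ≤ 1) : ConvOn (Box m 1 ε₁)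
    (fun ε n => (S.X i (ε * n i + ε) l - S.X i (ε * n i) l) / ε)
    (fun t => deriv (fun s => S.X i s l) (t i)) := by
  obtain ⟨q, hq, hq1, hq2⟩ := exists_hadamard_quotient (E := ℝ)
    (g := fun p => S.X i (p.1 + p.2) l) ((S.contDiff_coord i l).comp (by fun_prop))
  have := ConvOn.of_smooth (R := 1) hε₁ (G := fun p : (Fin m → ℝ) × ℝ => q (p.1 i, p.2))
    (hq.comp (by fun_prop))
  refine this.congr (box_admissible hε₁) (fun p hp => ?_) (fun p _ => ?_)
  · have h1 := hq1 (p.1 * p.2 i) p.1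
    rw [add_zero, smul_eq_mul] at h1
    rw [h1, mul_div_cancel_left₀ _ hp.1.ne']
    rfl
  · simp only [hq2]
    rw [deriv_comp_const_add (f := fun s => S.X i s l)]
    simp

theorem eventually_convOn_data : ∀ᶠ ε₁ in nhdsWithin (0 : ℝ) (Set.Ioi 0),
    ∀ a b, ConvOn (Box m 1 ε₁) (S.disc a b) (S.smooth a b) := by
  have h1 := Filter.eventually_all.2 fun i => Filter.eventually_all.2 fun j =>
      Filter.eventually_all.2 fun h => S.eventually_planes i j h
  have h2 := Filter.eventually_all.2 fun i => S.eventually_axes i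
  filter_upwards [eventually_le_one, h1, h2] with ε₁ hε₁ h1 h2
  have hD : Admissible (Box m 1 ε₁) := box_admissible hε₁
  intro a b
  rcases a with i | _ | _ | l <;> rcases b with j | _ | _ | l' <;> simp only [smooth, disc] <;>
    try exact ConvOn.const hε₁ _
  · by_cases h : i = j
    · simp only [h, if_true]; exact ConvOn.const hε₁ _
    · simp only [h, if_false]
      have := ConvOn.mul hD (ConvOn.mul hD (S.convOn_C h hε₁) (h1 j i (Ne.symm h)).2.1)
        (ConvOn.mul hD (h1 j i (Ne.symm h)).1.1 (h1 i j h).2.2.1.1)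
      exact this.congr hD (fun _ _ => rfl) (fun _ _ => by simp)
  · exact ConvOn.mul hD (convOn_axis (S.hQ i) i hε₁) (h2 i).2.1
  · exact S.convOn_diffQuot i l' hε₁
  · have := ConvOn.mul hD (convOn_axis (S.hCM j) j hε₁) (ConvOn.mul hD (h2 j).1.1 (h2 j).2.2.1.1)
    exact this.congr hD (fun _ _ => rfl) (fun _ _ => by simp)

theorem eventually_regular : ∀ᶠ ε₁ in nhdsWithin (0 : ℝ) (Set.Ioi 0),
    (∀ i j, i ≠ j → ∀ p ∈ Box m 1 ε₁, S.stretch i j p.1 p.2 ≠ 0 ∧ S.planeP i j p.1 p.2 ≠ 0 ∧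
      S.planeH i j p.1 p.2 ≠ 0) ∧
    ∀ i, ∀ p ∈ Box m 1 ε₁, 1 + p.1 * S.CiM i (p.1 * p.2 i) ≠ 0 ∧ S.axisP i p.1 p.2 ≠ 0 ∧
      S.axisH i p.1 p.2 ≠ 0 := by
  have h1 := Filter.eventually_all.2 fun i => Filter.eventually_all.2 fun j =>
      Filter.eventually_all.2 fun h => S.eventually_planes i j h
  have h2 := Filter.eventually_all.2 fun i => S.eventually_axes i
  filter_upwards [h1, h2] with ε₁ h1 h2
  exact ⟨fun i j h p hp => ⟨(h1 i j h).1.2 p hp, (h1 i j h).2.2.1.2 p hp, (h1 i j h).2.2.2 p hp⟩,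
    fun i p hp => ⟨(h2 i).1.2 p hp, (h2 i).2.2.1.2 p hp, (h2 i).2.2.2 p hp⟩⟩

end JonasData

/-! ### Algebra of length factors and rotation coefficients. -/

section DarbouxAlgebra

variable {A : Type}

/-- The length factor of the direction `k` of the net whose Lamé coefficients are the entries in
the row `o`. -/
noncomputable def lengthFactor (e : ℝ) (o k : A) (β : A → A → ℝ) : ℝ :=
  β o k * (1 - e * β k k)⁻¹

/-- This is δ_k p_l = c_kl p_l with c_kl = p_k' β_kl / h_l, where p_k' is p_k shifted along l. The
symmetric determinant `Δ` of `darbouxStep_comm` evaluates both shifted denominators. -/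
theorem lengthFactor_darbouxStep {e e' : ℝ} {o k l : A} {β : A → A → ℝ}
    (hk : 1 - e * β k k ≠ 0) (hl : 1 - e' * β l l ≠ 0)
    (hkl : 1 - e * darbouxStep e' l β k k ≠ 0) (hlk : 1 - e' * darbouxStep e k β l l ≠ 0)
    (ho : β o l ≠ 0) : lengthFactor e' o l (darbouxStep e k β) =
      (1 + e * (lengthFactor e o k (darbouxStep e' l β) * β k l / β o l)) *
        lengthFactor e' o l β := by
  have e1 : (1 - e * darbouxStep e' l β k k) * (1 - e' * β l l) =
      (1 - e * β k k) * (1 - e' * β l l) - e * e' * β k l * β l k := by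
    simp only [darbouxStep]; field_simp; ring
  have e2 : (1 - e' * darbouxStep e k β l l) * (1 - e * β k k) =
      (1 - e * β k k) * (1 - e' * β l l) - e * e' * β k l * β l k := by
    simp only [darbouxStep]; field_simp; ring
  set Δ := (1 - e * β k k) * (1 - e' * β l l) - e * e' * β k l * β l k with hΔ
  have hΔ0 : Δ ≠ 0 := e1 ▸ mul_ne_zero hkl hl
  have e3 : (1 - e * darbouxStep e' l β k k)⁻¹ = (1 - e' * β l l) / Δ := by
    rw [← e1]; field_simp
  have e4 : (1 - e' * darbouxStep e k β l l)⁻¹ = (1 - e * β k k) / Δ := by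
    rw [← e2]; field_simp
  simp only [lengthFactor, e3, e4]
  simp only [darbouxStep]
  field_simp
  rw [hΔ]
  ring

/-- One step of the Darboux system on a coordinate plane, expressed through the rotation
coefficients `c = c_{kl}` and `c' = c_{lk}`. -/
theorem darbouxStep_plane {e e' c c' : ℝ} {o k l : A} {β : A → A → ℝ}
    (hk : 1 - e * β k k ≠ 0) (hl : 1 - e' * β l l ≠ 0)
    (hlk : 1 - e' * darbouxStep e k β l l ≠ 0)
    (ho : β o l ≠ 0) (ho' : β o k ≠ 0) (ha : 1 + e * c ≠ 0) (ha' : 1 + e' * c' ≠ 0)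
    (hkl' : β k l = c * β o l / ((1 + e' * c') * lengthFactor e o k β))
    (hlk' : β l k = c' * β o k / ((1 + e * c) * lengthFactor e' o l β)) :
    darbouxStep e k β o l = β o l * (1 + e * c / (1 + e' * c')) ∧
      lengthFactor e' o l (darbouxStep e k β) = (1 + e * c) * lengthFactor e' o l β := by
  have h1 : darbouxStep e k β o l = β o l * (1 + e * c / (1 + e' * c')) := by
    simp only [darbouxStep, hkl', lengthFactor]
    field_simp
  refine ⟨h1, ?_⟩
  -- For entries of the prescribed form the product β_kl β_lk is explicit, and the shifted
  -- denominator factors. Its nonvanishing then gives that of 1 + e'c' + ec.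
  have h2 : (1 - e' * darbouxStep e k β l l) * ((1 + e * c) * (1 + e' * c')) =
      (1 - e' * β l l) * ((1 + e' * c') + e * c) := by
    simp only [darbouxStep]
    rw [hkl', hlk', lengthFactor, lengthFactor]
    field_simp
    ring
  have h3 : (1 + e' * c') + e * c ≠ 0 := fun h => by
    rw [h, mul_zero] at h2
    exact mul_ne_zero hlk (mul_ne_zero ha ha') h2
  rw [lengthFactor, h1, lengthFactor]
  have h4 : (1 - e' * darbouxStep e k β l l) = (1 - e' * β l l) * ((1 + e' * c') + e * c) /
      ((1 + e * c) * (1 + e' * c')) := by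
    rw [← h2]; field_simp
  rw [h4]
  field_simp

/-- The rotation coefficient on a coordinate plane. -/
theorem rotation_plane {e e' c c' : ℝ} {o k l : A} {β : A → A → ℝ}
    (hk : 1 - e * β k k ≠ 0) (ho : β o l ≠ 0) (ho' : β o k ≠ 0) (ha' : 1 + e' * c' ≠ 0)
    (hkl' : β k l = c * β o l / ((1 + e' * c') * lengthFactor e o k β)) (hT :
      lengthFactor e o k (darbouxStep e' l β) = (1 + e' * c') * lengthFactor e o k β) :
    lengthFactor e o k (darbouxStep e' l β) * β k l / β o l = c := by
  have : lengthFactor e o k β ≠ 0 := mul_ne_zero ho' (inv_ne_zero hk)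
  rw [hT, hkl']
  field_simp

end DarbouxAlgebra

/-! ### Discrete conjugate nets from solutions of the discrete Darboux system. -/

section DarbouxNet

variable {m N : ℕ}

/-- The matrix index of a lattice direction. -/
def dir (m N : ℕ) : Fin (m + 1) → NetIdx m N :=
  Fin.snoc (α := fun _ => NetIdx m N) Sum.inl (Sum.inr none)

@[simp] theorem dir_castSucc (i : Fin m) : dir m N i.castSucc = Sum.inl i := by
  simp [dir]

@[simp] theorem dir_last : dir m N (Fin.last m) = Sum.inr none := by
  simp [dir]

theorem dir_injective : Function.Injective (dir m N) := by
  intro k l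
  refine Fin.lastCases ?_ (fun i => ?_) k <;> refine Fin.lastCases ?_ (fun j => ?_) l <;> simp

theorem dir_ne_some (k : Fin (m + 1)) (a : Option (Fin N)) : Sum.inr (some a) ≠ dir m N k := by
  refine Fin.lastCases ?_ (fun i => ?_) k <;> simp

@[simp] theorem mesh_castSucc (ε : ℝ) (i : Fin m) : mesh m ε i.castSucc = ε := by simp [mesh]

@[simp] theorem mesh_last (ε : ℝ) : mesh m ε (Fin.last m) = 1 := by simp [mesh]

theorem mesh_pos {ε : ℝ} (hε : 0 < ε) (k : Fin (m + 1)) : 0 < mesh m ε k := by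
  refine Fin.lastCases ?_ (fun i => ?_) k <;> simp [hε]

/-- The net of a family of matrices. -/
noncomputable def matrixNet (B : (Fin (m + 1) → ℕ) → NetIdx m N → NetIdx m N → ℝ)
    (n : Fin (m + 1) → ℕ) : EuclideanSpace ℝ (Fin N) :=
  WithLp.toLp 2 fun l => B n (.inr (some none)) (.inr (some (some l)))

/-- The rotation coefficients of the net of a solution of the Darboux system. -/
noncomputable def matrixRotation (ε : ℝ)
    (B : (Fin (m + 1) → ℕ) → NetIdx m N → NetIdx m N → ℝ) (k l : Fin (m + 1))
    (n : Fin (m + 1) → ℕ) : ℝ :=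
  lengthFactor (mesh m ε k) (.inr (some none)) (dir m N k) (B (n + Pi.single l 1)) *
    B n (dir m N k) (dir m N l) / B n (.inr (some none)) (dir m N l)

theorem latticeBox_lower {ε r : ℝ} (hε : 0 < ε) {n : Fin (m + 1) → ℕ} {k : Fin (m + 1)}
    (h : n + Pi.single k 1 ∈ latticeBox m ε r) : n ∈ latticeBox m ε r := by
  have h1 : ∀ l, n l ≤ (n + Pi.single k 1 : Fin (m + 1) → ℕ) l := fun l => by simp
  refine ⟨fun i => le_trans ?_ (h.1 i), (h1 _).trans h.2⟩
  have := h1 i.castSucc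
  gcongr

/-- The differences are δ_k x = p_k w_k with w_k the k-th row. A step along i multiplies p_j by 1 +
ε_i c_ij and adds to w_j a multiple of w_i, so the second difference lies in the span of the two
first differences. -/
theorem isDiscreteConjugateNetWith_matrixNet {ε r : ℝ} (hε : 0 < ε)
    {B : (Fin (m + 1) → ℕ) → NetIdx m N → NetIdx m N → ℝ}
    (hstep : ∀ k n, n + Pi.single k 1 ∈ latticeBox m ε r → ∀ a c, a ≠ dir m N k → c ≠ dir m N k →
      B (n + Pi.single k 1) a c = darbouxStep (mesh m ε k) (dir m N k) (B n) a c)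
    (hs : ∀ k n, n + Pi.single k 1 ∈ latticeBox m ε r →
      1 - mesh m ε k * B n (dir m N k) (dir m N k) ≠ 0)
    (hh : ∀ k n, n + Pi.single k 1 ∈ latticeBox m ε r → B n (.inr (some none)) (dir m N k) ≠ 0) :
    IsDiscreteConjugateNetWith ε r (matrixNet B) (matrixRotation ε B) := by
  intro i j hij n hn
  have hni : n + Pi.single i 1 ∈ latticeBox m ε r := latticeBox_lower hε hn
  have hn' : n + Pi.single j 1 + Pi.single i 1 ∈ latticeBox m ε r := by rwa [add_right_comm]
  have hnj : n + Pi.single j 1 ∈ latticeBox m ε r := latticeBox_lower hε hn'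
  have hd : dir m N i ≠ dir m N j := fun h => hij (dir_injective h)
  have hx : ∀ k n, n + Pi.single k 1 ∈ latticeBox m ε r → ∀ l,
      (pdiff (mesh m ε) k (matrixNet B) n) l =
        lengthFactor (mesh m ε k) (.inr (some none)) (dir m N k) (B n) *
          B n (dir m N k) (.inr (some (some l))) := by
    intro k n hk l
    simp only [pdiff, matrixNet, PiLp.smul_apply, PiLp.sub_apply, smul_eq_mul]
    rw [hstep k n hk _ _ (dir_ne_some _ _) (dir_ne_some _ _)]
    have := (mesh_pos hε k).ne'
    simp only [darbouxStep, lengthFactor]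
    field_simp
    ring
  ext l
  have h1 : (pdiff (mesh m ε) i (pdiff (mesh m ε) j (matrixNet B)) n) l =
      (mesh m ε i)⁻¹ * ((pdiff (mesh m ε) j (matrixNet B) (n + Pi.single i 1)) l -
        (pdiff (mesh m ε) j (matrixNet B) n) l) := by
    simp [pdiff]
  rw [h1, hx j _ hn, hx j _ hnj]
  simp only [PiLp.add_apply, PiLp.smul_apply, smul_eq_mul]
  rw [hx i _ hni, hx j _ hnj]
  have hEi : ∀ a c, a ≠ dir m N i → c ≠ dir m N i → B (n + Pi.single i 1) a c =
    darbouxStep (mesh m ε i) (dir m N i) (B n) a c := hstep i n hni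
  have hEj : ∀ a c, a ≠ dir m N j → c ≠ dir m N j → B (n + Pi.single j 1) a c =
    darbouxStep (mesh m ε j) (dir m N j) (B n) a c := hstep j n hnj
  have hp : lengthFactor (mesh m ε j) (.inr (some none)) (dir m N j) (B (n + Pi.single i 1)) =
      (1 + mesh m ε i * matrixRotation ε B i j n) *
        lengthFactor (mesh m ε j) (.inr (some none)) (dir m N j) (B n) := by
    have h2 := lengthFactor_darbouxStep (e := mesh m ε i) (e' := mesh m ε j)
      (o := .inr (some none)) (hs i n hni) (hs j n hnj)
      (by rw [← hEj _ _ hd hd]; exact hs i _ hn') (by rw [← hEi _ _ hd.symm hd.symm]; exact hs j _ hn)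
      (hh j n hnj)
    have h3 : lengthFactor (mesh m ε j) (.inr (some none)) (dir m N j) (B (n + Pi.single i 1)) =
        lengthFactor (mesh m ε j) (.inr (some none)) (dir m N j)
          (darbouxStep (mesh m ε i) (dir m N i) (B n)) := by
      rw [lengthFactor, lengthFactor, hEi _ _ (dir_ne_some _ _) hd.symm, hEi _ _ hd.symm hd.symm]
    have h4 : lengthFactor (mesh m ε i) (.inr (some none)) (dir m N i) (B (n + Pi.single j 1)) =
        lengthFactor (mesh m ε i) (.inr (some none)) (dir m N i)
          (darbouxStep (mesh m ε j) (dir m N j) (B n)) := by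
      rw [lengthFactor, lengthFactor, hEj _ _ (dir_ne_some _ _) hd, hEj _ _ hd hd]
    rw [h3, h2, matrixRotation, h4]
  -- Identifies the multiple of w_i that a step along i adds to p_j w_j as c_ji δ_i x.
  have hc : matrixRotation ε B j i n * lengthFactor (mesh m ε i) (.inr (some none)) (dir m N i) (B n) =
      lengthFactor (mesh m ε j) (.inr (some none)) (dir m N j) (B (n + Pi.single i 1)) *
        (1 - mesh m ε i * B n (dir m N i) (dir m N i))⁻¹ * B n (dir m N j) (dir m N i) := by
    have := hh i n hni
    rw [matrixRotation, lengthFactor, lengthFactor]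
    field_simp
  have hw : B (n + Pi.single i 1) (dir m N j) (.inr (some (some l))) =
      darbouxStep (mesh m ε i) (dir m N i) (B n) (dir m N j) (.inr (some (some l))) :=
    hEi _ _ hd.symm (dir_ne_some _ _)
  have h0 := (mesh_pos hε i).ne'
  rw [hw, darbouxStep, ← mul_assoc (matrixRotation ε B j i n), hc, hp]
  field_simp
  ring

end DarbouxNet

/-! ### Values of the discrete solution on the axes and coordinate planes. -/

section LevelMatrix

open LatticeFamily

variable {m N : ℕ}

/-- The first `m` coordinates of a lattice point. -/
def base (n : Fin (m + 1) → ℕ) : Fin m → ℕ := fun i => n i.castSucc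

@[simp] theorem base_add (n n' : Fin (m + 1) → ℕ) : base (n + n') = base n + base n' := rfl

@[simp] theorem base_single_castSucc (i : Fin m) (k : ℕ) :
    base (Pi.single i.castSucc k) = Pi.single i k := by
  funext j
  by_cases h : j = i
  · subst h; simp [base]
  · simp [base, h]

@[simp] theorem base_single_last (k : ℕ) : base (Pi.single (Fin.last m) k) = 0 := by
  funext j
  simp [base, Fin.castSucc_ne_last]

/-- The matrices on the two levels: the second level is obtained by a Darboux step. -/
noncomputable def levelMatrix (b : (Fin m → ℕ) → NetIdx m N → NetIdx m N → ℝ)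
    (n : Fin (m + 1) → ℕ) : NetIdx m N → NetIdx m N → ℝ :=
  if n (Fin.last m) = 0 then b (base n) else darbouxStep 1 (.inr none) (b (base n))

/-- A nondegenerate solution of the discrete Darboux system with the discrete data of `S`. -/
structure JonasData.DiscSolution (S : JonasData m N) (ε R : ℝ)
    (b : (Fin m → ℕ) → NetIdx m N → NetIdx m N → ℝ) : Prop where
  pos : 0 < ε
  step : ∀ (n : Fin m → ℕ) k, (∀ i, ε * ((n + Pi.single k 1 : Fin m → ℕ) i : ℝ) ≤ R) → ∀ a c,
    Sum.inl k ≠ a → Sum.inl k ≠ c → b (n + Pi.single k 1) a c = darbouxStep ε (.inl k) (b n) a c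
  data : ∀ a c (n : Fin m → ℕ), b (keep Sum.inl a c n) a c = S.disc a c ε n
  diag : ∀ n : Fin m → ℕ, (∀ i, ε * (n i : ℝ) ≤ R) → ∀ k, 1 - ε * b n (.inl k) (.inl k) ≠ 0
  lame : ∀ n : Fin m → ℕ, (∀ i, ε * (n i : ℝ) ≤ R) → ∀ k, b n (.inr (some none)) (.inl k) ≠ 0
  diagM : ∀ n : Fin m → ℕ, (∀ i, ε * (n i : ℝ) ≤ R) → 1 - 1 * b n (.inr none) (.inr none) ≠ 0
  lameM : ∀ n : Fin m → ℕ, (∀ i, ε * (n i : ℝ) ≤ R) → b n (.inr (some none)) (.inr none) ≠ 0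
  diag' : ∀ n : Fin m → ℕ, (∀ i, ε * (n i : ℝ) ≤ R) → ∀ k,
    1 - ε * darbouxStep 1 (.inr none) (b n) (.inl k) (.inl k) ≠ 0
  lame' : ∀ n : Fin m → ℕ, (∀ i, ε * (n i : ℝ) ≤ R) → ∀ k,
    darbouxStep 1 (.inr none) (b n) (.inr (some none)) (.inl k) ≠ 0
  stretch : ∀ n : Fin m → ℕ, (∀ i, ε * (n i : ℝ) ≤ R) → ∀ i j, i ≠ j → S.stretch i j ε n ≠ 0
  stretchM : ∀ n : Fin m → ℕ, (∀ i, ε * (n i : ℝ) ≤ R) → ∀ i, 1 + ε * S.CiM i (ε * n i) ≠ 0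
  factorM : ∀ t, 0 ≤ t → t ≤ R → ∀ i, 1 + S.CM i t ≠ 0
  quot : ∀ t, 0 ≤ t → t ≤ R → ∀ i, S.Q i t * (1 + S.CM i t) = S.CiM i t
  origin : ∀ i, S.X i 0 = S.P

namespace JonasData.DiscSolution

variable {S : JonasData m N} {ε R : ℝ} {b : (Fin m → ℕ) → NetIdx m N → NetIdx m N → ℝ}

theorem lower (h : S.DiscSolution ε R b) {n : Fin m → ℕ} {k : Fin m}
    (hn : ∀ i, ε * ((n + Pi.single k 1 : Fin m → ℕ) i : ℝ) ≤ R) :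
    ∀ i, ε * (n i : ℝ) ≤ R := fun i => by
  refine le_trans ?_ (hn i)
  have := h.pos
  have h1 : n i ≤ (n + Pi.single k 1 : Fin m → ℕ) i := by simp
  gcongr

theorem eq_data (h : S.DiscSolution ε R b) {a c : NetIdx m N} {n : Fin m → ℕ}
    (hn : ∀ k, Sum.inl k ≠ a → Sum.inl k ≠ c → n k = 0) : b n a c = S.disc a c ε n := by
  rw [← h.data]
  congr 1
  funext k
  by_cases hk : Sum.inl k = a ∨ Sum.inl k = c
  · simp [keep, hk]
  · have := hk
    push Not at this
    simp [keep, hk, hn k this.1 this.2]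

theorem plane_entry (h : S.DiscSolution ε R b) {i j : Fin m} (hij : i ≠ j) {n : Fin m → ℕ}
    (hn : ∀ k, k ≠ i → k ≠ j → n k = 0)
    (hp : lengthFactor ε (.inr (some none)) (.inl i) (b n) = S.planeP i j ε n)
    (hh : b n (.inr (some none)) (.inl j) = S.planeH j i ε n) :
    b n (.inl i) (.inl j) = S.C i j (ε * n i, ε * n j) * b n (.inr (some none)) (.inl j) /
      ((1 + ε * S.C j i (ε * n j, ε * n i)) *
        lengthFactor ε (.inr (some none)) (.inl i) (b n)) := by
  rw [h.eq_data (fun k h1 h2 => hn k (fun e => h1 (by rw [e])) (fun e => h2 (by rw [e]))), hp, hh]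
  simp only [JonasData.disc, if_neg hij, JonasData.stretch]
  rw [div_eq_mul_inv, mul_inv]

theorem plane_step (h : S.DiscSolution ε R b) {i j : Fin m} (hij : i ≠ j) {n : Fin m → ℕ}
    (hn : ∀ k, k ≠ i → k ≠ j → n k = 0)
    (hR : ∀ l, ε * ((n + Pi.single i 1 : Fin m → ℕ) l : ℝ) ≤ R)
    (hpi : lengthFactor ε (.inr (some none)) (.inl i) (b n) = S.planeP i j ε n)
    (hhi : b n (.inr (some none)) (.inl i) = S.planeH i j ε n)
    (hpj : lengthFactor ε (.inr (some none)) (.inl j) (b n) = S.planeP j i ε n)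
    (hhj : b n (.inr (some none)) (.inl j) = S.planeH j i ε n) :
    b (n + Pi.single i 1) (.inr (some none)) (.inl j) = S.planeH j i ε (n + Pi.single i 1) ∧
      lengthFactor ε (.inr (some none)) (.inl j) (b (n + Pi.single i 1)) =
        S.planeP j i ε (n + Pi.single i 1) := by
  have hR' := h.lower hR
  have hd : (Sum.inl i : NetIdx m N) ≠ .inl j := fun e => hij (Sum.inl_injective e)
  have hst := h.step n i hR
  obtain ⟨e1, e2⟩ := darbouxStep_plane (e := ε) (e' := ε) (h.diag n hR' i) (h.diag n hR' j)
    (by rw [← hst _ _ hd hd]; exact h.diag _ hR j) (h.lame n hR' j) (h.lame n hR' i)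
    (h.stretch n hR' i j hij) (h.stretch n hR' j i hij.symm)
    (h.plane_entry hij hn hpi hhj)
    (h.plane_entry hij.symm (fun k h1 h2 => hn k h2 h1) hpj hhi)
  constructor
  · rw [hst _ _ (by simp) hd, e1, hhj, JonasData.planeH, prodFam_add_single]
    simp only [JonasData.stretch]
    ring
  · have : lengthFactor ε (.inr (some none)) (.inl j) (b (n + Pi.single i 1)) =
        lengthFactor ε (.inr (some none)) (.inl j) (darbouxStep ε (.inl i) (b n)) := by
      rw [lengthFactor, lengthFactor, hst _ _ (by simp) hd, hst _ _ hd hd]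
    rw [this, e2, hpj, JonasData.planeP, prodFam_add_single]

/-- On its own axis the direction i is normalised by h_i = 1 and β_ii = 0, so its length factor is
1. -/
theorem axis_entries (h : S.DiscSolution ε R b) {i : Fin m} {n : Fin m → ℕ}
    (hn : ∀ k, k ≠ i → n k = 0) : b n (.inr (some none)) (.inl i) = 1 ∧
      lengthFactor ε (.inr (some none)) (.inl i) (b n) = 1 := by
  have h1 : b n (.inr (some none)) (.inl i) = 1 := by
    rw [h.eq_data fun k _ h2 => hn k fun e => h2 (by rw [e])]; simp [JonasData.disc]
  have h2 : b n (.inl i) (.inl i) = 0 := by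
    rw [h.eq_data fun k _ h2 => hn k fun e => h2 (by rw [e])]; simp [JonasData.disc]
  simp [lengthFactor, h1, h2]

/-- A step of h_j and p_j along i involves both β_ij and β_ji, and these contain the Lamé and length
factors of both directions. So both ordered pairs are treated together, by induction on n_i + n_j.
-/
theorem plane_values (h : S.DiscSolution ε R b) (s : ℕ) : ∀ {i j : Fin m}, i ≠ j →
    ∀ {n : Fin m → ℕ}, (∀ k, k ≠ i → k ≠ j → n k = 0) → n i + n j = s →
    (∀ l, ε * (n l : ℝ) ≤ R) →
    b n (.inr (some none)) (.inl j) = S.planeH j i ε n ∧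
      lengthFactor ε (.inr (some none)) (.inl j) (b n) = S.planeP j i ε n := by
  induction s with
  | zero =>
    intro i j hij n hn hs hR
    have := h.axis_entries (i := j) (n := n) fun k hk => by
      by_cases hki : k = i
      · subst hki; omega
      · exact hn k hki hk
    rw [this.1, this.2, JonasData.planeH, JonasData.planeP, prodFam_of_eq_zero _ _ (by omega),
      prodFam_of_eq_zero _ _ (by omega)]
    exact ⟨rfl, rfl⟩
  | succ s ih =>
    intro i j hij n hn hs hR
    by_cases hi : n i = 0
    · have := h.axis_entries (i := j) (n := n) fun k hk => by
        by_cases hki : k = i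
        · subst hki; omega
        · exact hn k hki hk
      rw [this.1, this.2, JonasData.planeH, JonasData.planeP, prodFam_of_eq_zero _ _ hi,
        prodFam_of_eq_zero _ _ hi]
      exact ⟨rfl, rfl⟩
    · obtain ⟨n', rfl⟩ := exists_eq_add_single hi
      have hn' : ∀ k, k ≠ i → k ≠ j → n' k = 0 := fun k h1 h2 => by
        have := hn k h1 h2
        simp only [Pi.add_apply] at this
        omega
      have hs' : n' i + n' j = s := by
        simp only [Pi.add_apply, Pi.single_eq_same, Pi.single_eq_of_ne hij.symm] at hs
        omega
      have h1 := ih hij hn' hs' (h.lower hR)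
      have h2 := ih hij.symm (fun k h1 h2 => hn' k h2 h1) (by omega) (h.lower hR)
      exact h.plane_step hij hn' hR h2.2 h2.1 h1.2 h1.1

/-- Brings the data on the i-th axis into the form required by `darbouxStep_plane` for the pair (i,
M); the relation Q (1 + C_{Mi}) = C_{iM} restores the stretching factor. -/
theorem axis_step (h : S.DiscSolution ε R b) {i : Fin m} {n : Fin m → ℕ}
    (hn : ∀ k, k ≠ i → n k = 0) (hR : ∀ l, ε * (n l : ℝ) ≤ R)
    (hp : lengthFactor 1 (.inr (some none)) (.inr none) (b n) = S.axisP i ε n)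
    (hh : b n (.inr (some none)) (.inr none) = S.axisH i ε n) :
    b n (.inl i) (.inr none) = S.CiM i (ε * n i) * b n (.inr (some none)) (.inr none) /
      ((1 + 1 * S.CM i (ε * n i)) * lengthFactor ε (.inr (some none)) (.inl i) (b n)) ∧
    b n (.inr none) (.inl i) = S.CM i (ε * n i) * b n (.inr (some none)) (.inl i) /
      ((1 + ε * S.CiM i (ε * n i)) * lengthFactor 1 (.inr (some none)) (.inr none) (b n)) := by
  have h0 : 0 ≤ ε * (n i : ℝ) := mul_nonneg h.pos.le (Nat.cast_nonneg _)
  have h1 := h.factorM _ h0 (hR i) i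
  have h2 := h.quot _ h0 (hR i) i
  have h3 := h.axis_entries hn
  constructor
  · rw [h.eq_data fun k h2 _ => hn k fun e => h2 (by rw [e]), hh, h3.2, ← h2]
    simp only [JonasData.disc, one_mul, mul_one]
    field_simp
  · rw [h.eq_data fun k _ h2 => hn k fun e => h2 (by rw [e]), hp, h3.1]
    simp only [JonasData.disc, mul_one]
    rw [div_eq_mul_inv, mul_inv]

theorem axis_values (h : S.DiscSolution ε R b) (i : Fin m) (s : ℕ) :
    ∀ {n : Fin m → ℕ}, (∀ k, k ≠ i → n k = 0) → n i = s → (∀ l, ε * (n l : ℝ) ≤ R) →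
    b n (.inr (some none)) (.inr none) = S.axisH i ε n ∧
      lengthFactor 1 (.inr (some none)) (.inr none) (b n) = S.axisP i ε n := by
  induction s with
  | zero =>
    intro n hn hs _
    have hn' : ∀ k, n k = 0 := fun k => by
      by_cases hk : k = i
      · rw [hk, hs]
      · exact hn k hk
    have h1 : b n (.inr (some none)) (.inr none) = 1 := by
      rw [h.eq_data fun k _ _ => hn' k]; simp [JonasData.disc]
    have h2 : b n (.inr none) (.inr none) = 0 := by
      rw [h.eq_data fun k _ _ => hn' k]; simp [JonasData.disc]
    rw [JonasData.axisH, JonasData.axisP, prodFam_of_eq_zero _ _ hs, prodFam_of_eq_zero _ _ hs]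
    simp [lengthFactor, h1, h2]
  | succ s ih =>
    intro n hn hs hR
    obtain ⟨n', rfl⟩ := exists_eq_add_single (n := n) (i := i) (by omega)
    have hn' : ∀ k, k ≠ i → n' k = 0 := fun k h1 => by
      have := hn k h1
      simp only [Pi.add_apply] at this
      omega
    have hs' : n' i = s := by
      simp only [Pi.add_apply, Pi.single_eq_same] at hs
      omega
    have hR' := h.lower hR
    obtain ⟨i1, i2⟩ := ih hn' hs' hR'
    obtain ⟨d1, d2⟩ := h.axis_step hn' hR' i2 i1
    have h0 : 0 ≤ ε * (n' i : ℝ) := mul_nonneg h.pos.le (Nat.cast_nonneg _)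
    have hF := h.factorM _ h0 (hR' i) i
    have hst := h.step n' i hR
    obtain ⟨e1, e2⟩ := darbouxStep_plane (e := ε) (e' := 1) (h.diag n' hR' i) (h.diagM n' hR')
      (by rw [← hst _ _ (by simp) (by simp)]; exact h.diagM _ hR) (h.lameM n' hR')
      (h.lame n' hR' i) (h.stretchM n' hR' i) (by simpa using hF) d1 d2
    constructor
    · rw [hst _ _ (by simp) (by simp), e1, i1, JonasData.axisH, prodFam_add_single,
        ← h.quot _ h0 (hR' i) i]
      field_simp
    · have : lengthFactor 1 (.inr (some none)) (.inr none) (b (n' + Pi.single i 1)) =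
          lengthFactor 1 (.inr (some none)) (.inr none) (darbouxStep ε (.inl i) (b n')) := by
        rw [lengthFactor, lengthFactor, hst _ _ (by simp) (by simp), hst _ _ (by simp) (by simp)]
      rw [this, e2, i2, JonasData.axisP, prodFam_add_single]

/-- On the axis p_i = 1 and w_i is the difference quotient of the curve, so each step adds exactly
the increment of the curve. -/
theorem curve_values (h : S.DiscSolution ε R b) (i : Fin m) (s : ℕ) :
    ∀ {n : Fin m → ℕ}, (∀ k, k ≠ i → n k = 0) → n i = s → (∀ l, ε * (n l : ℝ) ≤ R) → ∀ l,
    b n (.inr (some none)) (.inr (some (some l))) = S.X i (ε * n i) l := by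
  induction s with
  | zero =>
    intro n hn hs _ l
    have hn' : ∀ k, n k = 0 := fun k => by
      by_cases hk : k = i
      · rw [hk, hs]
      · exact hn k hk
    rw [h.eq_data fun k _ _ => hn' k, hs]
    simp [JonasData.disc, h.origin]
  | succ s ih =>
    intro n hn hs hR l
    obtain ⟨n', rfl⟩ := exists_eq_add_single (n := n) (i := i) (by omega)
    have hn' : ∀ k, k ≠ i → n' k = 0 := fun k h1 => by
      have := hn k h1
      simp only [Pi.add_apply] at this
      omega
    have hs' : n' i = s := by
      simp only [Pi.add_apply, Pi.single_eq_same] at hs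
      omega
    have hR' := h.lower hR
    have h3 := h.axis_entries hn'
    have h4 : b n' (.inl i) (.inr (some (some l))) =
        (S.X i (ε * n' i + ε) l - S.X i (ε * n' i) l) / ε := by
      rw [h.eq_data fun k h2 _ => hn' k fun e => h2 (by rw [e])]; rfl
    rw [h.step n' i hR _ _ (by simp) (by simp), darbouxStep, ih hn' hs' hR' l, h4]
    have h5 : ε * (1 - ε * b n' (.inl i) (.inl i))⁻¹ * b n' (.inr (some none)) (.inl i) = ε := by
      have := h3.2
      rw [lengthFactor] at this
      rw [mul_assoc, mul_comm (_⁻¹), this, mul_one]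
    have := h.pos.ne'
    rw [h5, mul_div_cancel₀ _ this]
    simp [mul_add]

end JonasData.DiscSolution

end LevelMatrix

/-! ### The two-level net solves the discrete problem. -/

section LevelMatrix

open LatticeFamily

variable {m N : ℕ}

theorem levelMatrix_zero (b : (Fin m → ℕ) → NetIdx m N → NetIdx m N → ℝ)
    {n : Fin (m + 1) → ℕ} (hn : n (Fin.last m) = 0) : levelMatrix b n = b (base n) := if_pos hn

theorem levelMatrix_one (b : (Fin m → ℕ) → NetIdx m N → NetIdx m N → ℝ)
    {n : Fin (m + 1) → ℕ} (hn : n (Fin.last m) ≠ 0) :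
    levelMatrix b n = darbouxStep 1 (.inr none) (b (base n)) := if_neg hn

theorem base_mem {ε r R : ℝ} (hr : r ≤ R) {n : Fin (m + 1) → ℕ} (hn : n ∈ latticeBox m ε r) :
    ∀ i, ε * (base n i : ℝ) ≤ R := fun i => (hn.1 i).trans hr

namespace JonasData.DiscSolution

variable {S : JonasData m N} {ε R : ℝ} {b : (Fin m → ℕ) → NetIdx m N → NetIdx m N → ℝ}

/-- The step between the levels holds by construction. Steps within the upper level follow from the
lower one because a step along i commutes with the step along M. -/
theorem levelMatrix_step (h : S.DiscSolution ε R b) {r : ℝ} (hr : r ≤ R) (k : Fin (m + 1))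
    {n : Fin (m + 1) → ℕ} (hn : n + Pi.single k 1 ∈ latticeBox m ε r) (a c : NetIdx m N)
    (ha : a ≠ dir m N k) (hc : c ≠ dir m N k) : levelMatrix b (n + Pi.single k 1) a c =
      darbouxStep (mesh m ε k) (dir m N k) (levelMatrix b n) a c := by
  have hR := base_mem hr hn
  induction k using Fin.lastCases with
  | last =>
    have h0 : n (Fin.last m) = 0 := by
      have := hn.2
      simp only [Pi.add_apply, Pi.single_eq_same] at this
      omega
    rw [levelMatrix_one b (by simp), levelMatrix_zero b h0]
    simp
  | cast i =>
    simp only [base_add, base_single_castSucc, dir_castSucc, mesh_castSucc] at *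
    by_cases h0 : n (Fin.last m) = 0
    · rw [levelMatrix_zero b (by simp [h0]), levelMatrix_zero b h0]
      simp only [base_add, base_single_castSucc]
      exact h.step _ i hR a c ha.symm hc.symm
    · rw [levelMatrix_one b (by simp [h0]), levelMatrix_one b h0]
      have hR' := h.lower hR
      have hst := h.step (base n) i hR
      rw [← darbouxStep_comm ε 1 (Sum.inl i) (Sum.inr none) (b (base n))
        (h.diag _ hR' i) (h.diagM _ hR') (h.diag' _ hR' i)
        (by rw [← hst _ _ (by simp) (by simp)]; exact h.diagM _ hR)]
      simp only [base_add, base_single_castSucc]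
      rw [darbouxStep, darbouxStep, hst a c ha.symm hc.symm, hst a _ ha.symm (by simp),
        hst _ c (by simp) hc.symm, hst _ _ (by simp) (by simp)]

theorem levelMatrix_diag (h : S.DiscSolution ε R b) {r : ℝ} (hr : r ≤ R) (k : Fin (m + 1))
    {n : Fin (m + 1) → ℕ} (hn : n + Pi.single k 1 ∈ latticeBox m ε r) :
    1 - mesh m ε k * levelMatrix b n (dir m N k) (dir m N k) ≠ 0 := by
  have hR := base_mem hr (latticeBox_lower h.pos hn)
  induction k using Fin.lastCases with
  | last =>
    have h0 : n (Fin.last m) = 0 := by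
      have := hn.2
      simp only [Pi.add_apply, Pi.single_eq_same] at this
      omega
    rw [levelMatrix_zero b h0, dir_last, mesh_last]
    exact h.diagM _ hR
  | cast i =>
    rw [dir_castSucc, mesh_castSucc]
    by_cases h0 : n (Fin.last m) = 0
    · rw [levelMatrix_zero b h0]; exact h.diag _ hR i
    · rw [levelMatrix_one b h0]; exact h.diag' _ hR i

theorem levelMatrix_lame (h : S.DiscSolution ε R b) {r : ℝ} (hr : r ≤ R) (k : Fin (m + 1))
    {n : Fin (m + 1) → ℕ} (hn : n + Pi.single k 1 ∈ latticeBox m ε r) :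
    levelMatrix b n (.inr (some none)) (dir m N k) ≠ 0 := by
  have hR := base_mem hr (latticeBox_lower h.pos hn)
  induction k using Fin.lastCases with
  | last =>
    have h0 : n (Fin.last m) = 0 := by
      have := hn.2
      simp only [Pi.add_apply, Pi.single_eq_same] at this
      omega
    rw [levelMatrix_zero b h0, dir_last]
    exact h.lameM _ hR
  | cast i =>
    rw [dir_castSucc]
    by_cases h0 : n (Fin.last m) = 0
    · rw [levelMatrix_zero b h0]; exact h.lame _ hR i
    · rw [levelMatrix_one b h0]; exact h.lame' _ hR i

theorem rotation_on_plane (h : S.DiscSolution ε R b) {i j : Fin m} (hij : i ≠ j)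
    {n : Fin (m + 1) → ℕ} (h0 : n (Fin.last m) = 0) (hn : ∀ k, k ≠ i → k ≠ j → base n k = 0)
    (hR : ∀ l, ε * ((base n + Pi.single j 1 : Fin m → ℕ) l : ℝ) ≤ R) :
    matrixRotation ε (levelMatrix b) i.castSucc j.castSucc n =
      S.C i j (ε * base n i, ε * base n j) := by
  have hR' := h.lower hR
  have hd : (Sum.inl i : NetIdx m N) ≠ .inl j := fun e => hij (Sum.inl_injective e)
  rw [matrixRotation, levelMatrix_zero b h0, levelMatrix_zero b (by simp [h0])]
  simp only [base_add, base_single_castSucc, dir_castSucc, mesh_castSucc]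
  have hn' : ∀ k, k ≠ j → k ≠ i → base n k = 0 := fun k h1 h2 => hn k h2 h1
  have e1 := h.plane_values _ hij hn rfl hR'
  have e2 := h.plane_values _ hij.symm hn' rfl hR'
  have e3 := h.plane_step hij.symm hn' hR e1.2 e1.1 e2.2 e2.1
  have hst := h.step (base n) j hR
  have e4 : lengthFactor ε (.inr (some none)) (.inl i) (b (base n + Pi.single j 1)) =
      lengthFactor ε (.inr (some none)) (.inl i) (darbouxStep ε (.inl j) (b (base n))) := by
    rw [lengthFactor, lengthFactor, hst _ _ (by simp) hd.symm, hst _ _ hd.symm hd.symm]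
  rw [e4]
  refine rotation_plane (h.diag _ hR' i) (h.lame _ hR' j) (h.lame _ hR' i)
    (h.stretch _ hR' j i hij.symm) (h.plane_entry hij hn e2.2 e1.1) ?_
  rw [← e4, e3.2, e2.2, JonasData.planeP, prodFam_add_single]

theorem rotation_on_axis (h : S.DiscSolution ε R b) {i : Fin m}
    {n : Fin (m + 1) → ℕ} (h0 : n (Fin.last m) = 0) (hn : ∀ k, k ≠ i → base n k = 0)
    (hR : ∀ l, ε * ((base n + Pi.single i 1 : Fin m → ℕ) l : ℝ) ≤ R) :
    matrixRotation ε (levelMatrix b) (Fin.last m) i.castSucc n = S.CM i (ε * base n i) ∧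
      matrixRotation ε (levelMatrix b) i.castSucc (Fin.last m) n = S.CiM i (ε * base n i) := by
  have hR' := h.lower hR
  have hpos : 0 ≤ ε * (base n i : ℝ) := mul_nonneg h.pos.le (Nat.cast_nonneg _)
  have hF := h.factorM _ hpos (hR' i) i
  have e1 := h.axis_values i _ hn rfl hR'
  have hn' : ∀ k, k ≠ i → (base n + Pi.single i 1 : Fin m → ℕ) k = 0 := fun k hk => by
    simp [hn k hk, hk]
  have e2 := h.axis_values i _ hn' rfl hR
  have e3 := h.axis_entries hn
  obtain ⟨d1, d2⟩ := h.axis_step hn hR' e1.2 e1.1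
  have hst := h.step (base n) i hR
  constructor
  · rw [matrixRotation, levelMatrix_zero b h0, levelMatrix_zero b (by simp [h0])]
    simp only [base_add, base_single_castSucc, dir_castSucc, mesh_last, dir_last]
    have e4 : lengthFactor 1 (.inr (some none)) (.inr none) (b (base n + Pi.single i 1)) =
        lengthFactor 1 (.inr (some none)) (.inr none) (darbouxStep ε (.inl i) (b (base n))) := by
      rw [lengthFactor, lengthFactor, hst _ _ (by simp) (by simp), hst _ _ (by simp) (by simp)]
    rw [e4]
    refine rotation_plane (h.diagM _ hR') (h.lame _ hR' i) (h.lameM _ hR')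
      (h.stretchM _ hR' i) d2 ?_
    rw [← e4, e2.2, e1.2, JonasData.axisP, prodFam_add_single]
  · rw [matrixRotation, levelMatrix_zero b h0, levelMatrix_one b (by simp)]
    simp only [base_add, base_single_last, add_zero, dir_castSucc, mesh_castSucc, dir_last]
    refine rotation_plane (h.diag _ hR' i) (h.lameM _ hR') (h.lame _ hR' i)
      (by simpa using hF) d1 ?_
    -- The plane identity with the roles of i and M exchanged: now the step goes up to the second
    -- level.
    exact (darbouxStep_plane (h.diagM _ hR') (h.diag _ hR' i) (h.diag' _ hR' i) (h.lame _ hR' i)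
      (h.lameM _ hR') (by simpa using hF) (h.stretchM _ hR' i) d2 d1).2

/-- A rotation coefficient at a point contains a value one lattice step further, so coefficients on
all of [0, r] need the solution up to r + ε. -/
theorem solvesDiscreteProblem (h : S.DiscSolution ε R b) {r : ℝ} (hr0 : 0 ≤ r) (hr : r + ε ≤ R) :
    SolvesDiscreteProblem ε r S.X S.C (S.P + S.V) S.CM S.CiM (matrixNet (levelMatrix b)) := by
  have hε := h.pos
  have hrR : r ≤ R := by linarith
  have hsingle : ∀ (i : Fin m) (k : ℕ), ε * (k : ℝ) ≤ r → ∀ l,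
      ε * ((Pi.single i k : Fin m → ℕ) l : ℝ) ≤ r := by
    intro i k hk l
    by_cases hl : l = i
    · subst hl; simpa using hk
    · simpa [hl] using hr0
  have hadd : ∀ (n : Fin m → ℕ) (i : Fin m), (∀ l, ε * (n l : ℝ) ≤ r) →
      ∀ l, ε * ((n + Pi.single i 1 : Fin m → ℕ) l : ℝ) ≤ R := by
    intro n i hn l
    have := hn l
    by_cases hl : l = i
    · subst hl; simp [mul_add]; linarith
    · simp [hl]; linarith
  refine ⟨matrixRotation ε (levelMatrix b),
    isDiscreteConjugateNetWith_matrixNet hε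
      (fun k n hn a c ha hc => h.levelMatrix_step hrR k hn a c ha hc)
      (fun k n hn => h.levelMatrix_diag hrR k hn) (fun k n hn => h.levelMatrix_lame hrR k hn),
    ?_, ?_, ?_, ?_⟩
  · intro i k hk
    ext l
    rw [matrixNet, levelMatrix_zero b (by simp)]
    have := h.curve_values i k (n := Pi.single i k) (fun j hj => by simp [hj]) (by simp)
      (fun l => (hsingle i k hk l).trans hrR) l
    simpa using this
  · intro i j hij k l hk hl
    have hb : base (Pi.single i.castSucc k + Pi.single j.castSucc l : Fin (m + 1) → ℕ) =
        Pi.single i k + Pi.single j l := by simp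
    have := h.rotation_on_plane hij (n := Pi.single i.castSucc k + Pi.single j.castSucc l)
      (by simp) (by rw [hb]; intro q h1 h2; simp [h1, h2]) (by
        rw [hb]
        refine hadd _ j fun q => ?_
        by_cases hq : q = i
        · subst hq; simpa [hij] using hk
        · have := hsingle j l hl q
          simpa [hq] using this)
    rw [this, hb]
    simp [hij, hij.symm]
  · have h0 : ∀ c, b 0 (.inr none) c = S.disc (.inr none) c ε 0 :=
      fun c => h.eq_data fun _ _ _ => rfl
    have h1 : ∀ c, b 0 (.inr (some none)) c = S.disc (.inr (some none)) c ε 0 :=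
      fun c => h.eq_data fun _ _ _ => rfl
    ext l
    rw [matrixNet, levelMatrix_one b (by simp)]
    simp [darbouxStep, h0, h1, JonasData.disc]
  · intro i k hk
    have := h.rotation_on_axis (i := i) (n := Pi.single i.castSucc k) (by simp)
      (fun j hj => by simp [hj]) (by simpa using hadd _ i (hsingle i k hk))
    simpa using this

end JonasData.DiscSolution

end LevelMatrix

/-! ### From bounded difference quotients to O(ε)-convergence of nets. -/

namespace LatticeFamily

variable {m N : ℕ}

theorem DiffBdd.iterate {D : Set (ℝ × (Fin m → ℕ))} {u : LatticeFamily m} (i : Fin m) (l k : ℕ)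
    (h : DiffBdd (l + k) D u) : DiffBdd l ((pre i)^[k] D) ((dq i)^[k] u) := by
  induction k generalizing l with
  | zero => exact h
  | succ k ih =>
    rw [Function.iterate_succ_apply', Function.iterate_succ_apply']
    have := ih (l + 1) (by convert h using 1; ring)
    exact this.2 i

theorem DiffBdd.foldr {D : Set (ℝ × (Fin m → ℕ))} {u : LatticeFamily m} (α : Fin m → ℕ)
    (L : List (Fin m)) : ∀ l, DiffBdd (l + (L.map α).sum) D u →
      DiffBdd l (L.foldr (fun i T => (pre i)^[α i] T) D)
        (L.foldr (fun i v => (dq i)^[α i] v) u) := by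
  induction L with
  | nil => intro l h; simpa using h
  | cons i L ih =>
    intro l h
    simp only [List.foldr_cons]
    refine DiffBdd.iterate i l (α i) (ih _ ?_)
    rw [List.map_cons, List.sum_cons] at h
    rwa [add_assoc]

/-- Each difference uses one lattice step; allowing |α| steps in every coordinate matches the domain
B₀^ε(r - ε|α|). -/
theorem mem_foldr_pre {R ε₁ : ℝ} (α : Fin m → ℕ) (L : List (Fin m)) :
    {p : ℝ × (Fin m → ℕ) | 0 < p.1 ∧ p.1 < ε₁ ∧
      ∀ j, p.1 * ((p.2 j : ℝ) + (L.map α).sum) ≤ R} ⊆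
      L.foldr (fun i T => (pre i)^[α i] T) (Box m R ε₁) := by
  have key : ∀ (i : Fin m) (k s : ℕ) (T : Set (ℝ × (Fin m → ℕ))),
      {p : ℝ × (Fin m → ℕ) | 0 < p.1 ∧ p.1 < ε₁ ∧ ∀ j, p.1 * ((p.2 j : ℝ) + s) ≤ R} ⊆ T →
      {p : ℝ × (Fin m → ℕ) | 0 < p.1 ∧ p.1 < ε₁ ∧
        ∀ j, p.1 * ((p.2 j : ℝ) + (k + s : ℕ)) ≤ R} ⊆ (pre i)^[k] T := by
    intro i k
    induction k with
    | zero => intro s T h; simpa using h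
    | succ k ih =>
      intro s T h p hp
      rw [Function.iterate_succ_apply']
      refine ih s T h ⟨hp.1, hp.2.1, fun j => le_trans ?_ (hp.2.2 j)⟩
      have h1 : ((p.2 + Pi.single i 1 : Fin m → ℕ) j) + (k + s) ≤ p.2 j + (k + 1 + s) := by
        by_cases hj : j = i
        · subst hj; simp; omega
        · simp [hj]
      have h0 : 0 < p.1 := hp.1
      refine mul_le_mul_of_nonneg_left ?_ h0.le
      exact_mod_cast h1
  induction L with
  | nil => intro p hp; exact ⟨hp.1, hp.2.1, by simpa using hp.2.2⟩
  | cons i L ih =>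
    simp only [List.foldr_cons, List.map_cons, List.sum_cons]
    exact key i (α i) _ _ ih

theorem foldr_pdiff_apply {ε : ℝ} (α : Fin m → ℕ) {W : (Fin m → ℕ) → EuclideanSpace ℝ (Fin N)}
    {E : LatticeFamily m} {c : Fin N} (h : ∀ n, W n c = ε * E ε n) (L : List (Fin m)) :
    ∀ n, (L.foldr (fun i v => (pdiff (fun _ => ε) i)^[α i] v) W) n c =
      ε * (L.foldr (fun i v => (dq i)^[α i] v) E) ε n := by
  have key : ∀ (i : Fin m) (k : ℕ) (W : (Fin m → ℕ) → EuclideanSpace ℝ (Fin N))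
      (E : LatticeFamily m), (∀ n, W n c = ε * E ε n) →
      ∀ n, ((pdiff (fun _ => ε) i)^[k] W) n c = ε * ((dq i)^[k] E) ε n := by
    intro i k
    induction k with
    | zero => intro W E h; exact h
    | succ k ih =>
      intro W E h n
      rw [Function.iterate_succ_apply', Function.iterate_succ_apply', pdiff, PiLp.smul_apply,
        PiLp.sub_apply, ih W E h, ih W E h, dq, smul_eq_mul]
      ring
  induction L with
  | nil => exact h
  | cons i L ih => exact key i (α i) _ _ ih

theorem norm_le_sum_abs (x : EuclideanSpace ℝ (Fin N)) : ‖x‖ ≤ ∑ c, |x c| := by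
  have h : x = ∑ c, EuclideanSpace.single c (x c) := by
    ext c
    simp [Finset.sum_apply]
  calc ‖x‖ = ‖∑ c, EuclideanSpace.single c (x c)‖ := by rw [← h]
    _ ≤ _ := (norm_sum_le _ _).trans (le_of_eq (by simp))

/-- For fixed ℓ only finitely many multi-indices occur, so their constants can be added; vectors are
estimated coordinatewise. -/
theorem oConverges_of_convOn {R r ε₁ : ℝ} (hr : r ≤ R)
    {u : ℝ → (Fin m → ℕ) → EuclideanSpace ℝ (Fin N)} {v : (Fin m → ℝ) → EuclideanSpace ℝ (Fin N)}
    (h : ∀ c, ConvOn (Box m R ε₁) (fun ε n => u ε n c) (fun t => v t c)) :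
    OConverges r ε₁ u v := by
  intro l
  choose K hK using fun (α : Fin m → ℕ) (c : Fin N) =>
    (DiffBdd.foldr α (List.finRange m) 0 ((h c).err _)).bdd
  refine ⟨∑ α ∈ Finset.Iic (fun _ : Fin m => l), ∑ c, |K α c|, fun ε hε hε₁ _ => ?_⟩
  refine iSup₂_le fun α hα => iSup₂_le fun n hn => ?_
  rw [← ofReal_norm]
  refine ENNReal.ofReal_le_ofReal ((norm_le_sum_abs _).trans ?_)
  have hmem : (ε, n) ∈ (List.finRange m).foldr (fun i T => (pre i)^[α i] T) (Box m R ε₁) := by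
    refine mem_foldr_pre α _ ⟨hε, hε₁, fun j => ?_⟩
    have := hn j
    have e : ((List.finRange m).map α).sum = ∑ i, α i := by
      exact (Fin.sum_univ_def α).symm
    rw [e]
    simp only
    linarith
  have hα' : α ∈ Finset.Iic (fun _ : Fin m => l) := by
    rw [Finset.mem_Iic]
    exact fun i => (Finset.single_le_sum (f := α) (fun _ _ => Nat.zero_le _)
      (Finset.mem_univ i)).trans hα
  have h1 : ∀ c, |(multiDiff (fun _ => ε) α (fun n => u ε n - v (fun i => ε * n i)) n) c| ≤
      ε * |K α c| := by
    intro c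
    have h2 := foldr_pdiff_apply (ε := ε) α (W := fun n => u ε n - v (fun i => ε * n i))
      (E := fun ε n => (u ε n c - v (pt ε n) c) / ε) (c := c) (fun n => by
        rw [PiLp.sub_apply, mul_div_cancel₀ _ hε.ne']; rfl) (List.finRange m) n
    rw [multiDiff, h2, abs_mul, abs_of_pos hε]
    exact mul_le_mul_of_nonneg_left ((hK α c (ε, n) hmem).trans (le_abs_self _)) hε.le
  calc _ ≤ ∑ c, ε * |K α c| := Finset.sum_le_sum fun c _ => h1 c
    _ = (∑ c, |K α c|) * ε := by rw [← Finset.mul_sum, mul_comm]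
    _ ≤ _ := mul_le_mul_of_nonneg_right (Finset.single_le_sum (f := fun α => ∑ c, |K α c|)
        (fun _ _ => by positivity) hα') hε.le

/-- Shrinking the cube keeps the limit near its value at 0, and shrinking the mesh keeps the lattice
functions near the limit; one parameter δ controls both. -/
theorem ConvOn.eventually_ne_zero {R ε₁ : ℝ} (hR : 0 < R) (hε₁ : 0 < ε₁) {u : LatticeFamily m}
    {U : (Fin m → ℝ) → ℝ} (h : ConvOn (Box m R ε₁) u U) (hU : ContinuousAt U 0) (h0 : U 0 ≠ 0) :
    ∀ᶠ δ in nhdsWithin (0 : ℝ) (Set.Ioi 0),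
      (∃ c > 0, ∀ p ∈ Box m δ δ, c ≤ |u p.1 p.2| ∧ c ≤ |U (pt p.1 p.2)|) ∧
      ∀ t, ‖t‖ ≤ δ → U t ≠ 0 := by
  have hc : 0 < |U 0| / 2 := half_pos (abs_pos.2 h0)
  obtain ⟨δ₀, hδ₀, hδ₀'⟩ := Metric.eventually_nhds_iff_ball.1
    (hU.abs.tendsto.eventually (lt_mem_nhds (half_lt_self (abs_pos.2 h0))))
  have hd : ∀ t : Fin m → ℝ, ‖t‖ ≤ δ₀ / 2 → |U 0| / 2 ≤ |U t| := fun t ht =>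
    (hδ₀' t (by rw [mem_ball_zero_iff]; linarith)).le
  obtain ⟨ε₂, hε₂, hε₂', h2⟩ := (h.subset (box_subset (min_le_left R (δ₀ / 2)) le_rfl)).exists_pos_le_abs
    hc hε₁ (fun p hp => hd _ ((norm_pt_le (by positivity) hp).trans (min_le_right _ _)))
  filter_upwards [Ioo_mem_nhdsGT (lt_min (lt_min hR (half_pos hδ₀)) hε₂)] with δ hδ
  have e1 : δ ≤ min R (δ₀ / 2) := hδ.2.le.trans (min_le_left _ _)
  have e2 : δ ≤ ε₂ := hδ.2.le.trans (min_le_right _ _)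
  refine ⟨⟨|U 0| / 2 / 2, half_pos hc, fun p hp => ⟨h2 p (box_subset e1 e2 hp), ?_⟩⟩, fun t ht h' => ?_⟩
  · exact (half_le_self hc.le).trans
      (hd _ ((norm_pt_le hδ.1.le hp).trans (e1.trans (min_le_right _ _))))
  · have := hd t (ht.trans (e1.trans (min_le_right _ _)))
    rw [h', abs_zero] at this
    linarith

end LatticeFamily

/-! ### Nondegenerate solutions of both Darboux systems near the origin. -/

namespace JonasData

open LatticeFamily

variable {m N : ℕ}

/-- A nondegenerate solution of the smooth Darboux system with the data of `S`, on the ball of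
radius `δ`. -/
structure SmoothSolution (S : JonasData m N) (δ : ℝ)
    (β : NetIdx m N → NetIdx m N → (Fin m → ℝ) → ℝ) : Prop where
  contDiff : ∀ a c, ContDiff ℝ ∞ (β a c)
  data : ∀ t : Fin m → ℝ, ‖t‖ ≤ δ → ∀ a c, β a c (keep Sum.inl a c t) = S.smooth a c t
  pd_eq : ∀ t : Fin m → ℝ, ‖t‖ ≤ δ → ∀ a c k, Sum.inl k ≠ a → Sum.inl k ≠ c →
    pd k (β a c) t = β a (.inl k) t * β (.inl k) c t
  lame : ∀ t : Fin m → ℝ, ‖t‖ ≤ δ → ∀ k, β (.inr (some none)) (.inl k) t ≠ 0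
  lameM : ∀ t : Fin m → ℝ, ‖t‖ ≤ δ → β (.inr (some none)) (.inr none) t ≠ 0
  diagM : ∀ t : Fin m → ℝ, ‖t‖ ≤ δ → 1 - 1 * β (.inr none) (.inr none) t ≠ 0
  lame' : ∀ t : Fin m → ℝ, ‖t‖ ≤ δ → ∀ k,
    darbouxStep 1 (.inr none) (fun a c => β a c t) (.inr (some none)) (.inl k) ≠ 0
  quot : ∀ t, 0 ≤ t → t ≤ δ → ∀ i, S.Q i t * (1 + S.CM i t) = S.CiM i t
  origin : ∀ i, S.X i 0 = S.P

theorem eventually_forall_Icc {p : ℝ → Prop} (h : ∀ᶠ t in nhds (0 : ℝ), p t) :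
    ∀ᶠ δ in nhdsWithin (0 : ℝ) (Set.Ioi 0), ∀ t, 0 ≤ t → t ≤ δ → p t := by
  obtain ⟨δ₀, hδ₀, h0⟩ := Metric.eventually_nhds_iff_ball.1 h
  filter_upwards [Ioo_mem_nhdsGT hδ₀] with δ hδ t h1 h2
  refine h0 t ?_
  rw [mem_ball_zero_iff, Real.norm_of_nonneg h1]
  exact h2.trans_lt hδ.2

/-- At the origin the nondegeneracy quantities have limits 1 or 1 + C_{Mi}(0). All of them are
therefore bounded away from zero on a small cube for small ε. -/
theorem eventually_solutions (S : JonasData m N) (hM : ∀ i, 1 + S.CM i 0 ≠ 0)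
    (hq : ∀ i, ∀ᶠ t in nhds (0 : ℝ), S.Q i t * (1 + S.CM i t) = S.CiM i t)
    (ho : ∀ i, S.X i 0 = S.P) :
    ∃ (β : NetIdx m N → NetIdx m N → (Fin m → ℝ) → ℝ) (b : NetIdx m N → NetIdx m N → LatticeFamily m),
      ∀ᶠ δ in nhdsWithin (0 : ℝ) (Set.Ioi 0), S.SmoothSolution δ β ∧
        (∀ ε, 0 < ε → ε < δ → S.DiscSolution ε δ (fun n a c => b a c ε n)) ∧
        (∀ a c, ConvOn (Box m δ δ) (b a c) (β a c)) ∧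
        ∀ a c, ConvOn (Box m δ δ)
          (fun ε n => darbouxStep 1 (.inr none) (fun a c => b a c ε n) a c)
          (fun t => darbouxStep 1 (.inr none) (fun a c => β a c t) a c) := by
  obtain ⟨ρ, hρ, β, hβ, hplane, hpd⟩ := exists_darboux_solution
    (ι := (Sum.inl : Fin m → NetIdx m N)) Sum.inl_injective S.smooth S.smooth_contDiff S.smooth_keep
  obtain ⟨ε₀, ⟨hconv0, hreg0⟩, hε₀⟩ :=
    ((S.eventually_convOn_data.and S.eventually_regular).and self_mem_nhdsWithin).exists
  obtain ⟨R, hR, ε₁, hε₁, hR1, hRρ, hε₁₀, hε₁1, b, hb, hhalf, hdata, hstep⟩ :=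
    exists_discreteDarboux_convergence Sum.inl_injective hβ hρ hplane hpd one_pos hε₀ hconv0
      S.disc_keep
  refine ⟨β, b, ?_⟩
  have hβ0 : ∀ a c, β a c 0 = S.smooth a c 0 := by
    intro a c
    have := hplane 0 (by simpa using hρ.le) a c
    have hk : keep (Sum.inl : Fin m → NetIdx m N) a c (0 : Fin m → ℝ) = 0 := by
      funext i; simp [keep]
    rwa [hk] at this
  have hcont : ∀ a c, Continuous (β a c) := fun a c => (hβ a c).continuous
  have hD : ∀ δ, δ ≤ ε₁ → Admissible (Box m δ δ) := fun δ h => box_admissible (h.trans hε₁1)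
  have hRε := lt_min hR hε₁
  have cdiag : ConvOn (Box m R ε₁) (fun ε n => 1 + -1 * b (.inr none) (.inr none) ε n)
      (fun t => 1 + -1 * β (.inr none) (.inr none) t) :=
    (ConvOn.const hε₁1 1).add (ConvOn.mul (box_admissible hε₁1) (ConvOn.const hε₁1 _) (hb _ _))
  have ediag := cdiag.eventually_ne_zero hR hε₁ (by have := hcont (.inr none) (.inr none); fun_prop)
    (by rw [hβ0]; simp [smooth])
  -- This first radius secures 1 - β_MM ≠ 0; only then does the matrix of the second level converge,
  -- and its own conditions can be imposed.
  obtain ⟨δ₁, ⟨⟨⟨c, hc, hcu⟩, hcU⟩, hδ₁'⟩⟩ := (ediag.and (Ioo_mem_nhdsGT hRε)).exists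
  obtain ⟨hδ₁, hδ₁R⟩ := hδ₁'
  have hδR : δ₁ ≤ R := hδ₁R.le.trans (min_le_left _ _)
  have hδε : δ₁ ≤ ε₁ := hδ₁R.le.trans (min_le_right _ _)
  have hb1 : ∀ a c, ConvOn (Box m δ₁ δ₁) (b a c) (β a c) := fun a c =>
    (hb a c).subset (box_subset hδR hδε)
  have hlevel : ∀ a c, ConvOn (Box m δ₁ δ₁)
      (fun ε n => darbouxStep 1 (.inr none) (fun a c => b a c ε n) a c)
      (fun t => darbouxStep 1 (.inr none) (fun a c => β a c t) a c) := by
    intro a d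
    have e1 := ConvOn.inv (hD _ hδε) hc (cdiag.subset (box_subset hδR hδε))
      (fun p hp => (hcu p hp).1) (fun p hp => (hcu p hp).2)
    have e2 := (hb1 a d).add (ConvOn.mul (hD _ hδε) (ConvOn.mul (hD _ hδε) e1 (hb1 a (.inr none)))
      (hb1 (.inr none) d))
    refine e2.congr (hD _ hδε) (fun p _ => ?_) (fun p _ => ?_)
    · simp only [darbouxStep]; ring
    · simp only [darbouxStep]; ring
  have einl := fun k : Fin m => (hb1 (.inr (some none)) (.inl k)).eventually_ne_zero hδ₁
    hδ₁ (hcont _ _).continuousAt (by rw [hβ0]; simp [smooth])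
  have eM := (hb1 (.inr (some none)) (.inr none)).eventually_ne_zero hδ₁
    hδ₁ (hcont _ _).continuousAt (by rw [hβ0]; simp [smooth])
  have hβd : 1 - 1 * β (.inr none) (.inr none) 0 ≠ 0 := by rw [hβ0]; simp [smooth]
  have hcl : ∀ a c, ContinuousAt
      (fun t => darbouxStep 1 (.inr none) (fun a c => β a c t) a c) 0 := by
    intro a c
    have h1 := (hcont (.inr none) (.inr none)).continuousAt (x := 0)
    have h2 := (hcont a (.inr none)).continuousAt (x := 0)
    have h3 := (hcont (.inr none) c).continuousAt (x := 0)
    have h4 := (hcont a c).continuousAt (x := 0)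
    exact h4.add (((continuousAt_const.mul ((continuousAt_const.sub
      (continuousAt_const.mul h1)).inv₀ hβd)).mul h2).mul h3)
  -- The transformed Lamé coefficient equals 1 + C_{Mi}(0) at the origin.
  have elame' := fun k : Fin m =>
    (hlevel (.inr (some none)) (.inl k)).eventually_ne_zero hδ₁ hδ₁ (hcl _ _) (by
      simp only [darbouxStep, hβ0]
      have : S.axisEP k 0 = 1 := expFam_of_eq_zero _ rfl
      simp [smooth, this, hM k])
  have e0 : ConvOn (Box m δ₁ δ₁) (fun ε _ => ε) (fun _ => 0) :=
    ConvOn.of_smooth (hδε.trans hε₁1) (G := fun p => p.2) contDiff_snd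
  have ediag' := fun k : Fin m => ((ConvOn.const (R := δ₁) (hδε.trans hε₁1) 1).add
    (ConvOn.mul (hD _ hδε) (ConvOn.const (hδε.trans hε₁1) (-1))
      (ConvOn.mul (hD _ hδε) e0 (hlevel (.inl k) (.inl k))))).eventually_ne_zero hδ₁ hδ₁
      (by simpa using continuousAt_const) (by simp)
  have efac : ∀ᶠ t in nhds (0 : ℝ), ∀ i, 1 + S.CM i t ≠ 0 := Filter.eventually_all.2 fun i =>
    (continuous_const.add (S.hCM i).continuous).continuousAt.eventually_ne (hM i)
  filter_upwards [Filter.eventually_all.2 einl, eM, Filter.eventually_all.2 elame',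
    Filter.eventually_all.2 ediag', eventually_forall_Icc efac,
    eventually_forall_Icc (Filter.eventually_all.2 hq), Ioo_mem_nhdsGT hδ₁]
    with δ finl fM flame' fdiag' ffac fq hδ
  have hδδ : δ ≤ δ₁ := hδ.2.le
  have hδρ : δ ≤ ρ := (hδδ.trans hδR).trans hRρ
  have hsub : Box m δ δ ⊆ Box m δ₁ δ₁ := box_subset hδδ hδδ
  have hne : ∀ {c x : ℝ}, 0 < c → c ≤ |x| → x ≠ 0 := fun hc h h' => by
    rw [h', abs_zero] at h; linarith
  have hsubR : Box m δ δ ⊆ Box m R ε₁ := hsub.trans (box_subset hδR hδε)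
  refine ⟨⟨hβ, fun t ht => hplane t (ht.trans hδρ), fun t ht => hpd t (ht.trans hδρ),
    fun t ht k => (finl k).2 t ht, fM.2, fun t ht => ?_, fun t ht k => (flame' k).2 t ht, fq, ho⟩, fun ε hε hεδ => ?_, fun a c => (hb1 a c).subset hsub, fun a c => (hlevel a c).subset hsub⟩
  · have := hcU t (ht.trans hδδ)
    rwa [neg_mul, ← sub_eq_add_neg] at this
  · have mem : ∀ n : Fin m → ℕ, (∀ i, ε * (n i : ℝ) ≤ δ) → (ε, n) ∈ Box m δ δ :=
      fun n hn => ⟨hε, hεδ, hn⟩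
    have mem0 : ∀ n : Fin m → ℕ, (∀ i, ε * (n i : ℝ) ≤ δ) → (ε, n) ∈ Box m 1 ε₀ := fun n hn =>
      box_subset ((hδδ.trans hδR).trans hR1) ((hδδ.trans hδε).trans hε₁₀) (mem n hn)
    refine ⟨hε, ?_, ?_, ?_, ?_, ?_, ?_, ?_, ?_, ?_, ?_, ffac, fq, ho⟩
    · intro n k hn a c ha hc
      exact hstep a c k ha hc (ε, n) (hsubR (mem _ hn))
    · exact fun a c n => hdata a c ε n
    · intro n hn k h'
      have := hhalf (ε, n) (hsubR (mem n hn)) (.inl k)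
      have h2 : ε * b (.inl k) (.inl k) ε n = 1 := by linarith
      rw [h2] at this
      norm_num at this
    · intro n hn k
      obtain ⟨c, hc, h⟩ := (finl k).1
      exact hne hc (h _ (mem n hn)).1
    · intro n hn
      have := hne hc (hcu _ (hsub (mem n hn))).1
      rwa [neg_mul, ← sub_eq_add_neg] at this
    · intro n hn
      obtain ⟨c, hc, h⟩ := fM.1
      exact hne hc (h _ (mem n hn)).1
    · intro n hn k
      obtain ⟨c, hc, h⟩ := (fdiag' k).1
      have := hne hc (h _ (mem n hn)).1
      rwa [neg_mul, one_mul, ← sub_eq_add_neg] at this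
    · intro n hn k
      obtain ⟨c, hc, h⟩ := (flame' k).1
      exact hne hc (h _ (mem n hn)).1
    · exact fun n hn i j hij => (hreg0.1 i j hij _ (mem0 n hn)).1
    · exact fun n hn i => (hreg0.2 i _ (mem0 n hn)).1

end JonasData

/-! ### Calculus of partial derivatives within the cube. -/

section CubeCalculus

variable {m : ℕ} {F : Type} [NormedAddCommGroup F] [NormedSpace ℝ F]

/-- The partial derivative within the cube. -/
noncomputable def pdw (r : ℝ) (k : Fin m) (u : (Fin m → ℝ) → F) : (Fin m → ℝ) → F :=
  fun ξ => fderivWithin ℝ u (cube m r) ξ (Pi.single k 1)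

theorem cube_eq_pi (r : ℝ) : cube m r = Set.univ.pi fun _ => Set.Icc 0 r := by
  ext t
  simp only [cube, Set.mem_univ_pi, Set.mem_Icc, Set.mem_ofPred_eq]

theorem cube_uniqueDiffOn {r : ℝ} (hr : 0 < r) : UniqueDiffOn ℝ (cube m r) := by
  rw [cube_eq_pi]
  exact UniqueDiffOn.univ_pi fun _ => uniqueDiffOn_Icc hr

theorem cube_isCompact (r : ℝ) : IsCompact (cube m r) := by
  rw [cube_eq_pi]
  exact isCompact_univ_pi fun _ => isCompact_Icc

theorem cube_mono {r r' : ℝ} (h : r ≤ r') : cube m r ⊆ cube m r' :=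
  fun _ hξ i => ⟨(hξ i).1, (hξ i).2.trans h⟩

theorem norm_le_of_mem_cube {r : ℝ} (hr : 0 ≤ r) {ξ : Fin m → ℝ} (hξ : ξ ∈ cube m r) : ‖ξ‖ ≤ r :=
  (pi_norm_le_iff_of_nonneg hr).2 fun i => by
    rw [Real.norm_of_nonneg (hξ i).1]; exact (hξ i).2

theorem single_mem_cube {r t : ℝ} (h0 : 0 ≤ t) (h1 : t ≤ r) (i : Fin m) :
    (Pi.single i t : Fin m → ℝ) ∈ cube m r := by
  intro j
  by_cases h : j = i
  · subst h; simp [h0, h1]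
  · simp [h, h0.trans h1]

variable {r : ℝ} {k : Fin m} {ξ : Fin m → ℝ}

theorem pdw_congr {u v : (Fin m → ℝ) → F} (h : Set.EqOn u v (cube m r)) (hξ : ξ ∈ cube m r) :
    pdw r k u ξ = pdw r k v ξ := by
  rw [pdw, pdw, fderivWithin_congr h (h hξ)]

theorem pdw_eq_of_hasFDerivAt (hr : 0 < r) {u : (Fin m → ℝ) → F} {L : (Fin m → ℝ) →L[ℝ] F}
    (h : HasFDerivAt u L ξ) (hξ : ξ ∈ cube m r) : pdw r k u ξ = L (Pi.single k 1) := by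
  rw [pdw, h.hasFDerivWithinAt.fderivWithin (cube_uniqueDiffOn hr ξ hξ)]

theorem pdw_smul (hr : 0 < r) {u : (Fin m → ℝ) → ℝ} {v : (Fin m → ℝ) → F} (hξ : ξ ∈ cube m r)
    (hu : DifferentiableWithinAt ℝ u (cube m r) ξ) (hv : DifferentiableWithinAt ℝ v (cube m r) ξ) :
    pdw r k (fun t => u t • v t) ξ = pdw r k u ξ • v ξ + u ξ • pdw r k v ξ := by
  have := (hu.hasFDerivWithinAt.fun_smul hv.hasFDerivWithinAt).fderivWithin
    (cube_uniqueDiffOn hr ξ hξ)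
  rw [pdw, this]
  simp [pdw, add_comm]

theorem pdw_mul (hr : 0 < r) {u v : (Fin m → ℝ) → ℝ} (hξ : ξ ∈ cube m r)
    (hu : DifferentiableWithinAt ℝ u (cube m r) ξ) (hv : DifferentiableWithinAt ℝ v (cube m r) ξ) :
    pdw r k (fun t => u t * v t) ξ = pdw r k u ξ * v ξ + u ξ * pdw r k v ξ :=
  pdw_smul hr hξ hu hv

theorem pdw_add (hr : 0 < r) {u v : (Fin m → ℝ) → F} (hξ : ξ ∈ cube m r)
    (hu : DifferentiableWithinAt ℝ u (cube m r) ξ) (hv : DifferentiableWithinAt ℝ v (cube m r) ξ) :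
    pdw r k (fun t => u t + v t) ξ = pdw r k u ξ + pdw r k v ξ := by
  rw [pdw, (hu.hasFDerivWithinAt.fun_add hv.hasFDerivWithinAt).fderivWithin
    (cube_uniqueDiffOn hr ξ hξ)]
  rfl

theorem pdw_sub (hr : 0 < r) {u v : (Fin m → ℝ) → F} (hξ : ξ ∈ cube m r)
    (hu : DifferentiableWithinAt ℝ u (cube m r) ξ) (hv : DifferentiableWithinAt ℝ v (cube m r) ξ) :
    pdw r k (fun t => u t - v t) ξ = pdw r k u ξ - pdw r k v ξ := by
  rw [pdw, (hu.hasFDerivWithinAt.fun_sub hv.hasFDerivWithinAt).fderivWithin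
    (cube_uniqueDiffOn hr ξ hξ)]
  rfl

theorem pdw_inv (hr : 0 < r) {u : (Fin m → ℝ) → ℝ} (hξ : ξ ∈ cube m r)
    (hu : DifferentiableWithinAt ℝ u (cube m r) ξ) (h0 : u ξ ≠ 0) :
    pdw r k (fun t => (u t)⁻¹) ξ = -pdw r k u ξ * (u ξ)⁻¹ ^ 2 := by
  have h1 : HasDerivAt (fun x : ℝ => x⁻¹) (-(u ξ ^ 2)⁻¹) (u ξ) := hasDerivAt_inv h0
  have h2 := h1.comp_hasFDerivWithinAt ξ hu.hasFDerivWithinAt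
  have h3 : (fun t => (u t)⁻¹) = (fun x : ℝ => x⁻¹) ∘ u := rfl
  rw [pdw, h3, h2.fderivWithin (cube_uniqueDiffOn hr ξ hξ)]
  simp [pdw]
  ring

theorem pdw_apply {N : ℕ} (hr : 0 < r) {u : (Fin m → ℝ) → EuclideanSpace ℝ (Fin N)}
    (hξ : ξ ∈ cube m r) (hu : DifferentiableWithinAt ℝ u (cube m r) ξ) (l : Fin N) :
    pdw r k u ξ l = pdw r k (fun t => u t l) ξ := by
  have h1 := ((EuclideanSpace.proj (𝕜 := ℝ) l).hasFDerivAt (x := u ξ)).comp_hasFDerivWithinAt ξ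
    hu.hasFDerivWithinAt
  have h2 := h1.fderivWithin (cube_uniqueDiffOn hr ξ hξ)
  have h3 : (fun t => u t l) = (EuclideanSpace.proj (𝕜 := ℝ) l) ∘ u := rfl
  rw [pdw, pdw, h3, h2]
  rfl

theorem contDiffOn_pdw (hr : 0 < r) {u : (Fin m → ℝ) → F} (hu : ContDiffOn ℝ ∞ u (cube m r)) :
    ContDiffOn ℝ ∞ (pdw r k u) (cube m r) :=
  (hu.fderivWithin (cube_uniqueDiffOn hr) (m := ∞) le_rfl).clm_apply contDiffOn_const

theorem diffWithin_cube {u : (Fin m → ℝ) → F} (hu : ContDiffOn ℝ ∞ u (cube m r))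
    (hξ : ξ ∈ cube m r) : DifferentiableWithinAt ℝ u (cube m r) ξ :=
  hu.differentiableOn (by simp) ξ hξ

/-- The cube is the closure of its interior, so the symmetry of second derivatives extends to its
boundary. -/
theorem pdw_comm (hr : 0 < r) {u : (Fin m → ℝ) → F} (hu : ContDiffOn ℝ ∞ u (cube m r))
    (k l : Fin m) (hξ : ξ ∈ cube m r) : pdw r k (pdw r l u) ξ = pdw r l (pdw r k u) ξ := by
  have hD : DifferentiableWithinAt ℝ (fderivWithin ℝ u (cube m r)) (cube m r) ξ :=
    (hu.fderivWithin (cube_uniqueDiffOn hr) (m := ∞) le_rfl).differentiableOn (by simp) ξ hξ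
  have key : ∀ i j : Fin m, pdw r i (pdw r j u) ξ =
      fderivWithin ℝ (fderivWithin ℝ u (cube m r)) (cube m r) ξ (Pi.single i 1)
        (Pi.single j 1) := by
    intro i j
    have h := (hD.hasFDerivWithinAt.clm_apply (hasFDerivWithinAt_const
      (Pi.single j 1 : Fin m → ℝ) ξ (cube m r))).fderivWithin (cube_uniqueDiffOn hr ξ hξ)
    rw [pdw]
    change fderivWithin ℝ (fun t => fderivWithin ℝ u (cube m r) t (Pi.single j 1)) _ _ _ = _
    rw [h]
    simp
  rw [key, key]
  have hint : ξ ∈ closure (interior (cube m r)) := by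
    rw [cube_eq_pi, interior_pi_set Set.finite_univ, closure_pi_set]
    intro i _
    rw [interior_Icc, closure_Ioo hr.ne]
    exact hξ i
  exact (hu ξ hξ).isSymmSndFDerivWithinAt (by
    rw [minSmoothness_of_isRCLikeNormedField]; exact WithTop.coe_le_coe.2 le_top)
    (cube_uniqueDiffOn hr) hint hξ _ _

end CubeCalculus

/-! ### Uniqueness for Goursat problems. -/

section Goursat

variable {m : ℕ} {S : Type} [Fintype S]

/-- The point `t` with the coordinates in `e` multiplied by `μ`. -/
def scale (e : Finset (Fin m)) (μ : ℝ) (t : Fin m → ℝ) : Fin m → ℝ :=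
  fun k => if k ∈ e then μ * t k else t k

theorem scale_one (e : Finset (Fin m)) (t : Fin m → ℝ) : scale e 1 t = t := by
  funext k; simp [scale]

theorem sum_scale (e : Finset (Fin m)) (μ : ℝ) (t : Fin m → ℝ) :
    ∑ k, scale e μ t k = (∑ k ∈ eᶜ, t k) + μ * ∑ k ∈ e, t k := by
  rw [← Finset.sum_compl_add_sum e, Finset.mul_sum]
  congr 1
  · exact Finset.sum_congr rfl fun k hk => by simp [scale, Finset.mem_compl.1 hk]
  · exact Finset.sum_congr rfl fun k hk => by simp [scale, hk]

theorem scale_continuous (e : Finset (Fin m)) (t : Fin m → ℝ) : Continuous fun μ => scale e μ t := by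
  refine continuous_pi fun k => ?_
  by_cases h : k ∈ e <;> simp only [scale, h, if_true, if_false] <;> fun_prop

/-- Uniqueness for linear differential inequalities of Goursat type: every function `f s` has
its derivative prescribed in the directions `ev s`, and vanishes where these coordinates vanish. -/
theorem goursat_eq_zero {T : Set (Fin m → ℝ)} (hT : IsCompact T) (hT0 : ∀ t ∈ T, ∀ k, 0 ≤ t k)
    (ev : S → Finset (Fin m))
    (hstar : ∀ t ∈ T, ∀ s, ∀ μ ∈ Set.Icc (0 : ℝ) 1, scale (ev s) μ t ∈ T)
    {f : S → (Fin m → ℝ) → ℝ} (hf : ∀ s, ContinuousOn (f s) T)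
    (h0 : ∀ s, ∀ t ∈ T, (∀ k ∈ ev s, t k = 0) → f s t = 0) {K : ℝ} (hK : 0 ≤ K)
    (hd : ∀ s, ∀ t ∈ T, ∀ μ ∈ Set.Ico (0 : ℝ) 1, ∃ D,
      HasDerivWithinAt (fun μ => f s (scale (ev s) μ t)) D (Set.Ici μ) μ ∧
      |D| ≤ K * (∑ k ∈ ev s, t k) * ∑ s', |f s' (scale (ev s) μ t)|) :
    ∀ s, ∀ t ∈ T, f s t = 0 := by
  rcases T.eq_empty_or_nonempty with rfl | hne
  · simp
  -- The weight exp(-λ Σ t_k) gives a factor K/λ for each unknown upon integration; this λ makes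
  -- card S · K/λ at most 1/2.
  set lam : ℝ := 2 * (Fintype.card S * K + 1) with hlam
  have hlam0 : 0 < lam := by positivity
  have hΦ : ContinuousOn (fun t => Real.exp (-(lam * ∑ k, t k)) * ∑ s, |f s t|) T :=
    (by fun_prop : Continuous fun t : Fin m → ℝ => Real.exp (-(lam * ∑ k, t k))).continuousOn.mul
      (continuousOn_finsetSum _ fun s _ => (hf s).abs)
  obtain ⟨t₀, ht₀, hmax⟩ := hT.exists_isMaxOn hne hΦ
  set W := Real.exp (-(lam * ∑ k, t₀ k)) * ∑ s, |f s t₀| with hW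
  have hW0 : 0 ≤ W := by positivity
  have hbound : ∀ t ∈ T, ∑ s, |f s t| ≤ W * Real.exp (lam * ∑ k, t k) := by
    intro t ht
    have h1 : Real.exp (-(lam * ∑ k, t k)) * ∑ s, |f s t| ≤ W := hmax ht
    rw [Real.exp_neg, inv_mul_le_iff₀ (Real.exp_pos _)] at h1
    rwa [mul_comm] 
  -- Comparison along the segment on which the evolution coordinates are scaled from 0 to those of
  -- t₀, where the unknown starts from zero.
  have key : ∀ s, |f s t₀| ≤ K * W / lam * Real.exp (lam * ∑ k, t₀ k) := by
    intro s
    choose! D hD1 hD2 using hd s t₀ ht₀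
    have hσ : 0 ≤ ∑ k ∈ ev s, t₀ k := Finset.sum_nonneg fun k _ => hT0 t₀ ht₀ k
    have hB : ∀ μ, HasDerivAt
        (fun μ => K * W / lam * Real.exp (lam * ((∑ k ∈ (ev s)ᶜ, t₀ k) + μ * ∑ k ∈ ev s, t₀ k)))
        (K * W * (∑ k ∈ ev s, t₀ k) *
          Real.exp (lam * ((∑ k ∈ (ev s)ᶜ, t₀ k) + μ * ∑ k ∈ ev s, t₀ k))) μ := by
      intro μ
      have h1 := (((((hasDerivAt_id μ).mul_const (∑ k ∈ ev s, t₀ k)).const_add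
        (∑ k ∈ (ev s)ᶜ, t₀ k)).const_mul lam).exp).const_mul (K * W / lam)
      refine h1.congr_deriv ?_
      simp only [id]
      field_simp
    have h2 := image_norm_le_of_norm_deriv_right_le_deriv_boundary
      (f := fun μ => f s (scale (ev s) μ t₀)) (f' := D) (a := 0) (b := 1)
      ((hf s).comp (scale_continuous _ _).continuousOn fun μ hμ => hstar t₀ ht₀ s μ hμ)
      hD1 (B := fun μ => K * W / lam *
        Real.exp (lam * ((∑ k ∈ (ev s)ᶜ, t₀ k) + μ * ∑ k ∈ ev s, t₀ k))) ?_ hB ?_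
      (Set.right_mem_Icc.2 zero_le_one)
    · rw [scale_one] at h2
      have h3 := sum_scale (ev s) 1 t₀
      rw [scale_one] at h3
      rw [h3]
      exact h2
    · rw [h0 s _ (hstar t₀ ht₀ s 0 (by simp)) (fun k hk => by simp [scale, hk]), norm_zero]
      positivity
    · intro μ hμ
      refine (hD2 μ hμ).trans ?_
      have h4 := hbound _ (hstar t₀ ht₀ s μ ⟨hμ.1, hμ.2.le⟩)
      rw [sum_scale] at h4
      calc _ ≤ K * (∑ k ∈ ev s, t₀ k) * (W *
            Real.exp (lam * ((∑ k ∈ (ev s)ᶜ, t₀ k) + μ * ∑ k ∈ ev s, t₀ k))) := by gcongr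
        _ = _ := by ring
  have hWW : W ≤ W / 2 := by
    have h1 : ∑ s, |f s t₀| ≤ Fintype.card S * (K * W / lam * Real.exp (lam * ∑ k, t₀ k)) := by
      refine (Finset.sum_le_sum fun s _ => key s).trans (le_of_eq ?_)
      simp
    have h2 : W ≤ Fintype.card S * (K * W / lam) := by
      have h3 : Real.exp (-(lam * ∑ k, t₀ k)) * ∑ s, |f s t₀| ≤
          Fintype.card S * (K * W / lam) := by
        rw [Real.exp_neg, inv_mul_le_iff₀ (Real.exp_pos _)]
        linarith
      exact h3
    refine h2.trans ?_
    rw [hlam, ← mul_div_assoc, div_le_div_iff₀ (by positivity) (by norm_num)]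
    nlinarith
  have hW00 : W = 0 := by linarith
  intro s t ht
  have h1 := hbound t ht
  rw [hW00, zero_mul] at h1
  have h2 := (Finset.single_le_sum (f := fun s => |f s t|) (fun _ _ => abs_nonneg _)
    (Finset.mem_univ s)).trans h1
  exact abs_eq_zero.1 (le_antisymm h2 (abs_nonneg _))

theorem scale_mem_cube {r : ℝ} {t : Fin m → ℝ} (ht : t ∈ cube m r) (e : Finset (Fin m)) {μ : ℝ}
    (hμ : μ ∈ Set.Icc (0 : ℝ) 1) : scale e μ t ∈ cube m r := by
  intro k
  by_cases h : k ∈ e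
  · simp only [scale, h, if_true]
    exact ⟨mul_nonneg hμ.1 (ht k).1, (mul_le_of_le_one_left (ht k).1 hμ.2).trans (ht k).2⟩
  · simp only [scale, h, if_false]; exact ht k

theorem hasDerivWithinAt_scale {r : ℝ} {u : (Fin m → ℝ) → ℝ}
    (hu : DifferentiableOn ℝ u (cube m r)) {t : Fin m → ℝ} (ht : t ∈ cube m r)
    (e : Finset (Fin m)) {μ : ℝ} (hμ : μ ∈ Set.Ico (0 : ℝ) 1) :
    HasDerivWithinAt (fun μ => u (scale e μ t)) (∑ k ∈ e, t k * pdw r k u (scale e μ t))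
      (Set.Ici μ) μ := by
  have h1 : HasDerivWithinAt (fun μ => scale e μ t) (∑ k ∈ e, t k • Pi.single k (1 : ℝ))
      (Set.Icc 0 1) μ := by
    refine HasDerivAt.hasDerivWithinAt (hasDerivAt_pi.2 fun k => ?_)
    have e1 : (∑ k ∈ e, t k • (Pi.single k (1 : ℝ) : Fin m → ℝ)) k = if k ∈ e then t k else 0 := by
      simp [Finset.sum_apply, Pi.single_apply]
    rw [e1]
    by_cases h : k ∈ e
    · simp only [scale, h, if_true]
      simpa using (hasDerivAt_id μ).mul_const (t k)
    · simp only [scale, h, if_false]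
      exact hasDerivAt_const _ _
  have h2 := (hu _ (scale_mem_cube ht e ⟨hμ.1, hμ.2.le⟩)).hasFDerivWithinAt.comp_hasDerivWithinAt μ
    h1 (fun ν hν => scale_mem_cube ht e hν)
  have h3 := HasDerivWithinAt.mono_of_mem_nhdsWithin (s := Set.Ici μ) h2
    (Filter.mem_of_superset (Icc_mem_nhdsGE hμ.2) (Set.Icc_subset_Icc_left hμ.1))
  refine h3.congr_deriv ?_
  simp [map_sum, pdw]

/-- Uniqueness for the Goursat problem of an autonomous first order system. -/
theorem goursat_unique {r : ℝ} (ev : S → Finset (Fin m))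
    {Φ : Fin m → S → (S → ℝ) → ℝ} (hΦ : ∀ k s, ContDiff ℝ 1 (Φ k s))
    {f g : S → (Fin m → ℝ) → ℝ}
    (hf : ∀ s, ContDiffOn ℝ ∞ (f s) (cube m r)) (hg : ∀ s, ContDiffOn ℝ ∞ (g s) (cube m r))
    (hfΦ : ∀ s, ∀ k ∈ ev s, ∀ t ∈ cube m r, pdw r k (f s) t = Φ k s fun s => f s t)
    (hgΦ : ∀ s, ∀ k ∈ ev s, ∀ t ∈ cube m r, pdw r k (g s) t = Φ k s fun s => g s t)
    (h0 : ∀ s, ∀ t ∈ cube m r, (∀ k ∈ ev s, t k = 0) → f s t = g s t) :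
    ∀ s, ∀ t ∈ cube m r, f s t = g s t := by
  have hc : ∀ {f : S → (Fin m → ℝ) → ℝ}, (∀ s, ContDiffOn ℝ ∞ (f s) (cube m r)) →
      ∃ B, ∀ t ∈ cube m r, ‖fun s => f s t‖ ≤ B := fun hf =>
    (cube_isCompact r).exists_bound_of_continuousOn
      (continuousOn_pi.2 fun s => (hf s).continuousOn)
  obtain ⟨B, hB⟩ := hc hf
  obtain ⟨B', hB'⟩ := hc hg
  -- On a ball containing the values of both solutions the right-hand sides are Lipschitz, which
  -- makes the difference satisfy a linear inequality.
  have hLip : ∀ k s, ∃ K : ℝ, 0 ≤ K ∧ ∀ x ∈ Metric.closedBall (0 : S → ℝ) (max B B'),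
      ∀ y ∈ Metric.closedBall (0 : S → ℝ) (max B B'), |Φ k s x - Φ k s y| ≤ K * ‖x - y‖ := by
    intro k s
    obtain ⟨K, hK⟩ := (isCompact_closedBall (0 : S → ℝ) (max B B')).exists_bound_of_continuousOn
      ((hΦ k s).continuous_fderiv one_ne_zero).continuousOn
    refine ⟨max K 0, le_max_right _ _, fun x hx y hy => ?_⟩
    exact (convex_closedBall _ _).norm_image_sub_le_of_norm_fderiv_le
      (fun z _ => (hΦ k s).differentiable one_ne_zero z)
      (fun z hz => (hK z hz).trans (le_max_left _ _)) hy hx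
  choose K hK0 hK using hLip
  have hKs : ∀ k s, K k s ≤ ∑ k, ∑ s, K k s := fun k s =>
    (Finset.single_le_sum (f := fun s => K k s) (fun _ _ => hK0 _ _) (Finset.mem_univ s)).trans
      (Finset.single_le_sum (f := fun k => ∑ s, K k s)
        (fun _ _ => Finset.sum_nonneg fun _ _ => hK0 _ _) (Finset.mem_univ k))
  have hdiff : ∀ s, ContDiffOn ℝ ∞ (fun t => f s t - g s t) (cube m r) :=
    fun s => (hf s).sub (hg s)
  have hsum0 : 0 ≤ ∑ k, ∑ s, K k s :=
    Finset.sum_nonneg fun _ _ => Finset.sum_nonneg fun _ _ => hK0 _ _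
  intro s t ht
  have hr : 0 < r ∨ r ≤ 0 := lt_or_ge _ _
  rcases hr with hr | hr
  swap
  · refine h0 s t ht fun k _ => le_antisymm ((ht k).2.trans hr) (ht k).1
  refine sub_eq_zero.1 (goursat_eq_zero (cube_isCompact r) (fun t ht k => (ht k).1) ev
    (fun t ht s μ hμ => scale_mem_cube ht _ hμ) (f := fun s t => f s t - g s t)
    (fun s => (hdiff s).continuousOn) (fun s t ht h => sub_eq_zero.2 (h0 s t ht h)) hsum0 ?_ s t ht)
  intro s t ht μ hμ
  refine ⟨_, hasDerivWithinAt_scale ((hdiff s).differentiableOn (by simp)) ht _ hμ, ?_⟩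
  have hm := scale_mem_cube ht (ev s) ⟨hμ.1, hμ.2.le⟩
  set τ := scale (ev s) μ t
  have hnorm : ‖(fun s => f s τ) - fun s => g s τ‖ ≤ ∑ s', |f s' τ - g s' τ| := by
    refine (pi_norm_le_iff_of_nonneg (by positivity)).2 fun s' => ?_
    exact Finset.single_le_sum (f := fun s' => |f s' τ - g s' τ|) (fun _ _ => abs_nonneg _)
      (Finset.mem_univ s')
  have hsplit : (∑ k, ∑ s, K k s) * (∑ k ∈ ev s, t k) * ∑ s', |f s' τ - g s' τ| =
      ∑ k ∈ ev s, t k * ((∑ k, ∑ s, K k s) * ∑ s', |f s' τ - g s' τ|) := by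
    rw [← Finset.sum_mul]; ring
  rw [hsplit]
  refine (Finset.abs_sum_le_sum_abs _ _).trans (Finset.sum_le_sum fun k hk => ?_)
  rw [abs_mul, abs_of_nonneg (ht k).1, pdw_sub hr hm (diffWithin_cube (hf s) hm)
    (diffWithin_cube (hg s) hm), hfΦ s k hk τ hm, hgΦ s k hk τ hm]
  have h1 := hK k s _ (mem_closedBall_zero_iff.2 ((hB τ hm).trans (le_max_left _ _)))
    _ (mem_closedBall_zero_iff.2 ((hB' τ hm).trans (le_max_right _ _)))
  have h2 : |Φ k s (fun s => f s τ) - Φ k s fun s => g s τ| ≤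
      (∑ k, ∑ s, K k s) * ∑ s', |f s' τ - g s' τ| :=
    h1.trans (mul_le_mul (hKs k s) hnorm (norm_nonneg _) hsum0)
  exact mul_le_mul_of_nonneg_left h2 (ht k).1

end Goursat

/-! ### Smooth conjugate nets and Jonas pairs from the Darboux system. -/

section SmoothNets

variable {m N : ℕ}

/-- A solution of the smooth Darboux system on the cube `[0, r]^m`. -/
structure DarbouxOn (r : ℝ) (γ : NetIdx m N → NetIdx m N → (Fin m → ℝ) → ℝ) : Prop where
  contDiffOn : ∀ a c, ContDiffOn ℝ ∞ (γ a c) (cube m r)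
  pdw_eq : ∀ k a c, Sum.inl k ≠ a → Sum.inl k ≠ c → ∀ ξ ∈ cube m r,
    pdw r k (γ a c) ξ = γ a (.inl k) ξ * γ (.inl k) c ξ

/-- The vectors formed by the entries of the row `a`. -/
noncomputable def rowVec (γ : NetIdx m N → NetIdx m N → (Fin m → ℝ) → ℝ) (a : NetIdx m N)
    (t : Fin m → ℝ) : EuclideanSpace ℝ (Fin N) :=
  WithLp.toLp 2 fun l => γ a (.inr (some (some l))) t

namespace DarbouxOn

variable {r : ℝ} {γ : NetIdx m N → NetIdx m N → (Fin m → ℝ) → ℝ}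

theorem contDiffOn_rowVec (h : DarbouxOn r γ) (a : NetIdx m N) :
    ContDiffOn ℝ ∞ (rowVec γ a) (cube m r) :=
  contDiffOn_euclidean.2 fun _ => h.contDiffOn _ _

theorem pdw_rowVec (hr : 0 < r) (h : DarbouxOn r γ) {k : Fin m} {a : NetIdx m N}
    (ha : Sum.inl k ≠ a) {ξ : Fin m → ℝ} (hξ : ξ ∈ cube m r) :
    pdw r k (rowVec γ a) ξ = γ a (.inl k) ξ • rowVec γ (.inl k) ξ := by
  ext l
  rw [pdw_apply hr hξ (diffWithin_cube (h.contDiffOn_rowVec a) hξ)]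
  exact h.pdw_eq k a _ ha (by simp) ξ hξ

/-- From ∂_i x = h_i w_i one gets ∂_i ∂_j x = h_i β_ij w_j + h_j β_ji w_i. Dividing by the Lamé
coefficients expresses this in ∂_j x and ∂_i x. -/
theorem isConjugateNetWith (hr : 0 < r) (h : DarbouxOn r γ)
    (h0 : ∀ ξ ∈ cube m r, ∀ k, γ (.inr (some none)) (.inl k) ξ ≠ 0) :
    IsConjugateNetWith r (rowVec γ (.inr (some none)))
      fun i j ξ => γ (.inr (some none)) (.inl i) ξ * γ (.inl i) (.inl j) ξ /
        γ (.inr (some none)) (.inl j) ξ := by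
  refine ⟨h.contDiffOn_rowVec _, fun i j hij ξ hξ => ?_⟩
  have hd : (Sum.inl i : NetIdx m N) ≠ .inl j := fun e => hij (Sum.inl_injective e)
  have h1 : ∀ k, ∀ ξ ∈ cube m r, pderiv r k (rowVec γ (.inr (some none))) ξ =
      γ (.inr (some none)) (.inl k) ξ • rowVec γ (.inl k) ξ := fun k ξ hξ =>
    h.pdw_rowVec hr (by simp) hξ
  have h2 : pderiv r i (pderiv r j (rowVec γ (.inr (some none)))) ξ =
      pdw r i (fun ξ => γ (.inr (some none)) (.inl j) ξ • rowVec γ (.inl j) ξ) ξ :=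
    pdw_congr (h1 j) hξ
  rw [h2, pdw_smul hr hξ (diffWithin_cube (h.contDiffOn _ _) hξ)
    (diffWithin_cube (h.contDiffOn_rowVec _) hξ), h.pdw_eq i _ _ (by simp) hd ξ hξ,
    h.pdw_rowVec hr hd hξ, h1 i ξ hξ, h1 j ξ hξ, smul_smul, smul_smul, smul_smul, add_comm,
    div_mul_cancel₀ _ (h0 ξ hξ j), div_mul_cancel₀ _ (h0 ξ hξ i)]

/-- The differential version of `darbouxStep_comm`: the step in the direction M commutes with the
flow along k. The derivative of (1 - β_MM)⁻¹ supplies the missing quadratic term. -/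
theorem step (hr : 0 < r) (h : DarbouxOn r γ)
    (h0 : ∀ ξ ∈ cube m r, 1 - 1 * γ (.inr none) (.inr none) ξ ≠ 0) :
    DarbouxOn r fun a c t => darbouxStep 1 (.inr none) (fun a c => γ a c t) a c := by
  have hu : ContDiffOn ℝ ∞ (fun t => 1 - 1 * γ (.inr none) (.inr none) t) (cube m r) :=
    contDiffOn_const.sub (contDiffOn_const.mul (h.contDiffOn _ _))
  have hs : ContDiffOn ℝ ∞ (fun t => (1 - 1 * γ (.inr none) (.inr none) t)⁻¹) (cube m r) :=
    hu.inv h0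
  have hs1 : ContDiffOn ℝ ∞ (fun t => 1 * (1 - 1 * γ (.inr none) (.inr none) t)⁻¹) (cube m r) :=
    contDiffOn_const.mul hs
  refine ⟨fun a c => (h.contDiffOn a c).add ((hs1.mul (h.contDiffOn _ _)).mul (h.contDiffOn _ _)),
    fun k a c ha hc ξ hξ => ?_⟩
  have hd := fun a c => diffWithin_cube (h.contDiffOn a c) hξ
  have e1 : pdw r k (fun t => 1 - 1 * γ (.inr none) (.inr none) t) ξ =
      -(γ (.inr none) (.inl k) ξ * γ (.inl k) (.inr none) ξ) := by
    rw [← h.pdw_eq k _ _ (by simp) (by simp) ξ hξ]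
    have e2 : pdw r k (fun t => 1 - 1 * γ (.inr none) (.inr none) t) ξ =
        pdw r k (fun t => (1 : ℝ) - γ (.inr none) (.inr none) t) ξ := by simp only [one_mul]
    rw [e2, pdw_sub hr hξ (differentiableWithinAt_const _) (hd _ _)]
    have e3 : pdw r k (fun _ : Fin m → ℝ => (1 : ℝ)) ξ = 0 := by
      rw [pdw_eq_of_hasFDerivAt hr (hasFDerivAt_const _ _) hξ]; rfl
    rw [e3, zero_sub]
  have e4 : pdw r k (fun t => 1 * (1 - 1 * γ (.inr none) (.inr none) t)⁻¹) ξ =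
      γ (.inr none) (.inl k) ξ * γ (.inl k) (.inr none) ξ *
        (1 - 1 * γ (.inr none) (.inr none) ξ)⁻¹ ^ 2 := by
    have e5 : pdw r k (fun t => 1 * (1 - 1 * γ (.inr none) (.inr none) t)⁻¹) ξ =
        pdw r k (fun t => (1 - 1 * γ (.inr none) (.inr none) t)⁻¹) ξ := by
      congr 1; funext t; rw [one_mul]
    rw [e5, pdw_inv hr hξ (diffWithin_cube hu hξ) (h0 ξ hξ), e1, neg_neg]
  change pdw r k (fun t => γ a c t + 1 * (1 - 1 * γ (.inr none) (.inr none) t)⁻¹ *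
    γ a (.inr none) t * γ (.inr none) c t) ξ = _
  rw [pdw_add hr hξ (hd a c) (diffWithin_cube ((hs1.mul (h.contDiffOn a (.inr none))).mul
      (h.contDiffOn (.inr none) c)) hξ),
    pdw_mul hr hξ (diffWithin_cube (hs1.mul (h.contDiffOn a (.inr none))) hξ) (hd _ _),
    pdw_mul hr hξ (diffWithin_cube hs1 hξ) (hd _ _), e4, h.pdw_eq k _ _ ha hc ξ hξ,
    h.pdw_eq k _ _ ha (by simp) ξ hξ, h.pdw_eq k _ _ (by simp) hc ξ hξ]
  simp only [darbouxStep]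
  generalize (1 - 1 * γ (Sum.inr none) (Sum.inr none) ξ)⁻¹ = s
  ring

end DarbouxOn

/-- Here x⁺ - x = (1 - β_MM)⁻¹ h_M w_M, while ∂_i x⁺ = h_i⁺ w_i⁺, where w_i⁺ differs from w_i by a
multiple of w_M. -/
theorem isJonasPair_darbouxStep {r : ℝ} (hr : 0 < r)
    {γ : NetIdx m N → NetIdx m N → (Fin m → ℝ) → ℝ} (h : DarbouxOn r γ)
    (h0 : ∀ ξ ∈ cube m r, ∀ k, γ (.inr (some none)) (.inl k) ξ ≠ 0)
    (hM : ∀ ξ ∈ cube m r, γ (.inr (some none)) (.inr none) ξ ≠ 0)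
    (hs : ∀ ξ ∈ cube m r, 1 - 1 * γ (.inr none) (.inr none) ξ ≠ 0)
    (h0' : ∀ ξ ∈ cube m r, ∀ k,
      darbouxStep 1 (.inr none) (fun a c => γ a c ξ) (.inr (some none)) (.inl k) ≠ 0) :
    IsJonasPair r (rowVec γ (.inr (some none)))
      (rowVec (fun a c t => darbouxStep 1 (.inr none) (fun a c => γ a c t) a c)
        (.inr (some none))) := by
  have h' := h.step hr hs
  refine ⟨⟨_, h.isConjugateNetWith hr h0⟩, ⟨_, h'.isConjugateNetWith hr h0'⟩,
    fun i ξ => (1 - 1 * γ (.inr none) (.inr none) ξ)⁻¹ * γ (.inr (some none)) (.inr none) ξ *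
      γ (.inr none) (.inl i) ξ / γ (.inr (some none)) (.inl i) ξ,
    fun i ξ => darbouxStep 1 (.inr none) (fun a c => γ a c ξ) (.inr (some none)) (.inl i) *
      γ (.inl i) (.inr none) ξ / γ (.inr (some none)) (.inr none) ξ, fun i ξ hξ => ?_⟩
  have e1 := h.pdw_rowVec hr (k := i) (a := .inr (some none)) (by simp) hξ
  have e2 := h'.pdw_rowVec hr (k := i) (a := .inr (some none)) (by simp) hξ
  change pdw r i _ ξ - pdw r i _ ξ = _ • pdw r i _ ξ + _
  rw [e1, e2]
  ext l
  have := h0 ξ hξ i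
  have := hM ξ hξ
  have := hs ξ hξ
  simp only [rowVec, PiLp.add_apply, PiLp.sub_apply, PiLp.smul_apply, smul_eq_mul, darbouxStep]
  field_simp
  ring

end SmoothNets

/-! ### The smooth solution attains the prescribed curves and coefficients. -/

section SmoothAgreement

variable {m N : ℕ}

theorem hasDerivAt_comp_single {u : (Fin m → ℝ) → ℝ} (hu : ContDiff ℝ ∞ u) (i : Fin m) (t : ℝ) :
    HasDerivAt (fun s => u (Pi.single i s)) (pd i u (Pi.single i t)) t := by
  have h := hasDerivAt_comp_update (hu.differentiable (by simp) (Pi.single i t)) i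
  have e : (fun s => u (Function.update (Pi.single i t : Fin m → ℝ) i s)) =
      fun s => u (Pi.single i s) := by
    funext s
    congr 1
    funext k
    by_cases hk : k = i
    · subst hk; simp
    · simp [hk]
  rwa [e, Pi.single_eq_same] at h

theorem eqOn_of_hasDerivAt_eq {r : ℝ} {f g f' : ℝ → ℝ}
    (hf : ∀ t ∈ Set.Icc 0 r, HasDerivAt f (f' t) t) (hg : ∀ t ∈ Set.Icc 0 r, HasDerivAt g (f' t) t)
    (h0 : f 0 = g 0) : ∀ t ∈ Set.Icc 0 r, f t = g t := by
  intro t ht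
  have h := constant_of_has_deriv_right_zero (f := fun t => f t - g t) (a := 0) (b := r)
    (fun t ht => ((hf t ht).sub (hg t ht)).continuousAt.continuousWithinAt)
    (fun t ht => by
      have := ((hf t ⟨ht.1, ht.2.le⟩).sub (hg t ⟨ht.1, ht.2.le⟩)).hasDerivWithinAt (s := Set.Ici t)
      rwa [sub_self] at this) t ht
  simp only [h0, sub_self] at h
  linarith

theorem pdw_eq_pd {r : ℝ} (hr : 0 < r) {u : (Fin m → ℝ) → ℝ} (hu : ContDiff ℝ ∞ u) (k : Fin m)
    {ξ : Fin m → ℝ} (hξ : ξ ∈ cube m r) : pdw r k u ξ = pd k u ξ :=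
  pdw_eq_of_hasFDerivAt hr (hu.differentiable (by simp) ξ).hasFDerivAt hξ

namespace JonasData.SmoothSolution

variable {S : JonasData m N} {δ r : ℝ} {β : NetIdx m N → NetIdx m N → (Fin m → ℝ) → ℝ}

theorem darbouxOn (h : S.SmoothSolution δ β) (hr : 0 < r) (hrδ : r ≤ δ) : DarbouxOn r β :=
  ⟨fun a c => (h.contDiff a c).contDiffOn, fun k a c ha hc ξ hξ => by
    rw [pdw_eq_pd hr (h.contDiff a c) k hξ,
      h.pd_eq ξ ((norm_le_of_mem_cube hr.le hξ).trans hrδ) a c k ha hc]⟩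

theorem eq_data (h : S.SmoothSolution δ β) {a c : NetIdx m N} {t : Fin m → ℝ} (ht : ‖t‖ ≤ δ)
    (hn : ∀ k, Sum.inl k ≠ a → Sum.inl k ≠ c → t k = 0) : β a c t = S.smooth a c t := by
  rw [← h.data t ht]
  congr 1
  funext k
  by_cases hk : Sum.inl k = a ∨ Sum.inl k = c
  · simp [keep, hk]
  · have := hk
    push Not at this
    simp [keep, hk, hn k this.1 this.2]

theorem norm_single_le {t : ℝ} (ht : t ∈ Set.Icc 0 δ) (i : Fin m) :
    ‖(Pi.single i t : Fin m → ℝ)‖ ≤ δ := by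
  rw [Pi.norm_single, Real.norm_of_nonneg ht.1]
  exact ht.2

theorem eq_data_left (h : S.SmoothSolution δ β) (i : Fin m) (c : NetIdx m N) {t : ℝ}
    (ht : t ∈ Set.Icc 0 δ) : β (.inl i) c (Pi.single i t) = S.smooth (.inl i) c (Pi.single i t) :=
  h.eq_data (norm_single_le ht i) fun k hk _ => by
    have : k ≠ i := fun e => hk (by rw [e])
    simp [this]

theorem eq_data_right (h : S.SmoothSolution δ β) (i : Fin m) (a : NetIdx m N) {t : ℝ}
    (ht : t ∈ Set.Icc 0 δ) : β a (.inl i) (Pi.single i t) = S.smooth a (.inl i) (Pi.single i t) :=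
  h.eq_data (norm_single_le ht i) fun k _ hk => by
    have : k ≠ i := fun e => hk (by rw [e])
    simp [this]

theorem eq_data_zero (h : S.SmoothSolution δ β) (hδ : 0 ≤ δ) (a c : NetIdx m N) :
    β a c 0 = S.smooth a c 0 :=
  h.eq_data (by simpa using hδ) fun _ _ _ => rfl

theorem hasDerivAt_axis (h : S.SmoothSolution δ β) (i : Fin m) {a c : NetIdx m N}
    (ha : Sum.inl i ≠ a) (hc : Sum.inl i ≠ c) {t : ℝ} (ht : t ∈ Set.Icc 0 δ) :
    HasDerivAt (fun s => β a c (Pi.single i s))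
      (β a (.inl i) (Pi.single i t) * β (.inl i) c (Pi.single i t)) t := by
  rw [← h.pd_eq _ (norm_single_le ht i) a c i ha hc]
  exact hasDerivAt_comp_single (h.contDiff a c) i t

theorem agreesOnAxes (h : S.SmoothSolution δ β) (hr : 0 ≤ r) (hrδ : r ≤ δ) :
    AgreesOnAxes r (rowVec β (.inr (some none))) S.X := by
  intro i t h0 h1
  ext l
  have hsub : ∀ t ∈ Set.Icc 0 r, t ∈ Set.Icc 0 δ := fun t ht => ⟨ht.1, ht.2.trans hrδ⟩
  refine eqOn_of_hasDerivAt_eq (r := r)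
    (f := fun t => β (.inr (some none)) (.inr (some (some l))) (Pi.single i t))
    (g := fun t => S.X i t l) (f' := fun t => deriv (fun s => S.X i s l) t)
    (fun t ht => ?_) (fun t ht => ?_) ?_ t ⟨h0, h1⟩
  · have e := h.hasDerivAt_axis i (a := .inr (some none)) (c := .inr (some (some l)))
      (by simp) (by simp) (hsub t ht)
    rw [h.eq_data_right i _ (hsub t ht), h.eq_data_left i _ (hsub t ht)] at e
    simpa [smooth] using e
  · exact ((S.contDiff_coord i l).differentiable (by simp) t).hasDerivAt
  · simp only [Pi.single_zero]
    rw [h.eq_data_zero (hr.trans hrδ), h.origin]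
    rfl

/-- On the i-th axis h_M and 1 - β_MM satisfy explicit linear equations. In particular the length
factor h_M/(1 - β_MM) of the transformation is `axisEP`. -/
theorem axis_values (h : S.SmoothSolution δ β) (i : Fin m) :
    ∀ t ∈ Set.Icc 0 δ, β (.inr (some none)) (.inr none) (Pi.single i t) =
        S.axisEH i (Pi.single i t) ∧
      1 - β (.inr none) (.inr none) (Pi.single i t) =
        S.axisEH i (Pi.single i t) * (S.axisEP i (Pi.single i t))⁻¹ := by
  have hH := expFam_contDiff i (contDiff_axis (S.hQ i) i)
  have hP := expFam_contDiff i (contDiff_axis (S.hCiM i) i)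
  have hHp : ∀ t, 0 < S.axisEH i t := fun t => expFam_pos _ _ t
  have hPp : ∀ t, 0 < S.axisEP i t := fun t => expFam_pos _ _ t
  have dH : ∀ t, HasDerivAt (fun t => S.axisEH i (Pi.single i t))
      (S.Q i t * S.axisEH i (Pi.single i t)) t := fun t => by
    have := hasDerivAt_comp_single hH i t
    rw [pd_expFam i (contDiff_axis (S.hQ i) i)] at this
    simpa [axisEH] using this
  have dP : ∀ t, HasDerivAt (fun t => S.axisEP i (Pi.single i t))
      (S.CiM i t * S.axisEP i (Pi.single i t)) t := fun t => by
    have := hasDerivAt_comp_single hP i t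
    rw [pd_expFam i (contDiff_axis (S.hCiM i) i)] at this
    simpa [axisEP] using this
  intro t ht
  have hδ : 0 ≤ δ := ht.1.trans ht.2
  have eH0 : S.axisEH i 0 = 1 := expFam_of_eq_zero _ rfl
  have eP0 : S.axisEP i 0 = 1 := expFam_of_eq_zero _ rfl
  constructor
  · refine eqOn_of_hasDerivAt_eq (r := δ)
      (f := fun t => β (.inr (some none)) (.inr none) (Pi.single i t))
      (fun t ht => ?_) (fun t _ => dH t) ?_ t ht
    · have e := h.hasDerivAt_axis i (a := .inr (some none)) (c := .inr none) (by simp) (by simp) ht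
      rw [h.eq_data_right i _ ht, h.eq_data_left i _ ht] at e
      simpa [smooth] using e
    · simp [h.eq_data_zero hδ, smooth, eH0]
  · refine eqOn_of_hasDerivAt_eq (r := δ)
      (f := fun t => 1 - β (.inr none) (.inr none) (Pi.single i t))
      (g := fun t => S.axisEH i (Pi.single i t) * (S.axisEP i (Pi.single i t))⁻¹)
      (f' := fun t => -(S.CM i t * (S.axisEP i (Pi.single i t))⁻¹ *
        (S.Q i t * S.axisEH i (Pi.single i t)))) (fun t ht => ?_) (fun t ht => ?_) ?_ t ht
    · have e := h.hasDerivAt_axis i (a := .inr none) (c := .inr none) (by simp) (by simp) ht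
      rw [h.eq_data_right i _ ht, h.eq_data_left i _ ht] at e
      simpa [smooth] using e.const_sub 1
    · refine ((dH t).mul ((dP t).inv (hPp _).ne')).congr_deriv ?_
      have := (hPp (Pi.single i t)).ne'
      rw [← h.quot t ht.1 ht.2 i, Pi.inv_apply]
      field_simp
      ring
    · simp [h.eq_data_zero hδ, smooth, eH0, eP0]

/-- By the equation of the curves, (X⁺ - X) divided by the length factor of M has derivative β_Mi
X'. The row w_M has the same derivative and initial value, and x⁺ - x is w_M times the length
factor. -/
theorem agreesOnAxes_transform (h : S.SmoothSolution δ β) (hr : 0 ≤ r) (hrδ : r ≤ δ)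
    {Xp : Fin m → ℝ → EuclideanSpace ℝ (Fin N)} (hXp : ∀ i, Differentiable ℝ (Xp i))
    (h0 : ∀ i, Xp i 0 = S.P + S.V)
    (hode : ∀ i, ∀ t ∈ Set.Icc 0 r, deriv (Xp i) t - deriv (S.X i) t =
      S.CM i t • deriv (S.X i) t + S.CiM i t • (Xp i t - S.X i t)) :
    AgreesOnAxes r (rowVec (fun a c t => darbouxStep 1 (.inr none) (fun a c => β a c t) a c)
      (.inr (some none))) Xp := by
  intro i t ht0 ht1
  ext l
  have hδ : 0 ≤ δ := hr.trans hrδ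
  have hsub : ∀ t ∈ Set.Icc 0 r, t ∈ Set.Icc 0 δ := fun t ht => ⟨ht.1, ht.2.trans hrδ⟩
  have hP := expFam_contDiff i (contDiff_axis (S.hCiM i) i)
  have hPp : ∀ t, 0 < S.axisEP i t := fun t => expFam_pos _ _ t
  have hHp : ∀ t, 0 < S.axisEH i t := fun t => expFam_pos _ _ t
  have eP0 : S.axisEP i 0 = 1 := expFam_of_eq_zero _ rfl
  have dP : ∀ t, HasDerivAt (fun t => S.axisEP i (Pi.single i t))
      (S.CiM i t * S.axisEP i (Pi.single i t)) t := fun t => by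
    have := hasDerivAt_comp_single hP i t
    rw [pd_expFam i (contDiff_axis (S.hCiM i) i)] at this
    simpa [axisEP] using this
  have hcoord : ∀ {f : ℝ → EuclideanSpace ℝ (Fin N)} {f'} {t : ℝ}, HasDerivAt f f' t →
      HasDerivAt (fun t => f t l) (f' l) t := fun hf =>
    (EuclideanSpace.proj (𝕜 := ℝ) l).hasFDerivAt.comp_hasDerivAt _ hf
  have hcur := h.agreesOnAxes hr hrδ i
  have key : ∀ t ∈ Set.Icc 0 r, (Xp i t - S.X i t) l * (S.axisEP i (Pi.single i t))⁻¹ =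
      β (.inr none) (.inr (some (some l))) (Pi.single i t) := by
    refine eqOn_of_hasDerivAt_eq
      (f' := fun t => S.CM i t * (S.axisEP i (Pi.single i t))⁻¹ * deriv (fun s => S.X i s l) t)
      (fun t ht => ?_) (fun t ht => ?_) ?_
    · have e1 := hcoord (((hXp i) t).hasDerivAt.sub
        ((S.hX i).differentiable (by simp) t).hasDerivAt)
      have e2 := e1.mul ((dP t).inv (hPp _).ne')
      refine e2.congr_deriv ?_
      have e3 : deriv (fun s => S.X i s l) t = deriv (S.X i) t l :=
        (hcoord ((S.hX i).differentiable (by simp) t).hasDerivAt).deriv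
      rw [hode i t ht, e3]
      have := (hPp (Pi.single i t)).ne'
      simp only [PiLp.add_apply, PiLp.sub_apply, PiLp.smul_apply, smul_eq_mul, Pi.sub_apply,
        Pi.inv_apply]
      field_simp
      ring
    · have e := h.hasDerivAt_axis i (a := .inr none) (c := .inr (some (some l)))
        (by simp) (by simp) (hsub t ht)
      rw [h.eq_data_right i _ (hsub t ht), h.eq_data_left i _ (hsub t ht)] at e
      simpa [smooth] using e
    · simp [h.eq_data_zero hδ, smooth, eP0, h0, h.origin]
  have ht := (⟨ht0, ht1⟩ : t ∈ Set.Icc 0 r)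
  have hk := key t ht
  have hx := congrArg (fun v : EuclideanSpace ℝ (Fin N) => v l) (hcur t ht0 ht1)
  obtain ⟨a1, a2⟩ := h.axis_values i t (hsub t ht)
  simp only [rowVec] at hx
  simp only [rowVec, darbouxStep]
  rw [hx, a1, ← hk, one_mul, one_mul, a2]
  have := (hPp (Pi.single i t)).ne'
  have := (hHp (Pi.single i t)).ne'
  simp only [PiLp.sub_apply]
  field_simp
  ring

/-- On the (i, j)-plane the quotients q_i = h_i/E_ij and q_j = h_j/E_ji of actual by expected Lamé
coefficients satisfy ∂_j q_i = C_ji (q_j - q_i) and the symmetric equation. They equal 1 on the axes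
of i and j respectively, so Goursat uniqueness gives q = 1. -/
theorem plane_values (h : S.SmoothSolution δ β) (hr : 0 < r) (hrδ : r ≤ δ) {i j : Fin m}
    (hij : i ≠ j) : ∀ t ∈ cube m r, (∀ k, k ≠ i → k ≠ j → t k = 0) →
      β (.inr (some none)) (.inl i) t = S.planeE i j t ∧
      β (.inr (some none)) (.inl j) t = S.planeE j i t := by
  -- The system for the quotients holds only on this plane section, which is compact and stable
  -- under scaling of coordinates.
  set T : Set (Fin m → ℝ) := cube m r ∩ {t | ∀ k, k ≠ i → k ≠ j → t k = 0} with hT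
  have hTc : IsCompact T := by
    refine (cube_isCompact r).inter_right ?_
    simp only [Set.ofPred_forall]
    exact isClosed_iInter fun k => isClosed_iInter fun _ => isClosed_iInter fun _ =>
      isClosed_eq (continuous_apply k) continuous_const
  have hE : ∀ {i j : Fin m}, i ≠ j → ContDiff ℝ ∞ (fun t => (S.planeE i j t)⁻¹) := fun hij =>
    (S.planeE_contDiff hij).inv fun t => (expFam_pos _ _ t).ne'
  have hq : ∀ {i j : Fin m}, i ≠ j → ContDiff ℝ ∞ (fun t => β (.inr (some none)) (.inl i) t *
      (S.planeE i j t)⁻¹) := fun hij => (h.contDiff _ _).mul (hE hij)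
  have hmem : ∀ t ∈ cube m r, ‖t‖ ≤ δ := fun t ht => (norm_le_of_mem_cube hr.le ht).trans hrδ
  have hder : ∀ {i j : Fin m}, i ≠ j → ∀ t ∈ cube m r, (∀ k, k ≠ i → k ≠ j → t k = 0) →
      pdw r j (fun t => β (.inr (some none)) (.inl i) t * (S.planeE i j t)⁻¹) t =
        S.C j i (t j, t i) * (β (.inr (some none)) (.inl j) t * (S.planeE j i t)⁻¹ -
          β (.inr (some none)) (.inl i) t * (S.planeE i j t)⁻¹) := by
    intro i j hij t ht hk
    have hd : (Sum.inl j : NetIdx m N) ≠ .inl i := fun e => hij (Sum.inl_injective e).symm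
    have e0 : S.planeE i j t ≠ 0 := (expFam_pos _ _ t).ne'
    have e1 : S.planeE j i t ≠ 0 := (expFam_pos _ _ t).ne'
    have hdw : DifferentiableWithinAt ℝ (S.planeE i j) (cube m r) t :=
      diffWithin_cube (S.planeE_contDiff hij).contDiffOn ht
    rw [pdw_mul hr ht (diffWithin_cube (h.contDiff _ _).contDiffOn ht)
      (diffWithin_cube (hE hij).contDiffOn ht), pdw_inv hr ht hdw e0,
      (h.darbouxOn hr hrδ).pdw_eq j _ _ (by simp) hd t ht,
      pdw_eq_pd hr (S.planeE_contDiff hij) j ht]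
    have e2 : pd j (S.planeE i j) t = S.C j i (t j, t i) * S.planeE i j t :=
      pd_expFam j (S.contDiff_C hij.symm) t
    rw [e2, h.eq_data (a := .inl j) (c := .inl i) (hmem t ht) fun k h1 h2 =>
      hk k (fun e => h2 (by rw [e])) (fun e => h1 (by rw [e]))]
    simp only [smooth, if_neg hij.symm]
    field_simp
    ring
  have haxis : ∀ {i j : Fin m}, ∀ t ∈ cube m r, (∀ k, k ≠ i → k ≠ j → t k = 0) → t j = 0 →
      β (.inr (some none)) (.inl i) t * (S.planeE i j t)⁻¹ = 1 := by
    intro i j t ht hk hj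
    have e1 : S.planeE i j t = 1 := expFam_of_eq_zero _ hj
    rw [e1, h.eq_data (hmem t ht) fun k _ h2 => ?_]
    · simp [smooth]
    · by_cases hkj : k = j
      · rw [hkj, hj]
      · exact hk k (fun e => h2 (by rw [e])) hkj
  obtain ⟨K, hK⟩ := (cube_isCompact (m := m) r).exists_bound_of_continuousOn
    ((S.contDiff_C hij).continuous.prodMk (S.contDiff_C hij.symm).continuous).continuousOn
  have hK1 : ∀ t ∈ cube m r, |S.C i j (t i, t j)| ≤ max K 0 := fun t ht =>
    ((norm_fst_le (S.C i j (t i, t j), S.C j i (t j, t i))).trans (hK t ht)).trans (le_max_left _ _)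
  have hK2 : ∀ t ∈ cube m r, |S.C j i (t j, t i)| ≤ max K 0 := fun t ht =>
    ((norm_snd_le (S.C i j (t i, t j), S.C j i (t j, t i))).trans (hK t ht)).trans (le_max_left _ _)
  have habs : ∀ a b : ℝ, |a - b| ≤ |a - 1| + |b - 1| := fun a b => by
    have := abs_sub_le a 1 b
    rwa [abs_sub_comm 1 b] at this
  have hdiff : ∀ {i j : Fin m}, i ≠ j → DifferentiableOn ℝ (fun t =>
      β (.inr (some none)) (.inl i) t * (S.planeE i j t)⁻¹ - 1) (cube m r) := fun hij =>
    ((hq hij).sub contDiff_const).differentiable (by simp) |>.differentiableOn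
  have hsub1 : ∀ {i j : Fin m} (_ : i ≠ j) (k : Fin m), ∀ t ∈ cube m r, pdw r k (fun t =>
      β (.inr (some none)) (.inl i) t * (S.planeE i j t)⁻¹ - 1) t = pdw r k (fun t =>
      β (.inr (some none)) (.inl i) t * (S.planeE i j t)⁻¹) t := fun hij k t ht => by
    rw [pdw, pdw, fderivWithin_sub_const]
  have hscale : ∀ t ∈ T, ∀ e : Finset (Fin m), ∀ μ ∈ Set.Icc (0 : ℝ) 1, scale e μ t ∈ T :=
    fun t ht e μ hμ => ⟨scale_mem_cube ht.1 e hμ, fun k h1 h2 => by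
      by_cases hk : k ∈ e <;> simp [scale, hk, ht.2 k h1 h2]⟩
  have main := goursat_eq_zero (S := Bool) hTc (fun t ht k => (ht.1 k).1)
    (fun s => if s then {j} else {i}) (fun t ht s μ hμ => hscale t ht _ μ hμ)
    (f := fun s t => if s then β (.inr (some none)) (.inl i) t * (S.planeE i j t)⁻¹ - 1 else
      β (.inr (some none)) (.inl j) t * (S.planeE j i t)⁻¹ - 1)
    (fun s => by
      cases s
      · exact (hdiff hij.symm).continuousOn.mono Set.inter_subset_left
      · exact (hdiff hij).continuousOn.mono Set.inter_subset_left)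
    (fun s t ht hs => by
      cases s
      · simp only [Bool.false_eq_true, if_false, Finset.mem_singleton, forall_eq] at hs ⊢
        rw [haxis t ht.1 (fun k h1 h2 => ht.2 k h2 h1) hs, sub_self]
      · simp only [if_true, Finset.mem_singleton, forall_eq] at hs ⊢
        rw [haxis t ht.1 ht.2 hs, sub_self])
    (le_max_right K 0) (fun s t ht μ hμ => by
      cases s
      · simp only [Bool.false_eq_true, if_false]
        have hm := hscale t ht {i} μ ⟨hμ.1, hμ.2.le⟩
        refine ⟨_, hasDerivWithinAt_scale (hdiff hij.symm) ht.1 {i} hμ, ?_⟩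
        rw [Finset.sum_singleton, hsub1 hij.symm i _ hm.1,
          hder hij.symm _ hm.1 (fun k h1 h2 => hm.2 k h2 h1), abs_mul, abs_mul,
          abs_of_nonneg (ht.1 i).1]
        have := mul_le_mul (hK1 _ hm.1) (habs (β (.inr (some none)) (.inl i) (scale {i} μ t) *
          (S.planeE i j (scale {i} μ t))⁻¹) (β (.inr (some none)) (.inl j) (scale {i} μ t) *
          (S.planeE j i (scale {i} μ t))⁻¹)) (abs_nonneg _) (le_max_right _ _)
        have := mul_le_mul_of_nonneg_left this (ht.1 i).1
        simp only [Fintype.sum_bool, Finset.sum_singleton, if_true, Bool.false_eq_true, if_false]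
        linarith
      · simp only [if_true]
        have hm := hscale t ht {j} μ ⟨hμ.1, hμ.2.le⟩
        refine ⟨_, hasDerivWithinAt_scale (hdiff hij) ht.1 {j} hμ, ?_⟩
        rw [Finset.sum_singleton, hsub1 hij j _ hm.1, hder hij _ hm.1 hm.2, abs_mul, abs_mul,
          abs_of_nonneg (ht.1 j).1]
        have := mul_le_mul (hK2 _ hm.1) (habs (β (.inr (some none)) (.inl j) (scale {j} μ t) *
          (S.planeE j i (scale {j} μ t))⁻¹) (β (.inr (some none)) (.inl i) (scale {j} μ t) *
          (S.planeE i j (scale {j} μ t))⁻¹)) (abs_nonneg _) (le_max_right _ _)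
        have := mul_le_mul_of_nonneg_left this (ht.1 j).1
        simp only [Fintype.sum_bool, Finset.sum_singleton, if_true, Bool.false_eq_true, if_false]
        linarith)
  intro t ht hk
  have m1 := main true t ⟨ht, hk⟩
  have m2 := main false t ⟨ht, hk⟩
  simp only [if_true, Bool.false_eq_true, if_false] at m1 m2
  have e0 : S.planeE i j t ≠ 0 := (expFam_pos _ _ t).ne'
  have e1 : S.planeE j i t ≠ 0 := (expFam_pos _ _ t).ne'
  constructor
  · rw [sub_eq_zero, mul_inv_eq_one₀ e0] at m1; exact m1
  · rw [sub_eq_zero, mul_inv_eq_one₀ e1] at m2; exact m2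

theorem agreesOnPlanes (h : S.SmoothSolution δ β) (hr : 0 < r) (hrδ : r ≤ δ) :
    AgreesOnPlanes r (fun i j ξ => β (.inr (some none)) (.inl i) ξ * β (.inl i) (.inl j) ξ /
        β (.inr (some none)) (.inl j) ξ) S.C := by
  intro i j hij s t hs0 hs1 ht0 ht1
  have hmem : (Pi.single i s + Pi.single j t : Fin m → ℝ) ∈ cube m r := by
    intro k
    by_cases hi : k = i
    · subst hi; simpa [hij] using ⟨hs0, hs1⟩
    · by_cases hj : k = j
      · subst hj; simpa [hi] using ⟨ht0, ht1⟩
      · simpa [hi, hj] using hr.le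
  have hsupp : ∀ k, k ≠ i → k ≠ j → (Pi.single i s + Pi.single j t : Fin m → ℝ) k = 0 :=
    fun k h1 h2 => by simp [h1, h2]
  obtain ⟨e1, e2⟩ := h.plane_values hr hrδ hij _ hmem hsupp
  have e3 := h.eq_data (a := .inl i) (c := .inl j) ((norm_le_of_mem_cube hr.le hmem).trans hrδ)
    fun k h1 h2 => hsupp k (fun e => h1 (by rw [e])) (fun e => h2 (by rw [e]))
  simp only
  rw [e1, e2, e3]
  have p0 : ∀ ξ, S.planeE i j ξ ≠ 0 := fun ξ => (expFam_pos _ _ ξ).ne'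
  have p1 : ∀ ξ, S.planeE j i ξ ≠ 0 := fun ξ => (expFam_pos _ _ ξ).ne'
  simp only [smooth, if_neg hij]
  have q0 := p0 (Pi.single i s + Pi.single j t)
  have q1 := p1 (Pi.single i s + Pi.single j t)
  have a1 : (Pi.single i s + Pi.single j t : Fin m → ℝ) i = s := by simp [hij]
  have a2 : (Pi.single i s + Pi.single j t : Fin m → ℝ) j = t := by simp [hij.symm]
  rw [a1, a2]
  field_simp

end JonasData.SmoothSolution

end SmoothAgreement

/-! ### Smooth coefficients of linear combinations. -/

section LinearAlgebra

theorem linearIndependent_three_unique {E : Type} [AddCommGroup E] [Module ℝ E] {a b c : E}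
    (h : LinearIndependent ℝ ![a, b, c]) {α β γ α' β' γ' : ℝ}
    (e : α • a + β • b + γ • c = α' • a + β' • b + γ' • c) : α = α' ∧ β = β' ∧ γ = γ' := by
  have h1 := Fintype.linearIndependent_iff.1 h ![α - α', β - β', γ - γ'] (by
    simp only [Fin.sum_univ_three, Matrix.cons_val_zero, Matrix.cons_val_one, Matrix.cons_val]
    rw [sub_smul, sub_smul, sub_smul, ← sub_eq_zero.2 e]
    abel)
  exact ⟨sub_eq_zero.1 (h1 0), sub_eq_zero.1 (h1 1), sub_eq_zero.1 (h1 2)⟩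

theorem linearIndependent_two_unique {E : Type} [AddCommGroup E] [Module ℝ E] {a b : E}
    (h : LinearIndependent ℝ ![a, b]) {α β α' β' : ℝ}
    (e : α • a + β • b = α' • a + β' • b) : α = α' ∧ β = β' := by
  have h1 := LinearIndependent.pair_iff.1 h (α - α') (β - β') (by
    rw [sub_smul, sub_smul, ← sub_eq_zero.2 e]
    abel)
  exact ⟨sub_eq_zero.1 h1.1, sub_eq_zero.1 h1.2⟩

theorem linearIndependent_pair_of_three {E : Type} [AddCommGroup E] [Module ℝ E] {a b c : E}
    (h : LinearIndependent ℝ ![a, b, c]) : LinearIndependent ℝ ![a, b] := by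
  refine LinearIndependent.pair_iff.2 fun s t e => ?_
  have := linearIndependent_three_unique h (α := s) (β := t) (γ := 0) (α' := 0) (β' := 0)
    (γ' := 0) (by simpa using e)
  exact ⟨this.1, this.2.1⟩

theorem linearIndependent_pair_of_three' {E : Type} [AddCommGroup E] [Module ℝ E] {a b c : E}
    (h : LinearIndependent ℝ ![a, b, c]) : LinearIndependent ℝ ![a, c] := by
  refine LinearIndependent.pair_iff.2 fun s t e => ?_
  have := linearIndependent_three_unique h (α := s) (β := 0) (γ := t) (α' := 0) (β' := 0)
    (γ' := 0) (by simpa using e)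
  exact ⟨this.1, this.2.2⟩

variable {E : Type} [NormedAddCommGroup E] [InnerProductSpace ℝ E]

theorem gram_pos {a b : E} (h : LinearIndependent ℝ ![a, b]) :
    0 < inner ℝ a a * inner ℝ b b - inner ℝ a b * inner ℝ a b := by
  set s := inner ℝ a a with hs
  set p := inner ℝ a b with hp
  have ha : a ≠ 0 := h.ne_zero 0
  have hs0 : 0 < s := real_inner_self_pos.2 ha
  have hne : s • b - p • a ≠ 0 := fun e => by
    have h1 := (LinearIndependent.pair_iff.1 h (-p) s (by
      rw [← e, neg_smul]; abel)).2
    exact hs0.ne' h1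
  have h2 : inner ℝ (s • b - p • a) (s • b - p • a) = s * (s * inner ℝ b b - p * p) := by
    simp only [inner_sub_left, inner_sub_right, inner_smul_left, inner_smul_right,
      real_inner_comm a b, ← hp, ← hs, RCLike.conj_to_real]
    ring
  have h3 : 0 < inner ℝ (s • b - p • a) (s • b - p • a) := real_inner_self_pos.2 hne
  rw [h2] at h3
  exact (mul_pos_iff_of_pos_left hs0).1 h3

/-- The coefficients of a smooth linear combination of independent smooth vectors are smooth. -/
theorem contDiffOn_coefficient {G : Type} [NormedAddCommGroup G] [NormedSpace ℝ G] {T : Set G}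
    {u v w : G → E} {α β : G → ℝ} {n : ℕ∞ω} (hu : ContDiffOn ℝ n u T) (hv : ContDiffOn ℝ n v T)
    (hw : ContDiffOn ℝ n w T) (hi : ∀ t ∈ T, LinearIndependent ℝ ![u t, v t])
    (he : ∀ t ∈ T, w t = α t • u t + β t • v t) :
    ContDiffOn ℝ n α T := by
  -- Cramer's rule with the Gram determinant of u and v.
  have h : ContDiffOn ℝ n (fun t => (inner ℝ (u t) (w t) * inner ℝ (v t) (v t) -
      inner ℝ (v t) (w t) * inner ℝ (u t) (v t)) *
      (inner ℝ (u t) (u t) * inner ℝ (v t) (v t) - inner ℝ (u t) (v t) * inner ℝ (u t) (v t))⁻¹) T :=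
    (((hu.inner ℝ hw).mul (hv.inner ℝ hv)).sub ((hv.inner ℝ hw).mul (hu.inner ℝ hv))).mul
      ((((hu.inner ℝ hu).mul (hv.inner ℝ hv)).sub ((hu.inner ℝ hv).mul (hu.inner ℝ hv))).inv
        fun t ht => (gram_pos (hi t ht)).ne')
  refine h.congr fun t ht => ?_
  have hg := (gram_pos (hi t ht)).ne'
  rw [he t ht]
  simp only [inner_add_right, inner_smul_right, real_inner_comm (u t) (v t)]
  rw [eq_mul_inv_iff_mul_eq₀ hg]
  ring

end LinearAlgebra

/-! ### Continuation in the size of the cube. -/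

section Continuation

variable {m : ℕ} {r : ℝ}

/-- Continuation in the size of the cube. -/
theorem eqOn_cube_of_continuation {F : Type} [NormedAddCommGroup F] {f g : (Fin m → ℝ) → F}
    (hr : 0 < r) (hf : ContinuousOn f (cube m r)) (hg : ContinuousOn g (cube m r))
    (h0 : f 0 = g 0) {δ : ℝ} (hδ : 0 < δ)
    (hstep : ∀ τ, 0 < τ → τ ≤ r → (∀ ξ ∈ cube m τ, ‖f ξ - g ξ‖ < δ) → Set.EqOn f g (cube m τ)) :
    Set.EqOn f g (cube m r) := by
  have huc := (cube_isCompact r).uniformContinuousOn_of_continuous (hf.sub hg)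
  obtain ⟨η, hη, hη'⟩ := Metric.uniformContinuousOn_iff.1 huc δ hδ
  -- The cube grows by η/2 each time: agreement on the smaller cube and uniform continuity keep the
  -- difference below δ on the larger one, where `hstep` restores agreement.
  have key : ∀ n : ℕ, Set.EqOn f g (cube m (min r (n * (η / 2)))) := by
    intro n
    induction n with
    | zero =>
      intro ξ hξ
      have : ξ = 0 := by
        funext i
        have := hξ i
        simp only [Nat.cast_zero, zero_mul, le_min_iff] at this
        exact le_antisymm this.2.2 this.1
      rw [this, h0]
    | succ n ih =>
      have hpos : 0 < min r ((n + 1 : ℕ) * (η / 2)) := lt_min hr (by positivity)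
      refine hstep _ hpos (min_le_left _ _) fun ξ hξ => ?_
      have hξr : ξ ∈ cube m r := cube_mono (min_le_left _ _) hξ
      -- Coordinatewise truncation to the smaller cube moves ξ by at most η/2.
      set ξ' : Fin m → ℝ := fun i => min (ξ i) (n * (η / 2)) with hξ'
      have hmem : ξ' ∈ cube m (min r (n * (η / 2))) := fun i =>
        ⟨le_min (hξ i).1 (by positivity), le_min ((min_le_left _ _).trans (hξr i).2)
          (min_le_right _ _)⟩
      have hd : dist ξ ξ' < η := by
        refine lt_of_le_of_lt ?_ (half_lt_self hη)
        refine (dist_pi_le_iff (by positivity)).2 fun i => ?_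
        have h1 := (hξ i).2.trans (min_le_right _ _)
        push_cast at h1
        rw [Real.dist_eq, abs_le]
        simp only [hξ']
        rcases min_cases (ξ i) (n * (η / 2)) with h | h <;> constructor <;> linarith
      have := hη' ξ hξr ξ' (cube_mono (min_le_left _ _) hmem) hd
      simp only [Pi.sub_apply] at this
      rwa [ih hmem, sub_self, dist_zero_right] at this
  obtain ⟨n, hn⟩ := exists_nat_ge (r / (η / 2))
  rw [div_le_iff₀ (by positivity)] at hn
  have := key n
  rwa [min_eq_left hn] at this

variable {F : Type} [NormedAddCommGroup F] [NormedSpace ℝ F]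

theorem pdw_mono {τ : ℝ} (hτ : 0 < τ) (hτr : τ ≤ r) {u : (Fin m → ℝ) → F} {k : Fin m}
    {ξ : Fin m → ℝ} (hξ : ξ ∈ cube m τ) (hu : DifferentiableWithinAt ℝ u (cube m r) ξ) :
    pdw τ k u ξ = pdw r k u ξ := by
  rw [pdw, pdw, (hu.hasFDerivWithinAt.mono (cube_mono hτr)).fderivWithin
    (cube_uniqueDiffOn hτ ξ hξ)]

theorem isConjugateNetWith_mono {N : ℕ} {τ : ℝ} (hτ : 0 < τ) (hτr : τ ≤ r)
    {x : (Fin m → ℝ) → EuclideanSpace ℝ (Fin N)} {c : Fin m → Fin m → (Fin m → ℝ) → ℝ}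
    (h : IsConjugateNetWith r x c) : IsConjugateNetWith τ x c := by
  have hr := hτ.trans_le hτr
  have h1 : ∀ k, ∀ ξ ∈ cube m τ, pdw τ k x ξ = pdw r k x ξ := fun k ξ hξ =>
    pdw_mono hτ hτr hξ (diffWithin_cube h.1 (cube_mono hτr hξ))
  refine ⟨h.1.mono (cube_mono hτr), fun i j hij ξ hξ => ?_⟩
  have h2 := h.2 i j hij ξ (cube_mono hτr hξ)
  change pdw τ i (pdw τ j x) ξ = _ • pdw τ i x ξ + _ • pdw τ j x ξ
  rw [pdw_congr (h1 j) hξ, pdw_mono hτ hτr hξ (diffWithin_cube (contDiffOn_pdw hr h.1)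
    (cube_mono hτr hξ)), h1 i ξ hξ, h1 j ξ hξ]
  exact h2

theorem hasDerivWithinAt_axis {u : (Fin m → ℝ) → F} (hu : DifferentiableOn ℝ u (cube m r))
    (i : Fin m) {t : ℝ} (ht : t ∈ Set.Icc 0 r) :
    HasDerivWithinAt (fun s => u (Pi.single i s)) (pdw r i u (Pi.single i t)) (Set.Icc 0 r) t := by
  have h1 : HasDerivAt (fun s : ℝ => (Pi.single i s : Fin m → ℝ)) (Pi.single i 1) t := by
    refine hasDerivAt_pi.2 fun k => ?_
    by_cases hk : k = i
    · subst hk; simpa using hasDerivAt_id' t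
    · simpa [hk] using hasDerivAt_const t (0 : ℝ)
  exact (hu _ (single_mem_cube ht.1 ht.2 i)).hasFDerivWithinAt.comp_hasDerivWithinAt t
    h1.hasDerivWithinAt fun s hs => single_mem_cube hs.1 hs.2 i

theorem pdw_axis (hr : 0 < r) {u : (Fin m → ℝ) → F} (hu : DifferentiableOn ℝ u (cube m r))
    {i : Fin m} {γ : ℝ → F} (hγ : Differentiable ℝ γ)
    (h : ∀ t, 0 ≤ t → t ≤ r → u (Pi.single i t) = γ t) {t : ℝ} (ht : t ∈ Set.Icc 0 r) :
    pdw r i u (Pi.single i t) = deriv γ t := by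
  have h1 := (hasDerivWithinAt_axis hu i ht).congr (f₁ := γ) (fun s hs => (h s hs.1 hs.2).symm)
    (h t ht.1 ht.2).symm
  have h2 := (hγ t).hasDerivAt.hasDerivWithinAt (s := Set.Icc 0 r)
  exact (uniqueDiffOn_Icc hr t ht).eq_deriv _ h1 h2

end Continuation

/-! ### The closed system of a conjugate net in general position. -/

section ConjugateUniqueness

variable {m N : ℕ} {r : ℝ} {y : (Fin m → ℝ) → EuclideanSpace ℝ (Fin N)}
  {d : Fin m → Fin m → (Fin m → ℝ) → ℝ}

theorem conjugateNet_pdw_pdw (h : IsConjugateNetWith r y d) {i j : Fin m} (hij : i ≠ j)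
    {ξ : Fin m → ℝ} (hξ : ξ ∈ cube m r) : pdw r i (pdw r j y) ξ =
      d j i ξ • pdw r i y ξ + d i j ξ • pdw r j y ξ := h.2 i j hij ξ hξ

theorem eq_single_add_single {i j : Fin m} (h : ∀ k, k = i ∨ k = j) (hij : i ≠ j)
    (ξ : Fin m → ℝ) : Pi.single i (ξ i) + Pi.single j (ξ j) = ξ := by
  funext k
  rcases h k with rfl | rfl
  · simp [hij]
  · simp [hij.symm]

/-- The rotation coefficients of a conjugate net in general position are smooth. -/
theorem contDiffOn_rotation (hr : 0 < r) (h : IsConjugateNetWith r y d)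
    {C : Fin m → Fin m → ℝ × ℝ → ℝ} (hC : ∀ i j, i ≠ j → ContDiff ℝ ∞ (C i j))
    (hd : AgreesOnPlanes r d C)
    (hind : ∀ ξ ∈ cube m r, ∀ i j k, i ≠ j → j ≠ k → i ≠ k →
      LinearIndependent ℝ ![pdw r i y ξ, pdw r j y ξ, pdw r k y ξ])
    {i j : Fin m} (hij : i ≠ j) : ContDiffOn ℝ ∞ (d i j) (cube m r) := by
  by_cases hk : ∃ k, k ≠ i ∧ k ≠ j
  · obtain ⟨k, hki, hkj⟩ := hk
    refine contDiffOn_coefficient (u := pdw r j y) (v := pdw r i y) (w := pdw r i (pdw r j y))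
      (β := d j i) (contDiffOn_pdw hr h.1) (contDiffOn_pdw hr h.1)
      (contDiffOn_pdw hr (contDiffOn_pdw hr h.1))
      (fun ξ hξ => linearIndependent_pair_of_three (hind ξ hξ j i k hij.symm hki.symm hkj.symm))
      fun ξ hξ => ?_
    rw [conjugateNet_pdw_pdw h hij hξ, add_comm]
  -- Without a third direction the independence hypothesis is empty, but then the (i, j)-plane is
  -- the whole cube and the coefficient is prescribed.
  · push Not at hk
    have hk' : ∀ k, k = i ∨ k = j := fun k => by
      by_cases e : k = i
      · exact Or.inl e
      · exact Or.inr (hk k e)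
    have : ContDiff ℝ ∞ (fun ξ : Fin m → ℝ => C i j (ξ i, ξ j)) := (hC i j hij).comp (by fun_prop)
    refine this.contDiffOn.congr fun ξ hξ => ?_
    have := hd i j hij (ξ i) (ξ j) (hξ i).1 (hξ i).2 (hξ j).1 (hξ j).2
    rwa [eq_single_add_single hk' hij] at this

theorem pdw_pdw_pdw (hr : 0 < r) (h : IsConjugateNetWith r y d)
    (hs : ∀ i j, i ≠ j → ContDiffOn ℝ ∞ (d i j) (cube m r)) {i j k : Fin m} (hij : i ≠ j)
    (hki : k ≠ i) (hkj : k ≠ j) {ξ : Fin m → ℝ} (hξ : ξ ∈ cube m r) :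
    pdw r k (pdw r i (pdw r j y)) ξ =
      (pdw r k (d j i) ξ + d j i ξ * d k i ξ) • pdw r i y ξ +
      (pdw r k (d i j) ξ + d i j ξ * d k j ξ) • pdw r j y ξ +
      (d j i ξ * d i k ξ + d i j ξ * d j k ξ) • pdw r k y ξ := by
  have hv : ∀ i, DifferentiableWithinAt ℝ (pdw r i y) (cube m r) ξ := fun i =>
    diffWithin_cube (contDiffOn_pdw hr h.1) hξ
  have hdd : ∀ {i j}, i ≠ j → DifferentiableWithinAt ℝ (d i j) (cube m r) ξ := fun hij =>
    diffWithin_cube (hs _ _ hij) hξ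
  rw [pdw_congr (fun ξ hξ => conjugateNet_pdw_pdw h hij hξ) hξ,
    pdw_add hr hξ ((hdd hij.symm).fun_smul (hv i)) ((hdd hij).fun_smul (hv j)),
    pdw_smul hr hξ (hdd hij.symm) (hv i), pdw_smul hr hξ (hdd hij) (hv j), conjugateNet_pdw_pdw h hki hξ,
    conjugateNet_pdw_pdw h hkj hξ]
  module

/-- The rotation coefficients of a conjugate net in general position satisfy a closed system. -/
theorem pdw_rotation (hr : 0 < r) (h : IsConjugateNetWith r y d)
    (hs : ∀ i j, i ≠ j → ContDiffOn ℝ ∞ (d i j) (cube m r))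
    (hind : ∀ ξ ∈ cube m r, ∀ i j k, i ≠ j → j ≠ k → i ≠ k →
      LinearIndependent ℝ ![pdw r i y ξ, pdw r j y ξ, pdw r k y ξ])
    {i j k : Fin m} (hij : i ≠ j) (hki : k ≠ i) (hkj : k ≠ j) {ξ : Fin m → ℝ}
    (hξ : ξ ∈ cube m r) :
    pdw r k (d i j) ξ = d k i ξ * d i j ξ + d i k ξ * d k j ξ - d i j ξ * d k j ξ := by
  have hv : ContDiffOn ℝ ∞ (pdw r i y) (cube m r) := contDiffOn_pdw hr h.1
  have e1 := pdw_pdw_pdw hr h hs (i := i) (j := j) (k := k) hij hki hkj hξ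
  have e2 := pdw_pdw_pdw hr h hs (i := i) (j := k) (k := j) hki.symm hij.symm hkj.symm hξ
  -- Third derivatives are symmetric; comparing the coefficients of ∂_j y in the two expansions
  -- gives the equation for ∂_k d_ij.
  have e3 : pdw r k (pdw r i (pdw r j y)) ξ = pdw r j (pdw r i (pdw r k y)) ξ := by
    rw [pdw_congr (fun ξ hξ => pdw_comm hr h.1 i j hξ) hξ, pdw_comm hr hv k j hξ,
      pdw_congr (fun ξ hξ => pdw_comm hr h.1 k i hξ) hξ]
  rw [e1, e2] at e3
  have e4 := (linearIndependent_three_unique (hind ξ hξ i j k hij hkj.symm hki.symm)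
    (α := pdw r k (d j i) ξ + d j i ξ * d k i ξ) (β := pdw r k (d i j) ξ + d i j ξ * d k j ξ)
    (γ := d j i ξ * d i k ξ + d i j ξ * d j k ξ)
    (α' := pdw r j (d k i) ξ + d k i ξ * d j i ξ) (β' := d k i ξ * d i j ξ + d i k ξ * d k j ξ)
    (γ' := pdw r j (d i k) ξ + d i k ξ * d j k ξ) (by rw [e3]; abel)).2.1
  linarith

/-- The unknowns of the system for a conjugate net. -/
noncomputable def netUnknown (r : ℝ) (y : (Fin m → ℝ) → EuclideanSpace ℝ (Fin N))
    (d : Fin m → Fin m → (Fin m → ℝ) → ℝ) :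
    Fin N ⊕ (Fin m × Fin N) ⊕ (Fin m × Fin m) → (Fin m → ℝ) → ℝ
  | .inl l => fun t => y t l
  | .inr (.inl (i, l)) => fun t => pdw r i y t l
  | .inr (.inr (i, j)) => fun t => if i = j then 0 else d i j t

/-- The directions in which the unknowns have prescribed derivatives. -/
def netDirections : Fin N ⊕ (Fin m × Fin N) ⊕ (Fin m × Fin m) → Finset (Fin m)
  | .inl _ => Finset.univ
  | .inr (.inl (i, _)) => Finset.univ.filter fun k => k ≠ i
  | .inr (.inr (i, j)) => Finset.univ.filter fun k => i ≠ j ∧ k ≠ i ∧ k ≠ j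

/-- The right hand sides of the system for a conjugate net. -/
def netField (k : Fin m) : Fin N ⊕ (Fin m × Fin N) ⊕ (Fin m × Fin m) →
    (Fin N ⊕ (Fin m × Fin N) ⊕ (Fin m × Fin m) → ℝ) → ℝ
  | .inl l => fun z => z (.inr (.inl (k, l)))
  | .inr (.inl (i, l)) => fun z => z (.inr (.inr (i, k))) * z (.inr (.inl (k, l))) +
      z (.inr (.inr (k, i))) * z (.inr (.inl (i, l)))
  | .inr (.inr (i, j)) => fun z => z (.inr (.inr (k, i))) * z (.inr (.inr (i, j))) +
      z (.inr (.inr (i, k))) * z (.inr (.inr (k, j))) -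
      z (.inr (.inr (i, j))) * z (.inr (.inr (k, j)))

theorem netField_contDiff (k : Fin m) (s : Fin N ⊕ (Fin m × Fin N) ⊕ (Fin m × Fin m)) :
    ContDiff ℝ 1 (netField k s) := by
  rcases s with l | ⟨i, l⟩ | ⟨i, j⟩ <;> simp only [netField] <;> fun_prop

theorem netUnknown_contDiffOn (hr : 0 < r) (h : IsConjugateNetWith r y d)
    (hs : ∀ i j, i ≠ j → ContDiffOn ℝ ∞ (d i j) (cube m r))
    (s : Fin N ⊕ (Fin m × Fin N) ⊕ (Fin m × Fin m)) :
    ContDiffOn ℝ ∞ (netUnknown r y d s) (cube m r) := by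
  rcases s with l | ⟨i, l⟩ | ⟨i, j⟩ <;> simp only [netUnknown]
  · exact contDiffOn_euclidean.1 h.1 l
  · exact contDiffOn_euclidean.1 (contDiffOn_pdw hr h.1) l
  · by_cases hij : i = j
    · simp only [hij, if_true]; exact contDiffOn_const
    · simp only [hij, if_false]; exact hs i j hij

theorem pdw_netUnknown (hr : 0 < r) (h : IsConjugateNetWith r y d)
    (hs : ∀ i j, i ≠ j → ContDiffOn ℝ ∞ (d i j) (cube m r))
    (hind : ∀ ξ ∈ cube m r, ∀ i j k, i ≠ j → j ≠ k → i ≠ k →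
      LinearIndependent ℝ ![pdw r i y ξ, pdw r j y ξ, pdw r k y ξ])
    (s : Fin N ⊕ (Fin m × Fin N) ⊕ (Fin m × Fin m)) : ∀ k ∈ netDirections s, ∀ t ∈ cube m r,
      pdw r k (netUnknown r y d s) t = netField k s fun s => netUnknown r y d s t := by
  intro k hk t ht
  rcases s with l | ⟨i, l⟩ | ⟨i, j⟩
  · simp only [netUnknown, netField]
    exact (pdw_apply hr ht (diffWithin_cube h.1 ht) l).symm
  · simp only [netDirections, Finset.mem_filter, Finset.mem_univ, true_and] at hk
    simp only [netUnknown, netField, if_neg hk, if_neg (Ne.symm hk)]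
    rw [← pdw_apply hr ht (diffWithin_cube (contDiffOn_pdw hr h.1) ht) l, conjugateNet_pdw_pdw h hk ht]
    rfl
  · simp only [netDirections, Finset.mem_filter, Finset.mem_univ, true_and] at hk
    obtain ⟨hij, hki, hkj⟩ := hk
    simp only [netUnknown, netField, if_neg hij, if_neg hki, if_neg hkj, if_neg hki.symm]
    exact pdw_rotation hr h hs hind hij hki hkj ht

/-- Two conjugate nets in general position with the same data agree. -/
theorem conjugateNet_unique (hr : 0 < r) {y' : (Fin m → ℝ) → EuclideanSpace ℝ (Fin N)}
    {d' : Fin m → Fin m → (Fin m → ℝ) → ℝ} (hm : 0 < m)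
    (h : IsConjugateNetWith r y d) (h' : IsConjugateNetWith r y' d')
    {X : Fin m → ℝ → EuclideanSpace ℝ (Fin N)} (hX : ∀ i, Differentiable ℝ (X i))
    {C : Fin m → Fin m → ℝ × ℝ → ℝ} (hC : ∀ i j, i ≠ j → ContDiff ℝ ∞ (C i j))
    (hax : AgreesOnAxes r y X) (hax' : AgreesOnAxes r y' X)
    (hd : AgreesOnPlanes r d C) (hd' : AgreesOnPlanes r d' C)
    (hind : ∀ ξ ∈ cube m r, ∀ i j k, i ≠ j → j ≠ k → i ≠ k →
      LinearIndependent ℝ ![pdw r i y ξ, pdw r j y ξ, pdw r k y ξ])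
    (hind' : ∀ ξ ∈ cube m r, ∀ i j k, i ≠ j → j ≠ k → i ≠ k →
      LinearIndependent ℝ ![pdw r i y' ξ, pdw r j y' ξ, pdw r k y' ξ]) :
    Set.EqOn y y' (cube m r) := by
  have hs : ∀ i j, i ≠ j → ContDiffOn ℝ ∞ (d i j) (cube m r) := fun i j hij =>
    contDiffOn_rotation hr h hC hd hind hij
  have hs' : ∀ i j, i ≠ j → ContDiffOn ℝ ∞ (d' i j) (cube m r) := fun i j hij =>
    contDiffOn_rotation hr h' hC hd' hind' hij
  have main := goursat_unique netDirections netField_contDiff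
    (netUnknown_contDiffOn hr h hs) (netUnknown_contDiffOn hr h' hs')
    (pdw_netUnknown hr h hs hind) (pdw_netUnknown hr h' hs' hind') ?_
  · intro ξ hξ
    ext l
    exact main (.inl l) ξ hξ
  intro s t ht h0
  rcases s with l | ⟨i, l⟩ | ⟨i, j⟩
  · have : t = Pi.single ⟨0, hm⟩ 0 := by
      funext k
      rw [Pi.single_zero]
      exact h0 k (Finset.mem_univ k)
    simp only [netUnknown]
    rw [this, hax _ 0 le_rfl hr.le, hax' _ 0 le_rfl hr.le]
  · have : t = Pi.single i (t i) := by
      funext k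
      by_cases hk : k = i
      · subst hk; simp
      · rw [h0 k (by simp [netDirections, hk])]; simp [hk]
    simp only [netUnknown]
    rw [this, pdw_axis hr (h.1.differentiableOn (by simp)) (hX i) (hax i) (ht i),
      pdw_axis hr (h'.1.differentiableOn (by simp)) (hX i) (hax' i) (ht i)]
  · simp only [netUnknown]
    by_cases hij : i = j
    · simp [hij]
    · have : t = Pi.single i (t i) + Pi.single j (t j) := by
        funext k
        by_cases hki : k = i
        · subst hki; simp [hij]
        · by_cases hkj : k = j
          · subst hkj; simp [hki]
          · rw [h0 k (by simp [netDirections, hij, hki, hkj])]; simp [hki, hkj]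
      rw [if_neg hij, if_neg hij, this, hd i j hij _ _ (ht i).1 (ht i).2 (ht j).1 (ht j).2,
        hd' i j hij _ _ (ht i).1 (ht i).2 (ht j).1 (ht j).2]

end ConjugateUniqueness

/-! ### The closed system of a Jonas transform in general position. -/

section JonasUniqueness

variable {m N : ℕ} {r : ℝ} {x y : (Fin m → ℝ) → EuclideanSpace ℝ (Fin N)}
  {c e : Fin m → Fin m → (Fin m → ℝ) → ℝ} {a b : Fin m → (Fin m → ℝ) → ℝ}

/-- A Jonas transform in general position. -/
structure JonasTransformWith (r : ℝ) (x y : (Fin m → ℝ) → EuclideanSpace ℝ (Fin N))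
    (c e : Fin m → Fin m → (Fin m → ℝ) → ℝ) (a b : Fin m → (Fin m → ℝ) → ℝ) : Prop where
  pos : 0 < r
  net : IsConjugateNetWith r x c
  net' : IsConjugateNetWith r y e
  smooth : ∀ i j, i ≠ j → ContDiffOn ℝ ∞ (c i j) (cube m r)
  eqn : ∀ i, ∀ ξ ∈ cube m r,
    pdw r i y ξ - pdw r i x ξ = a i ξ • pdw r i x ξ + b i ξ • (y ξ - x ξ)
  ind : ∀ ξ ∈ cube m r, ∀ i j, i ≠ j →
    LinearIndependent ℝ ![pdw r i x ξ, pdw r j x ξ, y ξ - x ξ]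
  par : ∀ ξ ∈ cube m r, ∀ i, LinearIndependent ℝ ![y ξ - x ξ, pdw r i y ξ]
  two : ∀ i : Fin m, ∃ j, j ≠ i

namespace JonasTransformWith

theorem pair (h : JonasTransformWith r x y c e a b) {ξ : Fin m → ℝ} (hξ : ξ ∈ cube m r)
    (i : Fin m) : LinearIndependent ℝ ![pdw r i x ξ, y ξ - x ξ] := by
  obtain ⟨j, hj⟩ := h.two i
  exact linearIndependent_pair_of_three' (h.ind ξ hξ i j hj.symm)

theorem eqn' (h : JonasTransformWith r x y c e a b) (i : Fin m) {ξ : Fin m → ℝ}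
    (hξ : ξ ∈ cube m r) : pdw r i y ξ = (1 + a i ξ) • pdw r i x ξ + b i ξ • (y ξ - x ξ) := by
  rw [add_smul, one_smul, add_assoc, ← h.eqn i ξ hξ]
  abel

/-- Otherwise ∂_i y would be a multiple of y - x. -/
theorem one_add_ne_zero (h : JonasTransformWith r x y c e a b) (i : Fin m) {ξ : Fin m → ℝ}
    (hξ : ξ ∈ cube m r) : 1 + a i ξ ≠ 0 := fun h0 => by
  have h1 := h.eqn' i hξ
  rw [h0, zero_smul, zero_add] at h1
  have := (linearIndependent_two_unique (h.par ξ hξ i) (α := b i ξ) (β := 0) (α' := 0) (β' := 1)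
    (by rw [h1]; simp)).2
  exact zero_ne_one this

theorem contDiffOn_a (h : JonasTransformWith r x y c e a b) (i : Fin m) :
    ContDiffOn ℝ ∞ (a i) (cube m r) :=
  contDiffOn_coefficient (contDiffOn_pdw h.pos h.net.1) (h.net'.1.sub h.net.1)
    ((contDiffOn_pdw h.pos h.net'.1).sub (contDiffOn_pdw h.pos h.net.1))
    (fun _ hξ => h.pair hξ i) (h.eqn i)

theorem contDiffOn_b (h : JonasTransformWith r x y c e a b) (i : Fin m) :
    ContDiffOn ℝ ∞ (b i) (cube m r) :=
  contDiffOn_coefficient (h.net'.1.sub h.net.1) (contDiffOn_pdw h.pos h.net.1)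
    ((contDiffOn_pdw h.pos h.net'.1).sub (contDiffOn_pdw h.pos h.net.1))
    (fun _ hξ => LinearIndependent.pair_symm_iff.1 (h.pair hξ i))
    (fun ξ hξ => by rw [add_comm]; exact h.eqn i ξ hξ)

theorem pdw_pdw (h : JonasTransformWith r x y c e a b) {i j : Fin m} (hij : i ≠ j)
    {ξ : Fin m → ℝ} (hξ : ξ ∈ cube m r) : pdw r j (pdw r i y) ξ =
      (pdw r j (a i) ξ + (1 + a i ξ) * c j i ξ) • pdw r i x ξ +
      ((1 + a i ξ) * c i j ξ + b i ξ * a j ξ) • pdw r j x ξ +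
      (pdw r j (b i) ξ + b i ξ * b j ξ) • (y ξ - x ξ) := by
  have hr := h.pos
  have ha := diffWithin_cube (h.contDiffOn_a i) hξ
  have hb := diffWithin_cube (h.contDiffOn_b i) hξ
  have hv := diffWithin_cube (contDiffOn_pdw (k := i) hr h.net.1) hξ
  have hx := diffWithin_cube h.net.1 hξ
  have hy := diffWithin_cube h.net'.1 hξ
  have e1 : pdw r j (fun ξ => 1 + a i ξ) ξ = pdw r j (a i) ξ := by
    rw [pdw_add hr hξ (differentiableWithinAt_const _) ha,
      pdw_eq_of_hasFDerivAt hr (hasFDerivAt_const _ _) hξ]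
    simp
  rw [pdw_congr (fun ξ hξ => h.eqn' i hξ) hξ,
    pdw_add hr hξ ((ha.const_add 1).fun_smul hv) (hb.fun_smul (hy.fun_sub hx)),
    pdw_smul hr hξ (ha.const_add 1) hv, pdw_smul hr hξ hb (hy.fun_sub hx), pdw_sub hr hξ hy hx,
    e1, conjugateNet_pdw_pdw h.net hij.symm hξ, h.eqn j ξ hξ]
  module

/-- Symmetry of the mixed derivative of y gives the first identity; the conjugate net equation of y
gives the other three. All are coefficients with respect to the basis ∂_i x, ∂_j x, y - x. -/
theorem coefficients (h : JonasTransformWith r x y c e a b) {i j : Fin m} (hij : i ≠ j)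
    {ξ : Fin m → ℝ} (hξ : ξ ∈ cube m r) :
    pdw r j (a i) ξ + (1 + a i ξ) * c j i ξ = (1 + a j ξ) * c j i ξ + b j ξ * a i ξ ∧
    pdw r j (a i) ξ + (1 + a i ξ) * c j i ξ = e j i ξ * (1 + a i ξ) ∧
    (1 + a i ξ) * c i j ξ + b i ξ * a j ξ = e i j ξ * (1 + a j ξ) ∧
    pdw r j (b i) ξ + b i ξ * b j ξ = e i j ξ * b j ξ + e j i ξ * b i ξ := by
  have h1 := h.pdw_pdw hij hξ
  have h2 := h.pdw_pdw hij.symm hξ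
  rw [pdw_comm h.pos h.net'.1 i j hξ] at h2
  have h3 := conjugateNet_pdw_pdw h.net' hij.symm hξ
  rw [h.eqn' i hξ, h.eqn' j hξ] at h3
  have hI := h.ind ξ hξ i j hij
  have e1 := linearIndependent_three_unique hI (h1.symm.trans (h2.trans
    (add_right_cancel_iff.2 (add_comm _ _))))
  have e2 := linearIndependent_three_unique hI (α' := e j i ξ * (1 + a i ξ))
    (β' := e i j ξ * (1 + a j ξ)) (γ' := e i j ξ * b j ξ + e j i ξ * b i ξ)
    (h1.symm.trans (h3.trans (by module)))
  exact ⟨e1.1, e2.1, e2.2.1, e2.2.2⟩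

theorem pdw_a (h : JonasTransformWith r x y c e a b) {i j : Fin m} (hij : i ≠ j)
    {ξ : Fin m → ℝ} (hξ : ξ ∈ cube m r) :
    pdw r j (a i) ξ = (a j ξ - a i ξ) * c j i ξ + b j ξ * a i ξ := by
  linarith [(h.coefficients hij hξ).1]

/-- The rotation coefficients of y are eliminated by dividing by 1 + a_i and 1 + a_j. Taking (1 +
a_i)⁻¹ as a further unknown makes the whole system polynomial. -/
theorem pdw_b (h : JonasTransformWith r x y c e a b) {i j : Fin m} (hij : i ≠ j)
    {ξ : Fin m → ℝ} (hξ : ξ ∈ cube m r) : pdw r j (b i) ξ = -(b i ξ * b j ξ) +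
      ((1 + a j ξ) * c j i ξ + b j ξ * a i ξ) * (1 + a i ξ)⁻¹ * b i ξ +
      ((1 + a i ξ) * c i j ξ + b i ξ * a j ξ) * (1 + a j ξ)⁻¹ * b j ξ := by
  obtain ⟨h1, h2, h3, h4⟩ := h.coefficients hij hξ
  have hi := h.one_add_ne_zero i hξ
  have hj := h.one_add_ne_zero j hξ
  rw [← h1, h2, h3, mul_assoc (e j i ξ), mul_inv_cancel₀ hi, mul_assoc (e i j ξ),
    mul_inv_cancel₀ hj]
  linarith

end JonasTransformWith

/-- The indices of the unknowns of the system for a Jonas transform. -/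
abbrev JonasIdx (m N : ℕ) : Type :=
  Fin N ⊕ Fin m ⊕ Fin m ⊕ Fin m ⊕ (Fin m × Fin N) ⊕ (Fin m × Fin m)

/-- The unknowns of the system for a Jonas transform. -/
noncomputable def jonasUnknown (r : ℝ) (x y : (Fin m → ℝ) → EuclideanSpace ℝ (Fin N))
    (c : Fin m → Fin m → (Fin m → ℝ) → ℝ) (a b : Fin m → (Fin m → ℝ) → ℝ) :
    JonasIdx m N → (Fin m → ℝ) → ℝ
  | .inl l => fun t => y t l - x t l
  | .inr (.inl i) => a i
  | .inr (.inr (.inl i)) => b i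
  | .inr (.inr (.inr (.inl i))) => fun t => (1 + a i t)⁻¹
  | .inr (.inr (.inr (.inr (.inl (i, l))))) => fun t => pdw r i x t l
  | .inr (.inr (.inr (.inr (.inr (i, j))))) => fun t => if i = j then 0 else c i j t

/-- The directions in which the unknowns have prescribed derivatives. -/
def jonasDirections : JonasIdx m N → Finset (Fin m)
  | .inl _ => Finset.univ
  | .inr (.inl i) => Finset.univ.filter fun k => k ≠ i
  | .inr (.inr (.inl i)) => Finset.univ.filter fun k => k ≠ i
  | .inr (.inr (.inr (.inl i))) => Finset.univ.filter fun k => k ≠ i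
  -- The remaining unknowns belong to x, which both transforms share, so nothing has to be
  -- propagated.
  | _ => ∅

/-- The right hand sides of the system for a Jonas transform. -/
def jonasField (k : Fin m) : JonasIdx m N → (JonasIdx m N → ℝ) → ℝ
  | .inl l => fun z => z (.inr (.inl k)) * z (.inr (.inr (.inr (.inr (.inl (k, l)))))) +
      z (.inr (.inr (.inl k))) * z (.inl l)
  | .inr (.inl i) => fun z => (z (.inr (.inl k)) - z (.inr (.inl i))) *
      z (.inr (.inr (.inr (.inr (.inr (k, i)))))) + z (.inr (.inr (.inl k))) * z (.inr (.inl i))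
  | .inr (.inr (.inl i)) => fun z => -(z (.inr (.inr (.inl i))) * z (.inr (.inr (.inl k)))) +
      ((1 + z (.inr (.inl k))) * z (.inr (.inr (.inr (.inr (.inr (k, i)))))) +
        z (.inr (.inr (.inl k))) * z (.inr (.inl i))) * z (.inr (.inr (.inr (.inl i)))) *
        z (.inr (.inr (.inl i))) +
      ((1 + z (.inr (.inl i))) * z (.inr (.inr (.inr (.inr (.inr (i, k)))))) +
        z (.inr (.inr (.inl i))) * z (.inr (.inl k))) * z (.inr (.inr (.inr (.inl k)))) *
        z (.inr (.inr (.inl k)))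
  | .inr (.inr (.inr (.inl i))) => fun z => -((z (.inr (.inl k)) - z (.inr (.inl i))) *
      z (.inr (.inr (.inr (.inr (.inr (k, i)))))) + z (.inr (.inr (.inl k))) *
      z (.inr (.inl i))) * z (.inr (.inr (.inr (.inl i)))) ^ 2
  | _ => fun _ => 0

theorem jonasField_contDiff (k : Fin m) (s : JonasIdx m N) : ContDiff ℝ 1 (jonasField k s) := by
  rcases s with l | i | i | i | ⟨i, l⟩ | ⟨i, j⟩ <;> simp only [jonasField] <;> fun_prop

namespace JonasTransformWith

theorem jonasUnknown_contDiffOn (h : JonasTransformWith r x y c e a b) (s : JonasIdx m N) :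
    ContDiffOn ℝ ∞ (jonasUnknown r x y c a b s) (cube m r) := by
  rcases s with l | i | i | i | ⟨i, l⟩ | ⟨i, j⟩ <;> simp only [jonasUnknown]
  · exact (contDiffOn_euclidean.1 h.net'.1 l).sub (contDiffOn_euclidean.1 h.net.1 l)
  · exact h.contDiffOn_a i
  · exact h.contDiffOn_b i
  · exact (contDiffOn_const.add (h.contDiffOn_a i)).inv fun ξ hξ => h.one_add_ne_zero i hξ
  · exact contDiffOn_euclidean.1 (contDiffOn_pdw h.pos h.net.1) l
  · by_cases hij : i = j
    · simp only [hij, if_true]; exact contDiffOn_const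
    · simp only [hij, if_false]; exact h.smooth i j hij

theorem pdw_jonasUnknown (h : JonasTransformWith r x y c e a b) (s : JonasIdx m N) :
    ∀ k ∈ jonasDirections s, ∀ t ∈ cube m r, pdw r k (jonasUnknown r x y c a b s) t =
      jonasField k s fun s => jonasUnknown r x y c a b s t := by
  have hr := h.pos
  intro k hk t ht
  rcases s with l | i | i | i | ⟨i, l⟩ | ⟨i, j⟩
  · simp only [jonasUnknown, jonasField]
    have h1 := congrArg (fun v : EuclideanSpace ℝ (Fin N) => v l) (h.eqn k t ht)
    simp only [PiLp.add_apply, PiLp.sub_apply, PiLp.smul_apply, smul_eq_mul] at h1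
    rw [← h1, pdw_apply hr ht (diffWithin_cube h.net'.1 ht),
      pdw_apply hr ht (diffWithin_cube h.net.1 ht), pdw_sub hr ht
      (diffWithin_cube (contDiffOn_euclidean.1 h.net'.1 l) ht)
      (diffWithin_cube (contDiffOn_euclidean.1 h.net.1 l) ht)]
  · simp only [jonasDirections, Finset.mem_filter, Finset.mem_univ, true_and] at hk
    simp only [jonasUnknown, jonasField, if_neg hk]
    exact h.pdw_a (Ne.symm hk) ht
  · simp only [jonasDirections, Finset.mem_filter, Finset.mem_univ, true_and] at hk
    simp only [jonasUnknown, jonasField, if_neg hk, if_neg (Ne.symm hk)]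
    exact h.pdw_b (Ne.symm hk) ht
  · simp only [jonasDirections, Finset.mem_filter, Finset.mem_univ, true_and] at hk
    simp only [jonasUnknown, jonasField, if_neg hk]
    have ha := diffWithin_cube (h.contDiffOn_a i) ht
    rw [pdw_inv hr ht (ha.const_add 1) (h.one_add_ne_zero i ht),
      pdw_add hr ht (differentiableWithinAt_const _) ha,
      pdw_eq_of_hasFDerivAt hr (hasFDerivAt_const _ _) ht, h.pdw_a (Ne.symm hk) ht]
    simp
  · simp [jonasDirections] at hk
  · simp [jonasDirections] at hk

/-- Two Jonas transforms in general position with the same coordinate curves agree. -/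
theorem unique (h : JonasTransformWith r x y c e a b)
    {y' : (Fin m → ℝ) → EuclideanSpace ℝ (Fin N)} {e' : Fin m → Fin m → (Fin m → ℝ) → ℝ}
    {a' b' : Fin m → (Fin m → ℝ) → ℝ} (h' : JonasTransformWith r x y' c e' a' b') (hm : 0 < m)
    {Xp : Fin m → ℝ → EuclideanSpace ℝ (Fin N)} (hXp : ∀ i, Differentiable ℝ (Xp i))
    (hax : AgreesOnAxes r y Xp) (hax' : AgreesOnAxes r y' Xp) : Set.EqOn y y' (cube m r) := by
  have hr := h.pos
  -- On an axis a_i and b_i are the coefficients of a vector determined by the curves with respect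
  -- to ∂_i x and X⁺ - x, hence the same for both transforms.
  have hab : ∀ i t, t ∈ Set.Icc 0 r → a i (Pi.single i t) = a' i (Pi.single i t) ∧
      b i (Pi.single i t) = b' i (Pi.single i t) := by
    intro i t ht
    have hm := single_mem_cube ht.1 ht.2 i
    have e1 := h.eqn i _ hm
    have e2 := h'.eqn i _ hm
    have e0 := h.pair hm i
    rw [pdw_axis hr (h.net'.1.differentiableOn (by simp)) (hXp i) (hax i) ht,
      hax i t ht.1 ht.2] at e1
    rw [pdw_axis hr (h'.net'.1.differentiableOn (by simp)) (hXp i) (hax' i) ht,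
      hax' i t ht.1 ht.2] at e2
    rw [hax i t ht.1 ht.2] at e0
    exact linearIndependent_two_unique e0 (e1.symm.trans e2)
  have hsupp : ∀ {i : Fin m} {t : Fin m → ℝ}, (∀ k, k ≠ i → t k = 0) → t = Pi.single i (t i) := by
    intro i t h0
    funext k
    by_cases hk : k = i
    · subst hk; simp
    · rw [h0 k hk]; simp [hk]
  have main := goursat_unique jonasDirections jonasField_contDiff h.jonasUnknown_contDiffOn
    h'.jonasUnknown_contDiffOn h.pdw_jonasUnknown h'.pdw_jonasUnknown ?_
  · intro ξ hξ
    ext l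
    have := main (.inl l) ξ hξ
    simp only [jonasUnknown] at this
    linarith
  intro s t ht h0
  rcases s with l | i | i | i | ⟨i, l⟩ | ⟨i, j⟩
  · have : t = Pi.single ⟨0, hm⟩ 0 := by
      funext k
      rw [Pi.single_zero]
      exact h0 k (Finset.mem_univ k)
    simp only [jonasUnknown]
    rw [this, hax _ 0 le_rfl hr.le, hax' _ 0 le_rfl hr.le]
  · rw [hsupp (i := i) (t := t) fun k hk => h0 k (by simp [jonasDirections, hk])]
    exact (hab i _ (ht i)).1
  · rw [hsupp (i := i) (t := t) fun k hk => h0 k (by simp [jonasDirections, hk])]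
    exact (hab i _ (ht i)).2
  · rw [hsupp (i := i) (t := t) fun k hk => h0 k (by simp [jonasDirections, hk])]
    simp only [jonasUnknown]
    rw [(hab i _ (ht i)).1]
  · rfl
  · rfl

end JonasTransformWith

end JonasUniqueness

/-! ### Uniqueness of the smooth net and of its transform. -/

section SmoothUniqueness

variable {m N : ℕ} {r : ℝ}

theorem continuousOn_jet (hr : 0 < r) {y : (Fin m → ℝ) → EuclideanSpace ℝ (Fin N)}
    (hy : ContDiffOn ℝ ∞ y (cube m r)) :
    ContinuousOn (fun ξ => (y ξ, fun i => pdw r i y ξ)) (cube m r) :=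
  hy.continuousOn.prodMk (continuousOn_pi.2 fun _ => (contDiffOn_pdw hr hy).continuousOn)

theorem jet_zero (hr : 0 < r) {y : (Fin m → ℝ) → EuclideanSpace ℝ (Fin N)} (hm : 0 < m)
    (hy : ContDiffOn ℝ ∞ y (cube m r)) {X : Fin m → ℝ → EuclideanSpace ℝ (Fin N)}
    (hX : ∀ i, Differentiable ℝ (X i)) (hax : AgreesOnAxes r y X) :
    y 0 = X ⟨0, hm⟩ 0 ∧ ∀ i, pdw r i y 0 = deriv (X i) 0 := by
  constructor
  · have := hax ⟨0, hm⟩ 0 le_rfl hr.le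
    rwa [Pi.single_zero] at this
  · intro i
    have := pdw_axis hr (hy.differentiableOn (by simp)) (hX i) (hax i) (Set.left_mem_Icc.2 hr.le)
    rwa [Pi.single_zero] at this

theorem jet_near {y x : (Fin m → ℝ) → EuclideanSpace ℝ (Fin N)} {δ τ : ℝ}
    (hτ : 0 < τ) (hτr : τ ≤ r)
    (hy : ContDiffOn ℝ ∞ y (cube m r)) (hx : ContDiffOn ℝ ∞ x (cube m r)) {ξ : Fin m → ℝ}
    (hξ : ξ ∈ cube m τ)
    (h : ‖((y ξ, fun i => pdw r i y ξ) : EuclideanSpace ℝ (Fin N) × (Fin m → EuclideanSpace ℝ (Fin N)))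
      - (x ξ, fun i => pdw r i x ξ)‖ < δ) :
    ‖y ξ - x ξ‖ < δ ∧ ∀ i, ‖pdw τ i y ξ - pdw τ i x ξ‖ < δ := by
  have hξr := cube_mono hτr hξ
  rw [Prod.mk_sub_mk, Prod.norm_mk, max_lt_iff] at h
  refine ⟨h.1, fun i => ?_⟩
  rw [pdw_mono hτ hτr hξ (diffWithin_cube hy hξr), pdw_mono hτ hτr hξ (diffWithin_cube hx hξr)]
  exact (norm_le_pi_norm ((fun i => pdw r i y ξ) - fun i => pdw r i x ξ) i).trans_lt h.2

theorem eqOn_jet {y x : (Fin m → ℝ) → EuclideanSpace ℝ (Fin N)} {τ : ℝ}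
    (hτ : 0 < τ) (hτr : τ ≤ r)
    (hy : ContDiffOn ℝ ∞ y (cube m r)) (hx : ContDiffOn ℝ ∞ x (cube m r))
    (h : Set.EqOn y x (cube m τ)) :
    Set.EqOn (fun ξ => (y ξ, fun i => pdw r i y ξ)) (fun ξ => (x ξ, fun i => pdw r i x ξ))
      (cube m τ) := by
  intro ξ hξ
  have hξr := cube_mono hτr hξ
  simp only [Prod.mk.injEq]
  refine ⟨h hξ, ?_⟩
  funext i
  rw [← pdw_mono hτ hτr hξ (diffWithin_cube hy hξr), ← pdw_mono hτ hτr hξ (diffWithin_cube hx hξr)]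
  exact pdw_congr h hξ

/-- A competitor is in general position only as long as its first derivatives stay near those of x.
Where this holds the two nets agree, so the continuation principle, applied to the pair of value and
first derivatives, covers the whole cube. -/
theorem conjugateNet_eqOn (hm : 0 < m) (hr : 0 < r)
    {x y : (Fin m → ℝ) → EuclideanSpace ℝ (Fin N)}
    {c d : Fin m → Fin m → (Fin m → ℝ) → ℝ} (hx : IsConjugateNetWith r x c)
    (hy : IsConjugateNetWith r y d)
    {X : Fin m → ℝ → EuclideanSpace ℝ (Fin N)} (hX : ∀ i, Differentiable ℝ (X i))
    {C : Fin m → Fin m → ℝ × ℝ → ℝ} (hC : ∀ i j, i ≠ j → ContDiff ℝ ∞ (C i j))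
    (hax : AgreesOnAxes r x X) (hay : AgreesOnAxes r y X)
    (hcx : AgreesOnPlanes r c C) (hcy : AgreesOnPlanes r d C) {δ : ℝ} (hδ : 0 < δ)
    (hnear : ∀ ξ ∈ cube m r, ∀ v : Fin m → EuclideanSpace ℝ (Fin N),
      (∀ i, ‖v i - pdw r i x ξ‖ < δ) → ∀ i j k, i ≠ j → j ≠ k → i ≠ k →
        LinearIndependent ℝ ![v i, v j, v k]) : Set.EqOn y x (cube m r) := by
  have main := eqOn_cube_of_continuation hr (continuousOn_jet hr hy.1) (continuousOn_jet hr hx.1)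
    ?_ hδ ?_
  · exact fun ξ hξ => (Prod.mk.inj (main hξ)).1
  · obtain ⟨e1, e2⟩ := jet_zero hr hm hy.1 hX hay
    obtain ⟨e3, e4⟩ := jet_zero hr hm hx.1 hX hax
    simp only [e1, e2, e3, e4]
  · intro τ hτ hτr h
    refine eqOn_jet hτ hτr hy.1 hx.1 ?_
    have haxis : ∀ {z : (Fin m → ℝ) → EuclideanSpace ℝ (Fin N)}, AgreesOnAxes r z X →
      AgreesOnAxes τ z X := fun h i t h0 h1 => h i t h0 (h1.trans hτr)
    have hplane : ∀ {z : Fin m → Fin m → (Fin m → ℝ) → ℝ}, AgreesOnPlanes r z C →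
      AgreesOnPlanes τ z C := fun h i j hij s t h0 h1 h2 h3 =>
        h i j hij s t h0 (h1.trans hτr) h2 (h3.trans hτr)
    refine conjugateNet_unique hτ hm (isConjugateNetWith_mono hτ hτr hy)
      (isConjugateNetWith_mono hτ hτr hx) hX hC (haxis hay) (haxis hax) (hplane hcy) (hplane hcx)
      (fun ξ hξ => ?_) (fun ξ hξ => ?_)
    · refine hnear ξ (cube_mono hτr hξ) (fun i => pdw τ i y ξ) fun i => ?_
      rw [← pdw_mono hτ hτr hξ (diffWithin_cube hx.1 (cube_mono hτr hξ))]
      exact (jet_near hτ hτr hy.1 hx.1 hξ (h ξ hξ)).2 i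
    · refine hnear ξ (cube_mono hτr hξ) (fun i => pdw τ i x ξ) fun i => ?_
      rw [← pdw_mono hτ hτr hξ (diffWithin_cube hx.1 (cube_mono hτr hξ)), sub_self, norm_zero]
      exact hδ

/-- The same continuation for the transforms. With a single direction the closed system is not
available, but then the cube is the axis and the curve determines everything. -/
theorem jonas_eqOn (hm : 0 < m) (hr : 0 < r)
    {x y xp : (Fin m → ℝ) → EuclideanSpace ℝ (Fin N)}
    {c : Fin m → Fin m → (Fin m → ℝ) → ℝ} (hx : IsConjugateNetWith r x c)
    (hc : ∀ i j, i ≠ j → ContDiffOn ℝ ∞ (c i j) (cube m r))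
    (hy : IsJonasPair r x y) (hxp : IsJonasPair r x xp)
    {Xp : Fin m → ℝ → EuclideanSpace ℝ (Fin N)} (hXp : ∀ i, Differentiable ℝ (Xp i))
    (hay : AgreesOnAxes r y Xp) (haxp : AgreesOnAxes r xp Xp) {δ : ℝ} (hδ : 0 < δ)
    (hnear : ∀ ξ ∈ cube m r, ∀ (u : EuclideanSpace ℝ (Fin N))
      (w : Fin m → EuclideanSpace ℝ (Fin N)), ‖u - (xp ξ - x ξ)‖ < δ →
      (∀ i, ‖w i - pdw r i xp ξ‖ < δ) →
      (∀ i j, i ≠ j → LinearIndependent ℝ ![pdw r i x ξ, pdw r j x ξ, u]) ∧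
        ∀ i, LinearIndependent ℝ ![u, w i]) : Set.EqOn y xp (cube m r) := by
  by_cases htwo : ∀ i : Fin m, ∃ j, j ≠ i
  swap
  · push Not at htwo
    obtain ⟨i, hi⟩ := htwo
    intro ξ hξ
    have : ξ = Pi.single i (ξ i) := by
      funext k
      rw [hi k]; simp
    rw [this, hay i _ (hξ i).1 (hξ i).2, haxp i _ (hξ i).1 (hξ i).2]
  obtain ⟨-, ⟨e, he⟩, a, b, hab⟩ := hy
  obtain ⟨-, ⟨e', he'⟩, a', b', hab'⟩ := hxp
  have main := eqOn_cube_of_continuation hr (continuousOn_jet hr he.1) (continuousOn_jet hr he'.1)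
    ?_ hδ ?_
  · exact fun ξ hξ => (Prod.mk.inj (main hξ)).1
  · obtain ⟨e1, e2⟩ := jet_zero hr hm he.1 hXp hay
    obtain ⟨e3, e4⟩ := jet_zero hr hm he'.1 hXp haxp
    simp only [e1, e2, e3, e4]
  · intro τ hτ hτr h
    refine eqOn_jet hτ hτr he.1 he'.1 ?_
    have haxis : ∀ {z : (Fin m → ℝ) → EuclideanSpace ℝ (Fin N)}, AgreesOnAxes r z Xp →
      AgreesOnAxes τ z Xp := fun h i t h0 h1 => h i t h0 (h1.trans hτr)
    have hmono : ∀ {z : (Fin m → ℝ) → EuclideanSpace ℝ (Fin N)} (_ : ContDiffOn ℝ ∞ z (cube m r))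
        (i : Fin m), ∀ ξ ∈ cube m τ, pdw τ i z ξ = pdw r i z ξ := fun hz i ξ hξ =>
      pdw_mono hτ hτr hξ (diffWithin_cube hz (cube_mono hτr hξ))
    have key : ∀ {z : (Fin m → ℝ) → EuclideanSpace ℝ (Fin N)}
        {e : Fin m → Fin m → (Fin m → ℝ) → ℝ} {a b : Fin m → (Fin m → ℝ) → ℝ},
        IsConjugateNetWith r z e → (∀ i, ∀ ξ ∈ cube m r,
          pderiv r i z ξ - pderiv r i x ξ = a i ξ • pderiv r i x ξ + b i ξ • (z ξ - x ξ)) →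
        (∀ ξ ∈ cube m τ, ‖z ξ - xp ξ‖ < δ ∧ ∀ i, ‖pdw τ i z ξ - pdw τ i xp ξ‖ < δ) →
        JonasTransformWith τ x z c e a b := by
      intro z e a b hz hzab hzn
      have hn := fun ξ (hξ : ξ ∈ cube m τ) => hnear ξ (cube_mono hτr hξ) (z ξ - x ξ)
        (fun i => pdw τ i z ξ) (by
          have : z ξ - x ξ - (xp ξ - x ξ) = z ξ - xp ξ := by abel
          rw [this]; exact (hzn ξ hξ).1) fun i => by
          rw [← hmono he'.1 i ξ hξ]; exact (hzn ξ hξ).2 i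
      refine ⟨hτ, isConjugateNetWith_mono hτ hτr hx, isConjugateNetWith_mono hτ hτr hz,
        fun i j hij => (hc i j hij).mono (cube_mono hτr), fun i ξ hξ => ?_, fun ξ hξ i j hij => ?_,
        fun ξ hξ => (hn ξ hξ).2, htwo⟩
      · rw [hmono hz.1 i ξ hξ, hmono hx.1 i ξ hξ]
        exact hzab i ξ (cube_mono hτr hξ)
      · rw [hmono hx.1 i ξ hξ, hmono hx.1 j ξ hξ]
        exact (hn ξ hξ).1 i j hij
    refine (key he hab fun ξ hξ => jet_near hτ hτr he.1 he'.1 hξ (h ξ hξ)).unique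
      (key he' hab' fun ξ hξ => ?_) hm hXp (haxis hay) (haxis haxp)
    simp [hδ]

end SmoothUniqueness

/-! ### Uniqueness of the discrete net. -/

section DiscreteUniqueness

variable {m N : ℕ}

/-- The six vectors are such that the spans of `v 0, v 1`, of `v 2, v 3` and of `v 4, v 5`, have
no common vector apart from zero, and the three pairs are independent. -/
def SpansTransversal {E : Type} [AddCommGroup E] [Module ℝ E] (v : Fin 6 → E) : Prop :=
  LinearIndependent ℝ (![(v 0, v 0), (v 1, v 1), (v 2, 0), (v 3, 0), (0, v 4), (0, v 5)] :
    Fin 6 → E × E)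

theorem SpansTransversal.eq_zero {E : Type} [AddCommGroup E] [Module ℝ E] {v : Fin 6 → E}
    (h : SpansTransversal v) {D : E} (h1 : ∃ α β : ℝ, D = α • v 0 + β • v 1)
    (h2 : ∃ α β : ℝ, D = α • v 2 + β • v 3) (h3 : ∃ α β : ℝ, D = α • v 4 + β • v 5) : D = 0 := by
  obtain ⟨a, b, e1⟩ := h1
  obtain ⟨a', b', e2⟩ := h2
  obtain ⟨a'', b'', e3⟩ := h3
  have := Fintype.linearIndependent_iff.1 h ![a, b, -a', -b', -a'', -b''] (by
    have f1 : a • v 0 + b • v 1 - (a' • v 2 + b' • v 3) = 0 := by rw [← e1, ← e2, sub_self]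
    have f2 : a • v 0 + b • v 1 - (a'' • v 4 + b'' • v 5) = 0 := by rw [← e1, ← e3, sub_self]
    rw [Prod.ext_iff]
    constructor
    · refine Eq.trans ?_ f1
      simp [Fin.sum_univ_six]
      abel
    · refine Eq.trans ?_ f2
      simp [Fin.sum_univ_six]
      abel)
  have ha : a = 0 := this 0
  have hb : b = 0 := this 1
  rw [e1, ha, hb]; simp

theorem spansTransversal_of_forall {E : Type} [AddCommGroup E] [Module ℝ E] {v : Fin 6 → E}
    (h : ∀ a b a' b' a'' b'' : ℝ, a • v 0 + b • v 1 = a' • v 2 + b' • v 3 →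
      a • v 0 + b • v 1 = a'' • v 4 + b'' • v 5 →
      a = 0 ∧ b = 0 ∧ a' = 0 ∧ b' = 0 ∧ a'' = 0 ∧ b'' = 0) : SpansTransversal v := by
  refine Fintype.linearIndependent_iff.2 fun g hg => ?_
  simp only [Fin.sum_univ_six, Matrix.cons_val_zero, Matrix.cons_val_one, Matrix.cons_val] at hg
  have e1 := congrArg Prod.fst hg
  have e2 := congrArg Prod.snd hg
  simp only [Prod.fst_add, Prod.smul_fst, Prod.fst_zero, smul_zero, add_zero] at e1
  simp only [Prod.snd_add, Prod.smul_snd, Prod.snd_zero, smul_zero, add_zero] at e2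
  obtain ⟨h0, h1, h2, h3, h4, h5⟩ := h (g 0) (g 1) (-g 2) (-g 3) (-g 4) (-g 5)
    (by rw [← sub_eq_zero, ← e1, neg_smul, neg_smul]; abel)
    (by rw [← sub_eq_zero, ← e2, neg_smul, neg_smul]; abel)
  intro i
  fin_cases i
  · exact h0
  · exact h1
  · exact neg_eq_zero.1 h2
  · exact neg_eq_zero.1 h3
  · exact neg_eq_zero.1 h4
  · exact neg_eq_zero.1 h5

theorem eventually_near_of_isOpen {ι E : Type} [Fintype ι] [NormedAddCommGroup E]
    {U : Set (ι → E)} (hU : IsOpen U) {v : ι → E} (hv : v ∈ U) :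
    ∀ᶠ η in nhdsWithin (0 : ℝ) (Set.Ioi 0), ∀ v' : ι → E, (∀ k, ‖v' k - v k‖ ≤ η) → v' ∈ U := by
  obtain ⟨η₀, hη₀, h⟩ := Metric.isOpen_iff.1 hU v hv
  filter_upwards [Ioo_mem_nhdsGT hη₀] with η hη v' hv'
  refine h ?_
  rw [mem_ball_iff_norm]
  refine lt_of_le_of_lt ((pi_norm_le_iff_of_nonneg hη.1.le).2 fun k => ?_) hη.2
  exact hv' k

/-- Transversality of the three planes is phrased as linear independence of six vectors of E × E, so
it inherits the openness of linear independence. -/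
theorem isOpen_spansTransversal {E : Type} [NormedAddCommGroup E] [NormedSpace ℝ E] :
    IsOpen {v : Fin 6 → E | SpansTransversal v} := by
  have h1 : Continuous fun v : Fin 6 → E => (![(v 0, v 0), (v 1, v 1), (v 2, 0), (v 3, 0),
      (0, v 4), (0, v 5)] : Fin 6 → E × E) := by
    refine continuous_pi fun k => ?_
    fin_cases k
    · exact (by fun_prop : Continuous fun v : Fin 6 → E => (v 0, v 0))
    · exact (by fun_prop : Continuous fun v : Fin 6 → E => (v 1, v 1))
    · exact (by fun_prop : Continuous fun v : Fin 6 → E => (v 2, (0 : E)))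
    · exact (by fun_prop : Continuous fun v : Fin 6 → E => (v 3, (0 : E)))
    · exact (by fun_prop : Continuous fun v : Fin 6 → E => ((0 : E), v 4))
    · exact (by fun_prop : Continuous fun v : Fin 6 → E => ((0 : E), v 5))
  exact (isOpen_setOfPred_linearIndependent (𝕜 := ℝ) (E := E × E) (ι := Fin 6)).preimage h1

variable {ε r : ℝ} {x y : (Fin (m + 1) → ℕ) → EuclideanSpace ℝ (Fin N)}
  {c d : Fin (m + 1) → Fin (m + 1) → (Fin (m + 1) → ℕ) → ℝ}

/-- If three vertices of a square agree, so do the first differences there, and the fourth vertices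
can differ only by a vector of the plane of the square. -/
theorem eq_of_square (hε : 0 < ε) (hx : IsDiscreteConjugateNetWith ε r x c)
    (hy : IsDiscreteConjugateNetWith ε r y d) {i j : Fin (m + 1)} (hij : i ≠ j)
    {n : Fin (m + 1) → ℕ} (hn : n + Pi.single i 1 + Pi.single j 1 ∈ latticeBox m ε r)
    (h0 : y n = x n) (h1 : y (n + Pi.single i 1) = x (n + Pi.single i 1))
    (h2 : y (n + Pi.single j 1) = x (n + Pi.single j 1)) :
    y (n + Pi.single i 1 + Pi.single j 1) - x (n + Pi.single i 1 + Pi.single j 1) =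
      (mesh m ε i * mesh m ε j * (d j i n - c j i n)) • pdiff (mesh m ε) i x n +
      (mesh m ε i * mesh m ε j * (d i j n - c i j n)) • pdiff (mesh m ε) j x n := by
  have e1 := hx i j hij n hn
  have e2 := hy i j hij n hn
  have p1 : pdiff (mesh m ε) i y n = pdiff (mesh m ε) i x n := by rw [pdiff, pdiff, h0, h1]
  have p2 : pdiff (mesh m ε) j y n = pdiff (mesh m ε) j x n := by rw [pdiff, pdiff, h0, h2]
  rw [p1, p2] at e2
  have hi := (mesh_pos (m := m) hε i).ne'
  have hj := (mesh_pos (m := m) hε j).ne'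
  have e3 : pdiff (mesh m ε) i (pdiff (mesh m ε) j y) n - pdiff (mesh m ε) i (pdiff (mesh m ε) j x) n
      = ((mesh m ε i)⁻¹ * (mesh m ε j)⁻¹) •
        (y (n + Pi.single i 1 + Pi.single j 1) - x (n + Pi.single i 1 + Pi.single j 1)) := by
    simp only [pdiff, h0, h1, h2]
    module
  rw [e1, e2] at e3
  have e4 : y (n + Pi.single i 1 + Pi.single j 1) - x (n + Pi.single i 1 + Pi.single j 1) =
      (mesh m ε i * mesh m ε j) • (((mesh m ε i)⁻¹ * (mesh m ε j)⁻¹) •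
        (y (n + Pi.single i 1 + Pi.single j 1) - x (n + Pi.single i 1 + Pi.single j 1))) := by
    rw [smul_smul]
    field_simp
    simp
  rw [e4, ← e3]
  module

theorem eq_of_square_of_coeff (hε : 0 < ε) (hx : IsDiscreteConjugateNetWith ε r x c)
    (hy : IsDiscreteConjugateNetWith ε r y d) {i j : Fin (m + 1)} (hij : i ≠ j)
    {n : Fin (m + 1) → ℕ} (hn : n + Pi.single i 1 + Pi.single j 1 ∈ latticeBox m ε r)
    (h0 : y n = x n) (h1 : y (n + Pi.single i 1) = x (n + Pi.single i 1))
    (h2 : y (n + Pi.single j 1) = x (n + Pi.single j 1)) (h3 : d i j n = c i j n)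
    (h4 : d j i n = c j i n) :
    y (n + Pi.single i 1 + Pi.single j 1) = x (n + Pi.single i 1 + Pi.single j 1) := by
  have := eq_of_square hε hx hy hij hn h0 h1 h2
  rw [h3, h4, sub_self, sub_self, mul_zero, zero_smul, zero_smul, add_zero] at this
  exact sub_eq_zero.1 this

/-- The value at the last vertex of a cube is determined if the planes are in general position. -/
theorem eq_of_cube (hε : 0 < ε) (hx : IsDiscreteConjugateNetWith ε r x c)
    (hy : IsDiscreteConjugateNetWith ε r y d) {i j k : Fin (m + 1)} (hij : i ≠ j) (hjk : j ≠ k)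
    (hik : i ≠ k) {n : Fin (m + 1) → ℕ}
    (hn : n + Pi.single i 1 + Pi.single j 1 + Pi.single k 1 ∈ latticeBox m ε r)
    (hlow : ∀ n' : Fin (m + 1) → ℕ, n' ∈ latticeBox m ε r →
      ∑ l, n' l < ∑ l, (n + Pi.single i 1 + Pi.single j 1 + Pi.single k 1 : Fin (m + 1) → ℕ) l →
      y n' = x n')
    (ht : SpansTransversal ![pdiff (mesh m ε) i x (n + Pi.single k 1),
      pdiff (mesh m ε) j x (n + Pi.single k 1), pdiff (mesh m ε) i x (n + Pi.single j 1),
      pdiff (mesh m ε) k x (n + Pi.single j 1), pdiff (mesh m ε) j x (n + Pi.single i 1),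
      pdiff (mesh m ε) k x (n + Pi.single i 1)]) :
    y (n + Pi.single i 1 + Pi.single j 1 + Pi.single k 1) =
      x (n + Pi.single i 1 + Pi.single j 1 + Pi.single k 1) := by
  have key : ∀ {p q s : Fin (m + 1)}, p ≠ q → n + Pi.single s 1 + Pi.single p 1 + Pi.single q 1 =
      n + Pi.single i 1 + Pi.single j 1 + Pi.single k 1 →
      ∃ α β : ℝ, y (n + Pi.single i 1 + Pi.single j 1 + Pi.single k 1) -
        x (n + Pi.single i 1 + Pi.single j 1 + Pi.single k 1) =
        α • pdiff (mesh m ε) p x (n + Pi.single s 1) +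
          β • pdiff (mesh m ε) q x (n + Pi.single s 1) := by
    intro p q s hpq e
    rw [← e] at hn hlow ⊢
    have m1 : n + Pi.single s 1 + Pi.single p 1 ∈ latticeBox m ε r := latticeBox_lower hε hn
    have m2 : n + Pi.single s 1 + Pi.single q 1 ∈ latticeBox m ε r :=
      latticeBox_lower hε (k := p) (by rwa [add_right_comm])
    have hs : ∀ (n : Fin (m + 1) → ℕ) p, ∑ l, (n + Pi.single p 1 : Fin (m + 1) → ℕ) l =
      ∑ l, n l + 1 := LatticeFamily.sum_add_single
    exact ⟨_, _, eq_of_square hε hx hy hpq hn (hlow _ (latticeBox_lower hε m1)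
      (by simp only [hs]; omega)) (hlow _ m1 (by simp only [hs]; omega))
      (hlow _ m2 (by simp only [hs]; omega))⟩
  refine sub_eq_zero.1 (ht.eq_zero (key (p := i) (q := j) (s := k) hij ?_)
    (key (p := i) (q := k) (s := j) hik ?_) (key (p := j) (q := k) (s := i) hjk ?_)) <;> abel

theorem exists_eq_add_single {ι : Type*} [DecidableEq ι] {n : ι → ℕ} {i : ι} (h : n i ≠ 0) :
    ∃ o : ι → ℕ, n = o + Pi.single i 1 ∧ ∀ j, j ≠ i → o j = n j := by
  refine ⟨Function.update n i (n i - 1), ?_, fun j hj => Function.update_of_ne hj _ _⟩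
  ext j
  rcases eq_or_ne j i with rfl | hj
  · simp only [Pi.add_apply, Function.update_self, Pi.single_eq_same]; omega
  · simp [hj]

/-- Induction on the coordinate sum. Points on the axes and the point (0, 1) are data. Points with
two nonzero coordinates close a square whose coefficients are prescribed. All others close a 3-cube,
where the discrepancy lies in three transversal planes and vanishes. -/
theorem discreteProblem_eqOn (hm : 0 < m) (hε : 0 < ε) {X : Fin m → ℝ → EuclideanSpace ℝ (Fin N)}
    {C : Fin m → Fin m → ℝ × ℝ → ℝ} {P : EuclideanSpace ℝ (Fin N)} {CM CiM : Fin m → ℝ → ℝ}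
    (hx : SolvesDiscreteProblem ε r X C P CM CiM x) (hy : SolvesDiscreteProblem ε r X C P CM CiM y)
    (ht : ∀ i j k : Fin (m + 1), i ≠ j → j ≠ k → i ≠ k → i ≠ Fin.last m → j ≠ Fin.last m →
      ∀ n : Fin (m + 1) → ℕ, n + Pi.single i 1 + Pi.single j 1 + Pi.single k 1 ∈ latticeBox m ε r →
      n (Fin.last m) = 0 →
      SpansTransversal ![pdiff (mesh m ε) i x (n + Pi.single k 1),
      pdiff (mesh m ε) j x (n + Pi.single k 1), pdiff (mesh m ε) i x (n + Pi.single j 1),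
      pdiff (mesh m ε) k x (n + Pi.single j 1), pdiff (mesh m ε) j x (n + Pi.single i 1),
      pdiff (mesh m ε) k x (n + Pi.single i 1)]) :
    Set.EqOn y x (latticeBox m ε r) := by
  obtain ⟨c, hxc, hxX, hxC, hxP, hxM⟩ := hx
  obtain ⟨d, hyd, hyX, hyC, hyP, hyM⟩ := hy
  have hs : ∀ (n : Fin (m + 1) → ℕ) p, ∑ l, (n + Pi.single p 1 : Fin (m + 1) → ℕ) l =
      ∑ l, n l + 1 := LatticeFamily.sum_add_single
  suffices H : ∀ s : ℕ, ∀ n ∈ latticeBox m ε r, ∑ l, n l = s → y n = x n from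
    fun n hn => H _ n hn rfl
  intro s
  induction s using Nat.strong_induction_on with
  | _ s ih =>
  intro n hn hns
  have hlow : ∀ n' ∈ latticeBox m ε r, ∑ l, n' l < ∑ l, n l → y n' = x n' :=
    fun n' hn' h => ih _ (hns ▸ h) n' hn' rfl
  have hsq : ∀ i j : Fin (m + 1), i ≠ j → ∀ o : Fin (m + 1) → ℕ,
      n = o + Pi.single i 1 + Pi.single j 1 → d i j o = c i j o → d j i o = c j i o →
      y n = x n := by
    rintro i j hij o rfl h1 h2
    have m1 : o + Pi.single i 1 ∈ latticeBox m ε r := latticeBox_lower hε hn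
    have m2 : o + Pi.single j 1 ∈ latticeBox m ε r :=
      latticeBox_lower hε (k := i) (by rwa [add_right_comm])
    exact eq_of_square_of_coeff hε hxc hyd hij hn
      (hlow _ (latticeBox_lower hε m1) (by simp only [hs]; omega))
      (hlow _ m1 (by simp only [hs]; omega)) (hlow _ m2 (by simp only [hs]; omega)) h1 h2
  have hcube : ∀ i j k : Fin (m + 1), i ≠ j → j ≠ k → i ≠ k → i ≠ Fin.last m → j ≠ Fin.last m →
      n i ≠ 0 → n j ≠ 0 → n k ≠ 0 → (k ≠ Fin.last m → n (Fin.last m) = 0) → y n = x n := by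
    intro i j k hij hjk hik hi hj ni nj nk hk
    obtain ⟨o₁, e₁, f₁⟩ := exists_eq_add_single nk
    obtain ⟨o₂, e₂, f₂⟩ := exists_eq_add_single (n := o₁) (i := j) (by rwa [f₁ j hjk])
    obtain ⟨o₃, e₃, f₃⟩ := exists_eq_add_single (n := o₂) (i := i)
      (by rwa [f₂ i hij, f₁ i hik])
    -- The base vertex lies on the lower level, either because the whole cube does or because the
    -- third direction is M.
    have hl : o₃ (Fin.last m) = 0 := by
      rw [f₃ _ hi.symm, f₂ _ hj.symm]
      by_cases h : k = Fin.last m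
      · subst h
        have h1 := hn.2
        rw [e₁, Pi.add_apply, Pi.single_eq_same] at h1
        omega
      · rw [f₁ _ (Ne.symm h), hk h]
    rw [e₃] at e₂
    rw [e₂] at e₁
    subst e₁
    exact eq_of_cube hε hxc hyd hij hjk hik hn hlow (ht i j k hij hjk hik hi hj o₃ hn hl)
  set T : Finset (Fin m) := Finset.univ.filter fun i => n i.castSucc ≠ 0 with hT
  have memT : ∀ i, i ∈ T ↔ n i.castSucc ≠ 0 := fun i => by simp [hT]
  have hext : ∀ i : Fin m, (∀ j, j ∈ T → j = i) → n (Fin.last m) = 0 →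
      n = Pi.single i.castSucc (n i.castSucc) := by
    intro i hi h0
    ext j
    refine Fin.lastCases ?_ (fun j => ?_) j
    · rw [h0, Pi.single_eq_of_ne (Fin.castSucc_lt_last i).ne']
    · rcases eq_or_ne j i with rfl | hj
      · rw [Pi.single_eq_same]
      · rw [Pi.single_eq_of_ne (by simpa using hj)]
        by_contra h
        exact hj (hi j ((memT j).2 h))
  have hn2 := hn.2
  rcases (by omega : n (Fin.last m) = 0 ∨ n (Fin.last m) = 1) with hl | hl
  · rcases (by omega : T.card = 0 ∨ T.card = 1 ∨ T.card = 2 ∨ 2 < T.card) with h | h | h | h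
    · have := hext ⟨0, hm⟩ (fun j hj => absurd hj (by simp [Finset.card_eq_zero.1 h])) hl
      have hb := hn.1 ⟨0, hm⟩
      rw [this, hxX _ _ hb, hyX _ _ hb]
    · obtain ⟨i, hi⟩ := Finset.card_eq_one.1 h
      have := hext i (fun j hj => by simpa [hi] using hj) hl
      have hb := hn.1 i
      rw [this, hxX _ _ hb, hyX _ _ hb]
    · obtain ⟨i, j, hij, hi⟩ := Finset.card_eq_two.1 h
      have hij' : i.castSucc ≠ j.castSucc := by simpa using hij
      obtain ⟨o₁, e₁, f₁⟩ := exists_eq_add_single ((memT j).1 (by simp [hi]))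
      obtain ⟨o₂, e₂, f₂⟩ := exists_eq_add_single (n := o₁) (i := i.castSucc)
        (by rw [f₁ _ hij']; exact (memT i).1 (by simp [hi]))
      have ho : o₂ = Pi.single i.castSucc (o₂ i.castSucc) + Pi.single j.castSucc (o₂ j.castSucc) := by
        ext k
        rw [Pi.add_apply]
        refine Fin.lastCases ?_ (fun k => ?_) k
        · rw [f₂ _ (Fin.castSucc_lt_last i).ne', f₁ _ (Fin.castSucc_lt_last j).ne', hl,
            Pi.single_eq_of_ne (Fin.castSucc_lt_last i).ne',
            Pi.single_eq_of_ne (Fin.castSucc_lt_last j).ne', add_zero]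
        · rcases eq_or_ne k i with rfl | hki
          · rw [Pi.single_eq_same, Pi.single_eq_of_ne hij', add_zero]
          · rcases eq_or_ne k j with rfl | hkj
            · rw [Pi.single_eq_same, Pi.single_eq_of_ne (by simpa using hki), zero_add]
            · rw [Pi.single_eq_of_ne (by simpa using hki), Pi.single_eq_of_ne (by simpa using hkj),
                f₂ _ (by simpa using hki), f₁ _ (by simpa using hkj)]
              by_contra h
              have := (memT k).2 h
              simp [hi, hki, hkj] at this
      rw [e₂] at e₁
      have hb : ∀ l : Fin m, ε * (o₂ l.castSucc : ℝ) ≤ r :=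
        (latticeBox_lower hε (latticeBox_lower hε (e₁ ▸ hn))).1
      refine hsq _ _ hij' o₂ e₁ ?_ ?_
      · rw [ho, hxC i j hij _ _ (hb i) (hb j), hyC i j hij _ _ (hb i) (hb j)]
      · rw [ho, add_comm, hxC j i hij.symm _ _ (hb j) (hb i), hyC j i hij.symm _ _ (hb j) (hb i)]
    · obtain ⟨i, hi, j, hj, k, hk, hij, hik, hjk⟩ := Finset.two_lt_card.1 h
      exact hcube i.castSucc j.castSucc k.castSucc (by simpa using hij) (by simpa using hjk)
        (by simpa using hik) (Fin.castSucc_lt_last i).ne (Fin.castSucc_lt_last j).ne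
        ((memT i).1 hi) ((memT j).1 hj) ((memT k).1 hk) fun _ => hl
  · obtain ⟨o, e, f⟩ := exists_eq_add_single (n := n) (i := Fin.last m) (by omega)
    have hol : o (Fin.last m) = 0 := by
      have := congrFun e (Fin.last m)
      rw [Pi.add_apply, Pi.single_eq_same] at this
      omega
    rcases (by omega : T.card = 0 ∨ T.card = 1 ∨ 1 < T.card) with h | h | h
    · have : n = Pi.single (Fin.last m) 1 := by
        ext j
        refine Fin.lastCases ?_ (fun j => ?_) j
        · rw [hl, Pi.single_eq_same]
        · rw [Pi.single_eq_of_ne (Fin.castSucc_lt_last j).ne]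
          by_contra h'
          have := (memT j).2 h'
          simp [Finset.card_eq_zero.1 h] at this
      rw [this, hxP, hyP]
    · obtain ⟨i, hi⟩ := Finset.card_eq_one.1 h
      have hil := (Fin.castSucc_lt_last i).ne
      obtain ⟨o₂, e₂, f₂⟩ := exists_eq_add_single (n := o) (i := i.castSucc)
        (by rw [f _ hil]; exact (memT i).1 (by simp [hi]))
      have ho : o₂ = Pi.single i.castSucc (o₂ i.castSucc) := by
        ext k
        refine Fin.lastCases ?_ (fun k => ?_) k
        · rw [f₂ _ hil.symm, hol, Pi.single_eq_of_ne hil.symm]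
        · rcases eq_or_ne k i with rfl | hki
          · rw [Pi.single_eq_same]
          · rw [Pi.single_eq_of_ne (by simpa using hki), f₂ _ (by simpa using hki),
              f _ (Fin.castSucc_lt_last k).ne]
            by_contra h'
            have := (memT k).2 h'
            simp [hi, hki] at this
      rw [e₂] at e
      have hb : ε * (o₂ i.castSucc : ℝ) ≤ r :=
        (latticeBox_lower hε (latticeBox_lower hε (e ▸ hn))).1 i
      refine hsq _ _ hil o₂ e ?_ ?_
      · rw [ho, (hxM i _ hb).2, (hyM i _ hb).2]
      · rw [ho, (hxM i _ hb).1, (hyM i _ hb).1]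
    · obtain ⟨i, hi, j, hj, hij⟩ := Finset.one_lt_card.1 h
      exact hcube i.castSucc j.castSucc (Fin.last m) (by simpa using hij)
        (Fin.castSucc_lt_last j).ne (Fin.castSucc_lt_last i).ne (Fin.castSucc_lt_last i).ne
        (Fin.castSucc_lt_last j).ne ((memT i).1 hi) ((memT j).1 hj) (by omega)
        fun h => absurd rfl h

end DiscreteUniqueness

/-! ### First differences of the discrete nets. -/

section FirstDifferences

open LatticeFamily

variable {m N : ℕ}

/-- The mean value inequality for u minus the linear function with slope L along the segment. -/
theorem norm_quotient_sub_le {F : Type} [NormedAddCommGroup F] [NormedSpace ℝ F] {r h η : ℝ}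
    {u : (Fin m → ℝ) → F} (hu : DifferentiableOn ℝ u (cube m r)) {i : Fin m} {L : F}
    (hL : ∀ ξ ∈ cube m r, ‖pdw r i u ξ - L‖ ≤ η) {ξ : Fin m → ℝ} (hh : 0 < h) (hξ : ξ ∈ cube m r)
    (hξh : ξ + h • Pi.single i 1 ∈ cube m r) :
    ‖h⁻¹ • (u (ξ + h • Pi.single i 1) - u ξ) - L‖ ≤ η := by
  have hmem : ∀ t ∈ Set.Icc 0 h, ξ + t • (Pi.single i 1 : Fin m → ℝ) ∈ cube m r := by
    intro t ht k
    have h1 := hξ k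
    have h2 := hξh k
    rcases eq_or_ne k i with rfl | hk
    · simp only [Pi.add_apply, Pi.smul_apply, Pi.single_eq_same, smul_eq_mul, mul_one] at h2 ⊢
      exact ⟨by linarith [ht.1], by linarith [ht.2]⟩
    · simpa [hk] using h1
  have hd : ∀ t ∈ Set.Icc 0 h, HasDerivWithinAt
      (fun s : ℝ => u (ξ + s • (Pi.single i 1 : Fin m → ℝ)) - s • L)
      (pdw r i u (ξ + t • (Pi.single i 1 : Fin m → ℝ)) - L) (Set.Icc 0 h) t := by
    intro t ht
    have h1 : HasDerivAt (fun s : ℝ => ξ + s • (Pi.single i 1 : Fin m → ℝ)) (Pi.single i 1) t := by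
      simpa using ((hasDerivAt_id' t).smul_const (Pi.single i 1 : Fin m → ℝ)).const_add ξ
    have h2 : HasDerivAt (fun s : ℝ => s • L) L t := by
      simpa using (hasDerivAt_id' t).smul_const L
    exact ((hu _ (hmem t ht)).hasFDerivWithinAt.comp_hasDerivWithinAt t h1.hasDerivWithinAt
      hmem).sub h2.hasDerivWithinAt
  have := norm_image_sub_le_of_norm_deriv_le_segment' hd
    (fun t ht => hL _ (hmem t ⟨ht.1, ht.2.le⟩)) h (Set.right_mem_Icc.2 hh.le)
  simp only [zero_smul, add_zero, sub_zero] at this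
  have e : h⁻¹ • (u (ξ + h • Pi.single i 1) - u ξ) - L =
      h⁻¹ • (u (ξ + h • Pi.single i 1) - h • L - u ξ) := by
    rw [smul_sub, smul_sub, smul_sub, smul_smul, inv_mul_cancel₀ hh.ne', one_smul]
    abel
  rw [e, norm_smul, norm_inv, Real.norm_of_nonneg hh.le, inv_mul_le_iff₀ hh, mul_comm]
  exact this

theorem pt_mem_cube {ε r : ℝ} (hε : 0 < ε) {n : Fin m → ℕ} (h : ∀ j, ε * (n j : ℝ) ≤ r) :
    pt ε n ∈ cube m r := fun j => ⟨mul_nonneg hε.le (Nat.cast_nonneg _), h j⟩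

/-- Convergence of a lattice function controls its values and first differences by those of the
limit. -/
theorem exists_first_difference_bound {R ε₁ : ℝ}
    {u : ℝ → (Fin m → ℕ) → EuclideanSpace ℝ (Fin N)} {v : (Fin m → ℝ) → EuclideanSpace ℝ (Fin N)}
    (h : ∀ c, ConvOn (Box m R ε₁) (fun ε n => u ε n c) (fun t => v t c))
    (hv : ContDiffOn ℝ ∞ v (cube m R)) :
    ∃ K : ℝ, 0 ≤ K ∧ ∀ ε, 0 < ε → ε < ε₁ → ∀ r, 0 < r → r ≤ R →
      (∀ n : Fin m → ℕ, (∀ j, ε * (n j : ℝ) ≤ r) → ‖u ε n - v (pt ε n)‖ ≤ K * ε) ∧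
      ∀ i L η, (∀ ξ ∈ cube m r, ‖pdw r i v ξ - L‖ ≤ η) → ∀ n : Fin m → ℕ,
        (∀ j, ε * ((n + Pi.single i 1 : Fin m → ℕ) j : ℝ) ≤ r) →
        ‖ε⁻¹ • (u ε (n + Pi.single i 1) - u ε n) - L‖ ≤ η + K * ε := by
  choose K₀ hK₀ using fun c => ((h c).err 1).1
  choose K₁ hK₁ using fun c i => ((h c).err 1).2 i
  refine ⟨(∑ c, |K₀ c|) + ∑ i, ∑ c, |K₁ c i|, by positivity, fun ε hε hε₁ r hr hrR =>
    ⟨fun n hn => ?_, fun i L η hL n hn => ?_⟩⟩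
  · have hmem : (ε, n) ∈ Box m R ε₁ := ⟨hε, hε₁, fun j => (hn j).trans hrR⟩
    calc ‖u ε n - v (pt ε n)‖ ≤ ∑ c, |(u ε n - v (pt ε n)) c| := norm_le_sum_abs _
      _ ≤ ∑ c, |K₀ c| * ε := Finset.sum_le_sum fun c _ => by
        have := (hK₀ c _ hmem).trans (le_abs_self _)
        rwa [abs_div, abs_of_pos hε, div_le_iff₀ hε] at this
      _ = (∑ c, |K₀ c|) * ε := (Finset.sum_mul ..).symm
      _ ≤ _ := mul_le_mul_of_nonneg_right (le_add_of_nonneg_right (by positivity)) hε.le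
  · have hn0 : ∀ j, ε * (n j : ℝ) ≤ r := fun j => le_trans (by gcongr; simp) (hn j)
    have hmem : (ε, n) ∈ pre i (Box m R ε₁) := ⟨hε, hε₁, fun j => (hn j).trans hrR⟩
    have h1 : ‖ε⁻¹ • (u ε (n + Pi.single i 1) - u ε n) -
        ε⁻¹ • (v (pt ε (n + Pi.single i 1)) - v (pt ε n))‖ ≤
        ((∑ c, |K₀ c|) + ∑ i, ∑ c, |K₁ c i|) * ε := by
      calc _ ≤ ∑ c, |(ε⁻¹ • (u ε (n + Pi.single i 1) - u ε n) -
            ε⁻¹ • (v (pt ε (n + Pi.single i 1)) - v (pt ε n))) c| := norm_le_sum_abs _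
        _ ≤ ∑ c, |K₁ c i| * ε := Finset.sum_le_sum fun c _ => by
          have := (hK₁ c i _ hmem).trans (le_abs_self _)
          simp only [dq] at this
          rw [abs_div, abs_of_pos hε, div_le_iff₀ hε] at this
          refine le_trans (le_of_eq ?_) this
          congr 1
          simp only [PiLp.sub_apply, PiLp.smul_apply, smul_eq_mul]
          field_simp
          ring
        _ = (∑ c, |K₁ c i|) * ε := (Finset.sum_mul ..).symm
        _ ≤ _ := mul_le_mul_of_nonneg_right (le_add_of_nonneg_of_le (by positivity)
          (Finset.single_le_sum (f := fun i => ∑ c, |K₁ c i|) (fun _ _ => by positivity)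
            (Finset.mem_univ i))) hε.le
    have h2 := norm_quotient_sub_le ((hv.differentiableOn (by simp)).mono (cube_mono hrR)) hL hε
      (pt_mem_cube hε hn0) (by rw [← pt_add_single]; exact pt_mem_cube hε hn)
    rw [← pt_add_single] at h2
    refine (norm_sub_le_norm_sub_add_norm_sub _ _ _).trans ((add_le_add h1 h2).trans ?_)
    rw [add_comm]

end FirstDifferences

/-! ### Stability of general position. -/

section GeneralPosition

variable {E : Type} [NormedAddCommGroup E] [NormedSpace ℝ E] {m : ℕ}

theorem eventually_linearIndependent_near {n : ℕ} {v : Fin n → E} (h : LinearIndependent ℝ v) :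
    ∀ᶠ η in nhdsWithin (0 : ℝ) (Set.Ioi 0), ∀ v' : Fin n → E, (∀ k, ‖v' k - v k‖ ≤ η) →
      LinearIndependent ℝ v' :=
  eventually_near_of_isOpen (isOpen_setOfPred_linearIndependent (𝕜 := ℝ) (E := E) (ι := Fin n)) h

/-- The coordinate planes of three independent vectors meet only in 0. -/
theorem spansTransversal_of_independent {a b c : E} (h : LinearIndependent ℝ ![a, b, c]) :
    SpansTransversal ![a, b, a, c, b, c] := by
  refine spansTransversal_of_forall fun x y x' y' x'' y'' e1 e2 => ?_
  simp only [Matrix.cons_val_zero, Matrix.cons_val_one, Matrix.cons_val] at e1 e2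
  obtain ⟨h1, h2, h3⟩ := linearIndependent_three_unique h (α := x) (β := y) (γ := 0) (α' := x')
    (β' := 0) (γ' := y') (by simpa using e1)
  obtain ⟨h4, h5, h6⟩ := linearIndependent_three_unique h (α := x) (β := y) (γ := 0) (α' := 0)
    (β' := x'') (γ' := y'') (by simpa using e2)
  exact ⟨h4, h2, h1.symm.trans h4, h3.symm, h5.symm.trans h2, h6.symm⟩

/-- The limiting configuration of a cube between the two levels. A vector x a' + y b' in the span of
a and v has y α' = 0, and one in the span of b and v has x α = 0. -/
theorem spansTransversal_of_transform {a b v a' b' : E} {α β α' β' : ℝ}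
    (h : LinearIndependent ℝ ![a, b, v]) (ha : a' = α • a + β • v) (hb : b' = α' • b + β' • v)
    (hα : α ≠ 0) (hα' : α' ≠ 0) : SpansTransversal ![a', b', a, v, b, v] := by
  refine spansTransversal_of_forall fun x y x' y' x'' y'' e1 e2 => ?_
  simp only [Matrix.cons_val_zero, Matrix.cons_val_one, Matrix.cons_val, ha, hb] at e1 e2
  obtain ⟨h1, h2, h3⟩ := linearIndependent_three_unique h (α := x * α) (β := y * α')
    (γ := x * β + y * β') (α' := x') (β' := 0) (γ' := y')
    (by rw [zero_smul, add_zero, ← e1]; module)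
  obtain ⟨h4, h5, h6⟩ := linearIndependent_three_unique h (α := x * α) (β := y * α')
    (γ := x * β + y * β') (α' := 0) (β' := x'') (γ' := y'')
    (by rw [zero_smul, zero_add, ← e2]; module)
  have hx : x = 0 := (mul_eq_zero.1 h4).resolve_right hα
  have hy : y = 0 := (mul_eq_zero.1 h2).resolve_right hα'
  subst hx hy
  simp only [zero_mul, add_zero] at h1 h3 h5 h6
  exact ⟨rfl, rfl, h1.symm, h3.symm, h5.symm, h6.symm⟩

/-- Linear independence of the limits persists, with all its consequences, for nearby vectors. -/
theorem eventually_generalPosition {X' Xp' : Fin m → E} {V : E} {α β : Fin m → ℝ}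
    (hα : ∀ i, α i ≠ 0) (hX : ∀ i, Xp' i = α i • X' i + β i • V)
    (hpar : ∀ i, LinearIndependent ℝ ![V, Xp' i]) :
    ∀ᶠ η in nhdsWithin (0 : ℝ) (Set.Ioi 0),
      ((∀ i j k, i ≠ j → j ≠ k → i ≠ k → LinearIndependent ℝ ![X' i, X' j, X' k]) →
        ∀ i j k, i ≠ j → j ≠ k → i ≠ k →
          (∀ v : Fin 3 → E, (∀ l, ‖v l - ![X' i, X' j, X' k] l‖ ≤ η) → LinearIndependent ℝ v) ∧
          (∀ v : Fin 6 → E, (∀ l, ‖v l - ![X' i, X' j, X' i, X' k, X' j, X' k] l‖ ≤ η) →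
            SpansTransversal v)) ∧
      ((∀ i j, i ≠ j → LinearIndependent ℝ ![X' i, X' j, V]) →
        ∀ i j, i ≠ j →
          (∀ v : Fin 3 → E, (∀ l, ‖v l - ![X' i, X' j, V] l‖ ≤ η) → LinearIndependent ℝ v) ∧
          (∀ v : Fin 6 → E, (∀ l, ‖v l - ![Xp' i, Xp' j, X' i, V, X' j, V] l‖ ≤ η) →
            SpansTransversal v)) ∧
      ∀ i, ∀ v : Fin 2 → E, (∀ l, ‖v l - ![V, Xp' i] l‖ ≤ η) → LinearIndependent ℝ v := by
  refine (Filter.Eventually.and ?_ (Filter.Eventually.and ?_ ?_))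
  · by_cases h : ∀ i j k, i ≠ j → j ≠ k → i ≠ k → LinearIndependent ℝ ![X' i, X' j, X' k]
    swap
    · exact Filter.Eventually.of_forall fun η h' => absurd h' h
    simp only [Filter.eventually_all]
    intro _ i j k hij hjk hik
    exact (eventually_linearIndependent_near (h i j k hij hjk hik)).and
      (eventually_near_of_isOpen isOpen_spansTransversal
        (spansTransversal_of_independent (h i j k hij hjk hik)))
  · by_cases h : ∀ i j, i ≠ j → LinearIndependent ℝ ![X' i, X' j, V]
    swap
    · exact Filter.Eventually.of_forall fun η h' => absurd h' h
    simp only [Filter.eventually_all]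
    intro _ i j hij
    exact (eventually_linearIndependent_near (h i j hij)).and
      (eventually_near_of_isOpen isOpen_spansTransversal
        (spansTransversal_of_transform (h i j hij) (hX i) (hX j) (hα i) (hα j)))
  · exact Filter.eventually_all.2 fun i => eventually_linearIndependent_near (hpar i)

end GeneralPosition

/-! ### Smooth coefficients of the transformation along the axes. -/

section TransformCoefficients

theorem exists_contDiff_eventuallyEq {f : ℝ → ℝ} {s : Set ℝ} (hs : s ∈ nhds (0 : ℝ))
    (hf : ContDiffOn ℝ ∞ f s) : ∃ g : ℝ → ℝ, ContDiff ℝ ∞ g ∧ g =ᶠ[nhds 0] f := by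
  obtain ⟨ρ, hρ, h⟩ := Metric.mem_nhds_iff.1 hs
  obtain ⟨g, hg, he⟩ := exists_contDiff_eqOn_ball hρ (hf.mono h)
  exact ⟨g, hg, he.eventuallyEq_of_mem (Metric.ball_mem_nhds _ (half_pos hρ))⟩

/-- The vectors of the transformation equation at the origin are in general position. -/
theorem independent_of_transform {E : Type} [AddCommGroup E] [Module ℝ E] {a v a' : E} {α β : ℝ}
    (h : LinearIndependent ℝ ![v, a']) (e : a' - a = α • a + β • v) :
    1 + α ≠ 0 ∧ a' = (1 + α) • a + β • v ∧ LinearIndependent ℝ ![a, v] := by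
  have e' : a' = (1 + α) • a + β • v := by
    rw [add_smul, one_smul, add_assoc, ← e, add_sub_cancel]
  have hα : 1 + α ≠ 0 := by
    intro h0
    rw [h0, zero_smul, zero_add] at e'
    have := LinearIndependent.pair_iff.1 h (-β) 1 (by rw [e']; module)
    exact one_ne_zero this.2
  refine ⟨hα, e', LinearIndependent.pair_iff.2 fun s t hst => ?_⟩
  have := LinearIndependent.pair_iff.1 h (t * (1 + α) - s * β) s (by
    rw [e', ← smul_zero (1 + α), ← hst]; module)
  have hs := this.2
  subst hs
  have h2 := this.1
  rw [zero_mul, sub_zero] at h2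
  exact ⟨rfl, (mul_eq_zero.1 h2).resolve_right hα⟩

/-- The coefficients of the transformation equation along a curve are smooth near the origin. -/
theorem exists_smooth_transform_coefficients {E : Type} [NormedAddCommGroup E]
    [InnerProductSpace ℝ E] {X Xp : ℝ → E} (hX : ContDiff ℝ ∞ X) (hXp : ContDiff ℝ ∞ Xp)
    {α β : ℝ → ℝ} (hpar : LinearIndependent ℝ ![Xp 0 - X 0, deriv Xp 0])
    (h : ∀ᶠ t in nhds (0 : ℝ), deriv Xp t - deriv X t = α t • deriv X t + β t • (Xp t - X t)) :
    ∃ α' β' q : ℝ → ℝ, ContDiff ℝ ∞ α' ∧ ContDiff ℝ ∞ β' ∧ ContDiff ℝ ∞ q ∧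
      α' =ᶠ[nhds 0] α ∧ β' =ᶠ[nhds 0] β ∧ 1 + α' 0 ≠ 0 ∧
      ∀ᶠ t in nhds (0 : ℝ), q t * (1 + α' t) = β' t := by
  obtain ⟨h0, -, hi⟩ := independent_of_transform hpar h.self_of_nhds
  have hdX : ContDiff ℝ ∞ (deriv X) := (contDiff_infty_iff_deriv.1 hX).2
  have hdXp : ContDiff ℝ ∞ (deriv Xp) := (contDiff_infty_iff_deriv.1 hXp).2
  have hc : Continuous fun t => (![deriv X t, Xp t - X t] : Fin 2 → E) := by
    refine continuous_pi fun k => ?_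
    fin_cases k
    · exact hdX.continuous
    · exact hXp.continuous.sub hX.continuous
  have hev : ∀ᶠ t in nhds (0 : ℝ), LinearIndependent ℝ ![deriv X t, Xp t - X t] :=
    hc.continuousAt.eventually ((isOpen_setOfPred_linearIndependent (𝕜 := ℝ) (E := E)
      (ι := Fin 2)).mem_nhds hi)
  have hs := hev.and h
  obtain ⟨α', hα', eα⟩ := exists_contDiff_eventuallyEq hs (contDiffOn_coefficient (α := α) (β := β)
    hdX.contDiffOn (hXp.sub hX).contDiffOn (hdXp.sub hdX).contDiffOn (fun t ht => ht.1)
    fun t ht => ht.2)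
  obtain ⟨β', hβ', eβ⟩ := exists_contDiff_eventuallyEq hs (contDiffOn_coefficient (α := β) (β := α)
    (hXp.sub hX).contDiffOn hdX.contDiffOn (hdXp.sub hdX).contDiffOn
    (fun t ht => LinearIndependent.pair_symm_iff.1 ht.1) fun t ht => by
      rw [add_comm]; exact ht.2)
  have h1 : 1 + α' 0 ≠ 0 := by rwa [eα.self_of_nhds]
  have hne : ∀ᶠ t in nhds (0 : ℝ), 1 + α' t ≠ 0 :=
    (continuous_const.add hα'.continuous).continuousAt.eventually_ne h1
  -- The quotient β/(1 + α) is smooth only near 0, so a global smooth function replaces it and the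
  -- relation holds only near 0.
  obtain ⟨q, hq, eq⟩ := exists_contDiff_eventuallyEq (f := fun t => β' t / (1 + α' t)) hne
    (hβ'.contDiffOn.div (contDiff_const.add hα').contDiffOn fun t ht => ht)
  refine ⟨α', β', q, hα', hβ', hq, eα, eβ, h1, ?_⟩
  filter_upwards [eq, hne] with t h2 h3
  rw [h2, div_mul_cancel₀ _ h3]

end TransformCoefficients

section JetNear

variable {m N : ℕ}

theorem eventually_jet_near {R : ℝ} (hR : 0 < R) {x : (Fin m → ℝ) → EuclideanSpace ℝ (Fin N)}
    (hx : ContDiffOn ℝ ∞ x (cube m R)) {η : ℝ} (hη : 0 < η) :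
    ∀ᶠ r in nhdsWithin (0 : ℝ) (Set.Ioi 0), ∀ ξ ∈ cube m r,
      ‖x ξ - x 0‖ ≤ η ∧ ∀ i, ‖pdw r i x ξ - pdw R i x 0‖ ≤ η := by
  have h0 : (0 : Fin m → ℝ) ∈ cube m R := fun _ => ⟨le_rfl, hR.le⟩
  obtain ⟨δ, hδ, h⟩ := Metric.continuousWithinAt_iff.1 (continuousOn_jet hR hx 0 h0) η hη
  filter_upwards [Ioo_mem_nhdsGT (lt_min hR hδ)] with r hr ξ hξ
  have hrR : r ≤ R := hr.2.le.trans (min_le_left _ _)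
  have hξR := cube_mono hrR hξ
  have := h hξR (by
    rw [dist_zero_right]
    exact (norm_le_of_mem_cube hr.1.le hξ).trans_lt (hr.2.trans_le (min_le_right _ _)))
  rw [dist_eq_norm, Prod.mk_sub_mk, Prod.norm_mk, max_lt_iff] at this
  refine ⟨this.1.le, fun i => ?_⟩
  rw [pdw_mono hr.1 hrR hξ (diffWithin_cube hx hξR)]
  exact (norm_le_pi_norm ((fun i => pdw R i x ξ) - fun i => pdw R i x 0) i).trans this.2.le

end JetNear

/-! ### Local existence of the Jonas pair and its approximation. -/

section Approximation

open LatticeFamily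

variable {m N : ℕ}

/-- A Jonas pair with given coordinate curves on a cube, and its approximation by discrete nets. -/
structure LocalApproximation (R : ℝ) (X Xp : Fin m → ℝ → EuclideanSpace ℝ (Fin N))
    (C : Fin m → Fin m → ℝ × ℝ → ℝ) (Pp : EuclideanSpace ℝ (Fin N)) (CM CiM : Fin m → ℝ → ℝ)
    (x xp : (Fin m → ℝ) → EuclideanSpace ℝ (Fin N)) (c : Fin m → Fin m → (Fin m → ℝ) → ℝ)
    (xd : ℝ → (Fin (m + 1) → ℕ) → EuclideanSpace ℝ (Fin N)) : Prop where
  net : ∀ r, 0 < r → r ≤ R → IsConjugateNetWith r x c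
  axes : ∀ r, 0 < r → r ≤ R → AgreesOnAxes r x X
  planes : ∀ r, 0 < r → r ≤ R → AgreesOnPlanes r c C
  smooth : ∀ i j, ContDiffOn ℝ ∞ (c i j) (cube m R)
  pair : ∀ r, 0 < r → r ≤ R → IsJonasPair r x xp
  axes' : ∀ r, 0 < r → r ≤ R → AgreesOnAxes r xp Xp
  discrete : ∀ ε r, 0 < ε → 0 < r → r + ε ≤ R → SolvesDiscreteProblem ε r X C Pp CM CiM (xd ε)
  conv : ∀ k, ConvOn (Box m R R) (fun ε n => xd ε (Fin.snoc (α := fun _ => ℕ) n 0) k)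
    (fun t => x t k)
  conv' : ∀ k, ConvOn (Box m R R) (fun ε n => xd ε (Fin.snoc (α := fun _ => ℕ) n 1) k)
    (fun t => xp t k)

/-- Both nets are the row o of one Darboux solution, before and after the step along M, and the
discrete nets come from the corresponding discrete solution. The radius R leaves room for choosing r
later. -/
theorem exists_localApproximation
    {X : Fin m → ℝ → EuclideanSpace ℝ (Fin N)} (hX : ∀ i, ContDiff ℝ ∞ (X i))
    {P : EuclideanSpace ℝ (Fin N)} (hP : ∀ i, X i 0 = P)
    {C : Fin m → Fin m → ℝ × ℝ → ℝ} (hC : ∀ i j, i ≠ j → ContDiff ℝ ∞ (C i j))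
    {Xp : Fin m → ℝ → EuclideanSpace ℝ (Fin N)} (hXp : ∀ i, ContDiff ℝ ∞ (Xp i))
    {Pp : EuclideanSpace ℝ (Fin N)} (hPp : ∀ i, Xp i 0 = Pp)
    (hpar : ∀ i, LinearIndependent ℝ ![Pp - P, deriv (Xp i) 0])
    {CM CiM : Fin m → ℝ → ℝ}
    (hCM : ∀ i, ∀ᶠ t in nhds (0 : ℝ), deriv (Xp i) t - deriv (X i) t =
      CM i t • deriv (X i) t + CiM i t • (Xp i t - X i t)) :
    ∃ R > 0, ∃ x xp c xd, LocalApproximation R X Xp C Pp CM CiM x xp c xd := by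
  -- The given coefficients are controlled only near 0; globally smooth functions that agree with
  -- them there serve as data.
  choose cM cI q hcM hcI hq eM eI h0 hqe using fun i =>
    exists_smooth_transform_coefficients (hX i) (hXp i) (α := CM i) (β := CiM i)
      (by rw [hP, hPp]; exact hpar i) (hCM i)
  let S : JonasData m N := ⟨X, C, cM, cI, q, P, Pp - P, hX, hC, hcM, hcI, hq⟩
  obtain ⟨β, b, hev⟩ := S.eventually_solutions h0 hqe hP
  have hode : ∀ᶠ t in nhds (0 : ℝ), ∀ i, (cM i t = CM i t ∧ cI i t = CiM i t) ∧
      deriv (Xp i) t - deriv (X i) t = cM i t • deriv (X i) t + cI i t • (Xp i t - X i t) := by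
    refine Filter.eventually_all.2 fun i => ?_
    filter_upwards [eM i, eI i, hCM i] with t h1 h2 h3
    exact ⟨⟨h1, h2⟩, by rw [h1, h2]; exact h3⟩
  obtain ⟨R, ⟨⟨hsol, hdisc, hconv, hconv'⟩, hodeR⟩, hR⟩ :=
    ((hev.and (JonasData.eventually_forall_Icc hode)).and self_mem_nhdsWithin).exists
  have hR : 0 < R := hR
  have hnorm : ∀ r, 0 < r → r ≤ R → ∀ ξ ∈ cube m r, ‖ξ‖ ≤ R := fun r hr hrR ξ hξ =>
    (norm_le_of_mem_cube hr.le hξ).trans hrR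
  refine ⟨R, hR, _, _, _, fun ε => matrixNet (levelMatrix fun n a c => b a c ε n),
    fun r hr hrR => (hsol.darbouxOn hr hrR).isConjugateNetWith hr
      fun ξ hξ => hsol.lame ξ (hnorm r hr hrR ξ hξ),
    fun r hr hrR => hsol.agreesOnAxes hr.le hrR, fun r hr hrR => hsol.agreesOnPlanes hr hrR,
    fun i j => ?_,
    fun r hr hrR => isJonasPair_darbouxStep hr (hsol.darbouxOn hr hrR)
      (fun ξ hξ => hsol.lame ξ (hnorm r hr hrR ξ hξ))
      (fun ξ hξ => hsol.lameM ξ (hnorm r hr hrR ξ hξ))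
      (fun ξ hξ => hsol.diagM ξ (hnorm r hr hrR ξ hξ))
      (fun ξ hξ => hsol.lame' ξ (hnorm r hr hrR ξ hξ)),
    fun r hr hrR => hsol.agreesOnAxes_transform hr.le hrR
      (fun i => (hXp i).differentiable (by simp))
      (fun i => by rw [hPp]; exact (add_sub_cancel P Pp).symm)
      fun i t ht => (hodeR t ht.1 (ht.2.trans hrR) i).2,
    fun ε r hε hr hrε => ?_, fun k => ?_, fun k => ?_⟩
  · exact (((hsol.contDiff _ _).contDiffOn).mul ((hsol.contDiff _ _).contDiffOn)).div
      ((hsol.contDiff _ _).contDiffOn) fun ξ hξ => hsol.lame ξ (hnorm R hR le_rfl ξ hξ) j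
  · obtain ⟨c, h1, h2, h3, h4, h5⟩ :=
      (hdisc ε hε (by linarith)).solvesDiscreteProblem hr.le hrε
    refine ⟨c, h1, h2, h3, h4.trans (add_sub_cancel P Pp), fun i k hk => ?_⟩
    have hk0 : 0 ≤ ε * (k : ℝ) := mul_nonneg hε.le (Nat.cast_nonneg _)
    obtain ⟨e1, e2⟩ := (hodeR (ε * k) hk0 (by linarith) i).1
    exact ⟨(h5 i k hk).1.trans e1, (h5 i k hk).2.trans e2⟩
  · have : (fun ε n => matrixNet (levelMatrix fun n a c => b a c ε n)
        (Fin.snoc (α := fun _ => ℕ) n 0) k) = b (.inr (some none)) (.inr (some (some k))) := by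
      funext ε n
      simp only [matrixNet]
      rw [levelMatrix_zero _ (Fin.snoc_last _ _)]
      congr 1
      exact Fin.init_snoc _ _
    rw [this]
    exact hconv _ _
  · have : (fun ε n => matrixNet (levelMatrix fun n a c => b a c ε n)
        (Fin.snoc (α := fun _ => ℕ) n 1) k) = fun ε n => darbouxStep 1 (.inr none)
          (fun a c => b a c ε n) (.inr (some none)) (.inr (some (some k))) := by
      funext ε n
      simp only [matrixNet]
      rw [levelMatrix_one _ (by rw [Fin.snoc_last]; exact one_ne_zero)]
      have : base (Fin.snoc (α := fun _ => ℕ) n 1) = n := Fin.init_snoc _ _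
      rw [this]
    rw [this]
    exact hconv' _ _

theorem eq_snoc_base (n : Fin (m + 1) → ℕ) :
    n = Fin.snoc (α := fun _ => ℕ) (base n) (n (Fin.last m)) :=
  (Fin.snoc_init_self n).symm

/-- The first differences of the discrete nets are close to the vectors at the origin. -/
theorem LocalApproximation.exists_pdiff_near {R : ℝ}
    {X Xp : Fin m → ℝ → EuclideanSpace ℝ (Fin N)}
    {C : Fin m → Fin m → ℝ × ℝ → ℝ} {Pp : EuclideanSpace ℝ (Fin N)} {CM CiM : Fin m → ℝ → ℝ}
    {x xp : (Fin m → ℝ) → EuclideanSpace ℝ (Fin N)} {c : Fin m → Fin m → (Fin m → ℝ) → ℝ}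
    {xd : ℝ → (Fin (m + 1) → ℕ) → EuclideanSpace ℝ (Fin N)}
    (h : LocalApproximation R X Xp C Pp CM CiM x xp c xd)
    (hx : ContDiffOn ℝ ∞ x (cube m R)) (hxp : ContDiffOn ℝ ∞ xp (cube m R))
    (hR : 0 < R) {r η : ℝ} (hr : 0 < r) (hrR : r ≤ R) (hη : 0 < η)
    {X' Xp' : Fin m → EuclideanSpace ℝ (Fin N)} {V : EuclideanSpace ℝ (Fin N)}
    (h1 : ∀ ξ ∈ cube m r, ∀ i, ‖pdw r i x ξ - X' i‖ ≤ η)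
    (h2 : ∀ ξ ∈ cube m r, ∀ i, ‖pdw r i xp ξ - Xp' i‖ ≤ η)
    (h3 : ∀ ξ ∈ cube m r, ‖xp ξ - x ξ - V‖ ≤ η) :
    ∃ ε₁ > 0, ∀ ε, 0 < ε → ε < ε₁ →
      (∀ i : Fin m, ∀ n : Fin (m + 1) → ℕ, n + Pi.single i.castSucc 1 ∈ latticeBox m ε r →
        n (Fin.last m) = 0 → ‖pdiff (mesh m ε) i.castSucc (xd ε) n - X' i‖ ≤ 2 * η) ∧
      (∀ i : Fin m, ∀ n : Fin (m + 1) → ℕ, n + Pi.single i.castSucc 1 ∈ latticeBox m ε r →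
        n (Fin.last m) = 1 → ‖pdiff (mesh m ε) i.castSucc (xd ε) n - Xp' i‖ ≤ 2 * η) ∧
      (∀ n : Fin (m + 1) → ℕ, n + Pi.single (Fin.last m) 1 ∈ latticeBox m ε r →
        n (Fin.last m) = 0 → ‖pdiff (mesh m ε) (Fin.last m) (xd ε) n - V‖ ≤ 2 * η) := by
  obtain ⟨K, hK, hb⟩ := exists_first_difference_bound h.conv hx
  obtain ⟨K', hK', hb'⟩ := exists_first_difference_bound h.conv' hxp
  -- The difference along M contains the convergence errors of both levels, and this bound keeps
  -- their sum below η.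
  refine ⟨min R (η / (K + K' + 1)), lt_min hR (by positivity), fun ε hε hε₁ => ?_⟩
  have hεR : ε < R := hε₁.trans_le (min_le_left _ _)
  have hεη : (K + K' + 1) * ε ≤ η := by
    have := hε₁.le.trans (min_le_right _ _)
    rwa [le_div_iff₀ (by positivity), mul_comm] at this
  have hKε : 0 ≤ K * ε := mul_nonneg hK hε.le
  have hKε' : 0 ≤ K' * ε := mul_nonneg hK' hε.le
  obtain ⟨b0, b1⟩ := hb ε hε hεR r hr hrR
  obtain ⟨b0', b1'⟩ := hb' ε hε hεR r hr hrR
  have e0 : ∀ n : Fin (m + 1) → ℕ, n (Fin.last m) = 0 →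
      xd ε n = xd ε (Fin.snoc (α := fun _ => ℕ) (base n) 0) := fun n hn => by
    conv_lhs => rw [eq_snoc_base n, hn]
  have e1 : ∀ n : Fin (m + 1) → ℕ, n (Fin.last m) = 1 →
      xd ε n = xd ε (Fin.snoc (α := fun _ => ℕ) (base n) 1) := fun n hn => by
    conv_lhs => rw [eq_snoc_base n, hn]
  refine ⟨fun i n hn hl => ?_, fun i n hn hl => ?_, fun n hn hl => ?_⟩
  · have := b1 i (X' i) η (fun ξ hξ => h1 ξ hξ i) (base n) fun j => by
      have := hn.1 j
      rwa [← base_single_castSucc, ← base_add]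
    rw [pdiff, mesh_castSucc, e0 n hl, e0 (n + _) (by simp [hl]), base_add, base_single_castSucc]
    linarith
  · have := b1' i (Xp' i) η (fun ξ hξ => h2 ξ hξ i) (base n) fun j => by
      have := hn.1 j
      rwa [← base_single_castSucc, ← base_add]
    rw [pdiff, mesh_castSucc, e1 n hl, e1 (n + _) (by simp [hl]), base_add, base_single_castSucc]
    linarith
  · have hn0 := (latticeBox_lower hε hn).1
    have g0 := b0 (base n) hn0
    have g1 := b0' (base n) hn0
    have g2 := h3 _ (pt_mem_cube hε hn0)
    rw [pdiff, mesh_last, e0 n hl, e1 (n + _) (by simp [hl]), base_add, base_single_last, add_zero,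
      inv_one, one_smul]
    have e : xd ε (Fin.snoc (α := fun _ => ℕ) (base n) 1) -
        xd ε (Fin.snoc (α := fun _ => ℕ) (base n) 0) - V =
        (xd ε (Fin.snoc (α := fun _ => ℕ) (base n) 1) - xp (pt ε (base n))) -
        (xd ε (Fin.snoc (α := fun _ => ℕ) (base n) 0) - x (pt ε (base n))) +
        (xp (pt ε (base n)) - x (pt ε (base n)) - V) := by abel
    rw [e]
    refine (norm_add_le _ _).trans ?_
    have := norm_sub_le (xd ε (Fin.snoc (α := fun _ => ℕ) (base n) 1) - xp (pt ε (base n)))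
      (xd ε (Fin.snoc (α := fun _ => ℕ) (base n) 0) - x (pt ε (base n)))
    have g2' : ‖xp (pt ε (base n)) - x (pt ε (base n)) - V‖ ≤ η := g2
    linarith

end Approximation

/-! ### The theorem. -/

theorem mainTheorem5 (m N : ℕ) (hm : 0 < m)
    -- curves `Xᵢ` through `P`, and functions `Cᵢⱼ` on the coordinate planes
    (X : Fin m → ℝ → EuclideanSpace ℝ (Fin N)) (hX : ∀ i, ContDiff ℝ ∞ (X i))
    (P : EuclideanSpace ℝ (Fin N)) (hP : ∀ i, X i 0 = P)
    (C : Fin m → Fin m → ℝ × ℝ → ℝ) (hC : ∀ i j, i ≠ j → ContDiff ℝ ∞ (C i j))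
    -- curves `Xᵢ⁺` through `Pp`, with the coplanarity condition
    (Xp : Fin m → ℝ → EuclideanSpace ℝ (Fin N)) (hXp : ∀ i, ContDiff ℝ ∞ (Xp i))
    (Pp : EuclideanSpace ℝ (Fin N)) (hPp : ∀ i, Xp i 0 = Pp)
    (hcoplanar : ∀ i t,
      ¬ LinearIndependent ℝ ![deriv (X i) t, deriv (Xp i) t, Xp i t - X i t])
    -- `X⁺ - X` is not parallel to `∂ᵢXᵢ⁺(0)`
    (hpar : ∀ i, LinearIndependent ℝ ![Pp - P, deriv (Xp i) 0])
    -- the functions `C_{Mi}`, `C_{iM}`, defined by their formula near the origin of the axis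
    (CM CiM : Fin m → ℝ → ℝ)
    (hCM : ∀ i, ∀ᶠ t in nhds (0 : ℝ), deriv (Xp i) t - deriv (X i) t =
      CM i t • deriv (X i) t + CiM i t • (Xp i t - X i t)) :
    ∃ r : ℝ, 0 < r ∧
    ∃ (x : (Fin m → ℝ) → EuclideanSpace ℝ (Fin N)) (c : Fin m → Fin m → (Fin m → ℝ) → ℝ)
      (xp : (Fin m → ℝ) → EuclideanSpace ℝ (Fin N)),
      -- the conjugate net `x` with the given data, and its uniqueness
      (IsConjugateNetWith r x c ∧ AgreesOnAxes r x X ∧ AgreesOnPlanes r c C) ∧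
      ((∀ i j k, i ≠ j → j ≠ k → i ≠ k →
          LinearIndependent ℝ ![deriv (X i) 0, deriv (X j) 0, deriv (X k) 0]) →
        ∀ y d, IsConjugateNetWith r y d → AgreesOnAxes r y X → AgreesOnPlanes r d C →
          Set.EqOn y x (cube m r)) ∧
      -- the Jonas transform `x⁺` with the given coordinate curves, and its uniqueness
      (IsJonasPair r x xp ∧ AgreesOnAxes r xp Xp) ∧
      ((∀ i j, i ≠ j → LinearIndependent ℝ ![deriv (X i) 0, deriv (X j) 0, Pp - P]) →
        ∀ y, IsJonasPair r x y → AgreesOnAxes r y Xp → Set.EqOn y xp (cube m r)) ∧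
      -- the discrete nets, their uniqueness, and the convergence
      ∃ ε₁ : ℝ, 0 < ε₁ ∧ ∃ xd : ℝ → (Fin (m + 1) → ℕ) → EuclideanSpace ℝ (Fin N),
        (∀ ε, 0 < ε → ε < ε₁ → SolvesDiscreteProblem ε r X C Pp CM CiM (xd ε)) ∧
        ((∀ i j k, i ≠ j → j ≠ k → i ≠ k →
            LinearIndependent ℝ ![deriv (X i) 0, deriv (X j) 0, deriv (X k) 0]) →
          (∀ i j, i ≠ j → LinearIndependent ℝ ![deriv (X i) 0, deriv (X j) 0, Pp - P]) →
          ∀ ε, 0 < ε → ε < ε₁ → ∀ y, SolvesDiscreteProblem ε r X C Pp CM CiM y →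
            Set.EqOn y (xd ε) (latticeBox m ε r)) ∧
        OConverges r ε₁ (fun ε n => xd ε (Fin.snoc (α := fun _ => ℕ) n 0)) x ∧
        OConverges r ε₁ (fun ε n => xd ε (Fin.snoc (α := fun _ => ℕ) n 1)) xp := by
  obtain ⟨R, hR, x, xp, c, xd, h⟩ := exists_localApproximation hX hP hC hXp hPp hpar hCM
  have hx := (h.net R hR le_rfl).1
  have hxp : ContDiffOn ℝ ∞ xp (cube m R) := by
    obtain ⟨-, ⟨e, he⟩, -⟩ := h.pair R hR le_rfl
    exact he.1
  have hdX : ∀ i, Differentiable ℝ (X i) := fun i => (hX i).differentiable (by simp)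
  have hdXp : ∀ i, Differentiable ℝ (Xp i) := fun i => (hXp i).differentiable (by simp)
  obtain ⟨x0, dx0⟩ := jet_zero hR hm hx hdX (h.axes R hR le_rfl)
  obtain ⟨xp0, dxp0⟩ := jet_zero hR hm hxp hdXp (h.axes' R hR le_rfl)
  rw [hP] at x0
  rw [hPp] at xp0
  have htr := fun i => independent_of_transform (hpar i) (a := deriv (X i) 0) (α := CM i 0)
    (β := CiM i 0) (by rw [← hPp i, ← hP i]; exact (hCM i).self_of_nhds)
  -- η is the tolerance within which all general position conditions at the origin persist.
  obtain ⟨η, ⟨gX, gM, gp⟩, hη⟩ := ((eventually_generalPosition (fun i => (htr i).1)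
    (fun i => (htr i).2.1) hpar).and self_mem_nhdsWithin).exists
  have hη : 0 < η := hη
  -- On the final cube values and first derivatives stay within η/4 of the origin, so x⁺ - x stays
  -- within η/2. The remaining tolerance is left for competitors and for the discretisation. The
  -- bound r < R/2 leaves a margin for the mesh.
  obtain ⟨r, ⟨jx, jxp⟩, hr, hr2⟩ := (((eventually_jet_near hR hx (by positivity : 0 < η / 4)).and
    (eventually_jet_near hR hxp (by positivity : 0 < η / 4))).and
      (Ioo_mem_nhdsGT (half_pos hR))).exists
  have hrR : r ≤ R := by linarith
  simp only [x0, dx0] at jx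
  simp only [xp0, dxp0] at jxp
  have jV : ∀ ξ ∈ cube m r, ‖xp ξ - x ξ - (Pp - P)‖ ≤ η / 2 := fun ξ hξ => by
    have e : xp ξ - x ξ - (Pp - P) = (xp ξ - Pp) - (x ξ - P) := by abel
    rw [e]
    refine (norm_sub_le _ _).trans ?_
    linarith [(jx ξ hξ).1, (jxp ξ hξ).1]
  have near : ∀ {E : Type} [NormedAddCommGroup E] (a b c : E), ‖a - b‖ ≤ η / 4 → ‖b - c‖ ≤ η / 2 →
      ‖a - c‖ ≤ η := fun a b c h1 h2 => by
    have := norm_sub_le_norm_sub_add_norm_sub a b c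
    linarith
  have hη4 : η / 4 ≤ η / 2 := by linarith
  refine ⟨r, hr, x, c, xp, ⟨h.net r hr hrR, h.axes r hr hrR, h.planes r hr hrR⟩, fun G1 y d hy hay
    hdy => ?_, ⟨h.pair r hr hrR, h.axes' r hr hrR⟩, fun G2 y hy hay => ?_, ?_⟩
  · refine conjugateNet_eqOn hm hr (h.net r hr hrR) hy hdX hC (h.axes r hr hrR) hay
      (h.planes r hr hrR) hdy (by positivity : 0 < η / 4) fun ξ hξ v hv i j k hij hjk hik =>
        (gX G1 i j k hij hjk hik).1 _ fun l => ?_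
    have hv' := fun i => near _ _ _ (hv i).le (((jx ξ hξ).2 i).trans hη4)
    fin_cases l
    exacts [hv' i, hv' j, hv' k]
  · refine jonas_eqOn hm hr (h.net r hr hrR) (fun i j _ => (h.smooth i j).mono (cube_mono hrR)) hy
      (h.pair r hr hrR) hdXp hay (h.axes' r hr hrR) (by positivity : 0 < η / 4)
      fun ξ hξ u w hu hw => ⟨fun i j hij => (gM G2 i j hij).1 _ fun l => ?_,
        fun i => gp i _ fun l => ?_⟩
    · have hx' := fun i => ((jx ξ hξ).2 i).trans (by linarith : η / 4 ≤ η)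
      fin_cases l
      exacts [hx' i, hx' j, near _ _ _ hu.le (jV ξ hξ)]
    · fin_cases l
      exacts [near _ _ _ hu.le (jV ξ hξ), near _ _ _ (hw i).le (((jxp ξ hξ).2 i).trans hη4)]
  obtain ⟨ε₀, hε₀, hd⟩ := h.exists_pdiff_near hx hxp hR hr hrR (half_pos hη)
    (fun ξ hξ i => ((jx ξ hξ).2 i).trans hη4) (fun ξ hξ i => ((jxp ξ hξ).2 i).trans hη4) jV
  rw [mul_div_cancel₀ η two_ne_zero] at hd
  -- The additional layer of width ε needed for the rotation coefficients fits into R.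
  have hε : ∀ ε, ε < min ε₀ (R / 2) → r + ε ≤ R := fun ε hε => by
    have := hε.trans_le (min_le_right _ _)
    linarith
  have hconv := LatticeFamily.box_subset (m := m) (le_refl R)
    ((min_le_right ε₀ (R / 2)).trans (half_le_self hR.le))
  refine ⟨min ε₀ (R / 2), lt_min hε₀ (half_pos hR), xd, fun ε h0 h1 => h.discrete ε r h0 hr (hε ε h1),
    fun G1 G2 ε h0 h1 y hy => ?_, LatticeFamily.oConverges_of_convOn hrR
      fun k => (h.conv k).subset hconv, LatticeFamily.oConverges_of_convOn hrR
      fun k => (h.conv' k).subset hconv⟩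
  obtain ⟨d0, d1, dM⟩ := hd ε h0 (h1.trans_le (min_le_left _ _))
  refine discreteProblem_eqOn hm h0 (h.discrete ε r h0 hr (hε ε h1)) hy
    fun i j k hij hjk hik hi hj n hn hl => ?_
  have mij : n + Pi.single i 1 + Pi.single j 1 ∈ latticeBox m ε r := latticeBox_lower h0 hn
  have mik : n + Pi.single i 1 + Pi.single k 1 ∈ latticeBox m ε r :=
    latticeBox_lower h0 (k := j) (by rwa [add_right_comm])
  have mjk : n + Pi.single j 1 + Pi.single k 1 ∈ latticeBox m ε r :=
    latticeBox_lower h0 (k := i) (by rwa [add_right_comm, add_right_comm n])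
  have mji := add_right_comm n (Pi.single i 1) (Pi.single j 1) ▸ mij
  have mki := add_right_comm n (Pi.single i 1) (Pi.single k 1) ▸ mik
  have mkj := add_right_comm n (Pi.single j 1) (Pi.single k 1) ▸ mjk
  obtain ⟨i, rfl⟩ := Fin.exists_castSucc_eq.2 hi
  obtain ⟨j, rfl⟩ := Fin.exists_castSucc_eq.2 hj
  have hij' : i ≠ j := fun e => hij (e ▸ rfl)
  have z : ∀ l : Fin m, (n + Pi.single l.castSucc 1 : Fin (m + 1) → ℕ) (Fin.last m) = 0 :=
    fun l => by simp [hl]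
  -- A cube between the levels has difference vectors near X⁺_i', X⁺_j', X_i', X_j' and X⁺ - X, and
  -- uses (G2); a cube inside the lower level uses (G1).
  induction k using Fin.lastCases with
  | last =>
    have o : (n + Pi.single (Fin.last m) 1 : Fin (m + 1) → ℕ) (Fin.last m) = 1 := by simp [hl]
    refine (gM G2 i j hij').2 _ fun l => ?_
    fin_cases l
    exacts [d1 i _ mki o, d1 j _ mkj o, d0 i _ mji (z j), dM _ mjk (z j), d0 j _ mij (z i),
      dM _ mik (z i)]
  | cast k =>
    refine (gX G1 i j k hij' (fun e => hjk (e ▸ rfl)) fun e => hik (e ▸ rfl)).2 _ fun l => ?_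
    fin_cases l
    exacts [d0 i _ mki (z k), d0 j _ mkj (z k), d0 i _ mji (z j), d0 k _ mjk (z j),
      d0 j _ mij (z i), d0 k _ mik (z i)]
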